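/- All graphs are finite, simple and non-empty, and are considered up to isomorphism. Write $N_G(v)$ and $d_G(v)$ for the neighbourhood and the degree of a node $v$ of $G$. A chord of a cycle of $G$ is an edge of $G$ joining two nodes of the cycle that is not an edge of the cycle. Let $\mathcal C$ be the class of graphs in which no cycle has exactly one chord. A hole is a chordless cycle of length at least four; a square is a hole of length four. The Petersen graph has nodes $a_1,\dots,a_5,b_1,\dots,b_5$; $a_1\dots a_5$ and $b_1\dots b_5$ induce 5-cycles in this order, and the only other edges are $a_1b_1,a_2b_4,a_3b_2,a_4b_5,a_5b_3$. The Heawood graph has nodes $a_1,\dots,a_{14}$; its edges are those of the cycle $a_1a_2\dots a_{14}a_1$ together with $a_1a_{10},a_2a_7,a_3a_{12},a_4a_9,a_5a_{14},a_6a_{11},a_8a_{13}$. A graph is strongly 2-bipartite if it contains no square as an induced subgraph and it is bipartite with bipartition $(X,Y)$, where $X$ is the set of all nodes of degree $2$ and $Y$ is the set of all nodes of degree at least $3$ (in particular every node has degree at least $2$). A graph is basic if it is connected and it is a clique, or a hole of length at least $7$, or strongly 2-bipartite, or isomorphic to an induced subgraph of the Petersen graph or of the Heawood graph. A 1-cutset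 of a connected graph $G$ is a node $v$ such that $V(G)\setminus\{v\}$ can be partitioned into two non-empty sets with no edge between them. Each of the following operations takes two node-disjoint graphs $G_1,G_2$ and outputs a graph $G$. * $\mathcal O_0$: $G$ is the disjoint union of $G_1$ and $G_2$. * $\mathcal O_1$: for some nodes $u$ of $G_1$ and $w$ of $G_2$, $G$ is obtained from the disjoint union of $G_1\setminus\{u\}$ and $G_2\setminus\{w\}$ by adding a new node adjacent to exactly the nodes of $N_{G_1}(u)\cup N_{G_2}(w)$. * $\mathcal O_2$: for some nodes $u$ of $G_1$ and $v$ of $G_2$ such that $N_{G_1}(u)$ and $N_{G_2}(v)$ are stable sets of size at least $2$, $G$ is obtained from the disjoint union of $G_1\setminus\{u\}$ and $G_2\setminus\{v\}$ by adding all edges between $N_{G_1}(u)$ and $N_{G_2}(v)$. * $\mathcal O_3$: for some degree $2$ node $u$ of $G_1$ that is not a 1-cutset of $G_1$, with non-adjacent neighbours $u_1,u_2$, and some degree $2$ node $v$ of $G_2$ that is not a 1-cutset of $G_2$, with non-adjacent neighbours $v_1,v_2$, such that $(d_{G_1}(u_i)-1)+(d_{G_2}(v_i)-1)\ge 3$ for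 $i=1,2$, $G$ is obtained from the disjoint union of $G_1\setminus\{u,u_1,u_2\}$ and $G_2\setminus\{v,v_1,v_2\}$ by adding two new non-adjacent nodes $w_1,w_2$ where, for $i=1,2$, $w_i$ is adjacent to exactly the nodes of $(N_{G_1}(u_i)\setminus\{u\})\cup(N_{G_2}(v_i)\setminus\{v\})$. **Theorem.** If $G\in\mathcal C$, then either $G$ is basic or $G$ can be obtained, starting from basic graphs, by repeated applications of the operations $\mathcal O_0,\dots,\mathcal O_3$. Conversely, every basic graph and every graph obtained in this way is in $\mathcal C$. -/

import Mathlib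

open scoped SimpleGraph

universe u

namespace UniqueChord

section Basic

variable {V : Type u}

/-- The class `C`: no cycle of `G` has exactly one chord. -/
def InC (G : SimpleGraph V) : Prop :=
  ¬ ∃ (v : V) (c : G.Walk v v), c.IsCycle ∧ ∃! e : Sym2 V, c.IsChord e

/-- The degree of a vertex (used for finite graphs only). -/
noncomputable def deg (G : SimpleGraph V) (v : V) : ℕ := (G.neighborSet v).ncard

/-- The Petersen graph; `Sum.inl i` is `a_{i+1}` and `Sum.inr i` is `b_{i+1}`. Both five-element
sets induce a cycle in the natural order. -/
def petersen : SimpleGraph (Fin 5 ⊕ Fin 5) where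
  Adj
    | .inl i, .inl j => j = i + 1 ∨ i = j + 1
    | .inr i, .inr j => j = i + 1 ∨ i = j + 1
    | .inl i, .inr j => (i, j) ∈ [((0 : Fin 5), (0 : Fin 5)), (1, 3), (2, 1), (3, 4), (4, 2)]
    | .inr j, .inl i => (i, j) ∈ [((0 : Fin 5), (0 : Fin 5)), (1, 3), (2, 1), (3, 4), (4, 2)]
  symm := ⟨by
    rintro (i | i) (j | j) h
    all_goals first | exact h | exact h.symm⟩
  loopless := ⟨by
    rintro (i | i) h
    all_goals (revert h i; decide)⟩

/-- The Heawood graph; `i` is `a_{i+1}`. -/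
def heawood : SimpleGraph (Fin 14) where
  Adj i j := (j = i + 1 ∨ i = j + 1) ∨
    ((i, j) ∈ [((0 : Fin 14), (9 : Fin 14)), (1, 6), (2, 11), (3, 8), (4, 13), (5, 10), (7, 12)] ∨
      (j, i) ∈ [((0 : Fin 14), (9 : Fin 14)), (1, 6), (2, 11), (3, 8), (4, 13), (5, 10), (7, 12)])
  symm := ⟨fun _ _ h => h.imp Or.symm Or.symm⟩
  loopless := ⟨by decide⟩

/-- Strongly 2-bipartite: square-free, and bipartite with one side the set of all vertices of
degree two and the other side the set of all vertices of degree at least three. -/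
def StronglyTwoBipartite (G : SimpleGraph V) : Prop :=
  ¬ (SimpleGraph.cycleGraph 4 ⊴ G) ∧
  G.IsBipartiteWith {v | deg G v = 2} {v | 3 ≤ deg G v} ∧
  {v | deg G v = 2} ∪ {v | 3 ≤ deg G v} = Set.univ

/-- Basic graphs: connected, and a clique, a hole of length at least seven, a strongly 2-bipartite
graph, or isomorphic to an induced subgraph of the Petersen graph or of the Heawood graph. -/
def IsBasic (G : SimpleGraph V) : Prop :=
  G.Connected ∧
    (G = ⊤ ∨
      (∃ n : ℕ, 7 ≤ n ∧ Nonempty (G ≃g SimpleGraph.cycleGraph n)) ∨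
      StronglyTwoBipartite G ∨
      G ⊴ petersen ∨
      G ⊴ heawood)

/-- A 1-cutset of a connected graph `G`: a vertex `v` such that the vertex set can be partitioned
into nonempty sets `X`, `Y` and `{v}` with no edge between `X` and `Y`. -/
def IsOneCutset (G : SimpleGraph V) (v : V) : Prop :=
  G.Connected ∧ ∃ X Y : Set V, X.Nonempty ∧ Y.Nonempty ∧ Disjoint X Y ∧ v ∉ X ∧ v ∉ Y ∧
    X ∪ Y ∪ {v} = Set.univ ∧ ∀ x ∈ X, ∀ y ∈ Y, ¬ G.Adj x y

end Basic

section Operations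

variable {V₁ V₂ : Type u}

/-- Gluing along a vertex: delete `p` from `G₁` and `q` from `G₂`, take the disjoint union and add
a new vertex adjacent to the neighbours of `p` and the neighbours of `q`. -/
def glueVertex (G₁ : SimpleGraph V₁) (G₂ : SimpleGraph V₂) (p : V₁) (q : V₂) :
    SimpleGraph (({x : V₁ // x ≠ p} ⊕ {y : V₂ // y ≠ q}) ⊕ Unit) where
  Adj
    | .inl (.inl x), .inl (.inl x') => G₁.Adj x x'
    | .inl (.inr y), .inl (.inr y') => G₂.Adj y y'
    | .inl (.inl x), .inr _ => G₁.Adj p x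
    | .inr _, .inl (.inl x) => G₁.Adj p x
    | .inl (.inr y), .inr _ => G₂.Adj q y
    | .inr _, .inl (.inr y) => G₂.Adj q y
    | .inl (.inl _), .inl (.inr _) => False
    | .inl (.inr _), .inl (.inl _) => False
    | .inr _, .inr _ => False
  symm := ⟨by
    rintro ((x | y) | _) ((x' | y') | _) h
    all_goals first | exact h | exact h.symm⟩
  loopless := ⟨by
    rintro ((x | y) | _) h
    · exact G₁.loopless.irrefl _ h
    · exact G₂.loopless.irrefl _ h
    · exact h⟩

/-- Gluing along a 1-join: delete `p` from `G₁` and `q` from `G₂`, take the disjoint union and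
add all edges between the neighbours of `p` and the neighbours of `q`. -/
def glueJoin (G₁ : SimpleGraph V₁) (G₂ : SimpleGraph V₂) (p : V₁) (q : V₂) :
    SimpleGraph ({x : V₁ // x ≠ p} ⊕ {y : V₂ // y ≠ q}) where
  Adj
    | .inl x, .inl x' => G₁.Adj x x'
    | .inr y, .inr y' => G₂.Adj y y'
    | .inl x, .inr y => G₁.Adj p x ∧ G₂.Adj q y
    | .inr y, .inl x => G₁.Adj p x ∧ G₂.Adj q y
  symm := ⟨by
    rintro (x | y) (x' | y') h
    all_goals first | exact h | exact h.symm⟩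
  loopless := ⟨by
    rintro (x | y) h
    · exact G₁.loopless.irrefl _ h
    · exact G₂.loopless.irrefl _ h⟩

/-- Gluing along a pair: delete `p, p₁, p₂` from `G₁` and `q, q₁, q₂` from `G₂`, take the disjoint
union and add new vertices `w₁ = Sum.inr false` and `w₂ = Sum.inr true`, with `wᵢ` adjacent to the
remaining neighbours of `pᵢ` and of `qᵢ`. -/
def gluePair (G₁ : SimpleGraph V₁) (G₂ : SimpleGraph V₂) (p p₁ p₂ : V₁) (q q₁ q₂ : V₂) :
    SimpleGraph (({x : V₁ // x ≠ p ∧ x ≠ p₁ ∧ x ≠ p₂} ⊕ {y : V₂ // y ≠ q ∧ y ≠ q₁ ∧ y ≠ q₂}) ⊕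
      Bool) where
  Adj
    | .inl (.inl x), .inl (.inl x') => G₁.Adj x x'
    | .inl (.inr y), .inl (.inr y') => G₂.Adj y y'
    | .inl (.inl x), .inr i => G₁.Adj (bif i then p₂ else p₁) x
    | .inr i, .inl (.inl x) => G₁.Adj (bif i then p₂ else p₁) x
    | .inl (.inr y), .inr i => G₂.Adj (bif i then q₂ else q₁) y
    | .inr i, .inl (.inr y) => G₂.Adj (bif i then q₂ else q₁) y
    | .inl (.inl _), .inl (.inr _) => False
    | .inl (.inr _), .inl (.inl _) => False
    | .inr _, .inr _ => False
  symm := ⟨by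
    rintro ((x | y) | i) ((x' | y') | j) h
    all_goals first | exact h | exact h.symm⟩
  loopless := ⟨by
    rintro ((x | y) | i) h
    · exact G₁.loopless.irrefl _ h
    · exact G₂.loopless.irrefl _ h
    · exact h⟩

end Operations

/-- The graphs that are basic or can be obtained, starting from (finite) basic graphs, by repeated
applications of the four composition operations. Graphs are considered up to isomorphism. -/
inductive Constructible : {V : Type u} → SimpleGraph V → Prop
  | basic {V : Type u} [Finite V] (G : SimpleGraph V) (hG : IsBasic G) : Constructible G
  | iso {V W : Type u} {G : SimpleGraph V} {H : SimpleGraph W} (hG : Constructible G)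
      (e : G ≃g H) : Constructible H
  /-- Disjoint union. -/
  | op0 {V₁ V₂ : Type u} {G₁ : SimpleGraph V₁} {G₂ : SimpleGraph V₂}
      (h₁ : Constructible G₁) (h₂ : Constructible G₂) : Constructible (G₁ ⊕g G₂)
  /-- Reverse of the decomposition along a 1-cutset. -/
  | op1 {V₁ V₂ : Type u} {G₁ : SimpleGraph V₁} {G₂ : SimpleGraph V₂}
      (h₁ : Constructible G₁) (h₂ : Constructible G₂) (p : V₁) (q : V₂) :
      Constructible (glueVertex G₁ G₂ p q)
  /-- Reverse of the decomposition along a proper 1-join. -/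
  | op2 {V₁ V₂ : Type u} {G₁ : SimpleGraph V₁} {G₂ : SimpleGraph V₂}
      (h₁ : Constructible G₁) (h₂ : Constructible G₂) (p : V₁) (q : V₂)
      (hp : G₁.IsIndepSet (G₁.neighborSet p)) (hp2 : 2 ≤ deg G₁ p)
      (hq : G₂.IsIndepSet (G₂.neighborSet q)) (hq2 : 2 ≤ deg G₂ q) :
      Constructible (glueJoin G₁ G₂ p q)
  /-- Reverse of the decomposition along a proper 2-cutset. All the degrees in `hd₁` and `hd₂` are
  positive, so that the subtractions are not truncated. -/
  | op3 {V₁ V₂ : Type u} {G₁ : SimpleGraph V₁} {G₂ : SimpleGraph V₂}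
      (h₁ : Constructible G₁) (h₂ : Constructible G₂) (p p₁ p₂ : V₁) (q q₁ q₂ : V₂)
      (hp : G₁.neighborSet p = {p₁, p₂}) (hp12 : p₁ ≠ p₂) (hpadj : ¬ G₁.Adj p₁ p₂)
      (hpcut : ¬ IsOneCutset G₁ p)
      (hq : G₂.neighborSet q = {q₁, q₂}) (hq12 : q₁ ≠ q₂) (hqadj : ¬ G₂.Adj q₁ q₂)
      (hqcut : ¬ IsOneCutset G₂ q)
      (hd₁ : 3 ≤ (deg G₁ p₁ - 1) + (deg G₂ q₁ - 1))
      (hd₂ : 3 ≤ (deg G₁ p₂ - 1) + (deg G₂ q₂ - 1)) :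
      Constructible (gluePair G₁ G₂ p p₁ p₂ q q₁ q₂)

end UniqueChord

/-! A cycle whose only chord is `x y` amounts to a theta: the edge `x y` and two disjoint connected
sets with no edge between them, each attached to both `x` and `y`. The open arcs of the cycle are
such sets, and shortest paths through such sets give back the cycle (`inC_of_noTheta`,
`noTheta_of_inC`). Thetas are easier to handle than cycles because they lift through contractions:
if disjoint connected bags of `G` represent a pattern graph, a theta of the pattern whose chord
joins two one-vertex bags gives a theta of `G` (`Model.theta`). A theta in a concrete pattern is
thus a finite certificate, checked on bit masks.

Decomposition (`constructible_of_noTheta`) is by induction on the number of vertices. A disconnected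
graph or one with a cutvertex splits. Otherwise a triangle forces a complete graph
(`NoTheta.eq_top_of_triangle`). Without triangles, a square extends to a largest complete bipartite
pair, which is a 1-join (`NoTheta.exists_join`). A proper 2-cutset is undone by capping each side
with a vertex of degree two that stands for the other side (`Constructible.of_pair`). What is left
is a `Rigid` graph, and `Rigid.isBasic` shows that it is basic.

In a rigid graph all degrees are at least two, unless the graph is tiny. If no edge joins two
vertices of degree at least three, the graph is a cycle or strongly 2-bipartite, because a path of
several vertices of degree two would be cut off by its ends. If `x y` is such an edge, Menger's
theorem gives two disjoint paths between `x` and `y` besides the edge, and a shortest choice leaves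
exactly one edge between them (`Rigid.exists_pModel`). This is the Petersen graph without two
adjacent vertices, with its four vertices of degree two replaced by paths: `pattern8`.

The patterns are the Petersen graph without two adjacent vertices, without one vertex, and whole,
and the Heawood graph without a path of three vertices, without two adjacent vertices, without one
vertex, and whole. Positions of degree two are fat, that is, represented by connected bags; the
others are single vertices. The growth step (`PModel.growth`) shows that a model either covers `G`
by single vertices, and then `G` embeds in the target, or extends by a vertex attached to the fat
positions next to a missing vertex of the target. After an extension, each bag that has acquired a
third attachment collapses to one vertex, or to a vertex with a fat bag beside it
(`PModel.halfCollapse`). The second outcome is what leads from Petersen patterns to Heawood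
patterns.

Conversely, basic graphs have no theta: by degrees for cycles and strongly 2-bipartite graphs, and
by a finite check for the Petersen and Heawood graphs. For each operation, a theta of the composed
graph is pushed to the side containing its chord by a retraction of the other side, which gives a
theta in one of the two given graphs (`Constructible.noTheta`). -/

namespace UniqueChord

/-! ### Connected vertex sets and components inside a set -/

section Connectivity

variable {V W : Type*}

/-- There is an edge between `S` and `T`. -/
def Touch (G : SimpleGraph V) (S T : Set V) : Prop := ∃ s ∈ S, ∃ t ∈ T, G.Adj s t

/-- `S` is nonempty and induces a connected graph, expressed by the absence of proper nonempty
subsets closed under adjacency. -/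
def ConnSet (G : SimpleGraph V) (S : Set V) : Prop :=
  S.Nonempty ∧ ∀ T ⊆ S, T.Nonempty → (∀ x ∈ T, ∀ y ∈ S, G.Adj x y → y ∈ T) → S ⊆ T

variable {G : SimpleGraph V} {S T U : Set V}

theorem Touch.symm (h : Touch G S T) : Touch G T S := by
  obtain ⟨s, hs, t, ht, h⟩ := h
  exact ⟨t, ht, s, hs, h.symm⟩

theorem touch_comm : Touch G S T ↔ Touch G T S := ⟨Touch.symm, Touch.symm⟩

theorem Touch.mono {S' T' : Set V} (h : Touch G S T) (hS : S ⊆ S') (hT : T ⊆ T') :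
    Touch G S' T' := by
  obtain ⟨s, hs, t, ht, h⟩ := h
  exact ⟨s, hS hs, t, hT ht, h⟩

theorem touch_union_left : Touch G (S ∪ T) U ↔ Touch G S U ∨ Touch G T U := by
  constructor
  · rintro ⟨s, hs | hs, t, ht, h⟩
    · exact Or.inl ⟨s, hs, t, ht, h⟩
    · exact Or.inr ⟨s, hs, t, ht, h⟩
  · rintro (h | h)
    · exact h.mono Set.subset_union_left subset_rfl
    · exact h.mono Set.subset_union_right subset_rfl

theorem touch_union_right : Touch G U (S ∪ T) ↔ Touch G U S ∨ Touch G U T := by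
  rw [touch_comm, touch_union_left, touch_comm, touch_comm (S := T)]

theorem touch_singleton_left {x : V} : Touch G {x} S ↔ ∃ s ∈ S, G.Adj x s := by
  simp [Touch]

theorem touch_singleton_singleton {x y : V} : Touch G {x} {y} ↔ G.Adj x y := by
  simp [Touch]

theorem not_touch_empty_left : ¬ Touch G ∅ S := by simp [Touch]

theorem not_touch_empty_right : ¬ Touch G S ∅ := by simp [Touch]

theorem connSet_singleton (x : V) : ConnSet G {x} := by
  refine ⟨⟨x, rfl⟩, fun T hT hne _ => ?_⟩
  obtain ⟨y, hy⟩ := hne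
  rintro z rfl
  have := hT hy
  rw [Set.mem_singleton_iff] at this
  exact this ▸ hy

/-- A subset closed in the union is closed in each part, so it swallows every part that it meets;
the common point carries it from one part to the other. -/
theorem ConnSet.union_of_inter (hS : ConnSet G S) (hT : ConnSet G T) (h : (S ∩ T).Nonempty) :
    ConnSet G (S ∪ T) := by
  refine ⟨hS.1.mono Set.subset_union_left, fun A hA hne hcl => ?_⟩
  have key : ∀ R : Set V, ConnSet G R → R ⊆ S ∪ T → (A ∩ R).Nonempty → R ⊆ A := by
    intro R hR hsub hne
    have := hR.2 (A ∩ R) Set.inter_subset_right hne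
      (fun x hx y hy hxy => ⟨hcl x hx.1 y (hsub hy) hxy, hy⟩)
    exact this.trans Set.inter_subset_left
  obtain ⟨z, hzS, hzT⟩ := h
  obtain ⟨a, ha⟩ := hne
  rcases hA ha with h | h
  · have h1 := key S hS Set.subset_union_left ⟨a, ha, h⟩
    exact Set.union_subset h1 (key T hT Set.subset_union_right ⟨z, h1 hzS, hzT⟩)
  · have h1 := key T hT Set.subset_union_right ⟨a, ha, h⟩
    exact Set.union_subset (key S hS Set.subset_union_left ⟨z, h1 hzT, hzS⟩) h1

theorem connSet_pair {x y : V} (h : G.Adj x y) : ConnSet G {x, y} := by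
  refine ⟨⟨x, by simp⟩, fun T hT hne hcl => ?_⟩
  obtain ⟨a, ha⟩ := hne
  have h1 : x ∈ T := by
    rcases hT ha with rfl | h'
    · exact ha
    · rw [Set.mem_singleton_iff] at h'
      subst h'
      exact hcl _ ha x (by simp) h.symm
  have h2 : y ∈ T := hcl x h1 y (by simp) h
  rintro z (rfl | hz)
  · exact h1
  · rw [Set.mem_singleton_iff] at hz
    exact hz ▸ h2

theorem ConnSet.union (hS : ConnSet G S) (hT : ConnSet G T) (h : Touch G S T) :
    ConnSet G (S ∪ T) := by
  obtain ⟨s, hs, t, ht, h⟩ := h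
  have h1 : ConnSet G (S ∪ {s, t}) := hS.union_of_inter (connSet_pair h) ⟨s, hs, by simp⟩
  have h2 : ConnSet G (S ∪ {s, t} ∪ T) := h1.union_of_inter hT ⟨t, by simp, ht⟩
  convert h2 using 1
  ext z
  simp only [Set.mem_union, Set.mem_insert_iff, Set.mem_singleton_iff]
  constructor
  · tauto
  · rintro ((h | rfl | rfl) | h) <;> tauto

theorem ConnSet.insert {x : V} (hS : ConnSet G S) (h : ∃ s ∈ S, G.Adj x s) :
    ConnSet G (insert x S) := by
  have := (connSet_singleton x).union hS (touch_singleton_left.2 h)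
  rwa [Set.singleton_union] at this

/-- A set is connected if each of its points is joined to a base point inside it. -/
theorem connSet_of_forall {x : V} (hx : x ∈ S)
    (h : ∀ y ∈ S, ∃ R ⊆ S, ConnSet G R ∧ x ∈ R ∧ y ∈ R) : ConnSet G S := by
  refine ⟨⟨x, hx⟩, fun T hT hne hcl => ?_⟩
  have key : ∀ R : Set V, ConnSet G R → R ⊆ S → (T ∩ R).Nonempty → R ⊆ T := by
    intro R hR hsub hne
    have := hR.2 (T ∩ R) Set.inter_subset_right hne
      (fun x hx y hy hxy => ⟨hcl x hx.1 y (hsub hy) hxy, hy⟩)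
    exact this.trans Set.inter_subset_left
  obtain ⟨a, ha⟩ := hne
  obtain ⟨R, hRS, hR, hxR, haR⟩ := h a (hT ha)
  have hxT : x ∈ T := key R hR hRS ⟨a, ha, haR⟩ hxR
  intro y hy
  obtain ⟨R', hRS', hR', hxR', hyR'⟩ := h y hy
  exact key R' hR' hRS' ⟨x, hxT, hxR'⟩ hyR'

/-- The connected component of `x` in the subgraph induced by `S`. -/
def compIn (G : SimpleGraph V) (S : Set V) (x : V) : Set V :=
  {y | ∃ R ⊆ S, ConnSet G R ∧ x ∈ R ∧ y ∈ R}

theorem compIn_subset (x : V) : compIn G S x ⊆ S := by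
  rintro y ⟨R, hR, _, _, hy⟩
  exact hR hy

theorem mem_compIn_self {x : V} (hx : x ∈ S) : x ∈ compIn G S x :=
  ⟨{x}, by simpa using hx, connSet_singleton x, rfl, rfl⟩

theorem connSet_compIn {x : V} (hx : x ∈ S) : ConnSet G (compIn G S x) := by
  refine connSet_of_forall (mem_compIn_self hx) ?_
  rintro y ⟨R, hRS, hR, hxR, hyR⟩
  exact ⟨R, fun z hz => ⟨R, hRS, hR, hxR, hz⟩, hR, hxR, hyR⟩

theorem compIn_closed {x y z : V} (hy : y ∈ compIn G S x) (hz : z ∈ S) (h : G.Adj y z) :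
    z ∈ compIn G S x := by
  obtain ⟨R, hRS, hR, hxR, hyR⟩ := hy
  refine ⟨R ∪ {y, z}, Set.union_subset hRS ?_, hR.union_of_inter (connSet_pair h) ⟨y, hyR, by simp⟩,
    Or.inl hxR, Or.inr (by simp)⟩
  rintro w (rfl | hw)
  · exact hRS hyR
  · rw [Set.mem_singleton_iff] at hw
    exact hw ▸ hz

theorem subset_compIn {x : V} {R : Set V} (hR : ConnSet G R) (hRS : R ⊆ S) {y : V} (hy : y ∈ R)
    (hyc : y ∈ compIn G S x) : R ⊆ compIn G S x := by
  obtain ⟨R', hRS', hR', hxR', hyR'⟩ := hyc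
  intro z hz
  exact ⟨R' ∪ R, Set.union_subset hRS' hRS, hR'.union_of_inter hR ⟨y, hyR', hy⟩, Or.inl hxR',
    Or.inr hz⟩

theorem ConnSet.touch_diff (hS : ConnSet G S) (hT : T ⊆ S) (hne : T.Nonempty) (hd : (S \ T).Nonempty) :
    Touch G T (S \ T) := by
  by_contra hcon
  obtain ⟨z, hz, hzT⟩ := hd
  refine hzT (hS.2 T hT hne (fun x hx y hy hxy => ?_) hz)
  by_contra hyT
  exact hcon ⟨x, hx, y, ⟨hy, hyT⟩, hxy⟩

/-- Maps that preserve or contract edges send connected sets to connected sets. -/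
theorem ConnSet.image {H : SimpleGraph W} (hS : ConnSet G S) (f : V → W)
    (hf : ∀ u ∈ S, ∀ v ∈ S, G.Adj u v → f u = f v ∨ H.Adj (f u) (f v)) : ConnSet H (f '' S) := by
  refine ⟨hS.1.image f, fun T hT hne hcl => ?_⟩
  have h1 : S ⊆ {x ∈ S | f x ∈ T} := by
    refine hS.2 _ (fun x hx => hx.1) ?_ ?_
    · obtain ⟨t, ht⟩ := hne
      obtain ⟨x, hx, rfl⟩ := hT ht
      exact ⟨x, hx, ht⟩
    · rintro x ⟨hx, hxT⟩ y hy hxy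
      refine ⟨hy, ?_⟩
      rcases hf x hx y hy hxy with h | h
      · exact h ▸ hxT
      · exact hcl _ hxT _ ⟨y, hy, rfl⟩ h
  rintro _ ⟨x, hx, rfl⟩
  exact (h1 hx).2

theorem connSet_interval (f : ℕ → V) {a b : ℕ} (hab : a ≤ b)
    (h : ∀ i, a ≤ i → i < b → G.Adj (f i) (f (i + 1))) : ConnSet G (f '' Set.Icc a b) := by
  induction b, hab using Nat.le_induction with
  | base => simpa using connSet_singleton (f a)
  | succ b hab ih =>
    have h1 := (ih (fun i h1 h2 => h i h1 (by omega))).insert (x := f (b + 1))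
      ⟨f b, ⟨b, ⟨hab, le_rfl⟩, rfl⟩, (h b hab (by omega)).symm⟩
    convert h1 using 1
    rw [← Set.image_insert_eq]
    congr 1
    ext i
    simp only [Set.mem_Icc, Set.mem_insert_iff]
    omega

/-- The definition by closed subsets keeps walks out of nearly all arguments. This bridge serves the
connectedness demanded of basic graphs and the existence of vertices whose removal does not
disconnect. -/
theorem connSet_iff_induce_connected : ConnSet G S ↔ (G.induce S).Connected := by
  constructor
  · intro h
    rw [SimpleGraph.connected_iff]
    refine ⟨?_, h.1.to_subtype⟩
    rintro ⟨x, hx⟩ ⟨y, hy⟩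
    have := h.2 {z | ∃ hz : z ∈ S, (G.induce S).Reachable ⟨x, hx⟩ ⟨z, hz⟩} (fun z hz => hz.1)
      ⟨x, hx, SimpleGraph.Reachable.refl _⟩ ?_ hy
    · exact this.2
    · rintro z ⟨hz, hr⟩ w hw hzw
      exact ⟨hw, hr.trans (SimpleGraph.Adj.reachable (by simpa using hzw))⟩
  · intro h
    obtain ⟨x⟩ := h.nonempty
    refine ⟨⟨x, x.2⟩, fun T hT hne hcl y hy => ?_⟩
    obtain ⟨t, ht⟩ := hne
    obtain ⟨p⟩ := h.preconnected ⟨t, hT ht⟩ ⟨y, hy⟩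
    have key : ∀ (a b : S) (p : (G.induce S).Walk a b), (a : V) ∈ T → (b : V) ∈ T := by
      intro a b p
      induction p with
      | nil => exact id
      | cons hadj _ ih => exact fun ha => ih (hcl _ ha _ (Subtype.coe_prop _) (by simpa using hadj))
    exact key _ _ p ht

theorem connSet_univ_iff : ConnSet G Set.univ ↔ G.Connected := by
  rw [connSet_iff_induce_connected]
  exact (SimpleGraph.induceUnivIso G).connected_iff

/-- The splitting tool for minimality arguments: a smallest connected set with prescribed
attachments, if it is not one vertex, falls into a vertex and a connected rest, neither of which has
all the attachments. -/
theorem ConnSet.exists_diff_singleton (hS : ConnSet G S) (hfin : S.Finite) (hnt : S.Nontrivial) :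
    ∃ u ∈ S, ConnSet G (S \ {u}) := by
  have := hfin.to_subtype
  have : Nontrivial S := hnt.coe_sort
  obtain ⟨v, hv⟩ :=
    (connSet_iff_induce_connected.1 hS).exists_connected_induce_compl_singleton_of_finite_nontrivial
  refine ⟨v, v.2, ?_⟩
  rw [← connSet_iff_induce_connected] at hv
  have := hv.image (H := G) Subtype.val (fun a _ b _ hab => Or.inr (by simpa using hab))
  convert this using 1
  ext z
  simp only [Set.mem_sdiff, Set.mem_singleton_iff, Set.mem_image, Set.mem_compl_iff, Subtype.exists,
    exists_and_right, exists_eq_right]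
  constructor
  · rintro ⟨h1, h2⟩
    exact ⟨h1, fun h => h2 (congrArg Subtype.val h)⟩
  · rintro ⟨h1, h2⟩
    exact ⟨h1, fun h => h2 (Subtype.ext h)⟩

/-- Either `U₁` and `U₂` are joined inside `M` avoiding `N`, or some `z ∈ N` is the first point of
`N` on a way from `U₁` to `U₂`. -/
theorem barrier {M N U₁ U₂ : Set V} (hM : ConnSet G M) (hU₁ : ConnSet G U₁)
    (h₁ : Touch G U₁ M) (h₂ : Touch G U₂ M) :
    (∃ M' ⊆ M \ N, ConnSet G M' ∧ Touch G U₁ M' ∧ Touch G U₂ M') ∨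
    ∃ z ∈ M ∩ N, ∃ C ⊆ M \ N, ConnSet G (U₁ ∪ C) ∧ ¬ Touch G C U₂ ∧ Touch G {z} (U₁ ∪ C) ∧
      (∀ c ∈ C, ∃ R ⊆ C, ConnSet G R ∧ Touch G U₁ R ∧ c ∈ R) ∧
      (Touch G {z} U₂ ∨ ¬ Touch G {z} U₂ ∧ ∃ E ⊆ M, z ∉ E ∧ ConnSet G E ∧ Touch G {z} E ∧
        Touch G E U₂ ∧ Disjoint C E ∧ ¬ Touch G E (U₁ ∪ C)) := by
  by_cases hdir : ∃ M' ⊆ M \ N, ConnSet G M' ∧ Touch G U₁ M' ∧ Touch G U₂ M'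
  · exact Or.inl hdir
  right
  -- `C` is the part of `M` that can be reached from `U₁` before `N` is met.
  set C : Set V := {c | ∃ R ⊆ M \ N, ConnSet G R ∧ Touch G U₁ R ∧ c ∈ R} with hC
  have hCM : C ⊆ M \ N := by
    rintro c ⟨R, hR, _, _, hc⟩
    exact hR hc
  have hCR : ∀ c ∈ C, ∃ R ⊆ C, ConnSet G R ∧ Touch G U₁ R ∧ c ∈ R := by
    rintro c ⟨R, hR, hR', hR'', hc⟩
    exact ⟨R, fun r hr => ⟨R, hR, hR', hR'', hr⟩, hR', hR'', hc⟩
  have hconn : ConnSet G (U₁ ∪ C) := by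
    obtain ⟨x, hx⟩ := hU₁.1
    refine connSet_of_forall (Or.inl hx) ?_
    rintro y (hy | hy)
    · exact ⟨U₁, Set.subset_union_left, hU₁, hx, hy⟩
    · obtain ⟨R, hR, hR', hR'', hc⟩ := hCR y hy
      exact ⟨U₁ ∪ R, Set.union_subset_union_right _ hR, hU₁.union hR' hR'', Or.inl hx, Or.inr hc⟩
  have hCU : ¬ Touch G C U₂ := by
    rintro ⟨c, ⟨R, hR, hR', hR'', hc⟩, t, ht, hct⟩
    exact hdir ⟨R, hR, hR', hR'', t, ht, c, hc, hct.symm⟩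
  -- vertices of `M` next to `U₁ ∪ C` lie in `C ∪ N`
  have hnext : ∀ m ∈ M, Touch G {m} (U₁ ∪ C) → m ∈ C ∨ m ∈ N := by
    intro m hm ht
    by_contra hcon
    push Not at hcon
    refine hcon.1 ?_
    rw [touch_union_right] at ht
    rcases ht with ht | ht
    · exact ⟨{m}, by simpa using ⟨hm, hcon.2⟩, connSet_singleton m, ht.symm, rfl⟩
    · obtain ⟨c, hc, hmc⟩ := touch_singleton_left.1 ht
      obtain ⟨R, hR, hR', hR'', hcR⟩ := hc
      refine ⟨insert m R, Set.insert_subset ⟨hm, hcon.2⟩ hR, hR'.insert ⟨c, hcR, hmc⟩,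
        hR''.mono subset_rfl (Set.subset_insert _ _), Set.mem_insert _ _⟩
  -- `Z` is the set of first points of `N` met from `U₁`. If none of them sees `U₂`, the component
  -- `E` of `M \ (C ∪ Z)` attached to `U₂` can be left only through `Z`, and a vertex of `Z` next to
  -- `E` is the required `z`.
  set Z : Set V := {z ∈ M ∩ N | Touch G {z} (U₁ ∪ C)} with hZ
  by_cases hz : ∃ z ∈ Z, Touch G {z} U₂
  · obtain ⟨z, hz, hzU⟩ := hz
    exact ⟨z, hz.1, C, hCM, hconn, hCU, hz.2, hCR, Or.inl hzU⟩
  obtain ⟨u, hu, m, hm, hum⟩ := h₂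
  have hmC : m ∉ C := fun h => hCU ⟨m, h, u, hu, hum.symm⟩
  have hmZ : m ∉ Z := fun h => hz ⟨m, h, touch_singleton_left.2 ⟨u, hu, hum.symm⟩⟩
  have hmR : m ∈ M \ (C ∪ Z) := ⟨hm, fun h => h.elim hmC hmZ⟩
  set E := compIn G (M \ (C ∪ Z)) m with hE
  have hEsub : E ⊆ M \ (C ∪ Z) := compIn_subset m
  have hEU : ¬ Touch G E (U₁ ∪ C) := by
    rintro ⟨e, he, t, ht, het⟩
    have h1 := hEsub he
    have h2 : Touch G {e} (U₁ ∪ C) := touch_singleton_left.2 ⟨t, ht, het⟩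
    rcases hnext e h1.1 h2 with h | h
    · exact h1.2 (Or.inl h)
    · exact h1.2 (Or.inr ⟨⟨h1.1, h⟩, h2⟩)
  have hrest : (M \ E).Nonempty := by
    obtain ⟨a, ha, b, hb, hab⟩ := h₁
    exact ⟨b, hb, fun h => hEU ⟨b, h, a, Or.inl ha, hab.symm⟩⟩
  obtain ⟨e, he, z, hz', hez⟩ :=
    hM.touch_diff (hEsub.trans Set.sdiff_subset) ⟨m, mem_compIn_self hmR⟩ hrest
  have hzZ : z ∈ Z := by
    by_contra hcon
    by_cases hzC : z ∈ C
    · exact hEU ⟨e, he, z, Or.inr hzC, hez⟩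
    · exact hz'.2 (compIn_closed he ⟨hz'.1, fun h => h.elim hzC hcon⟩ hez)
  refine ⟨z, hzZ.1, C, hCM, hconn, hCU, hzZ.2, hCR, Or.inr ⟨fun h => hz ⟨z, hzZ, h⟩, E,
    hEsub.trans Set.sdiff_subset, hz'.2, connSet_compIn hmR,
    touch_singleton_left.2 ⟨e, he, hez.symm⟩, ⟨m, mem_compIn_self hmR, u, hu, hum.symm⟩, ?_, hEU⟩⟩
  rw [Set.disjoint_left]
  exact fun x hx hxE => (hEsub hxE).2 (Or.inl hx)

end Connectivity

/-! ### Thetas, cycles with a unique chord, and models by bags -/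

section Theta

variable {V W : Type*}

/-- An edge `x y` together with two disjoint connected sets with no edges between them, each
attached to both `x` and `y`. -/
structure Theta (G : SimpleGraph V) (x y : V) (D₁ D₂ : Set V) : Prop where
  adj : G.Adj x y
  conn₁ : ConnSet G D₁
  conn₂ : ConnSet G D₂
  disj : Disjoint D₁ D₂
  anti : ¬ Touch G D₁ D₂
  x₁ : x ∉ D₁
  x₂ : x ∉ D₂
  y₁ : y ∉ D₁
  y₂ : y ∉ D₂
  tx₁ : Touch G {x} D₁
  tx₂ : Touch G {x} D₂
  ty₁ : Touch G {y} D₁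
  ty₂ : Touch G {y} D₂

theorem Theta.swap {G : SimpleGraph V} {x y : V} {D₁ D₂ : Set V} (h : Theta G x y D₁ D₂) :
    Theta G x y D₂ D₁ :=
  ⟨h.adj, h.conn₂, h.conn₁, h.disj.symm, fun t => h.anti t.symm, h.x₂, h.x₁, h.y₂, h.y₁, h.tx₂,
    h.tx₁, h.ty₂, h.ty₁⟩

theorem Theta.symm {G : SimpleGraph V} {x y : V} {D₁ D₂ : Set V} (h : Theta G x y D₁ D₂) :
    Theta G y x D₁ D₂ :=
  ⟨h.adj.symm, h.conn₁, h.conn₂, h.disj, h.anti, h.y₁, h.y₂, h.x₁, h.x₂, h.ty₁, h.ty₂, h.tx₁,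
    h.tx₂⟩

/-- No edge is the unique chord of a cycle, in terms of connected sets. -/
def NoTheta (G : SimpleGraph V) : Prop := ∀ x y D₁ D₂, ¬ Theta G x y D₁ D₂

variable {G : SimpleGraph V}

/-- The chord cuts the cycle into two open arcs. An edge between the arcs would be a second chord,
so the arcs and the chord form a theta. -/
theorem inC_of_noTheta (h : NoTheta G) : InC G := by
  classical
  rintro ⟨v, c₀, hc₀, e, he, huniq⟩
  induction e using Sym2.ind with
  | _ x y =>
  -- The cycle is rotated to start at `x`, so that the chord joins the positions `0` and `k`.
  have hxs : x ∈ c₀.support := (SimpleGraph.Walk.isChord_sym2Mk.1 he).2.2.1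
  obtain ⟨c, hc, hch⟩ : ∃ c : G.Walk x x, c.IsCycle ∧ ∀ e, c.IsChord e ↔ c₀.IsChord e := by
    refine ⟨c₀.rotate x hxs, by simpa using hc₀, ?_⟩
    intro e
    induction e using Sym2.ind with
    | _ a b =>
    rw [SimpleGraph.Walk.isChord_sym2Mk, SimpleGraph.Walk.isChord_sym2Mk,
      SimpleGraph.Walk.mem_support_rotate_iff, SimpleGraph.Walk.mem_support_rotate_iff,
      (c₀.rotate_edges x hxs).mem_iff]
  rw [← hch] at he
  have huniq' : ∀ a b, c.IsChord s(a, b) → s(a, b) = s(x, y) := fun a b hab =>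
    huniq _ ((hch _).1 hab)
  have hadj := (SimpleGraph.Walk.isChord_sym2Mk.1 he).1
  have hedge := (SimpleGraph.Walk.isChord_sym2Mk.1 he).2.1
  obtain ⟨k, hk, hkn⟩ := SimpleGraph.Walk.mem_support_iff_exists_getVert.1
    (SimpleGraph.Walk.isChord_sym2Mk.1 he).2.2.2
  have hinj := hc.getVert_injOn'
  set n := c.length with hn
  have hn3 : 3 ≤ n := hc.three_le_length
  set g := c.getVert with hg
  have hg0 : g 0 = x := c.getVert_zero
  have hgn : g n = x := c.getVert_length
  have hinj' : ∀ a b, a < n → b < n → g a = g b → a = b := fun a b ha hb hab =>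
    hinj (by simp only [Set.mem_ofPred_eq]; omega) (by simp only [Set.mem_ofPred_eq]; omega) hab
  have hstep : ∀ i, i < n → G.Adj (g i) (g (i + 1)) := fun i hi => c.adj_getVert_succ hi
  have hcons : ∀ i, i < n → s(g i, g (i + 1)) ∈ c.edges := fun i hi => by
    rw [← SimpleGraph.Walk.adj_toSubgraph_iff_mem_edges]
    exact c.toSubgraph_adj_getVert hi
  have hk0 : k ≠ 0 := fun h => hadj.ne (by rw [← hk, h]; exact hg0.symm)
  have hk1 : k ≠ 1 := fun h => hedge (by
    have := hcons 0 (by omega)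
    rwa [hg0, zero_add, ← h, hk] at this)
  have hkn' : k ≠ n := fun h => hadj.ne (by rw [← hk, h]; exact hgn.symm)
  have hkn1 : k + 1 ≠ n := fun h => hedge (by
    have := hcons k (by omega)
    rw [h, hgn, hk] at this
    rwa [Sym2.eq_swap])
  -- Edges between two of the positions `0, …, n - 1` are steps of the cycle, its closing edge, or
  -- the chord.
  have hclass : ∀ a b, a < b → b < n → G.Adj (g a) (g b) → b = a + 1 ∨ (a = 0 ∧ b + 1 = n) ∨
      (a = 0 ∧ b = k) := by
    intro a b hab hb hadj'
    by_cases hed : s(g a, g b) ∈ c.edges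
    · rw [← SimpleGraph.Walk.adj_toSubgraph_iff_mem_edges, SimpleGraph.Walk.toSubgraph_adj_iff] at hed
      obtain ⟨i, hi, hin⟩ := hed
      rcases Sym2.eq_iff.1 hi with ⟨h1, h2⟩ | ⟨h1, h2⟩
      · have hia := hinj' _ _ hin (by omega) h1
        by_cases hi1 : i + 1 < n
        · have := hinj' _ _ hi1 hb h2
          omega
        · have hh : i + 1 = n := by omega
          have := hinj' 0 b (by omega) hb ((hg0.trans hgn.symm).trans ((congrArg g hh.symm).trans h2))
          omega
      · have hia := hinj' _ _ hin hb h1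
        by_cases hi1 : i + 1 < n
        · have := hinj' _ _ hi1 (by omega) h2
          omega
        · have hh : i + 1 = n := by omega
          have := hinj' 0 a (by omega) (by omega) ((hg0.trans hgn.symm).trans ((congrArg g hh.symm).trans h2))
          omega
    · have hch' : c.IsChord s(g a, g b) := SimpleGraph.Walk.isChord_sym2Mk.2
        ⟨hadj', hed, c.getVert_mem_support a, c.getVert_mem_support b⟩
      rcases Sym2.eq_iff.1 (huniq' _ _ hch') with ⟨h1, h2⟩ | ⟨h1, h2⟩
      · have e1 := hinj' a 0 (by omega) (by omega) (h1.trans hg0.symm)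
        have e2 := hinj' b k hb (by omega) (h2.trans hk.symm)
        omega
      · have e1 := hinj' b 0 (by omega) (by omega) (h2.trans hg0.symm)
        omega
  refine h x y (g '' Set.Icc 1 (k - 1)) (g '' Set.Icc (k + 1) (n - 1)) ⟨hadj,
    connSet_interval g (by omega) (fun i _ _ => hstep i (by omega)),
    connSet_interval g (by omega) (fun i _ _ => hstep i (by omega)), ?_, ?_, ?_, ?_, ?_, ?_, ?_, ?_,
    ?_, ?_⟩
  · rw [Set.disjoint_left]
    rintro _ ⟨a, ⟨ha1, ha2⟩, rfl⟩ ⟨b, ⟨hb1, hb2⟩, hab⟩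
    have := hinj' _ _ (by omega) (by omega) hab
    omega
  · rintro ⟨_, ⟨a, ⟨ha1, ha2⟩, rfl⟩, _, ⟨b, ⟨hb1, hb2⟩, rfl⟩, hab⟩
    have := hclass a b (by omega) (by omega) hab
    omega
  · rintro ⟨a, ⟨ha1, ha2⟩, hax⟩
    have := hinj' a 0 (by omega) (by omega) (hax.trans hg0.symm)
    omega
  · rintro ⟨a, ⟨ha1, ha2⟩, hax⟩
    have := hinj' a 0 (by omega) (by omega) (hax.trans hg0.symm)
    omega
  · rintro ⟨a, ⟨ha1, ha2⟩, hax⟩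
    have := hinj' a k (by omega) (by omega) (hax.trans hk.symm)
    omega
  · rintro ⟨a, ⟨ha1, ha2⟩, hax⟩
    have := hinj' a k (by omega) (by omega) (hax.trans hk.symm)
    omega
  · exact touch_singleton_left.2 ⟨g 1, ⟨1, ⟨by omega, by omega⟩, rfl⟩, hg0 ▸ hstep 0 (by omega)⟩
  · refine touch_singleton_left.2 ⟨g (n - 1), ⟨n - 1, ⟨by omega, by omega⟩, rfl⟩, ?_⟩
    have := hstep (n - 1) (by omega)
    rw [show n - 1 + 1 = n by omega, hgn] at this
    exact this.symm
  · refine touch_singleton_left.2 ⟨g (k - 1), ⟨k - 1, ⟨by omega, by omega⟩, rfl⟩, ?_⟩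
    have := hstep (k - 1) (by omega)
    rw [show k - 1 + 1 = k by omega, hk] at this
    exact this.symm
  · exact touch_singleton_left.2 ⟨g (k + 1), ⟨k + 1, ⟨by omega, by omega⟩, rfl⟩,
      hk ▸ hstep k (by omega)⟩

/-- `f` runs from `x` to `y` in `n + 2` steps with all intermediate points in `D`. -/
def IsTrack (G : SimpleGraph V) (D : Set V) (x y : V) (n : ℕ) (f : ℕ → V) : Prop :=
  f 0 = x ∧ f (n + 2) = y ∧ (∀ i, 1 ≤ i → i ≤ n + 1 → f i ∈ D) ∧
    ∀ i, i ≤ n + 1 → G.Adj (f i) (f (i + 1))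

/-- The points of `D` reached by tracks from `x`, together with the chosen neighbour `d` of `x`, are
closed under adjacency in `D`. The length `n + 2` records that at least one interior point is used.
-/
theorem exists_isTrack {D : Set V} (hD : ConnSet G D) {x y : V} (hx : Touch G {x} D)
    (hy : Touch G {y} D) : ∃ n f, IsTrack G D x y n f := by
  classical
  obtain ⟨d, hd, hxd⟩ := touch_singleton_left.1 hx
  obtain ⟨d', hd', hyd⟩ := touch_singleton_left.1 hy
  have key : D ⊆ {z ∈ D | ∃ n f, IsTrack G D x z n f} ∪ {d} := by
    refine hD.2 _ ?_ ⟨d, Or.inr rfl⟩ ?_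
    · rintro z (hz | hz)
      · exact hz.1
      · rw [Set.mem_singleton_iff] at hz
        exact hz ▸ hd
    · rintro z (⟨hz, n, f, h0, h2, h3, h4⟩ | hz) w hw hzw
      · refine Or.inl ⟨hw, n + 1, fun i => if i ≤ n + 2 then f i else w, by simpa using h0, by simp,
          fun i hi1 hi2 => ?_, fun i hi => ?_⟩
        · have hi2' : i ≤ n + 2 := by omega
          simp only [hi2', if_true]
          by_cases h : i = n + 2
          · rw [h, h2]; exact hz
          · exact h3 i hi1 (by omega)
        · have hi2' : i ≤ n + 2 := by omega
          simp only [hi2', if_true]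
          by_cases h : i = n + 2
          · rw [if_neg (by omega), h, h2]; exact hzw
          · rw [if_pos (by omega)]; exact h4 i (by omega)
      · rw [Set.mem_singleton_iff] at hz
        subst hz
        refine Or.inl ⟨hw, 0, fun i => if i = 0 then x else if i = 1 then z else w, by simp, by simp,
          fun i hi1 hi2 => ?_, fun i hi => ?_⟩
        · have : i = 1 := by omega
          simpa [this] using hd
        · have : i = 0 ∨ i = 1 := by omega
          rcases this with rfl | rfl <;> simpa
  rcases key hd' with ⟨_, n, f, h0, h2, h3, h4⟩ | h
  · refine ⟨n + 1, fun i => if i ≤ n + 2 then f i else y, by simpa using h0, by simp,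
      fun i hi1 hi2 => ?_, fun i hi => ?_⟩
    · have hi2' : i ≤ n + 2 := by omega
      simp only [hi2', if_true]
      by_cases h : i = n + 2
      · rw [h, h2]; exact hd'
      · exact h3 i hi1 (by omega)
    · have hi2' : i ≤ n + 2 := by omega
      simp only [hi2', if_true]
      by_cases h : i = n + 2
      · rw [if_neg (by omega), h, h2]; exact hyd.symm
      · rw [if_pos (by omega)]; exact h4 i (by omega)
  · rw [Set.mem_singleton_iff] at h
    subst h
    refine ⟨0, fun i => if i = 0 then x else if i = 1 then d' else y, by simp, by simp,
      fun i hi1 hi2 => ?_, fun i hi => ?_⟩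
    · have : i = 1 := by omega
      simpa [this] using hd
    · have : i = 0 ∨ i = 1 := by omega
      rcases this with rfl | rfl
      · simpa
      · simpa using hyd.symm

/-- The pair `0`, `n + 2` is excluded because a jump along the edge from `x` to `y` would leave no
interior point. -/
theorem IsTrack.shortcut {D : Set V} {x y : V} {n : ℕ} {f : ℕ → V} (h : IsTrack G D x y n f)
    {i j : ℕ} (hij : i + 1 < j) (hj : j ≤ n + 2) (hne : ¬ (i = 0 ∧ j = n + 2))
    (hadj : G.Adj (f i) (f j)) : ∃ m < n, ∃ g, IsTrack G D x y m g ∧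
      (fun k => g k) '' Set.Icc 1 (m + 1) ⊆ f '' Set.Icc 1 (n + 1) := by
  obtain ⟨h0, h2, h3, h4⟩ := h
  refine ⟨n - (j - i - 1), by omega, fun t => if t ≤ i then f t else f (t + (j - i - 1)),
    ⟨by simpa using h0, ?_, fun t ht1 ht2 => ?_, fun t ht => ?_⟩, ?_⟩
  · show (if _ then _ else _) = y
    rw [if_neg (by omega), ← h2]
    congr 1
    omega
  · show (if _ then _ else _) ∈ D
    split_ifs
    · exact h3 t ht1 (by omega)
    · exact h3 _ (by omega) (by omega)
  · show G.Adj (if _ then _ else _) (if _ then _ else _)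
    split_ifs with h5 h6 h6
    · exact h4 t (by omega)
    · have : t = i := by omega
      subst this
      rwa [show t + 1 + (j - t - 1) = j by omega]
    · omega
    · rw [show t + 1 + (j - i - 1) = t + (j - i - 1) + 1 by omega]
      exact h4 _ (by omega)
  · rintro _ ⟨t, ⟨ht1, ht2⟩, rfl⟩
    show (if _ then _ else _) ∈ _
    split_ifs
    · exact ⟨t, ⟨by omega, by omega⟩, rfl⟩
    · exact ⟨_, ⟨by omega, by omega⟩, rfl⟩

/-- A shortest track is injective and has no shortcuts. -/
theorem exists_induced_track {D : Set V} (hD : ConnSet G D) {x y : V} (hx : Touch G {x} D)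
    (hy : Touch G {y} D) (hxD : x ∉ D) (hyD : y ∉ D) (hxy : x ≠ y) :
    ∃ n f, IsTrack G D x y n f ∧ (∀ i j, i ≤ n + 2 → j ≤ n + 2 → f i = f j → i = j) ∧
      ∀ i j, i < j → j ≤ n + 2 → G.Adj (f i) (f j) → j = i + 1 ∨ (i = 0 ∧ j = n + 2) := by
  classical
  have hex := exists_isTrack hD hx hy
  obtain ⟨f, hf⟩ := Nat.find_spec hex
  have hmin := fun m (hm : m < Nat.find hex) => Nat.find_min hex hm
  set n := Nat.find hex with hn
  have hchord : ∀ i j, i < j → j ≤ n + 2 → G.Adj (f i) (f j) → j = i + 1 ∨ (i = 0 ∧ j = n + 2) := by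
    intro i j hij hj hadj
    by_contra hcon
    push Not at hcon
    obtain ⟨m, hm, g, hg, _⟩ := hf.shortcut (i := i) (j := j) (by omega) hj
      (fun h => hcon.2 h.1 h.2) hadj
    exact hmin m hm ⟨g, hg⟩
  refine ⟨n, f, hf, ?_, hchord⟩
  have key : ∀ i j, i < j → j ≤ n + 2 → f i ≠ f j := by
    intro i j hij hj heq
    obtain ⟨h0, h2, h3, h4⟩ := hf
    by_cases hi : i = 0
    · subst hi
      by_cases hj2 : j = n + 2
      · subst hj2
        exact hxy (by rw [← h0, heq, h2])
      · exact hxD (by rw [← h0, heq]; exact h3 j (by omega) (by omega))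
    · by_cases hj2 : j = n + 2
      · subst hj2
        exact hyD (by rw [← h2, ← heq]; exact h3 i (by omega) (by omega))
      · have := h4 j (by omega)
        rw [← heq] at this
        rcases hchord i (j + 1) (by omega) (by omega) this with h | h <;> omega
  intro i j hi hj heq
  rcases lt_trichotomy i j with h | h | h
  · exact absurd heq (key i j h hj)
  · exact h
  · exact absurd heq.symm (key j i h hi)

theorem exists_walk_of_track (f : ℕ → V) (n : ℕ) (h : ∀ i, i < n → G.Adj (f i) (f (i + 1))) :
    ∃ p : G.Walk (f 0) (f n), p.support = (List.range (n + 1)).map f ∧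
      p.edges = (List.range n).map (fun i => s(f i, f (i + 1))) := by
  induction n with
  | zero => exact ⟨.nil, by simp, by simp⟩
  | succ n ih =>
    obtain ⟨p, hp, hp'⟩ := ih (fun i hi => h i (by omega))
    refine ⟨p.concat (h n (by omega)), ?_, ?_⟩
    · rw [SimpleGraph.Walk.support_concat, hp, List.range_succ (n := n + 1), List.map_append]
      simp
    · rw [SimpleGraph.Walk.edges_concat, hp', List.range_succ (n := n), List.map_append]
      simp

/-- Shortest tracks through the two sides are induced apart from the edge `x y`, and nothing joins
their interiors. Their union is a cycle of which `x y` is the only chord. -/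
theorem noTheta_of_inC (h : InC G) : NoTheta G := by
  classical
  intro x y D₁ D₂ ht
  obtain ⟨n, f, hf, finj, fch⟩ := exists_induced_track ht.conn₁ ht.tx₁ ht.ty₁ ht.x₁ ht.y₁ ht.adj.ne
  obtain ⟨m, g, hg, ginj, gch⟩ := exists_induced_track ht.conn₂ ht.tx₂ ht.ty₂ ht.x₂ ht.y₂ ht.adj.ne
  obtain ⟨f0, fn, fD, fadj⟩ := hf
  obtain ⟨g0, gm, gD, gadj⟩ := hg
  obtain ⟨p, hps, hpe⟩ := exists_walk_of_track f (n + 2) (fun i hi => fadj i (by omega))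
  obtain ⟨q, hqs, hqe⟩ := exists_walk_of_track g (m + 2) (fun i hi => gadj i (by omega))
  obtain ⟨p, hps, hpe⟩ : ∃ p : G.Walk x y, p.support = (List.range (n + 2 + 1)).map f ∧
      p.edges = (List.range (n + 2)).map (fun i => s(f i, f (i + 1))) := by
    rw [← f0, ← fn]; exact ⟨p, hps, hpe⟩
  obtain ⟨q, hqs, hqe⟩ : ∃ q : G.Walk x y, q.support = (List.range (m + 2 + 1)).map g ∧
      q.edges = (List.range (m + 2)).map (fun i => s(g i, g (i + 1))) := by
    rw [← g0, ← gm]; exact ⟨q, hqs, hqe⟩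
  have hpp : p.IsPath := by
    rw [SimpleGraph.Walk.isPath_def, hps]
    refine List.Nodup.map_on ?_ List.nodup_range
    intro i hi j hj hij
    exact finj i j (by simp at hi; omega) (by simp at hj; omega) hij
  have hqp : q.IsPath := by
    rw [SimpleGraph.Walk.isPath_def, hqs]
    refine List.Nodup.map_on ?_ List.nodup_range
    intro i hi j hj hij
    exact ginj i j (by simp at hi; omega) (by simp at hj; omega) hij
  have hpm : ∀ z, z ∈ p.support ↔ z = x ∨ z = y ∨ ∃ i, 1 ≤ i ∧ i ≤ n + 1 ∧ f i = z := by
    intro z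
    rw [hps, List.mem_map]
    constructor
    · rintro ⟨i, hi, rfl⟩
      rw [List.mem_range] at hi
      by_cases h1 : i = 0
      · left; rw [h1, f0]
      by_cases h2 : i = n + 2
      · right; left; rw [h2, fn]
      exact Or.inr (Or.inr ⟨i, by omega, by omega, rfl⟩)
    · rintro (rfl | rfl | ⟨i, h1, h2, rfl⟩)
      · exact ⟨0, by simp, f0⟩
      · exact ⟨n + 2, by simp, fn⟩
      · exact ⟨i, by rw [List.mem_range]; omega, rfl⟩
  have hqm : ∀ z, z ∈ q.support ↔ z = x ∨ z = y ∨ ∃ i, 1 ≤ i ∧ i ≤ m + 1 ∧ g i = z := by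
    intro z
    rw [hqs, List.mem_map]
    constructor
    · rintro ⟨i, hi, rfl⟩
      rw [List.mem_range] at hi
      by_cases h1 : i = 0
      · left; rw [h1, g0]
      by_cases h2 : i = m + 2
      · right; left; rw [h2, gm]
      exact Or.inr (Or.inr ⟨i, by omega, by omega, rfl⟩)
    · rintro (rfl | rfl | ⟨i, h1, h2, rfl⟩)
      · exact ⟨0, by simp, g0⟩
      · exact ⟨m + 2, by simp, gm⟩
      · exact ⟨i, by rw [List.mem_range]; omega, rfl⟩
  have hdisj : ∀ z, z ∈ p.support → z ∈ q.support → z = x ∨ z = y := by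
    intro z hz1 hz2
    rcases (hpm z).1 hz1 with h1 | h1 | ⟨i, hi1, hi2, rfl⟩
    · exact Or.inl h1
    · exact Or.inr h1
    · rcases (hqm _).1 hz2 with h1 | h1 | ⟨j, hj1, hj2, hj⟩
      · exact Or.inl h1
      · exact Or.inr h1
      · exact absurd (hj ▸ gD j hj1 hj2 : f i ∈ D₂)
          (Set.disjoint_left.1 ht.disj (fD i hi1 hi2))
  have hplen : p.length = n + 2 := by
    have := p.length_support
    rw [hps] at this
    simpa using this.symm
  refine h ⟨x, p.append q.reverse, ?_, s(x, y), ?_, ?_⟩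
  · refine hpp.isCycle_append ((SimpleGraph.Walk.isPath_reverse_iff q).2 hqp) ?_
      (Or.inl (by omega))
    intro z hz1 hz2
    have hz1' : z ∈ p.support := List.mem_of_mem_tail hz1
    have hz2' : z ∈ q.reverse.support := List.mem_of_mem_tail hz2
    have hz2'' : z ∈ q.support := by simpa using hz2'
    rcases hdisj z hz1' hz2'' with rfl | rfl
    · have := hpp.support_nodup
      rw [← SimpleGraph.Walk.cons_tail_support] at this
      exact (List.nodup_cons.1 this).1 hz1
    · have := ((SimpleGraph.Walk.isPath_reverse_iff q).2 hqp).support_nodup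
      rw [← SimpleGraph.Walk.cons_tail_support] at this
      exact (List.nodup_cons.1 this).1 hz2
  · refine SimpleGraph.Walk.isChord_sym2Mk.2 ⟨ht.adj, ?_, by simp, by simp⟩
    rw [SimpleGraph.Walk.edges_append, List.mem_append, SimpleGraph.Walk.edges_reverse,
      List.mem_reverse, hpe, hqe]
    rintro (he | he)
    · obtain ⟨i, hi, he⟩ := List.mem_map.1 he
      rw [List.mem_range] at hi
      rcases Sym2.eq_iff.1 he with ⟨h1, h2⟩ | ⟨h1, h2⟩
      · have e1 := finj i 0 (by omega) (by omega) (h1.trans f0.symm)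
        have e2 := finj (i + 1) (n + 2) (by omega) (by omega) (h2.trans fn.symm)
        omega
      · have e1 := finj (i + 1) 0 (by omega) (by omega) (h2.trans f0.symm)
        omega
    · obtain ⟨i, hi, he⟩ := List.mem_map.1 he
      rw [List.mem_range] at hi
      rcases Sym2.eq_iff.1 he with ⟨h1, h2⟩ | ⟨h1, h2⟩
      · have e1 := ginj i 0 (by omega) (by omega) (h1.trans g0.symm)
        have e2 := ginj (i + 1) (m + 2) (by omega) (by omega) (h2.trans gm.symm)
        omega
      · have e1 := ginj (i + 1) 0 (by omega) (by omega) (h2.trans g0.symm)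
        omega
  · intro e he
    induction e using Sym2.ind with
    | _ a b =>
    obtain ⟨hab, hed, ha, hb⟩ := SimpleGraph.Walk.isChord_sym2Mk.1 he
    rw [SimpleGraph.Walk.edges_append, List.mem_append, SimpleGraph.Walk.edges_reverse,
      List.mem_reverse] at hed
    push Not at hed
    -- Among the vertices of one track, an edge not belonging to the track can only be `x y`. Edges
    -- between the two tracks reduce to this case, since the sides are far apart.
    have hF : ∀ u w, u ∈ p.support → w ∈ p.support → G.Adj u w → s(u, w) ∉ p.edges →
        s(u, w) = s(x, y) := by
      have key : ∀ i j, i < j → j ≤ n + 2 → G.Adj (f i) (f j) → s(f i, f j) ∉ p.edges →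
          s(f i, f j) = s(x, y) := by
        intro i j hij hj hadj hne
        rcases fch i j hij hj hadj with h' | h'
        · refine absurd ?_ hne
          rw [hpe, List.mem_map]
          exact ⟨i, by rw [List.mem_range]; omega, by rw [h']⟩
        · rw [h'.1, h'.2, f0, fn]
      intro u w hu hw huw hne
      rw [hps, List.mem_map] at hu hw
      obtain ⟨i, hi, rfl⟩ := hu
      obtain ⟨j, hj, rfl⟩ := hw
      rw [List.mem_range] at hi hj
      rcases lt_trichotomy i j with h' | h' | h'
      · exact key i j h' (by omega) huw hne
      · exact absurd (congrArg f h') huw.ne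
      · rw [Sym2.eq_swap] at hne ⊢
        exact key j i h' (by omega) huw.symm hne
    have hG : ∀ u w, u ∈ q.support → w ∈ q.support → G.Adj u w → s(u, w) ∉ q.edges →
        s(u, w) = s(x, y) := by
      have key : ∀ i j, i < j → j ≤ m + 2 → G.Adj (g i) (g j) → s(g i, g j) ∉ q.edges →
          s(g i, g j) = s(x, y) := by
        intro i j hij hj hadj hne
        rcases gch i j hij hj hadj with h' | h'
        · refine absurd ?_ hne
          rw [hqe, List.mem_map]
          exact ⟨i, by rw [List.mem_range]; omega, by rw [h']⟩
        · rw [h'.1, h'.2, g0, gm]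
      intro u w hu hw huw hne
      rw [hqs, List.mem_map] at hu hw
      obtain ⟨i, hi, rfl⟩ := hu
      obtain ⟨j, hj, rfl⟩ := hw
      rw [List.mem_range] at hi hj
      rcases lt_trichotomy i j with h' | h' | h'
      · exact key i j h' (by omega) huw hne
      · exact absurd (congrArg g h') huw.ne
      · rw [Sym2.eq_swap] at hne ⊢
        exact key j i h' (by omega) huw.symm hne
    have hmix : ∀ u w, u ∈ p.support → w ∈ q.support → G.Adj u w →
        u ∈ q.support ∨ w ∈ p.support := by
      intro u w hu hw huw
      rcases (hpm u).1 hu with h1 | h1 | ⟨i, hi1, hi2, rfl⟩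
      · left; rw [h1]; simp
      · left; rw [h1]; simp
      · rcases (hqm w).1 hw with h1 | h1 | ⟨j, hj1, hj2, rfl⟩
        · right; rw [h1]; simp
        · right; rw [h1]; simp
        · exact absurd ⟨_, fD i hi1 hi2, _, gD j hj1 hj2, huw⟩ ht.anti
    rw [SimpleGraph.Walk.mem_support_append_iff, SimpleGraph.Walk.support_reverse,
      List.mem_reverse] at ha hb
    rcases ha with ha | ha <;> rcases hb with hb | hb
    · exact hF a b ha hb hab hed.1
    · rcases hmix a b ha hb hab with h' | h'
      · exact hG a b h' hb hab hed.2
      · exact hF a b ha h' hab hed.1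
    · rcases hmix b a hb ha hab.symm with h' | h'
      · exact hG a b ha h' hab hed.2
      · exact hF a b h' hb hab hed.1
    · exact hG a b ha hb hab hed.2

/-- A model of the relation `K` in `G`: connected disjoint bags (isolated indices may have empty
bags), with edges between two bags exactly when `K` relates them. -/
structure Model (G : SimpleGraph V) (K : SimpleGraph W) (B : W → Set V) : Prop where
  conn : ∀ i j, K.Adj i j → ConnSet G (B i)
  disj : ∀ i j, i ≠ j → Disjoint (B i) (B j)
  touch : ∀ i j, i ≠ j → (Touch G (B i) (B j) ↔ K.Adj i j)

theorem Model.connSet_biUnion {K : SimpleGraph W} {B : W → Set V} (hB : Model G K B) {D : Set W}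
    (hD : ConnSet K D) (hne : ∀ i ∈ D, ConnSet G (B i)) : ConnSet G (⋃ i ∈ D, B i) := by
  obtain ⟨d, hd⟩ := hD.1
  obtain ⟨x, hx⟩ := (hne d hd).1
  refine connSet_of_forall (x := x) (Set.mem_biUnion hd hx) ?_
  intro y hy
  obtain ⟨e, he, hye⟩ := Set.mem_iUnion₂.1 hy
  have key : D ⊆ {i ∈ D | ∃ R ⊆ ⋃ i ∈ D, B i, ConnSet G R ∧ x ∈ R ∧ B i ⊆ R} := by
    refine hD.2 _ (fun i hi => hi.1) ⟨d, hd, B d, Set.subset_biUnion_of_mem hd, hne d hd, hx,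
      subset_rfl⟩ ?_
    rintro i ⟨hi, R, hR, hRc, hxR, hiR⟩ j hj hij
    refine ⟨hj, R ∪ B j, Set.union_subset hR (Set.subset_biUnion_of_mem hj),
      hRc.union (hne j hj) ?_, Or.inl hxR, Set.subset_union_right⟩
    exact ((hB.touch i j hij.ne).2 hij).mono hiR subset_rfl
  obtain ⟨_, R, hR, hRc, hxR, heR⟩ := key he
  exact ⟨R, hR, hRc, hxR, heR hye⟩

/-- Connectedness, attachment and absence of edges all pass from indices to unions of bags. Only the
chord has to be a single edge of `G`, which is why only the bags of its ends must be single
vertices. -/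
theorem Model.theta {K : SimpleGraph W} {B : W → Set V} (hB : Model G K B) {x y : W}
    {D₁ D₂ : Set W} (ht : Theta K x y D₁ D₂) {a b : V} (ha : B x = {a}) (hb : B y = {b}) :
    Theta G a b (⋃ i ∈ D₁, B i) (⋃ i ∈ D₂, B i) := by
  -- An index in a side of the theta is not isolated: it has a neighbour in that side or is adjacent
  -- to `x`. Hence its bag is not one of those allowed to be empty.
  have hne : ∀ {D : Set W}, ConnSet K D → Touch K {x} D → x ∉ D → ∀ i ∈ D, ConnSet G (B i) := by
    intro D hD hx hxD i hi
    by_cases h : D = {i}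
    · rw [h, touch_singleton_singleton] at hx
      exact hB.conn i x hx.symm
    · have hd : (D \ {i}).Nonempty := by
        by_contra hcon
        rw [Set.not_nonempty_iff_eq_empty, Set.sdiff_eq_empty] at hcon
        exact h (Set.Subset.antisymm hcon (by simpa using hi))
      obtain ⟨j, hj, k, _, hjk⟩ := hD.touch_diff (T := {i}) (by simpa using hi) ⟨i, rfl⟩ hd
      rw [Set.mem_singleton_iff] at hj
      exact hB.conn i k (hj ▸ hjk)
  have hmem : ∀ {D : Set W} {w : W} {c : V}, B w = {c} → w ∉ D → c ∉ ⋃ i ∈ D, B i := by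
    intro D w c hw hwD hc
    obtain ⟨i, hi, hci⟩ := Set.mem_iUnion₂.1 hc
    refine Set.disjoint_left.1 (hB.disj w i (fun h => hwD (h ▸ hi))) ?_ hci
    rw [hw]; rfl
  have htouch : ∀ {D : Set W} {w : W} {c : V}, B w = {c} → w ∉ D → Touch K {w} D →
      Touch G {c} (⋃ i ∈ D, B i) := by
    intro D w c hw hwD h
    obtain ⟨i, hi, hwi⟩ := touch_singleton_left.1 h
    rw [← hw]
    exact ((hB.touch w i hwi.ne).2 hwi).mono subset_rfl (Set.subset_biUnion_of_mem hi)
  refine ⟨?_, hB.connSet_biUnion ht.conn₁ (hne ht.conn₁ ht.tx₁ ht.x₁),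
    hB.connSet_biUnion ht.conn₂ (hne ht.conn₂ ht.tx₂ ht.x₂), ?_, ?_, hmem ha ht.x₁, hmem ha ht.x₂,
    hmem hb ht.y₁, hmem hb ht.y₂, htouch ha ht.x₁ ht.tx₁, htouch ha ht.x₂ ht.tx₂,
    htouch hb ht.y₁ ht.ty₁, htouch hb ht.y₂ ht.ty₂⟩
  · have := (hB.touch x y ht.adj.ne).2 ht.adj
    rwa [ha, hb, touch_singleton_singleton] at this
  · rw [Set.disjoint_left]
    intro z hz1 hz2
    obtain ⟨i, hi, hzi⟩ := Set.mem_iUnion₂.1 hz1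
    obtain ⟨j, hj, hzj⟩ := Set.mem_iUnion₂.1 hz2
    refine Set.disjoint_left.1 (hB.disj i j ?_) hzi hzj
    rintro rfl
    exact Set.disjoint_left.1 ht.disj hi hj
  · rintro ⟨z, hz, w, hw, hzw⟩
    obtain ⟨i, hi, hzi⟩ := Set.mem_iUnion₂.1 hz
    obtain ⟨j, hj, hwj⟩ := Set.mem_iUnion₂.1 hw
    have hij : i ≠ j := by
      rintro rfl
      exact Set.disjoint_left.1 ht.disj hi hj
    exact ht.anti ⟨i, hi, j, hj, (hB.touch i j hij).1 ⟨z, hzi, w, hwj, hzw⟩⟩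

/-- An induced subgraph is a model with one-vertex bags. -/
theorem NoTheta.of_embedding {H : SimpleGraph W} (hG : NoTheta G) (f : H ↪g G) : NoTheta H := by
  intro x y D₁ D₂ ht
  have hB : Model G H (fun i => {f i}) := by
    refine ⟨fun i _ _ => connSet_singleton _, fun i j hij => ?_, fun i j _ => ?_⟩
    · simpa using fun h => hij (f.injective h)
    · rw [touch_singleton_singleton, f.map_adj_iff]
  exact hG _ _ _ _ (hB.theta ht rfl rfl)

theorem NoTheta.of_isIndContained {H : SimpleGraph W} (hG : NoTheta G) (f : H ⊴ G) : NoTheta H := by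
  obtain ⟨f⟩ := f
  exact hG.of_embedding f

end Theta

/-! ### Graphs on the natural numbers as bit masks, and verified thetas -/

section Masks

/-- Adjacency in a graph on `ℕ` presented by a list of bit masks. -/
def bit (L : List ℕ) (i j : ℕ) : Bool := (L.getD i 0).testBit j

/-- The graph on `ℕ` presented by a list of bit masks. -/
def maskGraph (L : List ℕ) : SimpleGraph ℕ := SimpleGraph.fromRel fun i j => bit L i j = true

/-- The set of positions of the nonzero bits. -/
def maskSet (D : ℕ) : Set ℕ := {i | D.testBit i = true}

/-- Evaluate `n` before passing it on. -/
def force {α : Type*} (n : ℕ) (f : ℕ → α) : α :=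
  match n with
  | 0 => f 0
  | k + 1 => f (Nat.succ k)

theorem force_eq {α : Type*} (n : ℕ) (f : ℕ → α) : force n f = f n := by cases n <;> rfl

/-- Evaluate all entries of a list before passing it on. -/
def forceList {α : Type*} : List ℕ → (List ℕ → α) → α
  | [], f => f []
  | a :: l, f => force a fun a' => forceList l fun l' => f (a' :: l')

theorem forceList_eq {α : Type*} (l : List ℕ) (f : List ℕ → α) : forceList l f = f l := by
  induction l generalizing f with
  | nil => rfl
  | cons a l ih => rw [forceList, force_eq, ih]

/-- The union of the masks at the positions in `D`. -/
def nbrMask : List ℕ → ℕ → ℕ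
  | [], _ => 0
  | a :: L, D => force (D >>> 1) fun D' => (bif D.testBit 0 then a else 0) ||| nbrMask L D'

theorem testBit_nbrMask {L : List ℕ} {D j : ℕ} :
    (nbrMask L D).testBit j = true ↔ ∃ i, D.testBit i = true ∧ bit L i j = true := by
  induction L generalizing D with
  | nil => simp [nbrMask, bit]
  | cons a L ih =>
    rw [nbrMask, force_eq, Nat.testBit_or, Bool.or_eq_true, ih]
    constructor
    · rintro (h | ⟨i, h1, h2⟩)
      · refine ⟨0, ?_⟩
        cases hD : D.testBit 0 <;> simp [hD, bit] at h ⊢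
        exact h
      · exact ⟨i + 1, by rwa [Nat.testBit_shiftRight, add_comm] at h1, by simpa [bit] using h2⟩
    · rintro ⟨i, h1, h2⟩
      cases i with
      | zero => left; simpa [h1, bit] using h2
      | succ i =>
        right
        exact ⟨i, by rwa [Nat.testBit_shiftRight, add_comm], by simpa [bit] using h2⟩

theorem maskGraph_adj {L : List ℕ} {i j : ℕ} :
    (maskGraph L).Adj i j ↔ i ≠ j ∧ (bit L i j = true ∨ bit L j i = true) := by
  simp [maskGraph]

theorem touch_maskSet_of_land {L : List ℕ} {i D : ℕ} (h : L.getD i 0 &&& D ≠ 0)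
    (hi : D.testBit i = false) : Touch (maskGraph L) {i} (maskSet D) := by
  obtain ⟨j, hj⟩ := Nat.exists_testBit_of_ne_zero h
  rw [Nat.testBit_and, Bool.and_eq_true] at hj
  refine touch_singleton_left.2 ⟨j, hj.2, maskGraph_adj.2 ⟨?_, Or.inl hj.1⟩⟩
  rintro rfl
  rw [hi] at hj
  exact Bool.noConfusion hj.2

/-- Iterated neighbourhoods inside `D`. -/
def growMask (L : List ℕ) (D : ℕ) : ℕ → ℕ → ℕ
  | 0, C => C
  | k + 1, C => force (C ||| (nbrMask L C &&& D)) fun C' =>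
    bif Nat.beq C' C then C else growMask L D k C'

/-- The set presented by `D` is connected. -/
def connCheck (L : List ℕ) (D : ℕ) : Bool :=
  -- The seed is the highest bit of `D`, and `L.length` rounds are enough to exhaust a component of
  -- a graph on these positions.
  D != 0 && growMask L D L.length (2 ^ D.log2) == D

/-- Each round adds only vertices with a neighbour in the current set, so connectedness survives
whatever the number of rounds. Stopping too early could only make the test fail. -/
theorem connSet_growMask {L : List ℕ} {D k C : ℕ} (hC : ConnSet (maskGraph L) (maskSet C)) :
    ConnSet (maskGraph L) (maskSet (growMask L D k C)) := by
  induction k generalizing C with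
  | zero => exact hC
  | succ k ih =>
    rw [growMask, force_eq]
    cases Nat.beq (C ||| (nbrMask L C &&& D)) C
    swap
    · exact hC
    refine ih ?_
    obtain ⟨x, hx⟩ := hC.1
    have hsub : maskSet C ⊆ maskSet (C ||| (nbrMask L C &&& D)) := by
      intro i hi
      simp only [maskSet, Set.mem_ofPred_eq, Nat.testBit_or, Bool.or_eq_true] at hi ⊢
      exact Or.inl hi
    refine connSet_of_forall (hsub hx) ?_
    intro y hy
    by_cases hyC : y ∈ maskSet C
    · exact ⟨maskSet C, hsub, hC, hx, hyC⟩
    have hy' : y ∈ maskSet (C ||| (nbrMask L C &&& D)) := hy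
    simp only [maskSet, Set.mem_ofPred_eq, Nat.testBit_or, Nat.testBit_and, Bool.or_eq_true,
      Bool.and_eq_true] at hy
    rcases hy with h | ⟨h, _⟩
    · exact absurd h hyC
    obtain ⟨i, hi, hiy⟩ := testBit_nbrMask.1 h
    refine ⟨insert y (maskSet C), Set.insert_subset hy' hsub, hC.insert ⟨i, hi, ?_⟩,
      Or.inr hx, Or.inl rfl⟩
    refine maskGraph_adj.2 ⟨?_, Or.inr hiy⟩
    rintro rfl
    exact hyC hi

theorem connSet_of_connCheck {L : List ℕ} {D : ℕ} (h : connCheck L D = true) :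
    ConnSet (maskGraph L) (maskSet D) := by
  simp only [connCheck, Bool.and_eq_true, bne_iff_ne, ne_eq, beq_iff_eq] at h
  rw [← h.2]
  refine connSet_growMask ?_
  convert connSet_singleton (G := maskGraph L) D.log2
  ext i
  simp [maskSet, Nat.testBit_two_pow, eq_comm]

/-- Disjointness of, and absence of edges between, the sets presented by `D₁` and `D₂`. -/
def antiCheck (L : List ℕ) (D₁ D₂ : ℕ) : Bool :=
  D₁ &&& D₂ == 0 && (nbrMask L D₁ &&& D₂ == 0 && nbrMask L D₂ &&& D₁ == 0)

theorem disjoint_maskSet {D₁ D₂ : ℕ} (h : D₁ &&& D₂ = 0) : Disjoint (maskSet D₁) (maskSet D₂) := by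
  rw [Set.disjoint_left]
  intro i hi hi'
  have : (D₁ &&& D₂).testBit i = true := by
    rw [Nat.testBit_and, Bool.and_eq_true]
    exact ⟨hi, hi'⟩
  rw [h] at this
  simp at this

theorem not_touch_of_antiCheck {L : List ℕ} {D₁ D₂ : ℕ} (h : antiCheck L D₁ D₂ = true) :
    ¬ Touch (maskGraph L) (maskSet D₁) (maskSet D₂) := by
  simp only [antiCheck, Bool.and_eq_true, beq_iff_eq] at h
  rintro ⟨i, hi, j, hj, hij⟩
  rcases (maskGraph_adj.1 hij).2 with h' | h'
  · exact Set.disjoint_left.1 (disjoint_maskSet h.2.1) (testBit_nbrMask.2 ⟨i, hi, h'⟩) hj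
  · exact Set.disjoint_left.1 (disjoint_maskSet h.2.2) (testBit_nbrMask.2 ⟨j, hj, h'⟩) hi

/-- The edge `x y` and the sets presented by `D₁`, `D₂` form a theta. -/
def thetaCheck (L : List ℕ) (x y D₁ D₂ : ℕ) : Bool :=
  (force (L.getD x 0) fun X => X.testBit y && X &&& D₁ != 0 && X &&& D₂ != 0) &&
  ((force (L.getD y 0) fun Y => Y &&& D₁ != 0 && Y &&& D₂ != 0) &&
  (x != y && !D₁.testBit x && !D₂.testBit x && !D₁.testBit y && !D₂.testBit y &&
  (antiCheck L D₁ D₂ && (connCheck L D₁ && connCheck L D₂))))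

theorem theta_of_thetaCheck {L : List ℕ} {x y D₁ D₂ : ℕ} (h : thetaCheck L x y D₁ D₂ = true) :
    Theta (maskGraph L) x y (maskSet D₁) (maskSet D₂) := by
  simp only [thetaCheck, force_eq, Bool.and_eq_true, bne_iff_ne, ne_eq, Bool.not_eq_true'] at h
  obtain ⟨⟨⟨hxy, tx1⟩, tx2⟩, ⟨ty1, ty2⟩, ⟨⟨⟨⟨hne, x1⟩, x2⟩, y1⟩, y2⟩, h3, h1, h2⟩ := h
  refine ⟨maskGraph_adj.2 ⟨hne, Or.inl hxy⟩, connSet_of_connCheck h1, connSet_of_connCheck h2, ?_,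
    not_touch_of_antiCheck h3, by simp [maskSet, x1], by simp [maskSet, x2], by simp [maskSet, y1],
    by simp [maskSet, y2], touch_maskSet_of_land tx1 x1, touch_maskSet_of_land tx2 x2,
    touch_maskSet_of_land ty1 y1, touch_maskSet_of_land ty2 y2⟩
  simp only [antiCheck, Bool.and_eq_true, beq_iff_eq] at h3
  exact disjoint_maskSet h3.1

/-- The number with the first `n` bits prescribed by `p`. -/
def ofBits (p : ℕ → Bool) : ℕ → ℕ
  | 0 => 0
  | n + 1 => (bif p n then 2 ^ n else 0) ||| ofBits p n

theorem testBit_ofBits (p : ℕ → Bool) (n j : ℕ) :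
    (ofBits p n).testBit j = (decide (j < n) && p j) := by
  induction n with
  | zero => simp [ofBits]
  | succ n ih =>
    rw [ofBits, Nat.testBit_or, ih]
    by_cases hj : j = n
    · subst hj
      cases p j <;> simp
    · have h1 : (decide (j < n + 1)) = decide (j < n) := by
        simp only [decide_eq_decide]; omega
      have h2 : (bif p n then 2 ^ n else 0).testBit j = false := by
        cases p n
        · simp
        · simp only [cond_true, Nat.testBit_two_pow, decide_eq_false_iff_not]
          omega
      rw [h1, h2, Bool.false_or]

theorem ofBits_lt (p : ℕ → Bool) (n : ℕ) : ofBits p n < 2 ^ n := by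
  refine Nat.lt_pow_two_of_testBit _ (fun i hi => ?_)
  rw [testBit_ofBits]
  simp [hi]

/-- The list of masks of a relation on `{0, …, n - 1}`. -/
def mkMask (n : ℕ) (A : ℕ → ℕ → Bool) : List ℕ := (List.range n).map fun i => ofBits (A i) n

theorem length_mkMask (n : ℕ) (A : ℕ → ℕ → Bool) : (mkMask n A).length = n := by
  simp [mkMask]

theorem bit_mkMask (n : ℕ) (A : ℕ → ℕ → Bool) (i j : ℕ) :
    bit (mkMask n A) i j = (decide (i < n) && (decide (j < n) && A i j)) := by
  by_cases hi : i < n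
  · have : (mkMask n A).getD i 0 = ofBits (A i) n := by
      rw [List.getD_eq_getElem _ _ (by simpa [mkMask] using hi)]
      simp [mkMask]
    rw [bit, this, testBit_ofBits]
    simp [hi]
  · have : (mkMask n A).getD i 0 = 0 := by
      rw [List.getD_eq_default _ _ (by simpa [mkMask] using hi)]
    rw [bit, this]
    simp [hi]

/-- Symmetric irreflexive adjacency masks of a graph on `{0, …, L.length - 1}`. -/
def WF (L : List ℕ) : Prop := ∀ i j, bit L i j = true → j < L.length ∧ bit L j i = true ∧ i ≠ j

/-- A test for `WF`. -/
def wfCheck (L : List ℕ) : Bool :=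
  L.all (fun m => m < 2 ^ L.length) &&
  (List.range L.length).all fun i => !bit L i i && (List.range L.length).all fun j =>
    bit L i j == bit L j i

theorem bit_lt_left {L : List ℕ} {i j : ℕ} (h : bit L i j = true) : i < L.length := by
  by_contra hcon
  rw [bit, List.getD_eq_default _ _ (by omega)] at h
  simp at h

theorem wf_of_wfCheck {L : List ℕ} (hL : wfCheck L = true) : WF L := by
  intro i j h
  have hi := bit_lt_left h
  simp only [wfCheck, Bool.and_eq_true, List.all_eq_true, decide_eq_true_eq, List.mem_range,
    beq_iff_eq, Bool.not_eq_true'] at hL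
  have hj : j < L.length := by
    have := hL.1 (L.getD i 0) (by rw [List.getD_eq_getElem _ _ hi]; exact List.getElem_mem hi)
    by_contra hcon
    rw [bit, Nat.testBit_lt_two_pow
      (this.trans_le (Nat.pow_le_pow_right (by norm_num) (by omega)))] at h
    exact Bool.noConfusion h
  refine ⟨hj, by rw [← (hL.2 i hi).2 j hj]; exact h, ?_⟩
  rintro rfl
  rw [(hL.2 i hi).1] at h
  exact Bool.noConfusion h

theorem WF.bit_comm {L : List ℕ} (hL : WF L) (i j : ℕ) : bit L i j = bit L j i := by
  rw [Bool.eq_iff_iff]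
  exact ⟨fun h => (hL i j h).2.1, fun h => (hL j i h).2.1⟩

theorem WF.adj_iff {L : List ℕ} (hL : WF L) {i j : ℕ} :
    (maskGraph L).Adj i j ↔ bit L i j = true := by
  rw [maskGraph_adj, hL.bit_comm j i, or_self, and_iff_right_iff_imp]
  exact fun h => (hL i j h).2.2

end Masks

/-! ### Models of mask patterns with prescribed one-vertex bags -/

section PModel

variable {V : Type*} {G : SimpleGraph V}

/-- A model of the graph presented by `L` in which the bags of the positions in `σ` are
singletons. -/
structure PModel (G : SimpleGraph V) (L : List ℕ) (σ : ℕ) (B : ℕ → Set V) : Prop where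
  conn : ∀ i, i < L.length → ConnSet G (B i)
  disj : ∀ i j, i ≠ j → Disjoint (B i) (B j)
  touch : ∀ i j, i ≠ j → (Touch G (B i) (B j) ↔ (maskGraph L).Adj i j)
  sing : ∀ i, σ.testBit i = true → ∃ a, B i = {a}
  out : ∀ i, L.length ≤ i → B i = ∅

theorem PModel.toModel {L : List ℕ} {σ : ℕ} {B : ℕ → Set V} (hB : PModel G L σ B) :
    Model G (maskGraph L) B := by
  refine ⟨fun i j hij => hB.conn i ?_, hB.disj, hB.touch⟩
  by_contra h
  obtain ⟨x, hx, _⟩ := (hB.touch i j hij.ne).2 hij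
  rw [hB.out i (by omega)] at hx
  exact hx

theorem PModel.not_thetaCheck {L : List ℕ} {σ : ℕ} {B : ℕ → Set V} (hG : NoTheta G)
    (hB : PModel G L σ B) {x y D₁ D₂ : ℕ} (hx : σ.testBit x = true) (hy : σ.testBit y = true) :
    thetaCheck L x y D₁ D₂ ≠ true := by
  intro h
  obtain ⟨a, ha⟩ := hB.sing x hx
  obtain ⟨b, hb⟩ := hB.sing y hy
  exact hG _ _ _ _ (hB.toModel.theta (theta_of_thetaCheck h) ha hb)

/-- Search for a theta with chord ends in `σ`. -/
def hasTheta (σ : ℕ) (L : List ℕ) (certs : List (ℕ × ℕ × ℕ × ℕ)) : Bool :=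
  certs.any fun c => σ.testBit c.1 && σ.testBit c.2.1 && thetaCheck L c.1 c.2.1 c.2.2.1 c.2.2.2

/-- The candidates are untrusted data. Each one is verified, and a single valid one with chord ends
among the one-vertex bags is a contradiction. -/
theorem PModel.not_hasTheta {L : List ℕ} {σ : ℕ} {B : ℕ → Set V} (hG : NoTheta G)
    (hB : PModel G L σ B) {certs : List (ℕ × ℕ × ℕ × ℕ)} : hasTheta σ L certs ≠ true := by
  intro h
  simp only [hasTheta, List.any_eq_true, Bool.and_eq_true] at h
  obtain ⟨c, _, ⟨h1, h2⟩, h3⟩ := h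
  exact hB.not_thetaCheck hG h1 h2 h3

/-- Replace one bag of a model, changing adjacencies at that position only. -/
theorem PModel.update {L L' : List ℕ} {σ σ' : ℕ} {B : ℕ → Set V} (hB : PModel G L σ B) {m : ℕ}
    {M : Set V} (hlen : L.length ≤ L'.length) (hm : m < L'.length) (hM : ConnSet G M)
    (hlen' : ∀ i, L.length ≤ i → i < L'.length → i = m)
    (hL : ∀ i j, i ≠ m → j ≠ m → ((maskGraph L').Adj i j ↔ (maskGraph L).Adj i j))
    (hdisj : ∀ i, i ≠ m → Disjoint M (B i))
    (htouch : ∀ i, i ≠ m → i < L.length → (Touch G M (B i) ↔ (maskGraph L').Adj m i))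
    (hout : ∀ i, L'.length ≤ i → ¬ (maskGraph L').Adj m i)
    (hsing : ∀ i, i ≠ m → σ'.testBit i = true → σ.testBit i = true)
    (hsingm : σ'.testBit m = true → ∃ a, M = {a}) :
    PModel G L' σ' (Function.update B m M) := by
  have htouch' : ∀ i, i ≠ m → (Touch G M (B i) ↔ (maskGraph L').Adj m i) := by
    intro i hi
    by_cases hi' : i < L.length
    · exact htouch i hi hi'
    · rw [hB.out i (by omega)]
      by_cases hi'' : i < L'.length
      · exact absurd (hlen' i (by omega) hi'') hi
      · exact iff_of_false not_touch_empty_right (hout i (by omega))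
  refine ⟨fun i hi => ?_, fun i j hij => ?_, fun i j hij => ?_, fun i hi => ?_, fun i hi => ?_⟩
  · by_cases him : i = m
    · subst him; simpa using hM
    · rw [Function.update_of_ne him]
      exact hB.conn i (by by_contra h; exact him (hlen' i (by omega) hi))
  · by_cases him : i = m
    · subst him
      rw [Function.update_self, Function.update_of_ne hij.symm]
      exact hdisj j hij.symm
    · rw [Function.update_of_ne him]
      by_cases hjm : j = m
      · subst hjm
        rw [Function.update_self]
        exact (hdisj i him).symm
      · rw [Function.update_of_ne hjm]
        exact hB.disj i j hij
  · by_cases him : i = m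
    · subst him
      rw [Function.update_self, Function.update_of_ne hij.symm]
      exact htouch' j hij.symm
    · rw [Function.update_of_ne him]
      by_cases hjm : j = m
      · subst hjm
        rw [Function.update_self, touch_comm, SimpleGraph.adj_comm]
        exact htouch' i him
      · rw [Function.update_of_ne hjm, hL i j him hjm]
        exact hB.touch i j hij
  · by_cases him : i = m
    · subst him; simpa using hsingm hi
    · rw [Function.update_of_ne him]
      exact hB.sing i (hsing i him hi)
  · rw [Function.update_of_ne (by omega)]
    exact hB.out i (by omega)

end PModel

/-! ### Adding a position to a pattern -/

section AddVertex

variable {V : Type*} {G : SimpleGraph V}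

/-- Append the row `T` and add `P` to the rows at the positions in `S`. -/
def addRows (P T : ℕ) : ℕ → List ℕ → List ℕ
  | _, [] => [T]
  | S, a :: l => (bif S.testBit 0 then a ||| P else a) :: force (S >>> 1) fun S' => addRows P T S' l

theorem getD_addRows (P T S : ℕ) (l : List ℕ) (i : ℕ) : (addRows P T S l).getD i 0 =
    if i < l.length then (bif S.testBit i then l.getD i 0 ||| P else l.getD i 0)
    else if i = l.length then T else 0 := by
  induction l generalizing S i with
  | nil => cases i <;> simp [addRows]
  | cons a l ih =>
    rw [addRows, force_eq]
    cases i with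
    | zero => simp
    | succ i =>
      rw [List.getD_cons_succ, ih, Nat.testBit_shiftRight, add_comm 1 i]
      simp

/-- Add a vertex with neighbourhood mask `S`. -/
def addV (L : List ℕ) (S : ℕ) : List ℕ := force (2 ^ L.length) fun P => addRows P S S L

theorem length_addV (L : List ℕ) (S : ℕ) : (addV L S).length = L.length + 1 := by
  have h : ∀ P T S, (addRows P T S L).length = L.length + 1 := by
    intro P T S
    induction L generalizing S with
    | nil => rfl
    | cons a l ih => rw [addRows, force_eq, List.length_cons, ih, List.length_cons]
  rw [addV, force_eq, h]

theorem bit_addV {L : List ℕ} {S i j : ℕ} : bit (addV L S) i j = true ↔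
    i < L.length ∧ (bit L i j = true ∨ j = L.length ∧ S.testBit i = true) ∨
      i = L.length ∧ S.testBit j = true := by
  rw [bit, addV, force_eq, getD_addRows]
  by_cases hi : i < L.length
  · have : i ≠ L.length := by omega
    cases h : S.testBit i
    · simp [hi, this, bit]
    · simp only [hi, this, bit, Nat.testBit_or, Nat.testBit_two_pow, if_true, cond_true,
        Bool.or_eq_true, decide_eq_true_eq, true_and, false_and, or_false, and_true]
      rw [@eq_comm _ j]
  · by_cases hi' : i = L.length <;> simp [hi, hi']

theorem lt_of_testBit_of_lt {S n j : ℕ} (hS : S < 2 ^ n) (h : S.testBit j = true) : j < n := by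
  by_contra hcon
  rw [Nat.testBit_lt_two_pow
    (hS.trans_le (Nat.pow_le_pow_right (by norm_num) (by omega)))] at h
  exact Bool.noConfusion h

theorem wf_addV {L : List ℕ} (hL : WF L) {S : ℕ} (hS : S < 2 ^ L.length) : WF (addV L S) := by
  intro i j h
  rw [bit_addV] at h ⊢
  rw [length_addV]
  rcases h with ⟨hi, h | ⟨hj, h⟩⟩ | ⟨hi, h⟩
  · have := hL i j h
    exact ⟨by omega, Or.inl ⟨this.1, Or.inl this.2.1⟩, this.2.2⟩
  · exact ⟨by omega, Or.inr ⟨hj, h⟩, by omega⟩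
  · have := lt_of_testBit_of_lt hS h
    exact ⟨by omega, Or.inl ⟨this, Or.inr ⟨hi, h⟩⟩, by omega⟩

theorem bit_addV_old {L : List ℕ} (S : ℕ) {i j : ℕ} (hi : i ≠ L.length)
    (hj : j ≠ L.length) : bit (addV L S) i j = bit L i j := by
  rw [Bool.eq_iff_iff, bit_addV]
  have : bit L i j = true → i < L.length := bit_lt_left
  tauto

theorem bit_addV_new {L : List ℕ} {S : ℕ} (j : ℕ) :
    bit (addV L S) L.length j = S.testBit j := by
  rw [Bool.eq_iff_iff, bit_addV]
  simp

open Classical in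
/-- The mask of the bags touched by `X`. -/
noncomputable def touchMask (G : SimpleGraph V) (B : ℕ → Set V) (n : ℕ) (X : Set V) : ℕ :=
  ofBits (fun i => decide (Touch G X (B i))) n

theorem testBit_touchMask {B : ℕ → Set V} {n : ℕ} {X : Set V} {i : ℕ} :
    (touchMask G B n X).testBit i = true ↔ i < n ∧ Touch G X (B i) := by
  rw [touchMask, testBit_ofBits]
  simp

theorem touchMask_lt {B : ℕ → Set V} {n : ℕ} {X : Set V} : touchMask G B n X < 2 ^ n := ofBits_lt _ _

/-- The new row is read off from `G`, so the extended pattern fits by construction. The added bag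
may be any connected set disjoint from the others. -/
theorem PModel.addV {L : List ℕ} {σ σ' : ℕ} {B : ℕ → Set V} (hB : PModel G L σ B) (hL : WF L)
    {X : Set V} (hX : ConnSet G X) (hd : ∀ i, Disjoint X (B i))
    (hσ : ∀ i, i ≠ L.length → σ'.testBit i = true → σ.testBit i = true)
    (hσ' : σ'.testBit L.length = true → ∃ a, X = {a}) :
    PModel G (addV L (touchMask G B L.length X)) σ' (Function.update B L.length X) := by
  have hwf := wf_addV hL (touchMask_lt (G := G) (B := B) (n := L.length) (X := X))
  refine hB.update (by rw [length_addV]; omega) (by rw [length_addV]; omega) hX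
    (fun i h1 h2 => by rw [length_addV] at h2; omega) (fun i j hi hj => ?_) (fun i _ => hd i)
    (fun i hi hin => ?_) (fun i hi => ?_) hσ hσ'
  · rw [hwf.adj_iff, hL.adj_iff, bit_addV_old _ hi hj]
  · rw [hwf.adj_iff, bit_addV_new, testBit_touchMask, and_iff_right hin]
  · rw [hwf.adj_iff, bit_addV_new, testBit_touchMask]
    rw [length_addV] at hi
    omega

theorem testBit_or_two_pow {σ n i : ℕ} (h : i ≠ n) (hi : (σ ||| 2 ^ n).testBit i = true) :
    σ.testBit i = true := by
  rw [Nat.testBit_or, Bool.or_eq_true, Nat.testBit_two_pow, decide_eq_true_eq] at hi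
  rcases hi with h' | h'
  · exact h'
  · exact absurd h'.symm h

/-- Adjoin an outside vertex as a singleton bag. -/
theorem PModel.addV_single {L : List ℕ} {σ : ℕ} {B : ℕ → Set V} (hB : PModel G L σ B) (hL : WF L)
    {v : V} (hv : ∀ i, v ∉ B i) :
    PModel G (UniqueChord.addV L (touchMask G B L.length {v})) (σ ||| 2 ^ L.length)
      (Function.update B L.length {v}) :=
  hB.addV hL (connSet_singleton v) (fun i => by simpa using hv i)
    (fun _ hi h => testBit_or_two_pow hi h) (fun _ => ⟨v, rfl⟩)

end AddVertex

/-! ### Certificates against attachments of an outside vertex -/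

section Step

variable {V : Type*} {G : SimpleGraph V}

/-- The graphs left over after all reductions: no triangles, no squares, no cutvertices and no
proper 2-cutsets. -/
structure Rigid (G : SimpleGraph V) : Prop where
  noTheta : NoTheta G
  tri : ∀ x y z, G.Adj x y → G.Adj y z → G.Adj z x → False
  sq : ∀ x y z w, x ≠ z → y ≠ w → G.Adj x y → G.Adj y z → G.Adj z w → G.Adj w x → False
  cut₁ : ∀ x, ConnSet G {x}ᶜ
  cut₂ : ∀ a b X Y, a ≠ b → ¬ G.Adj a b → 3 ≤ deg G a → 3 ≤ deg G b → X ∪ Y = {a, b}ᶜ →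
    Disjoint X Y → X.Nontrivial → Y.Nontrivial → ¬ Touch G X Y → False

theorem three_le_deg [Finite V] {x a b c : V} (ha : G.Adj x a) (hb : G.Adj x b) (hc : G.Adj x c)
    (hab : a ≠ b) (hac : a ≠ c) (hbc : b ≠ c) : 3 ≤ deg G x := by
  have h : ({a, b, c} : Set V) ⊆ G.neighborSet x := by
    rintro z (rfl | rfl | rfl) <;> assumption
  have := Set.ncard_le_ncard h (Set.toFinite _)
  rwa [Set.ncard_eq_three.2 ⟨a, b, c, hab, hac, hbc, rfl⟩] at this

/-- Witnesses against an outside vertex `v` attached to a given set of bags. -/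
inductive Cert
  /-- A theta in the model extended by `v`. -/
  | theta (x y D₁ D₂ : ℕ)
  /-- If every way through the bag `m` meets `N(v)`, there is a theta with chord in `v`. -/
  | shrink (m D₁ D₂ : ℕ)
  /-- As `shrink`, with `v` adjacent to `b`, and `a` adjacent to `b` and attached to `m`. -/
  | corner (m a b D₁ D₂ : ℕ)

/-- A mask is spread if it is contained in none of the given masks. -/
def spread (lines : List ℕ) (S : ℕ) : Bool := lines.all fun l => S ||| l != l

/-- The sets presented by `D₁` and `D₂` are connected, far apart, and both attached to `m`. -/
def sidesCheck (L : List ℕ) (m D₁ D₂ : ℕ) : Bool :=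
  connCheck L D₁ && connCheck L D₂ && antiCheck L D₁ D₂ && !D₁.testBit m && !D₂.testBit m &&
  L.getD m 0 &&& D₁ != 0 && L.getD m 0 &&& D₂ != 0

/-- Verification of a witness; `L'` is the pattern extended by `v`. -/
def certCheck (L L' : List ℕ) (σ : ℕ) (lines : List ℕ) (S : ℕ) : Cert → Bool
  | .theta x y D₁ D₂ => (σ ||| 2 ^ L.length).testBit x && (σ ||| 2 ^ L.length).testBit y &&
      thetaCheck L' x y D₁ D₂
  | .shrink m D₁ D₂ => S.testBit m && !σ.testBit m && decide (m < L.length) &&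
      spread lines (S ^^^ 2 ^ m) && sidesCheck L m D₁ D₂ && S &&& D₁ != 0 && S &&& D₂ != 0
  -- The equation with `2 ^ a` makes `a` the only neighbour of `m` in the second side. A vertex of
  -- the bag `m` attached to that side is therefore adjacent to the vertex at `a`, which closes a
  -- square through `v` and `b`.
  | .corner m a b D₁ D₂ => S.testBit m && !σ.testBit m && decide (m < L.length) &&
      spread lines (S ^^^ 2 ^ m) && sidesCheck L m D₁ D₂ && S &&& D₂ != 0 && S.testBit b &&
      σ.testBit b && σ.testBit a && bit L b a && !D₁.testBit b && !D₂.testBit b &&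
      L.getD m 0 &&& D₂ == 2 ^ a && L.getD b 0 &&& D₁ != 0 && D₂.testBit a

/-- The union of the bags in the set presented by `D`. -/
def bagUnion (B : ℕ → Set V) (D : ℕ) : Set V := ⋃ i ∈ maskSet D, B i

theorem subset_bagUnion {B : ℕ → Set V} {D i : ℕ} (h : D.testBit i = true) :
    B i ⊆ bagUnion B D := Set.subset_biUnion_of_mem (u := B) h

theorem mem_bagUnion {B : ℕ → Set V} {D : ℕ} {x : V} :
    x ∈ bagUnion B D ↔ ∃ i, D.testBit i = true ∧ x ∈ B i := by
  simp [bagUnion, maskSet]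

theorem PModel.connSet_bagUnion {L : List ℕ} {σ D : ℕ} {B : ℕ → Set V} (hB : PModel G L σ B)
    (hD : connCheck L D = true) (hlt : ∀ i, D.testBit i = true → i < L.length) :
    ConnSet G (bagUnion B D) :=
  hB.toModel.connSet_biUnion (connSet_of_connCheck hD) (fun i hi => hB.conn i (hlt i hi))

theorem PModel.not_touch_bagUnion {L : List ℕ} {σ D₁ D₂ : ℕ} {B : ℕ → Set V}
    (hB : PModel G L σ B) (h : antiCheck L D₁ D₂ = true) :
    Disjoint (bagUnion B D₁) (bagUnion B D₂) ∧ ¬ Touch G (bagUnion B D₁) (bagUnion B D₂) := by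
  have hd : Disjoint (maskSet D₁) (maskSet D₂) := by
    simp only [antiCheck, Bool.and_eq_true, beq_iff_eq] at h
    exact disjoint_maskSet h.1
  have hne : ∀ i j, D₁.testBit i = true → D₂.testBit j = true → i ≠ j := by
    rintro i j hi hj rfl
    exact Set.disjoint_left.1 hd hi hj
  constructor
  · rw [Set.disjoint_left]
    intro x hx hx'
    obtain ⟨i, hi, hxi⟩ := mem_bagUnion.1 hx
    obtain ⟨j, hj, hxj⟩ := mem_bagUnion.1 hx'
    exact Set.disjoint_left.1 (hB.disj i j (hne i j hi hj)) hxi hxj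
  · rintro ⟨x, hx, y, hy, hxy⟩
    obtain ⟨i, hi, hxi⟩ := mem_bagUnion.1 hx
    obtain ⟨j, hj, hyj⟩ := mem_bagUnion.1 hy
    exact not_touch_of_antiCheck h ⟨i, hi, j, hj,
      (hB.touch i j (hne i j hi hj)).1 ⟨x, hxi, y, hyj, hxy⟩⟩

theorem PModel.touch_bagUnion {L : List ℕ} {σ m D : ℕ} {B : ℕ → Set V} (hB : PModel G L σ B)
    (hm : D.testBit m = false) (h : L.getD m 0 &&& D ≠ 0) : Touch G (B m) (bagUnion B D) := by
  obtain ⟨i, hi, hmi⟩ := touch_singleton_left.1 (touch_maskSet_of_land h hm)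
  exact ((hB.touch m i hmi.ne).2 hmi).mono subset_rfl (subset_bagUnion hi)

theorem land_pos {S D : ℕ} (h : S &&& D ≠ 0) : ∃ i, S.testBit i = true ∧ D.testBit i = true := by
  obtain ⟨j, hj⟩ := Nat.exists_testBit_of_ne_zero h
  rw [Nat.testBit_and, Bool.and_eq_true] at hj
  exact ⟨j, hj⟩

theorem testBit_xor_two_pow {S m i : ℕ} (hm : S.testBit m = true) :
    (S ^^^ 2 ^ m).testBit i = true ↔ S.testBit i = true ∧ i ≠ m := by
  rw [Nat.testBit_xor, Nat.testBit_two_pow]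
  by_cases h : m = i
  · subst h; simp [hm]
  · simp [h, Ne.symm h]

/-- Minimality of attachments is taken numerically in the mask; dropping a position makes the number
smaller. -/
theorem xor_two_pow_lt {S m : ℕ} (hm : S.testBit m = true) : S ^^^ 2 ^ m < S := by
  refine Nat.lt_of_testBit m ?_ hm (fun j hj => ?_)
  · rw [Nat.testBit_xor, hm]; simp
  · rw [Nat.testBit_xor, Nat.testBit_two_pow_of_ne (by omega)]; simp

theorem eq_of_testBit_iff {a b : ℕ} (h : ∀ i, a.testBit i = true ↔ b.testBit i = true) : a = b :=
  Nat.eq_of_testBit_eq fun i => Bool.eq_iff_iff.2 (h i)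

/-- Every position outside `σ` has exactly two neighbours; they are in `σ` and nonadjacent. Every
position in `σ` has at least three neighbours. -/
structure PatternShape (L : List ℕ) (σ : ℕ) : Prop where
  wf : WF L
  size : 5 ≤ L.length
  lt : ∀ i, σ.testBit i = true → i < L.length
  fat : ∀ m, m < L.length → σ.testBit m = false → ∃ a b, a ≠ b ∧ σ.testBit a = true ∧
    σ.testBit b = true ∧ bit L a b = false ∧ ∀ i, bit L m i = true ↔ i = a ∨ i = b
  thin : ∀ i, σ.testBit i = true → ∃ a b c, a ≠ b ∧ a ≠ c ∧ b ≠ c ∧ bit L i a = true ∧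
    bit L i b = true ∧ bit L i c = true

/-- The bag of a fat position can be replaced by a smaller connected set attached to both ends. -/
theorem PModel.shrinkBag {L : List ℕ} {σ : ℕ} {B : ℕ → Set V} (hB : PModel G L σ B)
    (hp : PatternShape L σ) {m : ℕ} (hm : m < L.length) (hσ : σ.testBit m = false) {M : Set V}
    (hM : ConnSet G M) (hsub : M ⊆ B m) {D₁ D₂ : ℕ} (hd : D₁ &&& D₂ = 0)
    (h₁ : Touch G M (bagUnion B D₁)) (h₂ : Touch G M (bagUnion B D₂)) (hm₁ : D₁.testBit m = false)
    (hm₂ : D₂.testBit m = false) : PModel G L σ (Function.update B m M) := by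
  obtain ⟨a, b, hab, ha, hb, _, hbit⟩ := hp.fat m hm hσ
  have hto : ∀ {D}, Touch G M (bagUnion B D) → D.testBit m = false →
      ∃ i, D.testBit i = true ∧ (i = a ∨ i = b) ∧ Touch G M (B i) := by
    rintro D ⟨x, hx, y, hy, hxy⟩ hmD
    obtain ⟨i, hi, hyi⟩ := mem_bagUnion.1 hy
    refine ⟨i, hi, ?_, ⟨x, hx, y, hyi, hxy⟩⟩
    have hmi : m ≠ i := by rintro rfl; rw [hmD] at hi; exact Bool.noConfusion hi
    rw [← hbit, ← hp.wf.adj_iff, ← hB.touch m i hmi]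
    exact ⟨x, hsub hx, y, hyi, hxy⟩
  obtain ⟨i, hi, hi', hti⟩ := hto h₁ hm₁
  obtain ⟨j, hj, hj', htj⟩ := hto h₂ hm₂
  have hij : i ≠ j := by
    rintro rfl
    exact Set.disjoint_left.1 (disjoint_maskSet hd) hi hj
  refine hB.update le_rfl hm hM (fun i h1 h2 => by omega) (fun _ _ _ _ => Iff.rfl)
    (fun k hk => (hB.disj m k hk.symm).mono_left hsub) (fun k hk _ => ?_) (fun k hk => ?_)
    (fun _ _ h => h) (fun h => by rw [hσ] at h; exact Bool.noConfusion h)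
  · rw [← hB.touch m k hk.symm]
    refine ⟨fun h => h.mono hsub subset_rfl, fun h => ?_⟩
    rw [hB.touch m k hk.symm, hp.wf.adj_iff, hbit] at h
    have : k = i ∨ k = j := by
      rcases hi' with rfl | rfl <;> rcases hj' with rfl | rfl <;> tauto
    rcases this with rfl | rfl <;> assumption
  · rw [hp.wf.adj_iff]
    intro h
    have := (hp.wf m k h).1
    omega

/-- `B` is a model and `v` an outside vertex attached to a spread set of bags. -/
def SpreadAt (G : SimpleGraph V) (L : List ℕ) (σ : ℕ) (lines : List ℕ) (S : ℕ) : Prop :=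
  ∃ B v, PModel G L σ B ∧ (∀ i, v ∉ B i) ∧ spread lines S = true ∧
    touchMask G B L.length {v} = S

/-- A `theta` certificate contradicts `NoTheta` at once. For the other two, either some way through
the bag `m` avoids the neighbours of `v`, and shrinking the bag to it drops `m` from the mask,
against minimality; or every way through `m` meets a neighbour of `v`, and the first one, `z`,
produces a theta or a square. -/
theorem certCheck_false (hG : Rigid G) {L : List ℕ} {σ : ℕ} {lines : List ℕ}
    (hp : PatternShape L σ) {S : ℕ} (hS : SpreadAt G L σ lines S)
    (hmin : ∀ S' < S, ¬ SpreadAt G L σ lines S') (c : Cert) :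
    certCheck L (addV L S) σ lines S c = false := by
  obtain ⟨B, v, hB, hv, hspread, rfl⟩ := hS
  rw [← Bool.not_eq_true]
  set S := touchMask G B L.length {v} with hSdef
  have hSv : ∀ i, S.testBit i = true ↔ i < L.length ∧ Touch G {v} (B i) := fun i =>
    testBit_touchMask
  -- replacing the bag `m` by a part avoiding `N(v)` contradicts minimality
  have hshrink : ∀ m, m < L.length → σ.testBit m = false → S.testBit m = true →
      spread lines (S ^^^ 2 ^ m) = true → ∀ M, M ⊆ B m \ G.neighborSet v → ConnSet G M →
      ∀ D₁ D₂, D₁ &&& D₂ = 0 → D₁.testBit m = false → D₂.testBit m = false →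
      Touch G (bagUnion B D₁) M → Touch G (bagUnion B D₂) M → False := by
    intro m hm hσ hSm hsp M hM hMc D₁ D₂ hd h1 h2 t1 t2
    have hMm : M ⊆ B m := hM.trans Set.sdiff_subset
    have hB' := hB.shrinkBag hp hm hσ hMc hMm hd t1.symm t2.symm h1 h2
    refine hmin _ (xor_two_pow_lt hSm) ⟨_, v, hB', fun i => ?_, hsp, ?_⟩
    · by_cases him : i = m
      · subst him
        rw [Function.update_self]
        exact fun h => hv _ (hMm h)
      · rw [Function.update_of_ne him]; exact hv i
    · refine eq_of_testBit_iff fun i => ?_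
      rw [testBit_touchMask, testBit_xor_two_pow hSm, hSv]
      by_cases him : i = m
      · subst him
        rw [Function.update_self]
        simp only [ne_eq, not_true_eq_false, and_false, iff_false, not_and]
        rintro - h
        obtain ⟨s, hs, hvs⟩ := touch_singleton_left.1 h
        exact (hM hs).2 hvs
      · rw [Function.update_of_ne him]
        tauto
  -- A position beyond the pattern is isolated, so a connected set containing one consists of it
  -- alone. Such a set cannot be attached to a position of the pattern.
  have hlt : ∀ D, connCheck L D = true → (∃ i, i < L.length ∧ D.testBit i = false ∧
      L.getD i 0 &&& D ≠ 0) → ∀ i, D.testBit i = true → i < L.length := by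
    rintro D hD ⟨k, hk, hkD, hkt⟩ i hi
    have hc := connSet_of_connCheck hD
    by_contra hcon
    have hsub : maskSet D ⊆ {i} := by
      refine hc.2 {i} (by simpa [maskSet] using hi) ⟨i, rfl⟩ ?_
      rintro x hx y hy hxy
      rw [Set.mem_singleton_iff] at hx
      subst hx
      have := bit_lt_left (hp.wf.adj_iff.1 hxy)
      omega
    obtain ⟨j, hj, hj'⟩ := land_pos hkt
    have : j = i := hsub hj'
    subst this
    have := (hp.wf k j hj).1
    omega
  have htv : ∀ D, S &&& D ≠ 0 → Touch G {v} (bagUnion B D) := by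
    intro D h
    obtain ⟨i, hi, hi'⟩ := land_pos h
    exact ((hSv i).1 hi).2.mono subset_rfl (subset_bagUnion hi')
  have hvU : ∀ D, v ∉ bagUnion B D := by
    intro D h
    obtain ⟨i, _, hi⟩ := mem_bagUnion.1 h
    exact hv i hi
  have hnotin : ∀ {i x D}, x ∈ B i → D.testBit i = false → x ∉ bagUnion B D := by
    intro i x D hx hi h
    obtain ⟨j, hj, hxj⟩ := mem_bagUnion.1 h
    refine Set.disjoint_left.1 (hB.disj i j ?_) hx hxj
    rintro rfl
    rw [hi] at hj
    exact Bool.noConfusion hj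
  cases c with
  | theta x y D₁ D₂ =>
    simp only [certCheck, Bool.and_eq_true]
    rintro ⟨⟨hx, hy⟩, ht⟩
    exact (hB.addV_single hp.wf hv).not_thetaCheck hG.noTheta hx hy ht
  | shrink m D₁ D₂ =>
    simp only [certCheck, sidesCheck, Bool.and_eq_true, Bool.not_eq_true', decide_eq_true_eq,
      bne_iff_ne]
    rintro ⟨⟨⟨⟨⟨⟨hSm, hσ⟩, hm⟩, hsp⟩, ⟨⟨⟨⟨⟨h1, h2⟩, ha⟩, hm1⟩, hm2⟩, t1⟩, t2⟩, s1⟩, s2⟩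
    have hd : D₁ &&& D₂ = 0 := by
      simp only [antiCheck, Bool.and_eq_true, beq_iff_eq] at ha
      exact ha.1
    have c1 := hB.connSet_bagUnion h1 (hlt D₁ h1 ⟨m, hm, hm1, t1⟩)
    have c2 := hB.connSet_bagUnion h2 (hlt D₂ h2 ⟨m, hm, hm2, t2⟩)
    obtain ⟨hdd, hanti⟩ := hB.not_touch_bagUnion ha
    -- In the second outcome the chord is `v z`. One side is the first set with the part `C` of the
    -- bag before `z`; the other is the second set with the part `E` after `z`, if there is one.
    rcases barrier (N := G.neighborSet v) (hB.conn m hm) c1 (hB.touch_bagUnion hm1 t1).symm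
      (hB.touch_bagUnion hm2 t2).symm with
      ⟨M, hM, hMc, hM1, hM2⟩ | ⟨z, ⟨hz, hzv⟩, C, hC, hUC, hCU, hzU, _, hE⟩
    · exact hshrink m hm hσ hSm hsp M hM hMc D₁ D₂ hd hm1 hm2 hM1 hM2
    · obtain ⟨E, hEsub, hzE, hcE, htE, hdE, haE⟩ : ∃ E : Set V, E ⊆ B m ∧ z ∉ E ∧
          ConnSet G (bagUnion B D₂ ∪ E) ∧ Touch G {z} (bagUnion B D₂ ∪ E) ∧ Disjoint C E ∧
          ¬ Touch G E (bagUnion B D₁ ∪ C) := by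
        rcases hE with hE | ⟨_, E, h3, h4, h5, h6, h7, h8, h9⟩
        · exact ⟨∅, by simp, by simp, by simpa using c2, by simpa using hE, by simp,
            not_touch_empty_left⟩
        · exact ⟨E, h3, h4, c2.union h5 h7.symm, touch_union_right.2 (Or.inr h6), h8, h9⟩
      have hCm : C ⊆ B m := hC.trans Set.sdiff_subset
      refine hG.noTheta v z (bagUnion B D₁ ∪ C) (bagUnion B D₂ ∪ E) ⟨hzv, hUC, hcE, ?_, ?_, ?_, ?_, ?_,
        ?_, (htv D₁ s1).mono subset_rfl Set.subset_union_left,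
        (htv D₂ s2).mono subset_rfl Set.subset_union_left, hzU, htE⟩
      · rw [Set.disjoint_union_left, Set.disjoint_union_right, Set.disjoint_union_right]
        refine ⟨⟨hdd, ?_⟩, ?_, hdE⟩
        · exact Set.disjoint_left.2 fun x hx hxE => hnotin (hEsub hxE) hm1 hx
        · exact Set.disjoint_left.2 fun x hx hxE => hnotin (hCm hx) hm2 hxE
      · rw [touch_union_right, touch_union_left]
        rintro ((h | h) | h)
        · exact hanti h
        · exact hCU h
        · exact haE h.symm
      · rintro (h | h)
        · exact hvU _ h
        · exact hv m (hCm h)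
      · rintro (h | h)
        · exact hvU _ h
        · exact hv m (hEsub h)
      · rintro (h | h)
        · exact hnotin hz hm1 h
        · exact (hC h).2 hzv
      · rintro (h | h)
        · exact hnotin hz hm2 h
        · exact hzE h
  | corner m a b D₁ D₂ =>
    simp only [certCheck, sidesCheck, Bool.and_eq_true, Bool.not_eq_true', decide_eq_true_eq,
      bne_iff_ne, beq_iff_eq]
    rintro ⟨⟨⟨⟨⟨⟨⟨⟨⟨⟨⟨⟨⟨⟨hSm, hσ⟩, hm⟩, hsp⟩, ⟨⟨⟨⟨⟨h1, h2⟩, ha⟩, hm1⟩, hm2⟩, t1⟩, t2⟩, s2⟩, hSb⟩, hσb⟩,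
      hσa⟩, hba⟩, hb1⟩, hb2⟩, hma⟩, hbD⟩, haD⟩
    have hd : D₁ &&& D₂ = 0 := by
      simp only [antiCheck, Bool.and_eq_true, beq_iff_eq] at ha
      exact ha.1
    have c1 := hB.connSet_bagUnion h1 (hlt D₁ h1 ⟨m, hm, hm1, t1⟩)
    have c2 := hB.connSet_bagUnion h2 (hlt D₂ h2 ⟨m, hm, hm2, t2⟩)
    obtain ⟨hdd, hanti⟩ := hB.not_touch_bagUnion ha
    obtain ⟨pa, hpa⟩ := hB.sing a hσa
    obtain ⟨pb, hpb⟩ := hB.sing b hσb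
    have habne : b ≠ a := (hp.wf b a hba).2.2
    have hab : G.Adj pb pa := by
      have := (hB.touch b a habne).2 (hp.wf.adj_iff.2 hba)
      rwa [hpa, hpb, touch_singleton_singleton] at this
    have hvb : G.Adj v pb := by
      have := ((hSv b).1 hSb).2
      rwa [hpb, touch_singleton_singleton] at this
    have hbb : pb ∈ B b := by rw [hpb]; rfl
    have haa : pa ∈ B a := by rw [hpa]; rfl
    have hmb : m ≠ b := by rintro rfl; rw [hσ] at hσb; exact Bool.noConfusion hσb
    rcases barrier (N := G.neighborSet v) (hB.conn m hm) c1 (hB.touch_bagUnion hm1 t1).symm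
      (hB.touch_bagUnion hm2 t2).symm with
      ⟨M, hM, hMc, hM1, hM2⟩ | ⟨z, ⟨hz, hzv⟩, C, hC, hUC, hCU, hzU, _, hE⟩
    · exact hshrink m hm hσ hSm hsp M hM hMc D₁ D₂ hd hm1 hm2 hM1 hM2
    · have hCm : C ⊆ B m := hC.trans Set.sdiff_subset
      have hzb : z ≠ pb := by
        rintro rfl
        exact Set.disjoint_left.1 (hB.disj m b hmb) hz hbb
      -- If `z` sees the second side, it sees the vertex at `a`, and `v`, `z`, `a`, `b` is a square.
      -- Otherwise `z` goes to the first side, attaching it to `v`, and the chord is the edge from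
      -- `v` to the vertex at `b`.
      by_cases hzU2 : Touch G {z} (bagUnion B D₂)
      · obtain ⟨y, hy, hzy⟩ := touch_singleton_left.1 hzU2
        obtain ⟨i, hi, hyi⟩ := mem_bagUnion.1 hy
        have hmi : m ≠ i := by rintro rfl; rw [hm2] at hi; exact Bool.noConfusion hi
        have hbit := hp.wf.adj_iff.1 ((hB.touch m i hmi).1 ⟨z, hz, y, hyi, hzy⟩)
        have : (L.getD m 0 &&& D₂).testBit i = true := by
          rw [Nat.testBit_and, Bool.and_eq_true]
          exact ⟨hbit, hi⟩
        rw [hma, Nat.testBit_two_pow, decide_eq_true_eq] at this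
        subst this
        rw [hpa] at hyi
        rw [Set.mem_singleton_iff] at hyi
        subst hyi
        refine hG.sq v z y pb ?_ hzb hzv hzy hab.symm hvb.symm
        rintro rfl
        exact hv _ haa
      · refine hG.noTheta v pb (insert z (bagUnion B D₁ ∪ C)) (bagUnion B D₂) ⟨hvb,
          hUC.insert (touch_singleton_left.1 hzU), c2, ?_, ?_, ?_, hvU _, ?_, hnotin hbb hb2, ?_,
          htv D₂ s2, ?_, ?_⟩
        · rw [Set.disjoint_insert_left, Set.disjoint_union_left]
          exact ⟨hnotin hz hm2, hdd, Set.disjoint_left.2 fun x hx hx' => hnotin (hCm hx) hm2 hx'⟩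
        · rw [← Set.singleton_union, touch_union_left, touch_union_left]
          rintro (h | h | h)
          · exact hzU2 h
          · exact hanti h
          · exact hCU h
        · rintro (h | h | h)
          · exact G.irrefl (h ▸ hzv)
          · exact hvU _ h
          · exact hv m (hCm h)
        · rintro (h | h | h)
          · exact hzb h.symm
          · exact hnotin hbb hb1 h
          · exact Set.disjoint_left.1 (hB.disj m b hmb) (hCm h) hbb
        · exact touch_singleton_left.2 ⟨z, Or.inl rfl, hzv⟩
        · have := hB.touch_bagUnion hb1 hbD
          rw [hpb] at this
          exact this.mono subset_rfl (Set.subset_union_left.trans (Set.subset_insert _ _))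
        · exact touch_singleton_left.2 ⟨pa, subset_bagUnion haD haa, hab⟩

end Step

/-! ### The growth step -/

section StepTheorem

variable {V : Type*} {G : SimpleGraph V}

/-- `p` holds for all masks with lowest `k` bits arbitrary and the others prescribed by `S`;
branches on which the monotone condition `prune` holds are skipped. -/
def allMasks (prune p : ℕ → Bool) : ℕ → ℕ → Bool
  | 0, S => prune S || p S
  | k + 1, S => prune S || (allMasks prune p k S && allMasks prune p k (S ||| 2 ^ k))

/-- Every mask in a skipped branch contains the partial mask at which `prune` succeeded, so
monotonicity covers it. -/
theorem allMasks_spec {prune p : ℕ → Bool}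
    (hprune : ∀ S T, (∀ i, S.testBit i = true → T.testBit i = true) → prune S = true → prune T = true)
    {k S : ℕ} (h : allMasks prune p k S = true) {T : ℕ} (hT : T < 2 ^ k) :
    prune (S ||| T) = true ∨ p (S ||| T) = true := by
  induction k generalizing S T with
  | zero =>
    have : T = 0 := by simpa using hT
    subst this
    simpa [allMasks] using h
  | succ k ih =>
    rw [allMasks, Bool.or_eq_true, Bool.and_eq_true] at h
    rcases h with h | ⟨h1, h2⟩
    · refine Or.inl (hprune _ _ (fun i hi => ?_) h)
      rw [Nat.testBit_or, hi, Bool.true_or]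
    · by_cases hb : T < 2 ^ k
      · exact ih h1 hb
      · have hTk : T = 2 ^ k ||| (T - 2 ^ k) := by
          have hlt : T - 2 ^ k < 2 ^ k := by rw [pow_succ] at hT; omega
          have h3 := Nat.two_pow_add_eq_or_of_lt hlt 1
          rw [mul_one] at h3
          omega
        have := ih h2 (T := T - 2 ^ k) (by rw [pow_succ] at hT; omega)
        rwa [Nat.or_assoc, ← hTk] at this

/-- A fat position together with its ends, or a single position. -/
def lineMask (L : List ℕ) (σ i : ℕ) : ℕ := if σ.testBit i then 2 ^ i else 2 ^ i ||| L.getD i 0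

/-- The pair of positions can not be attached to the same vertex. -/
def confCheck (L : List ℕ) (σ : ℕ) (p : ℕ × ℕ) : Bool :=
  σ.testBit p.1 && σ.testBit p.2 && p.1 != p.2 &&
    (bit L p.1 p.2 || L.getD p.1 0 &&& L.getD p.2 0 &&& σ != 0)

/-- The data used to verify the growth step for a pattern. -/
structure StepData where
  /-- maximal masks that are not spread -/
  lines : List ℕ
  /-- pairs of positions excluded by triangles and squares -/
  conf : List (ℕ × ℕ)
  /-- the possible attachments of a vertex -/
  core : List ℕ
  /-- witnesses against other attachments -/
  certs : List Cert
  /-- masks of single positions that are not spread -/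
  small : List ℕ
  /-- witnesses against longer connections -/
  thetas : List (ℕ × ℕ × ℕ × ℕ)

/-- Verification of the growth step. -/
def stepCheck (L : List ℕ) (σ : ℕ) (d : StepData) : Bool :=
  d.lines == (List.range L.length).map (lineMask L σ) && d.conf.all (confCheck L σ) &&
  allMasks (fun S => d.conf.any fun p => S.testBit p.1 && S.testBit p.2)
    (fun S => force S fun S => !spread d.lines S || d.core.contains S ||
      forceList (addV L S) fun L' => d.certs.any (certCheck L L' σ d.lines S))
    L.length 0 &&
  allMasks (spread d.lines) (fun S => S &&& σ != S || d.small.contains S) L.length 0 &&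
  d.small.all fun S₁ => d.small.all fun S₂ => !spread d.lines (S₁ ||| S₂) ||
    forceList (addV L S₁) fun L₁ => forceList (addV L₁ (S₂ ||| 2 ^ L.length)) fun L₂ =>
      hasTheta (σ ||| 2 ^ L.length) L₂ d.thetas


theorem spread_eq_false {L : List ℕ} {σ S : ℕ} :
    spread ((List.range L.length).map (lineMask L σ)) S = false ↔
      ∃ i < L.length, ∀ j, S.testBit j = true → (lineMask L σ i).testBit j = true := by
  simp only [spread, List.all_eq_false, List.mem_map, List.mem_range, bne_iff_ne, ne_eq, not_not]
  constructor
  · rintro ⟨_, ⟨i, hi, rfl⟩, h⟩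
    refine ⟨i, hi, fun j hj => ?_⟩
    rw [← h, Nat.testBit_or, hj, Bool.true_or]
  · rintro ⟨i, hi, h⟩
    refine ⟨_, ⟨i, hi, rfl⟩, eq_of_testBit_iff fun j => ?_⟩
    rw [Nat.testBit_or, Bool.or_eq_true]
    exact ⟨fun h' => h'.elim (h j) id, Or.inr⟩

theorem spread_mono {lines : List ℕ} (S T : ℕ) (h : ∀ i, S.testBit i = true → T.testBit i = true)
    (hS : spread lines S = true) : spread lines T = true := by
  simp only [spread, List.all_eq_true, bne_iff_ne, ne_eq] at hS ⊢
  refine fun l hl heq => hS l hl (eq_of_testBit_iff fun j => ?_)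
  rw [Nat.testBit_or, Bool.or_eq_true]
  refine ⟨fun h' => h'.elim (fun hj => ?_) id, Or.inr⟩
  rw [← heq, Nat.testBit_or, h j hj, Bool.true_or]

theorem testBit_lineMask {L : List ℕ} {σ i j : ℕ} : (lineMask L σ i).testBit j = true ↔
    i = j ∨ σ.testBit i = false ∧ bit L i j = true := by
  rw [lineMask]
  cases h : σ.testBit i
  · simp [Nat.testBit_or, Nat.testBit_two_pow, bit]
  · simp [Nat.testBit_two_pow]

/-- A set attached to the rest of the graph through the ends of a fat position only gives a proper
2-cutset. -/
theorem PModel.cutoff [Finite V] (hG : Rigid G) {L : List ℕ} {σ : ℕ} (hp : PatternShape L σ)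
    {B : ℕ → Set V} (hB : PModel G L σ B) {m : ℕ} (hm : m < L.length) (hσ : σ.testBit m = false)
    {X : Set V} (hX : X.Nontrivial) (hXB : ∀ i, i ≠ m → Disjoint X (B i))
    (hcl : ∀ x ∈ X, ∀ y, G.Adj x y → y ∈ X ∨ ∃ i, bit L m i = true ∧ y ∈ B i) : False := by
  obtain ⟨a, b, hab, ha, hb, hnab, hbit⟩ := hp.fat m hm hσ
  obtain ⟨pa, hpa⟩ := hB.sing a ha
  obtain ⟨pb, hpb⟩ := hB.sing b hb
  have hne : ∀ {i j x y}, x ∈ B i → y ∈ B j → i ≠ j → x ≠ y := by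
    rintro i j x y hx hy hij rfl
    exact Set.disjoint_left.1 (hB.disj i j hij) hx hy
  have hdeg : ∀ i p, σ.testBit i = true → B i = {p} → 3 ≤ deg G p := by
    intro i p hi hip
    obtain ⟨j, k, l, hjk, hjl, hkl, h1, h2, h3⟩ := hp.thin i hi
    have hex : ∀ j, bit L i j = true → ∃ q ∈ B j, G.Adj p q := by
      intro j hj
      have := (hB.touch i j (hp.wf i j hj).2.2).2 (hp.wf.adj_iff.2 hj)
      rwa [hip, touch_singleton_left] at this
    obtain ⟨q1, hq1, e1⟩ := hex j h1
    obtain ⟨q2, hq2, e2⟩ := hex k h2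
    obtain ⟨q3, hq3, e3⟩ := hex l h3
    exact three_le_deg e1 e2 e3 (hne hq1 hq2 hjk) (hne hq1 hq3 hjl) (hne hq2 hq3 hkl)
  have hma : m ≠ a := by rintro rfl; rw [hσ] at ha; exact Bool.noConfusion ha
  have hmb : m ≠ b := by rintro rfl; rw [hσ] at hb; exact Bool.noConfusion hb
  have hpaa : pa ∈ B a := by rw [hpa]; rfl
  have hpbb : pb ∈ B b := by rw [hpb]; rfl
  have hXa : pa ∉ X := fun h => Set.disjoint_left.1 (hXB a hma.symm) h hpaa
  have hXb : pb ∉ X := fun h => Set.disjoint_left.1 (hXB b hmb.symm) h hpbb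
  refine hG.cut₂ pa pb X ({pa, pb}ᶜ \ X) (hne hpaa hpbb hab) ?_ (hdeg a pa ha hpa)
    (hdeg b pb hb hpb) ?_ Set.disjoint_sdiff_right hX ?_ ?_
  · intro h
    have := (hB.touch a b hab).1 (by rw [hpa, hpb, touch_singleton_singleton]; exact h)
    rw [hp.wf.adj_iff, hnab] at this
    exact Bool.noConfusion this
  · rw [Set.union_sdiff_cancel]
    rintro x hx (rfl | rfl)
    · exact hXa hx
    · exact hXb hx
  -- The other side of the cutset also needs two vertices. There are at least five positions, so two
  -- of them are neither `m` nor its ends.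
  · obtain ⟨i, hi, j, hj, hij⟩ : ∃ i, (i < L.length ∧ i ≠ m ∧ i ≠ a ∧ i ≠ b) ∧
        ∃ j, (j < L.length ∧ j ≠ m ∧ j ≠ a ∧ j ≠ b) ∧ i ≠ j := by
      have hcard : 2 ≤ (Finset.range L.length \ {m, a, b}).card := by
        have h1 := Finset.le_card_sdiff {m, a, b} (Finset.range L.length)
        have h2 : ({m, a, b} : Finset ℕ).card ≤ 3 := Finset.card_le_three
        have h3 := hp.size
        rw [Finset.card_range] at h1
        omega
      obtain ⟨i, hi, j, hj, hij⟩ := Finset.one_lt_card.1 hcard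
      simp only [Finset.mem_sdiff, Finset.mem_range, Finset.mem_insert, Finset.mem_singleton,
        not_or] at hi hj
      exact ⟨i, ⟨hi.1, hi.2⟩, j, ⟨hj.1, hj.2⟩, hij⟩
    obtain ⟨x, hx⟩ := (hB.conn i hi.1).1
    obtain ⟨y, hy⟩ := (hB.conn j hj.1).1
    have key : ∀ i x, (i ≠ m ∧ i ≠ a ∧ i ≠ b) → x ∈ B i → x ∈ {pa, pb}ᶜ \ X := by
      intro i x hi hx
      refine ⟨?_, fun h => Set.disjoint_left.1 (hXB i hi.1) h hx⟩
      rintro (h | h)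
      · exact hne hx hpaa hi.2.1 h
      · exact hne hx hpbb hi.2.2 h
    exact ⟨x, key i x hi.2 hx, y, key j y hj.2 hy, hne hx hy hij⟩
  · rintro ⟨x, hx, y, ⟨hy, hyX⟩, hxy⟩
    rcases hcl x hx y hxy with h | ⟨i, hi, hyi⟩
    · exact hyX h
    · rw [hbit] at hi
      rcases hi with rfl | rfl
      · rw [hpa] at hyi; exact hy (Or.inl hyi)
      · rw [hpb] at hyi; exact hy (Or.inr hyi)

theorem touchMask_union {B : ℕ → Set V} {n : ℕ} {X Y : Set V} :
    touchMask G B n (X ∪ Y) = touchMask G B n X ||| touchMask G B n Y := by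
  refine eq_of_testBit_iff fun i => ?_
  rw [Nat.testBit_or, Bool.or_eq_true, testBit_touchMask, testBit_touchMask, testBit_touchMask,
    touch_union_left]
  tauto

/-- A model of a verified pattern either covers the graph with singletons or can be extended by a
vertex attached as in the core. -/
theorem PModel.growth [Finite V] (hG : Rigid G) {L : List ℕ} {σ : ℕ} (hp : PatternShape L σ)
    {d : StepData} (hd : stepCheck L σ d = true) {B₀ : ℕ → Set V} (hB₀ : PModel G L σ B₀) :
    (∃ B, PModel G L σ B ∧ (∀ x, ∃ i < L.length, x ∈ B i) ∧ ∀ i < L.length, ∃ a, B i = {a}) ∨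
      ∃ S ∈ d.core, ∃ B, PModel G (UniqueChord.addV L S) (σ ||| 2 ^ L.length) B := by
  simp only [stepCheck, Bool.and_eq_true] at hd
  obtain ⟨⟨⟨⟨hlines, hconf⟩, hmain⟩, hsmall⟩, hpairs⟩ := hd
  have hlines := eq_of_beq hlines
  -- If some model has an outside vertex with spread attachment, the numerically least such mask,
  -- over all models and vertices, is attacked by the certificates and must be in the core. If there
  -- is none, the model is shown to cover the graph.
  by_cases hex : ∃ S, SpreadAt G L σ d.lines S
  · right
    classical
    set S := Nat.find hex with hSdef
    have hS : SpreadAt G L σ d.lines S := Nat.find_spec hex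
    have hcert := certCheck_false hG hp hS (fun S' h => Nat.find_min hex h)
    obtain ⟨B, v, hB, hv, hspread, hmask⟩ := hS
    have hlt : S < 2 ^ L.length := by rw [← hmask]; exact touchMask_lt
    have hSv : ∀ i, S.testBit i = true ↔ i < L.length ∧ Touch G {v} (B i) := fun i => by
      rw [← hmask]; exact testBit_touchMask
    have h := allMasks_spec (T := S) (fun S T hST h => by
      simp only [List.any_eq_true, Bool.and_eq_true] at h ⊢
      obtain ⟨p, hp, h1, h2⟩ := h
      exact ⟨p, hp, hST _ h1, hST _ h2⟩) hmain hlt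
    rw [Nat.zero_or] at h
    rcases h with h | h
    -- A vertex adjacent to two single positions closes a triangle if these are adjacent, and a
    -- square if they have a common single neighbour.
    · exfalso
      simp only [List.any_eq_true, Bool.and_eq_true] at h
      obtain ⟨⟨i, j⟩, hq, hi, hj⟩ := h
      have hc := List.all_eq_true.1 hconf _ hq
      simp only [confCheck, Bool.and_eq_true, bne_iff_ne, Bool.or_eq_true] at hc
      obtain ⟨⟨⟨hσi, hσj⟩, hij⟩, hc⟩ := hc
      dsimp only at hi hj hσi hσj hij hc
      obtain ⟨x, hx⟩ := hB.sing i hσi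
      obtain ⟨y, hy⟩ := hB.sing j hσj
      have hvx := ((hSv i).1 hi).2
      have hvy := ((hSv j).1 hj).2
      rw [hx, touch_singleton_singleton] at hvx
      rw [hy, touch_singleton_singleton] at hvy
      rcases hc with hc | hc
      · have := (hB.touch i j hij).2 (hp.wf.adj_iff.2 hc)
        rw [hx, hy, touch_singleton_singleton] at this
        exact hG.tri v x y hvx this hvy.symm
      · obtain ⟨k, hk⟩ := Nat.exists_testBit_of_ne_zero hc
        rw [Nat.testBit_and, Bool.and_eq_true, Nat.testBit_and, Bool.and_eq_true] at hk
        obtain ⟨⟨hik, hjk⟩, hσk⟩ := hk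
        obtain ⟨z, hz⟩ := hB.sing k hσk
        have e1 := (hB.touch i k (hp.wf i k hik).2.2).2 (hp.wf.adj_iff.2 hik)
        have e2 := (hB.touch j k (hp.wf j k hjk).2.2).2 (hp.wf.adj_iff.2 hjk)
        rw [hx, hz, touch_singleton_singleton] at e1
        rw [hy, hz, touch_singleton_singleton] at e2
        refine hG.sq v x z y ?_ ?_ hvx e1 e2.symm hvy.symm
        · rintro rfl; exact hv k (by rw [hz]; rfl)
        · rintro rfl
          exact Set.disjoint_left.1 (hB.disj i j hij) (by rw [hx]; rfl) (by rw [hy]; rfl)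
    · simp only [force_eq, forceList_eq, Bool.or_eq_true, Bool.not_eq_true', hspread, List.any_eq_true, hcert,
        Bool.false_eq_true, and_false, exists_false, or_false, Bool.true_eq_false, false_or,
        List.contains_iff_mem] at h
      exact ⟨S, h, _, by rw [← hmask]; exact hB.addV_single hp.wf hv⟩
  · left
    push Not at hex
    -- A model leaving as few vertices uncovered as possible.
    obtain ⟨B, hB, hmin⟩ : ∃ B, PModel G L σ B ∧ ∀ B', PModel G L σ B' →
        (⋃ i, B i)ᶜ.ncard ≤ (⋃ i, B' i)ᶜ.ncard := by
      classical
      have : ∃ k B, PModel G L σ B ∧ (⋃ i, B i)ᶜ.ncard = k := ⟨_, B₀, hB₀, rfl⟩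
      obtain ⟨B, hB, h⟩ := Nat.find_spec this
      exact ⟨B, hB, fun B' hB' => h ▸ Nat.find_min' this ⟨B', hB', rfl⟩⟩
    set R : Set V := (⋃ i, B i)ᶜ with hR
    have hRB : ∀ {v}, v ∈ R → ∀ i, v ∉ B i := by
      intro v hv i hi
      exact hv (Set.mem_iUnion.2 ⟨i, hi⟩)
    have hnotR : ∀ {v}, v ∉ R → ∃ i, v ∈ B i := by
      intro v hv
      rw [hR, Set.mem_compl_iff, not_not, Set.mem_iUnion] at hv
      exact hv
    have hltB : ∀ {i x}, x ∈ B i → i < L.length := by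
      intro i x hx
      by_contra h
      rw [hB.out i (by omega)] at hx
      exact hx
    have hspv : ∀ v ∈ R, spread d.lines (touchMask G B L.length {v}) = false := by
      intro v hv
      rw [← Bool.not_eq_true]
      exact fun h => hex _ ⟨B, v, hB, hRB hv, h, rfl⟩
    -- The ends of a fat position are single, so the only line through a fat position is its own.
    have hfatline : ∀ {i m}, σ.testBit m = false → (lineMask L σ i).testBit m = true → i = m := by
      intro i m hm h
      rcases testBit_lineMask.1 h with h | ⟨hi, h⟩
      · exact h
      · obtain ⟨a, b, _, ha, hb, _, hbit⟩ := hp.fat i (bit_lt_left h) hi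
        rcases (hbit m).1 h with rfl | rfl
        · rw [ha] at hm; exact Bool.noConfusion hm
        · rw [hb] at hm; exact Bool.noConfusion hm
    -- An uncovered vertex touching a fat bag is attached, not being spread, within the line of that
    -- bag. The bag could absorb it, against the choice of the model.
    have hfat : ∀ v ∈ R, ∀ m, σ.testBit m = false → ¬ Touch G {v} (B m) := by
      intro v hv m hm ht
      have hml : m < L.length := by
        obtain ⟨_, _, y, hy, _⟩ := ht
        exact hltB hy
      have h := hspv v hv
      rw [hlines, spread_eq_false] at h
      obtain ⟨i, hi, h⟩ := h
      have him := hfatline hm (h m (testBit_touchMask.2 ⟨hml, ht⟩))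
      subst him
      have hB' : PModel G L σ (Function.update B i (insert v (B i))) := by
        refine hB.update le_rfl hi ((hB.conn i hi).insert (touch_singleton_left.1 ht))
          (fun i h1 h2 => by omega) (fun _ _ _ _ => Iff.rfl) (fun k hk => ?_) (fun k hk hkl => ?_)
          (fun k hk => ?_) (fun _ _ h => h) (fun h => by rw [hm] at h; exact Bool.noConfusion h)
        · rw [Set.disjoint_insert_left]
          exact ⟨hRB hv k, hB.disj i k hk.symm⟩
        · rw [← hB.touch i k hk.symm]
          refine ⟨fun h' => ?_, fun h' => h'.mono (Set.subset_insert _ _) subset_rfl⟩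
          rw [← Set.singleton_union, touch_union_left] at h'
          refine h'.elim (fun h' => ?_) id
          rcases testBit_lineMask.1 (h k (testBit_touchMask.2 ⟨hkl, h'⟩)) with h'' | ⟨_, h''⟩
          · exact absurd h''.symm hk
          · exact (hB.touch i k hk.symm).2 (hp.wf.adj_iff.2 h'')
        · rw [hp.wf.adj_iff]
          intro h
          have := (hp.wf i k h).1
          omega
      refine absurd (hmin _ hB') (not_le.2 (Set.ncard_lt_ncard ⟨?_, ?_⟩ (Set.toFinite _)))
      · rw [hR, Set.compl_subset_compl]
        refine Set.iUnion_mono fun k => ?_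
        by_cases hk : k = i
        · subst hk; rw [Function.update_self]; exact Set.subset_insert _ _
        · rw [Function.update_of_ne hk]
      · intro h
        exact h hv (Set.mem_iUnion.2 ⟨i, by rw [Function.update_self]; exact Set.mem_insert _ _⟩)
    by_cases hRe : R = ∅
    · refine ⟨B, hB, fun x => ?_, fun i hi => ?_⟩
      · obtain ⟨i, hi⟩ := hnotR (v := x) (by rw [hRe]; exact id)
        exact ⟨i, hltB hi, hi⟩
      · cases hσ : σ.testBit i
        -- When everything is covered, a fat bag is attached to its two ends only, so two vertices
        -- in it would give a proper 2-cutset.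
        · by_contra hcon
          have hnt : (B i).Nontrivial := by
            rw [← Set.not_subsingleton_iff]
            intro hs
            obtain ⟨a, ha⟩ := (hB.conn i hi).1
            exact hcon ⟨a, hs.eq_singleton_of_mem ha⟩
          refine hB.cutoff hG hp hi hσ hnt (fun j hj => hB.disj i j hj.symm) (fun x hx y hxy => ?_)
          obtain ⟨j, hj⟩ := hnotR (v := y) (by rw [hRe]; exact id)
          by_cases hij : i = j
          · subst hij; exact Or.inl hj
          · exact Or.inr ⟨j, hp.wf.adj_iff.1 ((hB.touch i j hij).1 ⟨x, hx, y, hj, hxy⟩), hj⟩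
        · exact hB.sing i hσ
    · exfalso
      obtain ⟨v, hv⟩ := Set.nonempty_iff_ne_empty.2 hRe
      set D := compIn G R v with hD
      have hDR : D ⊆ R := compIn_subset v
      have hDc : ConnSet G D := connSet_compIn hv
      have hDcl : ∀ x ∈ D, ∀ y, G.Adj x y → y ∈ D ∨ ∃ i, σ.testBit i = true ∧ i < L.length ∧
          Touch G D (B i) ∧ y ∈ B i := by
        intro x hx y hxy
        by_cases hy : y ∈ R
        · exact Or.inl (compIn_closed hx hy hxy)
        · obtain ⟨i, hi⟩ := hnotR hy
          refine Or.inr ⟨i, ?_, hltB hi, ⟨x, hx, y, hi, hxy⟩, hi⟩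
          by_contra hσ
          exact hfat x (hDR hx) i (by simpa using hσ) ⟨x, rfl, y, hi, hxy⟩
      -- A component of the uncovered vertices whose attachment lies in one line is cut off. On the
      -- line of a fat position, the component and the bag are separated from the rest by the two
      -- ends; on a single position, that vertex would be a cutvertex.
      cases hsp : spread d.lines (touchMask G B L.length D)
      · rw [hlines, spread_eq_false] at hsp
        obtain ⟨i, hi, hsp⟩ := hsp
        cases hσ : σ.testBit i
        · refine hB.cutoff hG hp hi hσ (X := B i ∪ D) ?_ (fun j hj => ?_) (fun x hx y hxy => ?_)
          · obtain ⟨x, hx⟩ := (hB.conn i hi).1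
            refine ⟨x, Or.inl hx, v, Or.inr (mem_compIn_self hv), ?_⟩
            rintro rfl
            exact hRB hv i hx
          · rw [Set.disjoint_union_left]
            exact ⟨hB.disj i j hj.symm, Set.disjoint_left.2 fun x hx => hRB (hDR hx) j⟩
          · rcases hx with hx | hx
            · by_cases hy : y ∈ R
              · exact absurd ⟨y, rfl, x, hx, hxy.symm⟩ (hfat y hy i hσ)
              · obtain ⟨j, hj⟩ := hnotR hy
                by_cases hij : i = j
                · subst hij; exact Or.inl (Or.inl hj)
                · exact Or.inr ⟨j, hp.wf.adj_iff.1 ((hB.touch i j hij).1 ⟨x, hx, y, hj, hxy⟩), hj⟩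
            · rcases hDcl x hx y hxy with h | ⟨j, hσj, hj, ht, hy⟩
              · exact Or.inl (Or.inr h)
              · rcases testBit_lineMask.1 (hsp j (testBit_touchMask.2 ⟨hj, ht⟩)) with h | h
                · subst h; exact Or.inl (Or.inl hy)
                · exact Or.inr ⟨j, h.2, hy⟩
        · obtain ⟨p, hpi⟩ := hB.sing i hσ
          have hc := hG.cut₁ p
          have hsub : ({p}ᶜ : Set V) ⊆ D := by
            refine hc.2 D (fun x hx hxp => ?_) hDc.1 (fun x hx y hy hxy => ?_)
            · rw [← hpi] at hxp; exact hRB (hDR hx) i hxp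
            · rcases hDcl x hx y hxy with h | ⟨j, hσj, hj, ht, hyj⟩
              · exact h
              · rcases testBit_lineMask.1 (hsp j (testBit_touchMask.2 ⟨hj, ht⟩)) with h | h
                · subst h; rw [hpi] at hyj; exact absurd hyj hy
                · rw [hσ] at h; exact Bool.noConfusion h.1
          obtain ⟨j, hj, hji⟩ : ∃ j, j < L.length ∧ j ≠ i := by
            have := hp.size
            by_cases h : i = 0
            · exact ⟨1, by omega, by omega⟩
            · exact ⟨0, by omega, Ne.symm h⟩
          obtain ⟨x, hx⟩ := (hB.conn j hj).1
          refine hRB (hDR (hsub (a := x) ?_)) j hx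
          rw [← hpi]
          exact fun h => Set.disjoint_left.1 (hB.disj j i hji) hx h
      -- A smallest connected `Q` with spread attachment is not one vertex. Splitting off a vertex
      -- `u` leaves two connected sets, each attached to single positions within one line, hence
      -- listed in `small`. Added as two new positions, they produce one of the listed thetas.
      · obtain ⟨Q, ⟨hQD, hQc, hQs⟩, hQmin⟩ : ∃ Q : Set V, (Q ⊆ D ∧ ConnSet G Q ∧
            spread d.lines (touchMask G B L.length Q) = true) ∧ ∀ Q' : Set V, (Q' ⊆ D ∧
            ConnSet G Q' ∧ spread d.lines (touchMask G B L.length Q') = true) →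
            Q.ncard ≤ Q'.ncard := by
          classical
          have : ∃ k, ∃ Q : Set V, (Q ⊆ D ∧ ConnSet G Q ∧
            spread d.lines (touchMask G B L.length Q) = true) ∧ Q.ncard = k :=
            ⟨_, D, ⟨subset_rfl, hDc, hsp⟩, rfl⟩
          obtain ⟨Q, hQ, h⟩ := Nat.find_spec this
          exact ⟨Q, hQ, fun Q' hQ' => h ▸ Nat.find_min' this ⟨Q', hQ', rfl⟩⟩
        have hQR : Q ⊆ R := hQD.trans hDR
        have hnt : Q.Nontrivial := by
          rw [← Set.not_subsingleton_iff]
          intro hs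
          obtain ⟨a, ha⟩ := hQc.1
          rw [hs.eq_singleton_of_mem ha, hspv a (hQR ha)] at hQs
          exact Bool.noConfusion hQs
        obtain ⟨u, hu, hQu⟩ := hQc.exists_diff_singleton (Set.toFinite _) hnt
        have hS₂ : spread d.lines (touchMask G B L.length (Q \ {u})) = false := by
          rw [← Bool.not_eq_true]
          intro h
          have h1 := hQmin _ ⟨Set.sdiff_subset.trans hQD, hQu, h⟩
          have h2 := Set.ncard_sdiff_singleton_lt_of_mem hu (Set.toFinite _)
          omega
        have hsing : ∀ X ⊆ R, touchMask G B L.length X &&& σ = touchMask G B L.length X := by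
          intro X hX
          refine eq_of_testBit_iff fun i => ?_
          rw [Nat.testBit_and, Bool.and_eq_true, and_iff_left_iff_imp, testBit_touchMask]
          rintro ⟨_, x, hx, y, hy, hxy⟩
          by_contra hσ
          exact hfat x (hX hx) i (by simpa using hσ) ⟨x, rfl, y, hy, hxy⟩
        have hmem : ∀ X ⊆ R, spread d.lines (touchMask G B L.length X) = false →
            touchMask G B L.length X ∈ d.small := by
          intro X hX hs
          have h := allMasks_spec (T := touchMask G B L.length X) spread_mono hsmall touchMask_lt
          rw [Nat.zero_or, hs] at h
          simpa [hsing X hX] using h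
        have hpair := List.all_eq_true.1 (List.all_eq_true.1 hpairs _
          (hmem {u} (by simpa using hQR hu) (hspv u (hQR hu)))) _
          (hmem (Q \ {u}) (Set.sdiff_subset.trans hQR) hS₂)
        have hQeq : Q = {u} ∪ Q \ {u} := by
          rw [Set.union_sdiff_cancel]
          simpa using hu
        rw [← touchMask_union, ← hQeq, hQs, Bool.not_true, Bool.false_or, forceList_eq, forceList_eq]
          at hpair
        have hB₁ := hB.addV_single hp.wf (hRB (hQR hu))
        have hB₂ := hB₁.addV (σ' := σ ||| 2 ^ L.length) (wf_addV hp.wf touchMask_lt) hQu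
          (fun i => by
            by_cases hi : i = L.length
            · subst hi; rw [Function.update_self]; exact Set.disjoint_sdiff_left
            · rw [Function.update_of_ne hi]
              exact Set.disjoint_left.2 fun x hx => hRB (hQR hx.1) i)
          (fun _ _ h => h) (fun h => by
            rw [length_addV] at h
            have := hp.lt _ (testBit_or_two_pow (by omega) h)
            omega)
        -- The additional bit records that the rest of `Q` is attached to `u`, since `Q` is
        -- connected.
        have hmask : touchMask G (Function.update B L.length {u})
            (UniqueChord.addV L (touchMask G B L.length {u})).length (Q \ {u}) =
            touchMask G B L.length (Q \ {u}) ||| 2 ^ L.length := by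
          refine eq_of_testBit_iff fun i => ?_
          rw [Nat.testBit_or, Bool.or_eq_true, testBit_touchMask, testBit_touchMask, length_addV,
            Nat.testBit_two_pow, decide_eq_true_eq]
          by_cases hi : i = L.length
          · subst hi
            rw [Function.update_self]
            refine iff_of_true ⟨by omega, ?_⟩ (Or.inr rfl)
            exact (hQc.touch_diff (T := {u}) (by simpa using hu) ⟨u, rfl⟩ hQu.1).symm
          · rw [Function.update_of_ne hi]
            constructor
            · rintro ⟨h1, h2⟩; exact Or.inl ⟨by omega, h2⟩
            · rintro (⟨h1, h2⟩ | h)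
              · exact ⟨by omega, h2⟩
              · exact absurd h.symm hi
        rw [hmask] at hB₂
        exact hB₂.not_hasTheta hG.noTheta hpair

/-- A test for `PatternShape`. -/
def shapeCheck (L : List ℕ) (σ : ℕ) : Bool :=
  wfCheck L && decide (5 ≤ L.length) && decide (σ < 2 ^ L.length) &&
  (List.range L.length).all fun i =>
    if σ.testBit i then
      (List.range L.length).any fun a => (List.range a).any fun b => (List.range b).any fun c =>
        bit L i a && bit L i b && bit L i c
    else
      (List.range L.length).any fun a => (List.range a).any fun b =>
        σ.testBit a && σ.testBit b && !bit L a b && L.getD i 0 == 2 ^ a ||| 2 ^ b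

theorem patternShape_of_shapeCheck {L : List ℕ} {σ : ℕ} (h : shapeCheck L σ = true) :
    PatternShape L σ := by
  simp only [shapeCheck, Bool.and_eq_true, decide_eq_true_eq, List.all_eq_true, List.mem_range]
    at h
  obtain ⟨⟨⟨hwf, hsize⟩, hσ⟩, hall⟩ := h
  have hlt : ∀ i, σ.testBit i = true → i < L.length := by
    intro i hi
    by_contra hcon
    rw [Nat.testBit_lt_two_pow
      (hσ.trans_le (Nat.pow_le_pow_right (by norm_num) (by omega)))] at hi
    exact Bool.noConfusion hi
  refine ⟨wf_of_wfCheck hwf, hsize, hlt, fun m hm hσm => ?_, fun i hi => ?_⟩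
  · have h := hall m hm
    simp only [hσm, Bool.false_eq_true, if_false, List.any_eq_true, List.mem_range,
      Bool.and_eq_true, Bool.not_eq_true', beq_iff_eq] at h
    obtain ⟨a, _, b, hba, ⟨⟨h1, h2⟩, h3⟩, h4⟩ := h
    refine ⟨a, b, by omega, h1, h2, h3, fun i => ?_⟩
    rw [bit, h4, Nat.testBit_or, Nat.testBit_two_pow, Nat.testBit_two_pow, Bool.or_eq_true,
      decide_eq_true_eq, decide_eq_true_eq, eq_comm, @eq_comm _ b]
  · have h := hall i (hlt i hi)
    simp only [hi, if_true, List.any_eq_true, List.mem_range, Bool.and_eq_true] at h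
    obtain ⟨a, _, b, hba, c, hcb, ⟨h1, h2⟩, h3⟩ := h
    exact ⟨a, b, c, by omega, by omega, by omega, h1, h2, h3⟩

end StepTheorem

/-! ### The patterns cut from the Petersen and Heawood graphs -/

section Patterns

/-- The pattern with 8 positions. -/
def pattern8 : List ℕ := [148, 56, 97, 194, 3, 6, 12, 9]

/-- Witnesses for the growth step of `pattern8`. -/
def stepData8 : StepData where
  lines := [1, 2, 4, 8, 19, 38, 76, 137]
  conf := [(0, 2), (1, 3)]
  core := [80, 160]
  certs := [.theta 8 0 16 136, .theta 8 2 32 137, .theta 8 1 32 137, .theta 8 2 64 17, .theta 8 3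
    64 34, .theta 8 1 16 76, .theta 8 3 128 100, .theta 3 1 145 320, .theta 2 0 200 304, .theta 8
    0 68 18, .theta 2 0 320 50, .theta 3 1 384 100, .theta 3 1 272 100, .theta 3 1 145 352,
    .shrink 5 68 18, .theta 2 0 384 50, .theta 8 2 129 34, .theta 8 0 36 136, .theta 8 3 18 68,
    .theta 2 0 272 200, .theta 2 0 200 288, .theta 3 1 288 145, .corner 4 1 3 129 34, .corner 6 2
    0 136 36, .theta 3 1 400 100, .corner 7 0 2 72 17, .shrink 4 129 34, .theta 2 0 448 50,
    .corner 7 3 1 17 72, .shrink 7 72 17, .shrink 6 136 36]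
  small := [0, 1, 2, 3, 4, 6, 8, 9, 12]
  thetas := [(2, 0, 768, 200), (3, 1, 768, 100), (2, 0, 768, 50), (3, 1, 768, 145), (8, 0, 516,
    18), (8, 2, 513, 34), (8, 3, 514, 129), (8, 3, 514, 68)]

/-- The pattern is the 8-cycle 0 4 1 5 2 6 3 7 with the crossing chords 0–2 and 1–3, which is the
Petersen graph without two adjacent vertices. The mask 15 makes the chord ends single; the four
positions of degree two are fat. -/
theorem shapeCheck_pattern8 : shapeCheck pattern8 15 = true := by decide +kernel

/-- The core masks 80 and 160 are the two pairs of opposite fat positions, {4, 6} and {5, 7}.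
Attaching a new vertex to either pair restores one of the two missing vertices of the Petersen
graph. -/
theorem stepCheck_pattern8 : stepCheck pattern8 15 stepData8 = true := by decide +kernel

/-- The pattern with 9 positions. -/
def pattern9 : List ℕ := [148, 56, 97, 194, 259, 6, 268, 9, 80]

/-- Witnesses for the growth step of `pattern9`. -/
def stepData9 : StepData where
  lines := [1, 2, 4, 8, 16, 38, 64, 137, 336]
  conf := [(0, 1), (0, 2), (0, 4), (0, 6), (1, 3), (1, 4), (1, 6), (2, 3), (2, 4), (2, 6), (3, 4),
    (3, 6)]
  core := [416]
  certs := [.theta 2 0 336 544, .theta 2 0 336 672, .theta 4 1 800 137, .theta 4 0 640 38, .theta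
    9 4 129 34, .theta 4 0 768 38, .theta 9 0 272 36, .theta 9 1 272 136, .theta 4 0 896 38,
    .theta 3 1 544 145, .theta 4 1 544 137, .theta 6 2 544 273, .theta 3 1 640 336, .theta 2 0 640
    50, .theta 4 1 768 137, .theta 6 3 640 38, .theta 4 0 772 138, .theta 6 3 768 133, .theta 9 2
    320 129, .theta 9 3 274 128, .theta 9 6 256 133]
  small := [0, 1, 2, 4, 6, 8, 9, 16, 64, 80]
  thetas := [(2, 0, 1536, 336), (4, 0, 1536, 38), (4, 1, 1536, 137), (3, 1, 1536, 336), (6, 2,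
    1536, 137), (6, 3, 1536, 38), (4, 1, 328, 1537), (6, 2, 1537, 42), (6, 3, 1538, 133), (6, 3,
    274, 1540), (4, 0, 1540, 138), (3, 1, 1552, 100)]

/-- The Petersen graph without one vertex. The mask 95 leaves fat the positions 5, 7 and 8, the
neighbours of the missing vertex; they link the opposite corners of the hexagon 0 2 6 3 1 4 of
single positions. -/
theorem shapeCheck_pattern9 : shapeCheck pattern9 95 = true := by decide +kernel

/-- The core mask 416 is {5, 7, 8}: only the missing vertex of the Petersen graph can be added. -/
theorem stepCheck_pattern9 : stepCheck pattern9 95 stepData9 = true := by decide +kernel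

/-- The pattern with 10 positions. -/
def pattern10 : List ℕ := [148, 56, 97, 194, 259, 518, 268, 521, 592, 416]

/-- Witnesses for the growth step of `pattern10`. -/
def stepData10 : StepData where
  lines := [1, 2, 4, 8, 16, 32, 64, 128, 256, 512]
  conf := [(0, 1), (0, 2), (0, 3), (0, 4), (0, 5), (0, 6), (0, 7), (0, 8), (0, 9), (1, 2), (1, 3),
    (1, 4), (1, 5), (1, 6), (1, 7), (1, 8), (1, 9), (2, 3), (2, 4), (2, 5), (2, 6), (2, 7), (2,
    8), (2, 9), (3, 4), (3, 5), (3, 6), (3, 7), (3, 8), (3, 9), (4, 5), (4, 6), (4, 7), (4, 8),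
    (4, 9), (5, 6), (5, 7), (5, 8), (5, 9), (6, 7), (6, 8), (6, 9), (7, 8), (7, 9), (8, 9)]
  core := []
  certs := []
  small := [0, 1, 2, 4, 8, 16, 32, 64, 128, 256, 512]
  thetas := [(4, 0, 896, 3074), (2, 0, 3072, 90), (7, 0, 784, 3080), (4, 0, 3072, 138), (5, 2,
    3073, 74), (6, 3, 896, 3078), (3, 1, 3072, 165), (4, 1, 3072, 328), (6, 2, 3073, 42), (5, 1,
    3072, 21), (5, 2, 641, 3138), (6, 2, 273, 3080), (7, 0, 3072, 562), (3, 1, 3200, 100), (2, 0,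
    3088, 672), (5, 2, 3072, 832), (6, 2, 3072, 137), (6, 2, 3329, 42), (4, 1, 3328, 137), (7, 0,
    3076, 26), (8, 6, 3076, 26), (9, 7, 3073, 328), (5, 1, 3584, 76), (9, 5, 3076, 138), (3, 1,
    3088, 100), (6, 2, 273, 3112), (6, 3, 3072, 38), (7, 3, 3072, 337), (6, 3, 3328, 38), (7, 3,
    3584, 69), (2, 0, 200, 3120), (8, 6, 548, 3088), (9, 8, 3216, 100), (8, 4, 3072, 74), (5, 1,
    3600, 76), (6, 2, 3104, 273), (2, 0, 336, 3232), (9, 5, 3328, 133), (9, 5, 3072, 138), (6, 3,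
    3200, 274), (8, 6, 3072, 54), (8, 6, 3584, 26), (9, 8, 3200, 100), (9, 7, 3072, 328), (9, 8,
    3072, 100)]

theorem shapeCheck_pattern10 : shapeCheck pattern10 1023 = true := by decide +kernel

/-- Any two vertices of the Petersen graph are adjacent or have a common neighbour, so `conf`
excludes every spread mask and no further certificate is required. -/
theorem stepCheck_pattern10 : stepCheck pattern10 1023 stepData10 = true := by decide +kernel

/-- The pattern with 11 positions. -/
def pattern11 : List ℕ := [644, 56, 97, 1154, 770, 6, 1284, 9, 80, 17, 72]

/-- Witnesses for the growth step of `pattern11`. -/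
def stepData11 : StepData where
  lines := [1, 2, 4, 8, 16, 38, 64, 137, 336, 529, 1096]
  conf := [(0, 2), (0, 6), (1, 3), (1, 4), (2, 6), (3, 4)]
  core := [1536, 384]
  certs := [.theta 11 0 128 36, .theta 11 2 129 32, .theta 4 1 2561 1352, .theta 6 2 2080 785,
    .theta 2 0 2576 1224, .theta 4 1 649 2304, .theta 6 2 3080 785, .theta 4 1 649 2336, .theta 2
    0 1224 2080, .theta 3 1 2080 657, .theta 11 0 324 128, .theta 11 4 641 34, .theta 11 6 256
    133, .theta 11 2 320 129, .theta 11 3 34 129, .theta 4 1 2184 356, .theta 11 6 784 36, .theta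
    4 1 2568 356, .theta 11 2 513 1096, .theta 11 4 138 324, .theta 6 2 2177 306, .theta 11 0 512
    1480, .theta 11 6 517 1034, .theta 11 1 272 136, .theta 6 2 1066 2817, .theta 4 1 549 2312,
    .shrink 5 274 133, .theta 2 0 3136 562, .theta 2 0 1224 2592, .theta 11 1 1032 529, .theta 3 1
    3088 165, .theta 3 1 3072 657, .theta 11 3 641 34, .theta 3 1 3344 165, .shrink 5 1034 517,
    .theta 6 2 3201 306, .theta 11 1 136 100, .theta 11 3 274 133, .theta 4 1 2080 649, .theta 3 1
    1360 2208, .theta 11 4 1034 517, .theta 6 2 2561 1066, .theta 6 2 3104 785, .theta 4 1 649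
    2368, .theta 3 1 1360 2176, .theta 2 0 2176 848, .theta 11 1 272 37, .theta 6 2 1161 2304,
    .theta 4 1 2696 356, .corner 9 0 2 1360 129, .corner 8 4 1 100 528, .theta 11 3 641 1344,
    .corner 7 3 1 37 1032, .corner 8 6 2 50 1088, .shrink 10 320 136]
  small := [0, 1, 2, 4, 6, 8, 9, 16, 17, 64, 72, 80]
  thetas := [(2, 0, 6144, 848), (3, 1, 6144, 657), (4, 1, 6144, 1352), (4, 1, 6152, 356), (2, 0,
    6208, 562), (6, 2, 6144, 1161), (6, 2, 6145, 1066), (3, 1, 6160, 165), (3, 1, 1360, 6273), (4,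
    1, 649, 6464), (6, 2, 7176, 785), (2, 0, 6672, 1224), (11, 3, 4114, 129), (11, 4, 4106, 513),
    (11, 6, 4101, 1032), (11, 4, 4609, 320)]

/-- The pattern differs from `pattern9` in that the edges 0–4 and 3–6 are replaced by the fat
positions 9 and 10. It is the Heawood graph without a path of three vertices. -/
theorem shapeCheck_pattern11 : shapeCheck pattern11 95 = true := by decide +kernel

/-- The core masks are {9, 10} and {7, 8}: a new vertex restores one of the two ends of the missing
path. -/
theorem stepCheck_pattern11 : stepCheck pattern11 95 stepData11 = true := by decide +kernel

/-- The pattern with 12 positions. -/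
def pattern12 : List ℕ := [644, 56, 97, 1154, 770, 6, 1284, 9, 80, 2065, 2120, 1536]

/-- Witnesses for the growth step of `pattern12`. -/
def stepData12 : StepData where
  lines := [1, 2, 4, 8, 16, 38, 64, 137, 336, 512, 1024, 3584]
  conf := [(0, 2), (0, 4), (0, 6), (0, 9), (1, 3), (1, 4), (1, 9), (1, 10), (2, 6), (2, 9), (2,
    10), (3, 4), (3, 6), (3, 10), (4, 9), (6, 10)]
  core := [384, 2080]
  certs := [.theta 3 1 3600 4224, .theta 3 1 4128 1360, .theta 6 2 3585 4352, .theta 6 2 4128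
    1161, .theta 3 1 3600 4256, .theta 12 4 641 34, .theta 4 1 4128 649, .theta 2 0 1224 4128,
    .theta 9 0 4224 54, .theta 12 9 129 50, .theta 12 3 1344 34, .theta 10 6 4101 282, .theta 9 4
    4352 139, .theta 10 6 4352 46, .theta 12 0 324 128, .theta 4 1 649 4352, .theta 9 0 6144 340,
    .theta 12 10 320 42, .theta 2 0 4232 848, .theta 9 4 6144 139, .theta 9 0 6272 340, .theta 12
    6 3072 133, .theta 4 1 4232 356, .theta 10 3 6144 102, .theta 12 2 2561 320, .theta 10 6 6400
    46, .theta 12 1 2576 32, .theta 6 2 5152 785, .theta 10 6 6144 141, .theta 12 4 138 324,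
    .theta 12 0 324 138, .theta 2 0 4288 562, .theta 3 1 4368 165, .theta 6 2 1161 4384, .theta 2
    0 1224 4640, .theta 9 0 6148 154, .theta 2 0 3648 4130, .theta 4 1 4132 3592, .theta 4 1 649
    4416, .theta 6 2 1066 4353, .theta 12 3 358 128, .theta 3 1 4624 1124, .theta 9 4 4416 139,
    .theta 3 1 5136 165, .theta 12 9 3072 50, .theta 6 2 5249 306, .theta 4 1 6656 356, .theta 12
    2 3136 34, .shrink 11 784 1160]
  small := [0, 1, 2, 4, 6, 8, 9, 16, 64, 80, 512, 1024, 1536]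
  thetas := [(9, 4, 3392, 12291), (4, 1, 12288, 649), (10, 3, 2578, 12356), (9, 0, 12288, 54), (9,
    0, 3140, 12304), (3, 1, 13376, 657), (9, 4, 3082, 12293), (3, 1, 12288, 3600), (9, 4, 12288,
    139), (10, 3, 12288, 338), (10, 6, 12288, 141), (9, 4, 12290, 325), (2, 0, 12800, 1224), (10,
    6, 12292, 282), (4, 1, 12296, 549), (2, 0, 12288, 474), (2, 0, 13376, 562), (6, 2, 12288,
    3585), (3, 1, 12816, 1124), (10, 3, 12306, 197), (10, 6, 14848, 46), (12, 1, 9224, 36), (12,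
    3, 8210, 129), (12, 6, 9224, 272), (12, 10, 8260, 2560)]

theorem shapeCheck_pattern12 : shapeCheck pattern12 1631 = true := by decide +kernel

/-- The pattern is the Heawood graph without two adjacent vertices, which have the remaining
neighbours {7, 8} and {5, 11}; these are the core masks 384 and 2080. -/
theorem stepCheck_pattern12 : stepCheck pattern12 1631 stepData12 = true := by decide +kernel

/-- The pattern with 13 positions. -/
def pattern13 : List ℕ := [644, 56, 97, 1154, 770, 6, 1284, 4105, 4176, 2065, 2120, 1536, 384]

/-- Witnesses for the growth step of `pattern13`. -/
def stepData13 : StepData where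
  lines := [1, 2, 4, 8, 16, 38, 64, 128, 256, 512, 1024, 3584, 4480]
  conf := [(0, 2), (0, 3), (0, 4), (0, 6), (0, 7), (0, 9), (1, 3), (1, 4), (1, 7), (1, 8), (1, 9),
    (1, 10), (2, 6), (2, 7), (2, 8), (2, 9), (2, 10), (3, 4), (3, 6), (3, 7), (3, 10), (4, 6), (4,
    8), (4, 9), (6, 8), (6, 10), (7, 9), (7, 10), (8, 9), (8, 10)]
  core := [6176]
  certs := [.theta 7 0 8228 3592, .theta 9 0 8228 4496, .theta 2 0 1224 8224, .theta 3 1 8224 657,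
    .theta 4 1 8224 649, .theta 6 2 8224 785, .theta 3 1 11264 4496, .theta 9 4 10240 325, .theta
    10 3 8321 338, .theta 8 4 10752 102, .theta 3 1 3600 12416, .theta 2 0 10752 4544, .theta 6 2
    3585 12544, .theta 7 3 12288 1093, .theta 8 6 12288 1050, .theta 6 2 1161 8480, .theta 7 0
    12288 1100, .theta 13 2 4225 3136, .theta 9 0 10368 340, .theta 10 3 12416 102, .theta 3 1
    9248 657, .theta 7 0 12800 1100, .theta 10 6 10240 46, .theta 13 1 4232 2576, .theta 7 0 8720
    1100, .theta 7 0 4420 8712, .theta 13 7 3080 37, .theta 13 9 4225 50, .theta 7 0 4420 8202,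
    .theta 7 0 4880 8204, .theta 8 4 4234 8260, .theta 10 3 2689 8258, .theta 10 3 2578 8384,
    .theta 2 0 8512 170, .theta 10 3 2689 8512, .theta 8 4 4234 8768, .theta 10 6 8464 141, .theta
    9 0 10240 154, .theta 10 3 10240 4544, .theta 3 1 11296 4496, .theta 3 1 1124 12432, .theta 3
    1 3600 12448, .theta 8 4 14848 102]
  small := [0, 1, 2, 4, 6, 8, 16, 64, 128, 256, 384, 512, 1024, 1536]
  thetas := [(3, 1, 1360, 24705), (4, 1, 3592, 24832), (9, 4, 24578, 4481), (6, 2, 25608, 785),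
    (2, 0, 25104, 1224), (2, 0, 24576, 474), (7, 0, 4420, 24584), (3, 1, 25664, 657), (9, 4, 3392,
    24577), (7, 0, 24576, 538), (9, 0, 24576, 154), (10, 3, 2578, 24772), (7, 0, 25104, 1100), (8,
    6, 25608, 533), (7, 3, 25600, 39), (7, 0, 4420, 25096), (9, 4, 24896, 139), (9, 4, 24576,
    139), (8, 6, 24581, 1050), (2, 0, 25664, 562), (3, 1, 24576, 1124), (4, 1, 24576, 356), (6, 2,
    24576, 1563), (7, 3, 4370, 25605), (4, 1, 24584, 549), (10, 3, 2689, 24640), (7, 3, 24576,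
    3585), (10, 3, 24576, 4544), (8, 4, 4234, 24640), (8, 4, 24576, 3648), (8, 6, 4229, 25616),
    (8, 6, 24576, 5256), (10, 6, 24576, 2832)]

theorem shapeCheck_pattern13 : shapeCheck pattern13 2015 = true := by decide +kernel

/-- The core mask 6176 is {5, 11, 12}, the neighbourhood of the one missing vertex of the Heawood
graph. -/
theorem stepCheck_pattern13 : stepCheck pattern13 2015 stepData13 = true := by decide +kernel

/-- The pattern with 14 positions. -/
def pattern14 : List ℕ := [644, 56, 97, 1154, 770, 8198, 1284, 4105, 4176, 2065, 2120, 9728, 8576,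
    6176]

/-- Witnesses for the growth step of `pattern14`. -/
def stepData14 : StepData where
  lines := [1, 2, 4, 8, 16, 32, 64, 128, 256, 512, 1024, 2048, 4096, 8192]
  conf := [(0, 2), (0, 3), (0, 4), (0, 5), (0, 6), (0, 7), (0, 9), (0, 11), (0, 12), (1, 2), (1,
    3), (1, 4), (1, 5), (1, 7), (1, 8), (1, 9), (1, 10), (1, 13), (2, 5), (2, 6), (2, 7), (2, 8),
    (2, 9), (2, 10), (2, 13), (3, 4), (3, 5), (3, 6), (3, 7), (3, 10), (3, 11), (3, 12), (4, 5),
    (4, 6), (4, 8), (4, 9), (4, 11), (4, 12), (5, 6), (5, 11), (5, 12), (5, 13), (6, 8), (6, 10),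
    (6, 11), (6, 12), (7, 8), (7, 9), (7, 10), (7, 12), (7, 13), (8, 9), (8, 10), (8, 12), (8,
    13), (9, 10), (9, 11), (9, 13), (10, 11), (10, 13), (11, 12), (11, 13), (12, 13)]
  core := []
  certs := [.theta 13 11 5440 16931, .theta 11 9 12560 17421, .theta 13 12 3208 16692, .theta 13
    11 4737 17506, .theta 11 10 8292 17048, .theta 11 9 24737 1360, .theta 13 5 20676 2578, .theta
    11 10 8234 17217, .theta 12 8 10768 16520, .theta 13 12 19728 165, .theta 13 11 5440 16418,
    .theta 10 6 18436 4488, .theta 8 4 23168 102, .theta 11 10 28682 581, .theta 5 2 29760 531,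
    .theta 5 1 24592 141]
  small := [0, 1, 2, 4, 8, 16, 32, 64, 128, 256, 512, 1024, 2048, 4096, 8192]
  thetas := [(8, 6, 15360, 49175), (2, 0, 49152, 11432), (4, 1, 49673, 12576), (3, 1, 49152, 165),
    (4, 1, 49152, 1613), (12, 8, 10768, 49356), (9, 0, 10276, 49304), (4, 1, 49697, 1352), (11,
    10, 8234, 49729), (5, 1, 49152, 10768), (5, 2, 49152, 1098), (6, 2, 50216, 785), (13, 12,
    3208, 49456), (7, 0, 49152, 538), (12, 7, 10753, 49482), (6, 2, 49152, 12576), (11, 10, 12424,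
    49744), (5, 2, 49216, 10753), (8, 4, 53378, 3648), (7, 3, 49152, 12322), (11, 9, 57505, 1360),
    (13, 11, 54017, 1066), (13, 5, 53508, 3082), (8, 4, 49152, 3648), (9, 0, 49152, 1496), (13, 5,
    4420, 51714), (10, 6, 51716, 4488), (13, 5, 4370, 52229), (3, 1, 50176, 657), (10, 3, 49152,
    4544), (9, 4, 49152, 139), (13, 5, 4229, 52242), (9, 0, 51336, 340), (9, 4, 51234, 4481), (8,
    6, 49152, 159), (11, 10, 61448, 581), (11, 9, 61456, 1093), (13, 12, 2832, 49184), (11, 10,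
    57354, 581), (11, 10, 57412, 538), (13, 5, 49152, 4885), (10, 6, 49152, 282), (9, 4, 51520,
    139), (13, 11, 54336, 562), (12, 8, 8292, 49280), (13, 11, 53888, 1124), (11, 9, 8242, 50305),
    (12, 7, 49152, 311), (4, 1, 549, 50440), (12, 8, 49152, 183), (13, 12, 49408, 3208), (11, 9,
    12417, 50176), (11, 9, 49152, 1050), (5, 1, 57872, 1100), (11, 10, 49152, 12485), (5, 1,
    58376, 533), (10, 3, 55424, 102), (13, 11, 49152, 562), (13, 12, 49152, 2714)]

theorem shapeCheck_pattern14 : shapeCheck pattern14 16383 = true := by decide +kernel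

/-- Two vertices in the same class of the Heawood graph have a common neighbour, so `conf` leaves
only nonadjacent pairs from opposite classes; the certificates exclude those. -/
theorem stepCheck_pattern14 : stepCheck pattern14 16383 stepData14 = true := by decide +kernel

end Patterns

/-! ### Collapsing a fat bag that has a third attachment -/

section Surgery

variable {V : Type*} {G : SimpleGraph V}

theorem PModel.lt_length {L : List ℕ} {σ i : ℕ} {B : ℕ → Set V} (hB : PModel G L σ B)
    (h : σ.testBit i = true) : i < L.length := by
  by_contra hcon
  obtain ⟨a, ha⟩ := hB.sing i h
  rw [hB.out i (by omega)] at ha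
  exact Set.singleton_ne_empty a ha.symm

theorem PModel.weaken {L : List ℕ} {σ σ' : ℕ} {B : ℕ → Set V} (hB : PModel G L σ B)
    (h : ∀ i, σ'.testBit i = true → σ.testBit i = true) : PModel G L σ' B :=
  ⟨hB.conn, hB.disj, hB.touch, fun i hi => hB.sing i (h i hi), hB.out⟩

/-- Delete the edge between `i` and `j`. -/
def delEdge (L : List ℕ) (i j : ℕ) : List ℕ :=
  (L.set i (L.getD i 0 ^^^ 2 ^ j)).set j (L.getD j 0 ^^^ 2 ^ i)

theorem length_delEdge (L : List ℕ) (i j : ℕ) : (delEdge L i j).length = L.length := by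
  simp [delEdge]

theorem bit_delEdge {L : List ℕ} (hL : WF L) {i j : ℕ} (hij : bit L i j = true) {k l : ℕ} :
    bit (delEdge L i j) k l = true ↔
      bit L k l = true ∧ ¬ (k = i ∧ l = j) ∧ ¬ (k = j ∧ l = i) := by
  obtain ⟨hj, hji, hne⟩ := hL i j hij
  have hi := bit_lt_left hij
  have key : (delEdge L i j).getD k 0 = if k = j then L.getD j 0 ^^^ 2 ^ i else
      if k = i then L.getD i 0 ^^^ 2 ^ j else L.getD k 0 := by
    simp only [delEdge, List.getD_eq_getElem?_getD, List.getElem?_set, List.length_set]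
    by_cases h1 : k = j
    · subst h1; simp [hj]
    · by_cases h2 : k = i
      · subst h2; simp [hi, h1, Ne.symm h1]
      · simp [h1, h2, Ne.symm h1, Ne.symm h2]
  rw [bit, key]
  split_ifs with h1 h2
  · subst h1
    rw [testBit_xor_two_pow hji]
    simp [bit, Ne.symm hne]
  · subst h2
    rw [testBit_xor_two_pow hij]
    simp [bit, hne]
  · simp [bit, h1, h2]

theorem wf_delEdge {L : List ℕ} (hL : WF L) {i j : ℕ} (hij : bit L i j = true) :
    WF (delEdge L i j) := by
  intro k l h
  rw [bit_delEdge hL hij] at h ⊢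
  obtain ⟨h1, h2, h3⟩ := hL k l h.1
  rw [length_delEdge]
  exact ⟨h1, ⟨h2, by tauto⟩, h3⟩

/-- The fat position `m` is attached exactly to the single positions `a`, `b` and to the fat
position `v`. -/
structure Joint (L : List ℕ) (σ m a b v : ℕ) : Prop where
  wf : WF L
  fat : σ.testBit m = false
  fat' : σ.testBit v = false
  ha : σ.testBit a = true
  hb : σ.testBit b = true
  ne : a ≠ b
  bit_iff : ∀ i, bit L m i = true ↔ i = a ∨ i = b ∨ i = v

/-- A test for `Joint`. -/
def jointCheck (L : List ℕ) (σ m a b v : ℕ) : Bool :=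
  wfCheck L && !σ.testBit m && !σ.testBit v && σ.testBit a && σ.testBit b && a != b &&
    L.getD m 0 == 2 ^ a ||| 2 ^ b ||| 2 ^ v

theorem joint_of_jointCheck {L : List ℕ} {σ m a b v : ℕ} (h : jointCheck L σ m a b v = true) :
    Joint L σ m a b v := by
  simp only [jointCheck, Bool.and_eq_true, Bool.not_eq_true', bne_iff_ne, beq_iff_eq] at h
  obtain ⟨⟨⟨⟨⟨⟨h1, h2⟩, h3⟩, h4⟩, h5⟩, h6⟩, h7⟩ := h
  refine ⟨wf_of_wfCheck h1, h2, h3, h4, h5, h6, fun i => ?_⟩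
  rw [bit, h7, Nat.testBit_or, Nat.testBit_or, Nat.testBit_two_pow, Nat.testBit_two_pow,
    Nat.testBit_two_pow, Bool.or_eq_true, Bool.or_eq_true, decide_eq_true_eq, decide_eq_true_eq,
    decide_eq_true_eq, or_assoc, @eq_comm _ a, @eq_comm _ b, @eq_comm _ v]

theorem Joint.symm {L : List ℕ} {σ m a b v : ℕ} (h : Joint L σ m a b v) : Joint L σ m b a v :=
  ⟨h.wf, h.fat, h.fat', h.hb, h.ha, h.ne.symm, fun i => by rw [h.bit_iff]; tauto⟩

theorem Joint.facts {L : List ℕ} {σ m a b v : ℕ} (h : Joint L σ m a b v) :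
    m ≠ a ∧ m ≠ b ∧ m ≠ v ∧ v ≠ a ∧ v ≠ b ∧ m < L.length ∧ v < L.length := by
  have hm := (h.bit_iff v).2 (by simp)
  have := h.wf m v hm
  refine ⟨?_, ?_, this.2.2, ?_, ?_, bit_lt_left hm, this.1⟩
  · rintro rfl; exact Bool.noConfusion (h.fat.symm.trans h.ha)
  · rintro rfl; exact Bool.noConfusion (h.fat.symm.trans h.hb)
  · rintro rfl; exact Bool.noConfusion (h.fat'.symm.trans h.ha)
  · rintro rfl; exact Bool.noConfusion (h.fat'.symm.trans h.hb)

/-- Some part of the bag `m` is attached to the bags `v` and `a` but not to `b`. -/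
def Free (G : SimpleGraph V) (B : ℕ → Set V) (v m a b : ℕ) : Prop :=
  ∃ M ⊆ B m, ConnSet G M ∧ Touch G (B v) M ∧ Touch G (B a) M ∧ ¬ Touch G (B b) M

/-- The part of the bag that witnesses freedom can replace the bag; the only attachment lost is the
one to `b`. -/
theorem PModel.of_free {L : List ℕ} {σ m a b v : ℕ} {B : ℕ → Set V} (hB : PModel G L σ B)
    (hJ : Joint L σ m a b v) (hF : Free G B v m a b) :
    ∃ B', PModel G (delEdge L m b) σ B' ∧ ∀ i, i ≠ m → B' i = B i := by
  obtain ⟨M, hM, hMc, hv, ha, hb⟩ := hF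
  obtain ⟨hma, hmb, hmv, hva, hvb, hml, hvl⟩ := hJ.facts
  have hbit := (hJ.bit_iff b).2 (by simp)
  have hwf := wf_delEdge hJ.wf hbit
  refine ⟨_, hB.update (L' := delEdge L m b) (σ' := σ) (M := M) (m := m)
    (by rw [length_delEdge]) (by rwa [length_delEdge]) hMc
    (fun i h1 h2 => by rw [length_delEdge] at h2; omega) (fun i j hi hj => ?_)
    (fun i hi => (hB.disj m i hi.symm).mono_left hM) (fun i hi _ => ?_) (fun i hi => ?_)
    (fun _ _ h => h) (fun h => by rw [hJ.fat] at h; exact Bool.noConfusion h),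
    fun i hi => Function.update_of_ne hi _ _⟩
  · rw [hwf.adj_iff, hJ.wf.adj_iff, bit_delEdge hJ.wf hbit]
    tauto
  · rw [hwf.adj_iff, bit_delEdge hJ.wf hbit, hJ.bit_iff]
    constructor
    · intro h
      have h1 := hJ.wf.adj_iff.1 ((hB.touch m i hi.symm).1 (h.mono hM subset_rfl))
      refine ⟨(hJ.bit_iff i).1 h1, ?_, fun h => hi h.2⟩
      rintro ⟨_, rfl⟩
      exact hb h.symm
    · rintro ⟨rfl | rfl | rfl, h2, _⟩
      · exact ha.symm
      · exact absurd ⟨rfl, rfl⟩ h2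
      · exact hv.symm
  · rw [hwf.adj_iff]
    intro h
    have := (hwf m i h).1
    rw [length_delEdge] at hi this
    omega

/-- Shrink the bag `m` to `M`, moving its part `C` to the bag `v`. -/
theorem PModel.move {L L' : List ℕ} {σ σ' m v : ℕ} {B : ℕ → Set V} (hB : PModel G L σ B)
    (hmv : m ≠ v) (hm : m < L.length) (hv : v < L.length) (hL' : L'.length = L.length)
    {M C : Set V} (hM : M ⊆ B m) (hC : C ⊆ B m) (hMC : Disjoint M C) (hMc : ConnSet G M)
    (hvC : ConnSet G (B v ∪ C)) (ht : Touch G M (B v ∪ C))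
    (hMt : ∀ i, i ≠ m → i ≠ v → (Touch G M (B i) ↔ (maskGraph L').Adj m i))
    (hCt : ∀ i, i ≠ m → i ≠ v → Touch G C (B i) → (maskGraph L).Adj v i)
    (hadj : ∀ i j, i ≠ m → j ≠ m → ((maskGraph L').Adj i j ↔ (maskGraph L).Adj i j))
    (hadj' : (maskGraph L').Adj m v) (hσ : ∀ i, i ≠ m → σ'.testBit i = true → σ.testBit i = true)
    (hσm : σ'.testBit m = true → ∃ a, M = {a}) (hσv : σ'.testBit v = false) :
    PModel G L' σ' (Function.update (Function.update B m M) v (B v ∪ C)) := by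
  set B' := Function.update (Function.update B m M) v (B v ∪ C) with hB'
  have eqv : B' v = B v ∪ C := Function.update_self ..
  have eqm : B' m = M := by
    rw [hB', Function.update_of_ne hmv, Function.update_self]
  have eqi : ∀ i, i ≠ m → i ≠ v → B' i = B i := fun i h1 h2 => by
    rw [hB', Function.update_of_ne h2, Function.update_of_ne h1]
  have hvi : ∀ i, i ≠ m → i ≠ v → Disjoint (B v ∪ C) (B i) := fun i h1 h2 =>
    Set.disjoint_union_left.2 ⟨hB.disj v i h2.symm, (hB.disj m i h1.symm).mono_left hC⟩
  have hmi : ∀ i, i ≠ m → Disjoint M (B i) := fun i h1 => (hB.disj m i h1.symm).mono_left hM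
  have hmv' : Disjoint M (B v ∪ C) := Set.disjoint_union_right.2 ⟨hmi v hmv.symm, hMC⟩
  have htv : ∀ i, i ≠ m → i ≠ v → (Touch G (B v ∪ C) (B i) ↔ (maskGraph L').Adj v i) := by
    intro i h1 h2
    rw [hadj v i hmv.symm h1, touch_union_left, hB.touch v i h2.symm]
    exact ⟨fun h => h.elim id (hCt i h1 h2), Or.inl⟩
  refine ⟨fun i hi => ?_, fun i j hij => ?_, fun i j hij => ?_, fun i hi => ?_, fun i hi => ?_⟩
  · by_cases h1 : i = v
    · subst h1; rwa [eqv]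
    · by_cases h2 : i = m
      · subst h2; rwa [eqm]
      · rw [eqi i h2 h1]; exact hB.conn i (hL' ▸ hi)
  · by_cases h1 : i = v
    · subst h1
      by_cases h2 : j = m
      · subst h2; rw [eqv, eqm]; exact hmv'.symm
      · rw [eqv, eqi j h2 hij.symm]; exact hvi j h2 hij.symm
    · by_cases h2 : i = m
      · subst h2
        by_cases h3 : j = v
        · subst h3; rw [eqv, eqm]; exact hmv'
        · rw [eqm, eqi j hij.symm h3]; exact hmi j hij.symm
      · rw [eqi i h2 h1]
        by_cases h3 : j = v
        · subst h3; rw [eqv]; exact (hvi i h2 h1).symm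
        · by_cases h4 : j = m
          · subst h4; rw [eqm]; exact (hmi i h2).symm
          · rw [eqi j h4 h3]; exact hB.disj i j hij
  · by_cases h1 : i = v
    · subst h1
      by_cases h2 : j = m
      · subst h2; rw [eqv, eqm]; exact iff_of_true ht.symm hadj'.symm
      · rw [eqv, eqi j h2 hij.symm]; exact htv j h2 hij.symm
    · by_cases h2 : i = m
      · subst h2
        by_cases h3 : j = v
        · subst h3; rw [eqv, eqm]; exact iff_of_true ht hadj'
        · rw [eqm, eqi j hij.symm h3]; exact hMt j hij.symm h3
      · rw [eqi i h2 h1]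
        by_cases h3 : j = v
        · subst h3; rw [eqv, touch_comm, SimpleGraph.adj_comm]; exact htv i h2 h1
        · by_cases h4 : j = m
          · subst h4; rw [eqm, touch_comm, SimpleGraph.adj_comm]; exact hMt i h2 h1
          · rw [eqi j h4 h3, hadj i j h2 h4]; exact hB.touch i j hij
  · have h1 : i ≠ v := by rintro rfl; rw [hσv] at hi; exact Bool.noConfusion hi
    by_cases h2 : i = m
    · subst h2; rw [eqm]; exact hσm hi
    · rw [eqi i h2 h1]; exact hB.sing i (hσ i h2 hi)
  · rw [eqi i (by omega) (by omega)]
    exact hB.out i (by omega)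

/-- The freedom of all positions other than `m` not attached to `m` is the same in both models. -/
def SameFree (G : SimpleGraph V) (L : List ℕ) (v m : ℕ) (B B' : ℕ → Set V) : Prop :=
  ∀ m' a b, bit L m m' = false → m' ≠ m → a ≠ m → a ≠ v → b ≠ m → b ≠ v → m' < L.length →
    a < L.length → b < L.length → (Free G B' v m' a b ↔ Free G B v m' a b)

theorem testBit_or_two_pow_iff {σ n i : ℕ} :
    (σ ||| 2 ^ n).testBit i = true ↔ σ.testBit i = true ∨ i = n := by
  rw [Nat.testBit_or, Bool.or_eq_true, Nat.testBit_two_pow, decide_eq_true_eq, @eq_comm _ n]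

set_option maxHeartbeats 1000000 in
/-- If no part of the bag `m` leads from `v` to `a` avoiding `b`, then the bag of `m` can be made a
single vertex attached to `b`, which is attached either to `a` or to a new fat bag attached
to `a`. -/
theorem PModel.halfCollapse {L : List ℕ} {σ m a b v : ℕ} {B : ℕ → Set V} (hB : PModel G L σ B)
    (hJ : Joint L σ m a b v) (hF : ¬ Free G B v m a b) :
    ∃ B', SameFree G L v m B B' ∧ (PModel G L (σ ||| 2 ^ m) B' ∨
      Free G B v m b a ∧ PModel G (delEdge L m a) (σ ||| 2 ^ m) B' ∧ ∃ B'', (∀ i < L.length, B'' i = B' i) ∧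
        (PModel G (UniqueChord.addV (delEdge L m a) (2 ^ m ||| 2 ^ a)) (σ ||| 2 ^ m) B'' ∨
          PModel G (UniqueChord.addV (delEdge L m a) (2 ^ m ||| 2 ^ a ||| 2 ^ b)) (σ ||| 2 ^ m) B'')) := by
  obtain ⟨hma, hmb, hmv, hva, hvb, hml, hvl⟩ := hJ.facts
  have hbita := (hJ.bit_iff a).2 (by simp)
  have hbitb := (hJ.bit_iff b).2 (by simp)
  have hbitv := (hJ.bit_iff v).2 (by simp)
  have hal := (hJ.wf m a hbita).1
  have hbl := (hJ.wf m b hbitb).1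
  obtain ⟨pb, hpb⟩ := hB.sing b hJ.hb
  have hwf := wf_delEdge hJ.wf hbita
  have htm : ∀ {i}, i ≠ m → Touch G (B m) (B i) → i = a ∨ i = b ∨ i = v := by
    intro i hi h
    rw [← hJ.bit_iff, ← hJ.wf.adj_iff]
    exact (hB.touch m i hi.symm).1 h
  -- The obstacles on the way from the bag of `v` to `a` are the neighbours of the vertex `pb` at
  -- `b`. A way without obstacles would be freedom.
  rcases barrier (M := B m) (N := G.neighborSet pb) (hB.conn m hml) (hB.conn v hvl)
    ((hB.touch v m hmv.symm).2 (hJ.wf.adj_iff.2 (hJ.wf _ _ hbitv).2.1))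
    ((hB.touch a m hma.symm).2 (hJ.wf.adj_iff.2 (hJ.wf _ _ hbita).2.1)) with
    ⟨M, hM, hMc, hMv, hMa⟩ | ⟨z, ⟨hz, hzb⟩, C, hC, hvC, hCa, hzv, hCR, hE⟩
  · exfalso
    refine hF ⟨M, hM.trans Set.sdiff_subset, hMc, hMv, hMa, ?_⟩
    rw [hpb, touch_singleton_left]
    rintro ⟨x, hx, hxb⟩
    exact (hM hx).2 hxb
  · have hCm : C ⊆ B m := hC.trans Set.sdiff_subset
    have hzC : z ∉ C := fun h => (hC h).2 hzb
    have hCt : ∀ i, i ≠ m → i ≠ v → ¬ Touch G C (B i) := by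
      intro i h1 h2 h
      rcases htm h1 (h.mono hCm subset_rfl) with rfl | rfl | rfl
      · exact hCa h
      · rw [hpb, touch_comm, touch_singleton_left] at h
        obtain ⟨c, hc, hcb⟩ := h
        exact (hC hc).2 hcb
      · exact h2 rfl
    have hzbt : Touch G {z} (B b) := by
      rw [hpb, touch_singleton_singleton]; exact (show G.Adj pb z from hzb).symm
    have hσm : ∀ i, i ≠ m → (σ ||| 2 ^ m).testBit i = true → σ.testBit i = true := fun i h =>
      testBit_or_two_pow h
    have hσv : (σ ||| 2 ^ m).testBit v = false := by
      rw [← Bool.not_eq_true, testBit_or_two_pow_iff, hJ.fat']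
      simp [hmv.symm]
    -- The vertex `z` alone becomes the bag of `m`. The part `C` between `v` and `z` touches no
    -- other bag and moves to `v`; the part `E` between `z` and `a`, if needed, becomes a new
    -- position.
    set B' := Function.update (Function.update B m {z}) v (B v ∪ C) with hB'
    have eqv : B' v = B v ∪ C := Function.update_self ..
    have eqm : B' m = {z} := by rw [hB', Function.update_of_ne hmv, Function.update_self]
    have eqi : ∀ i, i ≠ m → i ≠ v → B' i = B i := fun i h1 h2 => by
      rw [hB', Function.update_of_ne h2, Function.update_of_ne h1]
    refine ⟨B', ?_, ?_⟩
    · intro m' a' b' hbit hm' ha1 ha2 hb1 hb2 hml' hal' hbl'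
      have hm'v : m' ≠ v := by rintro rfl; rw [hbitv] at hbit; exact Bool.noConfusion hbit
      have hCm' : ∀ M, M ⊆ B m' → ¬ Touch G C M := by
        intro M hM h
        have := hJ.wf.adj_iff.1 ((hB.touch m m' hm'.symm).1 (h.mono hCm hM))
        rw [hbit] at this
        exact Bool.noConfusion this
      simp only [Free, eqi m' hm' hm'v, eqi a' ha1 ha2, eqi b' hb1 hb2, eqv, touch_union_left]
      refine exists_congr fun M => and_congr_right fun hM => and_congr_right fun _ => ?_
      have := hCm' M hM
      tauto
    · rcases hE with hE | ⟨hnE, E, hEm, hzE, hEc, hzEt, hEa, hCE, hEv⟩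
      · left
        refine hB.move hmv hml hvl rfl (by simpa using hz) hCm (by simpa using hzC)
          (connSet_singleton z) hvC hzv (fun i h1 h2 => ?_)
          (fun i h1 h2 h => absurd h (hCt i h1 h2)) (fun _ _ _ _ => Iff.rfl)
          (hJ.wf.adj_iff.2 hbitv) hσm (fun _ => ⟨z, rfl⟩) hσv
        rw [hJ.wf.adj_iff, hJ.bit_iff]
        refine ⟨fun h => htm h1 (h.mono (by simpa using hz) subset_rfl), ?_⟩
        rintro (rfl | rfl | rfl)
        · exact hE.symm.symm
        · exact hzbt
        · exact absurd rfl h2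
      · right
        have hmod : PModel G (delEdge L m a) (σ ||| 2 ^ m) B' := by
          refine hB.move hmv hml hvl (length_delEdge _ _ _) (by simpa using hz) hCm
            (by simpa using hzC) (connSet_singleton z) hvC hzv (fun i h1 h2 => ?_)
            (fun i h1 h2 h => absurd h (hCt i h1 h2)) (fun i j h1 h2 => ?_)
            (hwf.adj_iff.2 ((bit_delEdge hJ.wf hbita).2 ⟨hbitv, by tauto, by tauto⟩)) hσm
            (fun _ => ⟨z, rfl⟩) hσv
          · rw [hwf.adj_iff, bit_delEdge hJ.wf hbita, hJ.bit_iff]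
            constructor
            · intro h
              refine ⟨htm h1 (h.mono (by simpa using hz) subset_rfl), ?_, fun h => h1 h.2⟩
              rintro ⟨_, rfl⟩
              exact hnE h
            · rintro ⟨rfl | rfl | rfl, h3, _⟩
              · exact absurd ⟨rfl, rfl⟩ h3
              · exact hzbt
              · exact absurd rfl h2
          · rw [hwf.adj_iff, hJ.wf.adj_iff, bit_delEdge hJ.wf hbita]
            tauto
        refine ⟨?_, hmod, Function.update B' L.length E, fun i hi => Function.update_of_ne (by omega) _ _,
          ?_⟩
        -- The vertex `z` with a way back to `v` inside `C` reaches `b` without touching `a`, which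
        -- is the opposite freedom.
        · obtain ⟨y, hy, hzy⟩ := touch_singleton_left.1 hzv
          rcases hy with hy | hy
          · exact ⟨{z}, by simpa using hz, connSet_singleton z, ⟨y, hy, z, rfl, hzy.symm⟩,
              hzbt.symm, fun h => hnE h.symm⟩
          · obtain ⟨R, hR, hRc, hvR, hyR⟩ := hCR y hy
            refine ⟨insert z R, Set.insert_subset hz (hR.trans hCm), hRc.insert ⟨y, hyR, hzy⟩,
              hvR.mono subset_rfl (Set.subset_insert _ _),
              hzbt.symm.mono subset_rfl (by simp), fun h => ?_⟩
            rw [touch_comm, ← Set.singleton_union, touch_union_left] at h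
            exact h.elim hnE fun h => hCa (h.mono hR subset_rfl)
        have hadd := hmod.addV (σ' := σ ||| 2 ^ m) hwf hEc (fun i => ?_) (fun _ _ h => h)
          (fun h => absurd (hmod.lt_length h) (by omega))
        · rw [length_delEdge] at hadd
          have hmask : ∀ i, (touchMask G B' L.length E).testBit i = true ↔
              i = m ∨ i = a ∨ i = b ∧ Touch G E (B b) := by
            intro i
            rw [testBit_touchMask]
            by_cases h1 : i = m
            · subst h1; rw [eqm]; simp [hml, hzEt.symm]
            by_cases h2 : i = v
            · subst h2; rw [eqv]
              simp [hmv.symm, hva, hvb, hEv]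
            rw [eqi i h1 h2]
            constructor
            · rintro ⟨_, h⟩
              rcases htm h1 (h.mono hEm subset_rfl) with rfl | rfl | rfl
              · tauto
              · tauto
              · exact absurd rfl h2
            · rintro (h | rfl | ⟨rfl, h⟩)
              · exact absurd h h1
              · exact ⟨hal, hEa⟩
              · exact ⟨hbl, h⟩
          -- The new bag sees `z` and `a`; whether it also sees `b` separates the last two
          -- alternatives.
          by_cases hEb : Touch G E (B b)
          · right
            rwa [show touchMask G B' L.length E = 2 ^ m ||| 2 ^ a ||| 2 ^ b from
              eq_of_testBit_iff fun i => by
                rw [hmask, testBit_or_two_pow_iff, testBit_or_two_pow_iff, Nat.testBit_two_pow,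
                  decide_eq_true_eq, @eq_comm _ m, and_iff_left hEb, or_assoc]] at hadd
          · left
            rwa [show touchMask G B' L.length E = 2 ^ m ||| 2 ^ a from
              eq_of_testBit_iff fun i => by
                rw [hmask, testBit_or_two_pow_iff, Nat.testBit_two_pow, decide_eq_true_eq,
                  @eq_comm _ m, and_iff_right_of_imp (fun h => absurd h hEb)]
                simp [hEb]] at hadd
        · by_cases h1 : i = m
          · subst h1; rw [eqm]; simpa using hzE
          by_cases h2 : i = v
          · subst h2; rw [eqv, Set.disjoint_union_right]
            exact ⟨(hB.disj m i hmv).mono_left hEm, hCE.symm⟩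
          · rw [eqi i h1 h2]
            exact (hB.disj m i (Ne.symm h1)).mono_left hEm

/-- If no part of the bag `m` leads from `v` to only one of `a` and `b`, then the bag of `m` can be
made a single vertex. -/
theorem PModel.collapse {L : List ℕ} {σ m a b v : ℕ} {B : ℕ → Set V} (hB : PModel G L σ B)
    (hJ : Joint L σ m a b v) (hF : ¬ Free G B v m a b) (hF' : ¬ Free G B v m b a) :
    ∃ B', SameFree G L v m B B' ∧ PModel G L (σ ||| 2 ^ m) B' := by
  obtain ⟨B', h, h' | h'⟩ := hB.halfCollapse hJ hF
  · exact ⟨B', h, h'⟩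
  · exact absurd h'.1 hF'

end Surgery

/-! ### Renaming positions -/

section Relabel

variable {V : Type*} {G : SimpleGraph V}

/-- The pattern `L'` is the pattern `L` with position `i` renamed from `p i`. -/
def relabelCheck (L L' : List ℕ) (σ σ' : ℕ) (p : List ℕ) : Bool :=
  L'.length == L.length && decide (σ' < 2 ^ L.length) && p.length == L.length && wfCheck L && wfCheck L' &&
  (List.range L.length).all fun i => force (p.getD i i) fun pi => decide (pi < L.length) &&
    (!σ'.testBit i || σ.testBit pi) && (List.range i).all fun j => force (p.getD j j) fun pj =>
      pi != pj && bit L' i j == bit L pi pj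

theorem PModel.relabel {L L' : List ℕ} {σ σ' : ℕ} {B : ℕ → Set V} (hB : PModel G L σ B)
    {p : List ℕ} (h : relabelCheck L L' σ σ' p = true) :
    PModel G L' σ' (fun i => B (p.getD i i)) := by
  simp only [relabelCheck, force_eq, Bool.and_eq_true, beq_iff_eq, List.all_eq_true,
    List.mem_range, decide_eq_true_eq, bne_iff_ne] at h
  obtain ⟨⟨⟨⟨⟨hlen, hσ'⟩, hplen⟩, hwf⟩, hwf'⟩, hall⟩ := h
  have hwf := wf_of_wfCheck hwf
  have hwf' := wf_of_wfCheck hwf'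
  have hge : ∀ i, L.length ≤ i → p.getD i i = i := fun i hi =>
    List.getD_eq_default _ _ (by omega)
  have hlt : ∀ i, i < L.length → p.getD i i < L.length := fun i hi => (hall i hi).1.1
  have hinj : ∀ i j, i ≠ j → p.getD i i ≠ p.getD j j := by
    have key : ∀ i j, j < i → p.getD i i ≠ p.getD j j := by
      intro i j hij
      by_cases hi : i < L.length
      · exact ((hall i hi).2 j hij).1
      · rw [hge i (by omega)]
        by_cases hj : j < L.length
        · have := hlt j hj; omega
        · rw [hge j (by omega)]; omega
    intro i j hij
    rcases lt_or_gt_of_ne hij with h | h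
    · exact (key j i h).symm
    · exact key i j h
  have hbit : ∀ i j, i ≠ j → bit L' i j = bit L (p.getD i i) (p.getD j j) := by
    have key : ∀ i j, j < i → bit L' i j = bit L (p.getD i i) (p.getD j j) := by
      intro i j hij
      by_cases hi : i < L.length
      · exact ((hall i hi).2 j hij).2
      · rw [hge i (by omega), Bool.eq_iff_iff]
        refine iff_of_false (fun h => ?_) (fun h => ?_) <;>
        · have := bit_lt_left h
          omega
    intro i j hij
    rcases lt_or_gt_of_ne hij with h | h
    · rw [hwf'.bit_comm, hwf.bit_comm]; exact key j i h
    · exact key i j h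
  refine ⟨fun i hi => hB.conn _ (hlt i (hlen ▸ hi)), fun i j hij => hB.disj _ _ (hinj i j hij),
    fun i j hij => ?_, fun i hi => ?_, fun i hi => ?_⟩
  · rw [hB.touch _ _ (hinj i j hij), hwf.adj_iff, hwf'.adj_iff, hbit i j hij]
  · have := (hall i (lt_of_testBit_of_lt hσ' hi)).1.2
    rw [hi] at this
    exact hB.sing _ (by simpa using this)
  · rw [hge i (by omega)]
    exact hB.out i (by omega)

end Relabel

/-! ### Turning an enlarged bag back into one vertex -/

section Tripod

variable {V : Type*} {G : SimpleGraph V}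

/-- Replace the row and the column `v` by `S`. -/
def setRow (L : List ℕ) (v S : ℕ) : List ℕ :=
  mkMask L.length fun i j => bif Nat.beq i v then S.testBit j else
    bif Nat.beq j v then S.testBit i else bit L i j

/-- Verification that a bag attached to the positions in `full` can be made a singleton. -/
def singleCheck (L : List ℕ) (σ v full : ℕ) (certs : List (ℕ × ℕ × ℕ × ℕ)) : Bool :=
  wfCheck L && decide (v < L.length) && !σ.testBit v && L.getD v 0 == full &&
  allMasks (fun S => S ||| full != full || S == full) (fun S₁ => force S₁ fun S₁ =>
    forceList (setRow L v S₁) fun L₁ =>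
    allMasks (fun S => S ||| full != full || S == full) (fun S₂ => force S₂ fun S₂ =>
      S₁ ||| S₂ != full || forceList (addV L₁ (S₂ ||| 2 ^ v)) fun L₂ =>
        hasTheta (σ ||| 2 ^ v) L₂ certs) L.length 0) L.length 0

theorem or_eq_right_iff {a b : ℕ} :
    a ||| b = b ↔ ∀ i, a.testBit i = true → b.testBit i = true := by
  constructor
  · intro h i hi
    rw [← h, Nat.testBit_or, hi, Bool.true_or]
  · intro h
    refine eq_of_testBit_iff fun i => ?_
    rw [Nat.testBit_or, Bool.or_eq_true]
    exact ⟨fun h' => h'.elim (h i) id, Or.inr⟩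

/-- A smallest connected part of the bag with all its attachments is one vertex. Otherwise it splits
into a vertex and a connected rest, each lacking some attachment; used as two adjacent positions in
place of the bag, they yield a theta for every distribution of the attachments. -/
theorem PModel.single [Finite V] (hG : NoTheta G) {L : List ℕ} {σ v full : ℕ} {B : ℕ → Set V}
    (hB : PModel G L σ B) {certs : List (ℕ × ℕ × ℕ × ℕ)}
    (h : singleCheck L σ v full certs = true) : ∃ B', PModel G L (σ ||| 2 ^ v) B' := by
  simp only [singleCheck, force_eq, forceList_eq, Bool.and_eq_true, Bool.not_eq_true', beq_iff_eq,
    decide_eq_true_eq] at h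
  obtain ⟨⟨⟨⟨hwf, hv⟩, hσ⟩, hfull⟩, hall⟩ := h
  have hwf := wf_of_wfCheck hwf
  have hbit : ∀ i, bit L v i = full.testBit i := fun i => by rw [bit, hfull]
  have hprune : ∀ S T : ℕ, (∀ i, S.testBit i = true → T.testBit i = true) →
      (S ||| full != full || S == full) = true → (T ||| full != full || T == full) = true := by
    intro S T hST
    simp only [Bool.or_eq_true, bne_iff_ne, beq_iff_eq]
    rintro (h | rfl)
    · exact Or.inl fun h' => h (or_eq_right_iff.2 fun i hi => or_eq_right_iff.1 h' i (hST i hi))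
    · by_cases hT : T = S
      · exact Or.inr hT
      · refine Or.inl fun h' => hT (eq_of_testBit_iff fun i => ?_)
        exact ⟨or_eq_right_iff.1 h' i, hST i⟩
  have hvv : full.testBit v = false := by
    rw [← hbit, ← Bool.not_eq_true]
    exact fun h => (hwf v v h).2.2 rfl
  -- Attachments are recorded with the bag of `v` emptied, so that a part of this bag does not count
  -- edges to its own bag.
  set T : Set V → ℕ := touchMask G (Function.update B v ∅) L.length with hT
  have hTX : ∀ X i, (T X).testBit i = true ↔ i < L.length ∧ i ≠ v ∧ Touch G X (B i) := by
    intro X i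
    rw [hT, testBit_touchMask]
    by_cases hi : i = v
    · subst hi
      rw [Function.update_self]
      simp [not_touch_empty_right]
    · rw [Function.update_of_ne hi]
      simp [hi]
  have hTadj : ∀ i, full.testBit i = true ↔ i < L.length ∧ i ≠ v ∧ Touch G (B v) (B i) := by
    intro i
    constructor
    · intro h
      rw [← hbit] at h
      exact ⟨(hwf v i h).1, (hwf v i h).2.2.symm,
        (hB.touch v i (hwf v i h).2.2).2 (hwf.adj_iff.2 h)⟩
    · rintro ⟨_, hi, ht⟩
      rw [← hbit, ← hwf.adj_iff]
      exact (hB.touch v i hi.symm).1 ht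
  have hTsub : ∀ X ⊆ B v, T X ||| full = full := by
    intro X hX
    rw [or_eq_right_iff]
    intro i hi
    obtain ⟨h1, h2, h3⟩ := (hTX X i).1 hi
    exact (hTadj i).2 ⟨h1, h2, h3.mono hX subset_rfl⟩
  obtain ⟨M, ⟨hMv, hMc, hMT⟩, hmin⟩ : ∃ M : Set V, (M ⊆ B v ∧ ConnSet G M ∧ T M = full) ∧
      ∀ M' : Set V, (M' ⊆ B v ∧ ConnSet G M' ∧ T M' = full) → M.ncard ≤ M'.ncard := by
    classical
    have : ∃ k, ∃ M : Set V, (M ⊆ B v ∧ ConnSet G M ∧ T M = full) ∧ M.ncard = k :=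
      ⟨_, B v, ⟨subset_rfl, hB.conn v hv, eq_of_testBit_iff fun i => by rw [hTX, hTadj]⟩, rfl⟩
    obtain ⟨M, hM, h⟩ := Nat.find_spec this
    exact ⟨M, hM, fun M' hM' => h ▸ Nat.find_min' this ⟨M', hM', rfl⟩⟩
  by_cases hs : M.Subsingleton
  · obtain ⟨a, ha⟩ := hMc.1
    refine ⟨_, hB.update (M := M) le_rfl hv hMc (fun i h1 h2 => by omega)
      (fun _ _ _ _ => Iff.rfl) (fun i hi => (hB.disj v i hi.symm).mono_left hMv)
      (fun i hi hil => ?_) (fun i hi => ?_) (fun i hi h => testBit_or_two_pow hi h)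
      (fun _ => ⟨a, hs.eq_singleton_of_mem ha⟩)⟩
    · rw [hwf.adj_iff, hbit, ← hMT, hTX]
      tauto
    · rw [hwf.adj_iff]
      intro h
      have := (hwf v i h).1
      omega
  · exfalso
    rw [Set.not_subsingleton_iff] at hs
    obtain ⟨u, hu, hMu⟩ := hMc.exists_diff_singleton (Set.toFinite _) hs
    have huv : {u} ⊆ B v := by simpa using hMv hu
    have hMuv : M \ {u} ⊆ B v := Set.sdiff_subset.trans hMv
    have h2M : 1 < M.ncard := Set.one_lt_ncard_iff_nontrivial.2 hs
    have h1 : T {u} ≠ full := fun h => by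
      have := hmin {u} ⟨huv, connSet_singleton u, h⟩
      rw [Set.ncard_singleton] at this
      omega
    have h2 : T (M \ {u}) ≠ full := fun h => by
      have := hmin _ ⟨hMuv, hMu, h⟩
      have := Set.ncard_sdiff_singleton_lt_of_mem hu (Set.toFinite _)
      omega
    have hMeq : M = {u} ∪ M \ {u} := by rw [Set.union_sdiff_cancel]; simpa using hu
    have hTu : T {u} ||| T (M \ {u}) = full := by
      rw [hT, ← touchMask_union, ← hMeq, ← hT, hMT]
    have hlt : ∀ X, T X < 2 ^ L.length := fun X => touchMask_lt
    have hall := allMasks_spec (T := T {u}) hprune hall (hlt _)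
    rw [Nat.zero_or, hTsub _ huv, Bool.or_eq_true, bne_self_eq_false, Bool.false_eq_true, false_or,
      beq_iff_eq] at hall
    have hall := allMasks_spec (T := T (M \ {u})) hprune (hall.resolve_left h1) (hlt _)
    rw [Nat.zero_or, hTsub _ hMuv, Bool.or_eq_true, bne_self_eq_false, Bool.false_eq_true,
      false_or, beq_iff_eq] at hall
    have hall := hall.resolve_left h2
    rw [hTu, bne_self_eq_false, Bool.false_or] at hall
    have hTv : ∀ X, (T X).testBit v = false := by
      intro X
      rw [← Bool.not_eq_true, hTX]
      simp
    have hsetbit : ∀ S, S.testBit v = false → ∀ i j, bit (setRow L v S) i j = true ↔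
        i < L.length ∧ j < L.length ∧ (i = v ∧ S.testBit j = true ∨
          j = v ∧ S.testBit i = true ∨ i ≠ v ∧ j ≠ v ∧ bit L i j = true) := by
      intro S hS i j
      rw [setRow, bit_mkMask]
      by_cases hi : i = v <;> by_cases hj : j = v
      · subst hi; subst hj; simp [hS]
      · subst hi; simp [hj]
      · subst hj; simp [hi]
      · have e1 : Nat.beq i v = false := by
          rw [← Bool.not_eq_true]; exact fun h => hi (Nat.eq_of_beq_eq_true h)
        have e2 : Nat.beq j v = false := by
          rw [← Bool.not_eq_true]; exact fun h => hj (Nat.eq_of_beq_eq_true h)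
        simp [e1, e2, hi, hj]
    have hlen : (setRow L v (T {u})).length = L.length := length_mkMask _ _
    have hbitu := hsetbit (T {u}) (hTv _)
    have hwf₁ : WF (setRow L v (T {u})) := by
      intro i j h
      rw [hbitu] at h ⊢
      refine ⟨by omega, by rw [hwf.bit_comm j i]; tauto, ?_⟩
      rintro rfl
      rcases h with ⟨_, _, ⟨rfl, h⟩ | ⟨rfl, h⟩ | ⟨_, _, h⟩⟩
      · rw [hTv] at h; exact Bool.noConfusion h
      · rw [hTv] at h; exact Bool.noConfusion h
      · exact (hwf i i h).2.2 rfl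
    have hB₁ : PModel G (setRow L v (T {u})) (σ ||| 2 ^ v) (Function.update B v {u}) := by
      refine hB.update (by rw [hlen]) (by rwa [hlen]) (connSet_singleton u)
        (fun i h1 h2 => by omega) (fun i j hi hj => ?_)
        (fun i hi => (hB.disj v i hi.symm).mono_left huv) (fun i hi hil => ?_) (fun i hi => ?_)
        (fun i hi h => testBit_or_two_pow hi h) (fun _ => ⟨u, rfl⟩)
      · rw [hwf₁.adj_iff, hwf.adj_iff, hbitu]
        have : bit L i j = true → i < L.length ∧ j < L.length := fun h =>
          ⟨bit_lt_left h, (hwf i j h).1⟩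
        tauto
      · rw [hwf₁.adj_iff, hbitu, hTX]
        tauto
      · rw [hwf₁.adj_iff, hbitu]
        omega
    have hB₂ := hB₁.addV (σ' := σ ||| 2 ^ v) hwf₁ hMu (fun i => ?_) (fun _ _ h => h) (fun h => ?_)
    · have hmask : touchMask G (Function.update B v {u}) (setRow L v (T {u})).length (M \ {u}) =
          T (M \ {u}) ||| 2 ^ v := by
        refine eq_of_testBit_iff fun i => ?_
        rw [testBit_touchMask, testBit_or_two_pow_iff, hTX, hlen]
        by_cases hi : i = v
        · subst hi
          rw [Function.update_self]
          exact iff_of_true ⟨hv, (hMc.touch_diff (T := {u}) (by simpa using hu) ⟨u, rfl⟩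
            hMu.1).symm⟩ (Or.inr rfl)
        · rw [Function.update_of_ne hi]
          tauto
      rw [hmask] at hB₂
      exact hB₂.not_hasTheta hG hall
    · by_cases hi : i = v
      · subst hi; rw [Function.update_self]; exact Set.disjoint_sdiff_left
      · rw [Function.update_of_ne hi]; exact (hB.disj v i (Ne.symm hi)).mono_left hMuv
    · rw [hlen] at h
      exact absurd (hB₁.lt_length h) (by rw [hlen]; omega)

end Tripod

/-! ### Embedding a covering model in its target -/

section Targets

instance : DecidableRel petersen.Adj
  | .inl i, .inl j => inferInstanceAs (Decidable (j = i + 1 ∨ i = j + 1))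
  | .inr i, .inr j => inferInstanceAs (Decidable (j = i + 1 ∨ i = j + 1))
  | .inl i, .inr j => inferInstanceAs (Decidable ((i, j) ∈
      [((0 : Fin 5), (0 : Fin 5)), (1, 3), (2, 1), (3, 4), (4, 2)]))
  | .inr j, .inl i => inferInstanceAs (Decidable ((i, j) ∈
      [((0 : Fin 5), (0 : Fin 5)), (1, 3), (2, 1), (3, 4), (4, 2)]))

instance : DecidableRel heawood.Adj := fun i j =>
  inferInstanceAs (Decidable ((j = i + 1 ∨ i = j + 1) ∨
    ((i, j) ∈ [((0 : Fin 14), (9 : Fin 14)), (1, 6), (2, 11), (3, 8), (4, 13), (5, 10), (7, 12)] ∨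
      (j, i) ∈ [((0 : Fin 14), (9 : Fin 14)), (1, 6), (2, 11), (3, 8), (4, 13), (5, 10), (7, 12)])))

variable {V W : Type*} {G : SimpleGraph V} {H : SimpleGraph W}

/-- Covering one-vertex bags identify the vertices of `G` with distinct positions, and contact of
bags is then adjacency in `G`. -/
theorem PModel.isIndContained {L : List ℕ} {σ : ℕ} {B : ℕ → Set V} (hB : PModel G L σ B)
    (hwf : WF L) (hcov : ∀ x, ∃ i < L.length, x ∈ B i) (hsing : ∀ i < L.length, ∃ a, B i = {a})
    (τ : ℕ → W) (h : ∀ i < L.length, ∀ j < i, τ i ≠ τ j ∧ (H.Adj (τ i) (τ j) ↔ bit L i j = true)) :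
    G ⊴ H := by
  choose f hf hxf using hcov
  have hne : ∀ x y, x ≠ y → f x ≠ f y := by
    intro x y hxy h'
    obtain ⟨a, ha⟩ := hsing _ (hf x)
    have h1 := hxf x
    have h2 := hxf y
    rw [← h', ha] at h2
    rw [ha] at h1
    exact hxy (h1.trans h2.symm)
  have hBf : ∀ x, B (f x) = {x} := by
    intro x
    obtain ⟨a, ha⟩ := hsing _ (hf x)
    have h1 := hxf x
    rw [ha] at h1 ⊢
    rw [Set.mem_singleton_iff.1 h1]
  have key : ∀ i < L.length, ∀ j < L.length, i ≠ j →
      τ i ≠ τ j ∧ (H.Adj (τ i) (τ j) ↔ bit L i j = true) := by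
    intro i hi j hj hij
    rcases lt_or_gt_of_ne hij with h' | h'
    · obtain ⟨h1, h2⟩ := h j hj i h'
      exact ⟨h1.symm, by rw [H.adj_comm, h2, hwf.bit_comm]⟩
    · exact h i hi j h'
  refine ⟨⟨⟨fun x => τ (f x), fun x y hxy => ?_⟩, fun {x y} => ?_⟩⟩
  · by_contra hcon
    exact (key _ (hf x) _ (hf y) (hne x y hcon)).1 hxy
  · change H.Adj (τ (f x)) (τ (f y)) ↔ G.Adj x y
    by_cases hxy : x = y
    · subst hxy; simp
    · rw [(key _ (hf x) _ (hf y) (hne x y hxy)).2, ← hwf.adj_iff, ← hB.touch _ _ (hne x y hxy), hBf,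
        hBf, touch_singleton_singleton]

/-- The vertices of the Petersen graph in numerical order. -/
def petersenVertex (i : ℕ) : Fin 5 ⊕ Fin 5 :=
  if i < 5 then .inl (Fin.ofNat 5 i) else .inr (Fin.ofNat 5 i)

/-- A test for an embedding of a pattern. -/
def embedCheck [DecidableEq W] (H : SimpleGraph W) [DecidableRel H.Adj] (L : List ℕ)
    (τ : ℕ → W) : Bool :=
  (List.range L.length).all fun i => (List.range i).all fun j =>
    decide (τ i ≠ τ j) && decide (H.Adj (τ i) (τ j)) == bit L i j

theorem PModel.isIndContained_of_embedCheck [DecidableEq W] [DecidableRel H.Adj] {L : List ℕ}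
    {σ : ℕ} {B : ℕ → Set V} (hB : PModel G L σ B) (hwf : WF L)
    (hcov : ∀ x, ∃ i < L.length, x ∈ B i) (hsing : ∀ i < L.length, ∃ a, B i = {a}) (τ : ℕ → W)
    (h : embedCheck H L τ = true) : G ⊴ H := by
  refine hB.isIndContained hwf hcov hsing τ fun i hi j hj => ?_
  simp only [embedCheck, List.all_eq_true, List.mem_range, Bool.and_eq_true, decide_eq_true_eq,
    beq_iff_eq] at h
  obtain ⟨h1, h2⟩ := h i hi j hj
  exact ⟨h1, by rw [← h2, decide_eq_true_eq]⟩

end Targets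

/-! ### From two crossing chords to the Petersen or Heawood graph -/

section Growth

variable {V : Type*} {G : SimpleGraph V}

theorem PModel.weaken_of_or {L : List ℕ} {σ σ' : ℕ} {B : ℕ → Set V} (hB : PModel G L σ B)
    (h : σ' ||| σ = σ) : PModel G L σ' B :=
  hB.weaken (or_eq_right_iff.1 h)

/-- Freedom would delete an edge of the pattern, and the resulting pattern contains a theta. -/
theorem PModel.not_free {L : List ℕ} {σ m a b v : ℕ} {B : ℕ → Set V} (hB : PModel G L σ B)
    (hG : NoTheta G) (hJ : jointCheck L σ m a b v = true) {certs : List (ℕ × ℕ × ℕ × ℕ)}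
    (h : hasTheta σ (delEdge L m b) certs = true) : ¬ Free G B v m a b := by
  intro hF
  obtain ⟨B', hB', _⟩ := hB.of_free (joint_of_jointCheck hJ) hF
  exact hB'.not_hasTheta hG h

/-- Freedoms in different bags can be realised at the same time. Two of them are incompatible when
the pattern without both edges contains a theta. -/
theorem PModel.not_free_of_free {L : List ℕ} {σ m a b v m' a' b' : ℕ} {B : ℕ → Set V}
    (hB : PModel G L σ B) (hG : NoTheta G) (hJ : jointCheck L σ m a b v = true)
    (hF : Free G B v m a b) (hne : v ≠ m ∧ m' ≠ m ∧ a' ≠ m ∧ b' ≠ m)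
    (hJ' : jointCheck (delEdge L m b) σ m' a' b' v = true) {certs : List (ℕ × ℕ × ℕ × ℕ)}
    (h : hasTheta σ (delEdge (delEdge L m b) m' b') certs = true) : ¬ Free G B v m' a' b' := by
  intro hF'
  obtain ⟨B', hB', heq⟩ := hB.of_free (joint_of_jointCheck hJ) hF
  refine hB'.not_free hG hJ' h ?_
  obtain ⟨h1, h2, h3, h4⟩ := hne
  rwa [Free, heq _ h1, heq _ h2, heq _ h3, heq _ h4]

/-- Both possible freedoms are excluded by thetas, so the bag becomes one vertex. -/
theorem PModel.collapse_of_hasTheta {L : List ℕ} {σ : ℕ} {B : ℕ → Set V} (hB : PModel G L σ B)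
    (hG : NoTheta G) (m a b v : ℕ) (certs : List (ℕ × ℕ × ℕ × ℕ))
    (h : (jointCheck L σ m a b v && (hasTheta σ (delEdge L m b) certs &&
      hasTheta σ (delEdge L m a) certs)) = true) : ∃ B', PModel G L (σ ||| 2 ^ m) B' := by
  simp only [Bool.and_eq_true] at h
  obtain ⟨hJ, h₁, h₂⟩ := h
  have hJ' := joint_of_jointCheck hJ
  obtain ⟨B', _, h⟩ := hB.collapse hJ' (hB.not_free hG hJ h₁)
    (fun h => by obtain ⟨B', hB', _⟩ := hB.of_free hJ'.symm h; exact hB'.not_hasTheta hG h₂)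
  exact ⟨B', h⟩

/-- A consequence of `PModel.halfCollapse` when all but one of the outcomes are excluded. -/
theorem PModel.split {L : List ℕ} {σ m a b v : ℕ} {B : ℕ → Set V} (hB : PModel G L σ B)
    (hG : NoTheta G) (hJ : jointCheck L σ m a b v = true) (hF : ¬ Free G B v m a b)
    (h₁ : ∀ B', SameFree G L v m B B' → ¬ PModel G L (σ ||| 2 ^ m) B')
    {certs : List (ℕ × ℕ × ℕ × ℕ)} (h₂ : hasTheta (σ ||| 2 ^ m)
      (UniqueChord.addV (delEdge L m a) (2 ^ m ||| 2 ^ a ||| 2 ^ b)) certs = true) :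
    ∃ B', SameFree G L v m B B' ∧
      PModel G (UniqueChord.addV (delEdge L m a) (2 ^ m ||| 2 ^ a)) (σ ||| 2 ^ m) B' := by
  have hJ := joint_of_jointCheck hJ
  obtain ⟨B', hS, h | ⟨_, _, B'', heq, h | h⟩⟩ := hB.halfCollapse hJ hF
  · exact absurd h (h₁ B' hS)
  · refine ⟨B'', fun m' a' b' h1 h2 h3 h4 h5 h6 h7 h8 h9 => ?_, h⟩
    rw [← hS m' a' b' h1 h2 h3 h4 h5 h6 h7 h8 h9]
    simp only [Free, heq _ h7, heq _ h8, heq _ h9, heq _ hJ.facts.2.2.2.2.2.2]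
  · exact absurd h₂ (h.not_hasTheta hG)

variable [Finite V]

theorem isIndContained_of_pattern14 (hG : Rigid G) {B : ℕ → Set V}
    (hB : PModel G pattern14 16383 B) : G ⊴ heawood := by
  have hp := patternShape_of_shapeCheck shapeCheck_pattern14
  rcases hB.growth hG hp stepCheck_pattern14 with ⟨B', h1, h2, h3⟩ | ⟨S, hS, _⟩
  · exact h1.isIndContained_of_embedCheck hp.wf h2 h3
      (fun i => Fin.ofNat 14 ([0, 3, 1, 4, 8, 2, 6, 13, 7, 9, 5, 10, 12, 11].getD i 0))
      (by decide +kernel)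
  · simp [stepData14] at hS

/-- The added vertex first serves as a fat bag, which receives what is cut from the bags 5, 11 and
12 while these collapse. It is then reduced to one vertex, and the whole Heawood graph is reached.
-/
theorem isIndContained_of_pattern13 (hG : Rigid G) {B : ℕ → Set V}
    (hB : PModel G pattern13 2015 B) : G ⊴ heawood := by
  have hp := patternShape_of_shapeCheck shapeCheck_pattern13
  rcases hB.growth hG hp stepCheck_pattern13 with ⟨B', h1, h2, h3⟩ | ⟨S, hS, B₁, h₁⟩
  · exact h1.isIndContained_of_embedCheck hp.wf h2 h3
      (fun i => Fin.ofNat 14 ([0, 3, 1, 4, 8, 2, 6, 13, 7, 9, 5, 10, 12].getD i 0))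
      (by decide +kernel)
  · rw [show stepData13.core = [6176] from rfl, List.mem_singleton] at hS
    subst hS
    rw [show addV pattern13 6176 = pattern14 by decide +kernel] at h₁
    obtain ⟨B₂, h₂⟩ := (h₁.weaken_of_or (σ' := 2015) (by decide +kernel)).collapse_of_hasTheta
      hG.noTheta 5 1 2 13 [(7, 3, 12322, 1093), (7, 0, 12324, 538)] (by decide +kernel)
    obtain ⟨B₃, h₃⟩ := h₂.collapse_of_hasTheta hG.noTheta 11 9 10 13
      [(2, 0, 1224, 10784), (3, 1, 11296, 657)] (by decide +kernel)
    obtain ⟨B₄, h₄⟩ := h₃.collapse_of_hasTheta hG.noTheta 12 7 8 13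
      [(2, 0, 848, 12448), (4, 1, 649, 12576)] (by decide +kernel)
    obtain ⟨B₅, h₅⟩ := h₄.single hG.noTheta (v := 13) (full := 6176)
      (certs := [(9, 4, 22784, 39), (7, 3, 20514, 3585), (3, 1, 19488, 4496), (3, 1, 11296, 4496),
        (7, 3, 12322, 3585), (8, 6, 15360, 54)]) (by decide +kernel)
    exact isIndContained_of_pattern14 hG (h₅.weaken_of_or (by decide +kernel))

/-- The two core attachments are exchanged by a symmetry of the pattern. Once the bags 7 and 8 have
collapsed, the added position has two attachments and remains fat. -/
theorem isIndContained_of_pattern12 (hG : Rigid G) {B : ℕ → Set V}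
    (hB : PModel G pattern12 1631 B) : G ⊴ heawood := by
  have hp := patternShape_of_shapeCheck shapeCheck_pattern12
  have key : ∀ B, PModel G pattern13 1631 B → G ⊴ heawood := by
    intro B h₁
    obtain ⟨B₂, h₂⟩ := h₁.collapse_of_hasTheta hG.noTheta 7 0 3 12
      [(6, 2, 1066, 4481), (4, 1, 549, 4488)] (by decide +kernel)
    obtain ⟨B₃, h₃⟩ := h₂.collapse_of_hasTheta hG.noTheta 8 4 6 12
      [(3, 1, 1124, 4496), (2, 0, 4544, 562)] (by decide +kernel)
    exact isIndContained_of_pattern13 hG (h₃.weaken_of_or (by decide +kernel))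
  rcases hB.growth hG hp stepCheck_pattern12 with ⟨B', h1, h2, h3⟩ | ⟨S, hS, B₁, h₁⟩
  · exact h1.isIndContained_of_embedCheck hp.wf h2 h3
      (fun i => Fin.ofNat 14 ([0, 3, 1, 4, 8, 2, 6, 13, 7, 9, 5, 10].getD i 0))
      (by decide +kernel)
  · rw [show stepData12.core = [384, 2080] from rfl, List.mem_pair] at hS
    rcases hS with rfl | rfl
    · rw [show addV pattern12 384 = pattern13 by decide +kernel] at h₁
      exact key _ (h₁.weaken_of_or (by decide +kernel))
    · exact key _ (h₁.relabel (L' := pattern13) (σ' := 1631)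
        (p := [1, 0, 3, 2, 9, 7, 10, 5, 11, 4, 6, 8, 12]) (by decide +kernel))

/-- The two core attachments correspond under a symmetry of the pattern; the bags 9 and 10 collapse
and the added position remains fat. -/
theorem isIndContained_of_pattern11 (hG : Rigid G) {B : ℕ → Set V}
    (hB : PModel G pattern11 95 B) : G ⊴ heawood := by
  have hp := patternShape_of_shapeCheck shapeCheck_pattern11
  have key : ∀ B, PModel G pattern12 95 B → G ⊴ heawood := by
    intro B h₁
    obtain ⟨B₂, h₂⟩ := h₁.collapse_of_hasTheta hG.noTheta 9 0 4 11
      [(6, 2, 3585, 306), (3, 1, 3600, 165)] (by decide +kernel)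
    obtain ⟨B₃, h₃⟩ := h₂.collapse_of_hasTheta hG.noTheta 10 3 6 11
      [(4, 1, 3592, 356), (2, 0, 3648, 170)] (by decide +kernel)
    exact isIndContained_of_pattern12 hG (h₃.weaken_of_or (by decide +kernel))
  rcases hB.growth hG hp stepCheck_pattern11 with ⟨B', h1, h2, h3⟩ | ⟨S, hS, B₁, h₁⟩
  · exact h1.isIndContained_of_embedCheck hp.wf h2 h3
      (fun i => Fin.ofNat 14 ([0, 3, 1, 4, 8, 2, 6, 13, 7, 9, 5].getD i 0))
      (by decide +kernel)
  · rw [show stepData11.core = [1536, 384] from rfl, List.mem_pair] at hS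
    rcases hS with rfl | rfl
    · rw [show addV pattern11 1536 = pattern12 by decide +kernel] at h₁
      exact key _ (h₁.weaken_of_or (by decide +kernel))
    · exact key _ (h₁.relabel (L' := pattern12) (σ' := 95)
        (p := [0, 1, 2, 4, 3, 5, 6, 9, 10, 7, 8, 11]) (by decide +kernel))

/-- Only the vertex 9 with three attachments is still a bag. After its reduction the pattern is the
whole Petersen graph, to which nothing can be attached. -/
theorem isIndContained_of_pattern10 (hG : Rigid G) {B : ℕ → Set V}
    (hB : PModel G pattern10 511 B) : G ⊴ petersen := by
  obtain ⟨B₁, h₁⟩ := hB.single hG.noTheta (v := 9) (full := 416)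
    (certs := [(4, 0, 1408, 38), (6, 2, 1312, 137), (3, 1, 1184, 336), (3, 1, 672, 336),
      (4, 1, 800, 137), (6, 3, 896, 38)]) (by decide +kernel)
  have hp := patternShape_of_shapeCheck shapeCheck_pattern10
  rcases (h₁.weaken_of_or (by decide +kernel)).growth hG hp stepCheck_pattern10 with
    ⟨B', h1, h2, h3⟩ | ⟨S, hS, _⟩
  · exact h1.isIndContained_of_embedCheck hp.wf h2 h3
      (fun i => petersenVertex ([0, 2, 4, 6, 1, 3, 7, 5, 8, 9].getD i 0)) (by decide +kernel)
  · simp [stepData10] at hS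

/-- Two bags with free corners at distance two in the 6-cycle. -/
theorem isIndContained_of_free (hG : Rigid G) {B : ℕ → Set V} (hB : PModel G pattern10 95 B)
    (h1 : Free G B 9 5 1 2) (h0 : Free G B 9 7 0 3) : G ⊴ heawood := by
  -- On the hexagon 0 2 6 3 1 4 the corners 2, 3 and 4 are each next to one of the free corners 0
  -- and 1, hence not free.
  have n2 : ¬ Free G B 9 5 2 1 := hB.not_free_of_free hG.noTheta (by decide +kernel) h0
    (by decide) (by decide +kernel) (certs := [(2, 0, 90, 672)]) (by decide +kernel)
  have n3 : ¬ Free G B 9 7 3 0 := hB.not_free_of_free hG.noTheta (by decide +kernel) h1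
    (by decide) (by decide +kernel) (certs := [(3, 1, 672, 85)]) (by decide +kernel)
  have n4 : ¬ Free G B 9 8 4 6 := hB.not_free_of_free hG.noTheta (by decide +kernel) h1
    (by decide) (by decide +kernel) (certs := [(4, 1, 800, 77)]) (by decide +kernel)
  -- Each of the three bags becomes a vertex keeping its attachments to 9 and to the corner 1, 0 or
  -- 6, with a new fat position towards the opposite corner 2, 3 or 4. Collapse without a new
  -- position is excluded in all three cases. The resulting 13 positions form the Heawood graph
  -- without a vertex.
  obtain ⟨B₁, hS₁, hB₁⟩ := hB.split hG.noTheta (by decide +kernel) n2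
    (fun B' hS h => h.not_free hG.noTheta (certs := [(5, 2, 641, 74)])
      (by decide +kernel) (by decide +kernel) ((hS 7 0 3 (by decide) (by decide) (by decide)
      (by decide) (by decide) (by decide) (by decide) (by decide) (by decide)).2 h0))
    (certs := [(4, 0, 896, 1030)]) (by decide +kernel)
  have n3' : ¬ Free G B₁ 9 7 3 0 := by
    rwa [hS₁ 7 3 0 (by decide) (by decide) (by decide)
      (by decide) (by decide) (by decide) (by decide) (by decide) (by decide)]
  have n4' : ¬ Free G B₁ 9 8 4 6 := by
    rwa [hS₁ 8 4 6 (by decide) (by decide) (by decide)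
      (by decide) (by decide) (by decide) (by decide) (by decide) (by decide)]
  obtain ⟨B₂, hS₂, hB₂⟩ := hB₁.split hG.noTheta (by decide +kernel) n3'
    (fun B' hS h => h.not_hasTheta hG.noTheta (certs := [(7, 3, 546, 69)]) (by decide +kernel))
    (certs := [(4, 1, 800, 2057)]) (by decide +kernel)
  have n4'' : ¬ Free G B₂ 9 8 4 6 := by
    rwa [hS₂ 8 4 6 (by decide +kernel) (by decide) (by decide)
      (by decide) (by decide) (by decide) (by decide) (by decide) (by decide)]
  obtain ⟨B₃, hS₃, hB₃⟩ := hB₂.split hG.noTheta (by decide +kernel) n4''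
    (fun B' hS h => h.not_hasTheta hG.noTheta (certs := [(8, 4, 546, 69)]) (by decide +kernel))
    (certs := [(2, 0, 1696, 4176)]) (by decide +kernel)
  obtain ⟨B₄, hB₄⟩ := hB₃.single hG.noTheta (v := 9) (full := 416)
    (certs := [(2, 0, 1074, 8640), (4, 1, 12576, 2185), (2, 0, 9376, 4432), (4, 0, 4420, 674),
      (4, 1, 4896, 2185), (6, 3, 2944, 1062)]) (by decide +kernel)
  exact isIndContained_of_pattern13 hG (hB₄.relabel (L' := pattern13) (σ' := 2015)
    (p := [0, 3, 7, 1, 6, 11, 9, 4, 8, 2, 5, 10, 12]) (by decide +kernel))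

/-- One bag can be made a single vertex. -/
theorem isIndContained_of_not_free (hG : Rigid G) {B : ℕ → Set V} (hB : PModel G pattern10 95 B)
    {m a b : ℕ} (hm : (m, a, b) ∈ [(5, 1, 2), (7, 0, 3), (8, 6, 4)]) (h1 : ¬ Free G B 9 m a b)
    (h2 : ¬ Free G B 9 m b a) : G ⊴ petersen := by
  set certs : List (ℕ × ℕ × ℕ × ℕ) := [(5, 2, 641, 74), (5, 2, 832, 19), (5, 1, 648, 21),
    (5, 1, 784, 76), (7, 0, 548, 26), (7, 3, 832, 19), (7, 3, 546, 69), (7, 0, 784, 76),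
    (8, 4, 641, 74), (8, 6, 548, 26), (8, 6, 648, 21), (8, 4, 546, 69)] with hcerts
  simp only [List.mem_cons, Prod.mk.injEq, List.not_mem_nil, or_false] at hm
  rcases hm with ⟨rfl, rfl, rfl⟩ | ⟨rfl, rfl, rfl⟩ | ⟨rfl, rfl, rfl⟩
  · obtain ⟨B₁, _, h₁⟩ := hB.collapse (joint_of_jointCheck (by decide +kernel)) h1 h2
    obtain ⟨B₂, h₂⟩ := h₁.collapse_of_hasTheta hG.noTheta 7 0 3 9 certs (by decide +kernel)
    obtain ⟨B₃, h₃⟩ := h₂.collapse_of_hasTheta hG.noTheta 8 6 4 9 certs (by decide +kernel)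
    exact isIndContained_of_pattern10 hG (h₃.weaken_of_or (by decide +kernel))
  · obtain ⟨B₁, _, h₁⟩ := hB.collapse (joint_of_jointCheck (by decide +kernel)) h1 h2
    obtain ⟨B₂, h₂⟩ := h₁.collapse_of_hasTheta hG.noTheta 5 1 2 9 certs (by decide +kernel)
    obtain ⟨B₃, h₃⟩ := h₂.collapse_of_hasTheta hG.noTheta 8 6 4 9 certs (by decide +kernel)
    exact isIndContained_of_pattern10 hG (h₃.weaken_of_or (by decide +kernel))
  · obtain ⟨B₁, _, h₁⟩ := hB.collapse (joint_of_jointCheck (by decide +kernel)) h1 h2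
    obtain ⟨B₂, h₂⟩ := h₁.collapse_of_hasTheta hG.noTheta 5 1 2 9 certs (by decide +kernel)
    obtain ⟨B₃, h₃⟩ := h₂.collapse_of_hasTheta hG.noTheta 7 0 3 9 certs (by decide +kernel)
    exact isIndContained_of_pattern10 hG (h₃.weaken_of_or (by decide +kernel))

/-- After the missing vertex 9 is added, each of the bags 5, 7 and 8 links opposite corners of a
hexagon. Adjacent corners are never both free. So either some bag has no free corner, it collapses,
the others follow, and the Petersen graph appears; or one corner of each bag is free, alternately
around the hexagon, which leads to the Heawood graph. -/
theorem isIndContained_of_pattern9 (hG : Rigid G) {B : ℕ → Set V}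
    (hB : PModel G pattern9 95 B) : G ⊴ petersen ∨ G ⊴ heawood := by
  have hp := patternShape_of_shapeCheck shapeCheck_pattern9
  rcases hB.growth hG hp stepCheck_pattern9 with ⟨B', h1, h2, h3⟩ | ⟨S, hS, B₁, h₁⟩
  · exact Or.inl (h1.isIndContained_of_embedCheck hp.wf h2 h3
      (fun i => petersenVertex ([0, 2, 4, 6, 1, 3, 7, 5, 8].getD i 0)) (by decide +kernel))
  · rw [show stepData9.core = [416] from rfl, List.mem_singleton] at hS
    subst hS
    rw [show addV pattern9 416 = pattern10 by decide +kernel] at h₁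
    replace h₁ := h₁.weaken_of_or (σ' := 95) (by decide +kernel)
    -- The six listed pairs are the pairs of adjacent corners of the hexagon.
    have excl : ∀ {m a b m' a' b' : ℕ}, Free G B₁ 9 m a b → Free G B₁ 9 m' a' b' →
        ((m, a, b), (m', a', b')) ∈ [((7, 0, 3), (5, 2, 1)), ((5, 2, 1), (8, 6, 4)),
          ((8, 6, 4), (7, 3, 0)), ((7, 3, 0), (5, 1, 2)), ((5, 1, 2), (8, 4, 6)),
          ((8, 4, 6), (7, 0, 3))] → False := by
      intro m a b m' a' b' h h' hmem
      simp only [List.mem_cons, Prod.mk.injEq, List.not_mem_nil, or_false] at hmem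
      rcases hmem with ⟨⟨rfl, rfl, rfl⟩, rfl, rfl, rfl⟩ | ⟨⟨rfl, rfl, rfl⟩, rfl, rfl, rfl⟩ |
        ⟨⟨rfl, rfl, rfl⟩, rfl, rfl, rfl⟩ | ⟨⟨rfl, rfl, rfl⟩, rfl, rfl, rfl⟩ |
        ⟨⟨rfl, rfl, rfl⟩, rfl, rfl, rfl⟩ | ⟨⟨rfl, rfl, rfl⟩, rfl, rfl, rfl⟩
      all_goals
        exact h₁.not_free_of_free hG.noTheta (by decide +kernel) h (by decide) (by decide +kernel)
          (certs := [(2, 0, 90, 672), (6, 2, 800, 27), (6, 3, 896, 23), (3, 1, 672, 85),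
            (4, 1, 800, 77), (4, 0, 896, 78)]) (by decide +kernel) h'
    by_cases f1 : Free G B₁ 9 5 1 2
    · have n3 : ¬ Free G B₁ 9 7 3 0 := fun h => excl h f1 (by decide)
      by_cases f0 : Free G B₁ 9 7 0 3
      · exact Or.inr (isIndContained_of_free hG h₁ f1 f0)
      · exact Or.inl (isIndContained_of_not_free hG h₁ (by decide) f0 n3)
    · by_cases f2 : Free G B₁ 9 5 2 1
      · have n0 : ¬ Free G B₁ 9 7 0 3 := fun h => excl h f2 (by decide)
        by_cases f3 : Free G B₁ 9 7 3 0
        · exact Or.inr (isIndContained_of_free hG (h₁.relabel (L' := pattern10) (σ' := 95)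
            (p := [3, 2, 1, 0, 6, 5, 4, 7, 8, 9]) (by decide +kernel)) f2 f3)
        · exact Or.inl (isIndContained_of_not_free hG h₁ (by decide) n0 f3)
      · exact Or.inl (isIndContained_of_not_free hG h₁ (by decide) f1 f2)

/-- The growth of `pattern8` to `pattern9` or `pattern11`. -/
theorem isIndContained_of_not_free' (hG : Rigid G) {B : ℕ → Set V} (hB : PModel G pattern9 15 B)
    (hF : ¬ Free G B 8 4 0 1) : G ⊴ petersen ∨ G ⊴ heawood := by
  obtain ⟨B₁, _, h₁ | ⟨_, _, B₂, _, h₂ | h₂⟩⟩ :=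
    hB.halfCollapse (joint_of_jointCheck (by decide +kernel)) hF
  · obtain ⟨B₃, h₃⟩ := h₁.collapse_of_hasTheta hG.noTheta 6 2 3 8
      [(4, 0, 324, 138), (4, 1, 328, 37)] (by decide +kernel)
    exact isIndContained_of_pattern9 hG (h₃.weaken_of_or (by decide +kernel))
  · obtain ⟨B₃, _, h₃⟩ := h₂.split hG.noTheta (m := 6) (a := 3) (b := 2) (v := 8)
      (by decide +kernel)
      (h₂.not_free hG.noTheta (by decide +kernel) (certs := [(3, 1, 165, 336)]) (by decide +kernel))
      (fun B' _ h => h.not_hasTheta hG.noTheta (certs := [(6, 3, 274, 133)]) (by decide +kernel))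
      (certs := [(6, 2, 1024, 306)]) (by decide +kernel)
    rw [show addV (delEdge (addV (delEdge pattern9 4 0) (2 ^ 4 ||| 2 ^ 0)) 6 3) (2 ^ 6 ||| 2 ^ 3) =
      pattern11 by decide +kernel] at h₃
    exact Or.inr (isIndContained_of_pattern11 hG (h₃.weaken_of_or (by decide +kernel)))
  · exact absurd (by decide +kernel) (h₂.not_hasTheta hG.noTheta (certs := [(4, 1, 512, 356)]))

/-- Up to symmetry the new vertex 8 is attached to the opposite bags 4 and 6. If the bag 4 has a
corner that is not free, it half-collapses, and the bag 6 does the same as the bag 4: without new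
positions this gives `pattern9`, with them `pattern11`. -/
theorem isIndContained_of_pattern8 (hG : Rigid G) {B : ℕ → Set V}
    (hB : PModel G pattern8 15 B) : G ⊴ petersen ∨ G ⊴ heawood := by
  have hp := patternShape_of_shapeCheck shapeCheck_pattern8
  have key : ∀ B, PModel G pattern9 15 B → G ⊴ petersen ∨ G ⊴ heawood := by
    intro B h₁
    by_cases f0 : Free G B 8 4 0 1
    · by_cases f1 : Free G B 8 4 1 0
      -- If both corners of the bag 4 are free, neither corner of the bag 6 is, so this bag
      -- collapses to a vertex; but then a free corner of the bag 4 gives a theta.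
      · exfalso
        obtain ⟨B₂, hS, h₂⟩ := h₁.collapse (m := 6) (a := 2) (b := 3) (v := 8)
          (joint_of_jointCheck (by decide +kernel))
          (h₁.not_free_of_free hG.noTheta (by decide +kernel) f0 (by decide) (by decide +kernel)
            (certs := [(2, 0, 336, 170)]) (by decide +kernel))
          (h₁.not_free_of_free hG.noTheta (by decide +kernel) f1 (by decide) (by decide +kernel)
            (certs := [(3, 1, 165, 336)]) (by decide +kernel))
        refine h₂.not_free hG.noTheta (by decide +kernel) (certs := [(6, 2, 273, 42)])
          (by decide +kernel) ((hS 4 0 1 (by decide) (by decide) (by decide)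
          (by decide) (by decide) (by decide) (by decide) (by decide) (by decide)).2 f0)
      · exact isIndContained_of_not_free' hG (h₁.relabel (L' := pattern9) (σ' := 15)
          (p := [1, 0, 3, 2, 4, 7, 6, 5, 8]) (by decide +kernel)) f1
    · exact isIndContained_of_not_free' hG h₁ f0
  rcases hB.growth hG hp stepCheck_pattern8 with ⟨B', h1, h2, h3⟩ | ⟨S, hS, B₁, h₁⟩
  · exact Or.inl (h1.isIndContained_of_embedCheck hp.wf h2 h3
      (fun i => petersenVertex ([0, 2, 4, 6, 1, 3, 7, 5].getD i 0)) (by decide +kernel))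
  · rw [show stepData8.core = [80, 160] from rfl, List.mem_pair] at hS
    rcases hS with rfl | rfl
    · rw [show addV pattern8 80 = pattern9 by decide +kernel] at h₁
      exact key _ (h₁.weaken_of_or (by decide +kernel))
    · exact key _ (h₁.relabel (L' := pattern9) (σ' := 15)
        (p := [0, 3, 2, 1, 7, 6, 5, 4, 8]) (by decide +kernel))

end Growth

/-! ### Two disjoint connections -/

section Menger

variable {V : Type*} {G : SimpleGraph V} [Finite V]

/-- Menger's theorem for two paths, in terms of connected sets. -/
theorem exists_disjoint_connSet {S : Set V} (hS : ConnSet G S) {x y : V} (hx : Touch G {x} S)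
    (h : ∀ z, ∃ E ⊆ S \ {z}, ConnSet G E ∧ Touch G {x} E ∧ Touch G {y} E) :
    ∃ D₁ ⊆ S, ∃ D₂ ⊆ S, Disjoint D₁ D₂ ∧ (ConnSet G D₁ ∧ Touch G {x} D₁ ∧ Touch G {y} D₁) ∧
      ConnSet G D₂ ∧ Touch G {x} D₂ ∧ Touch G {y} D₂ := by
  classical
  obtain ⟨a, ha, hxa⟩ := touch_singleton_left.1 hx
  -- a connected set `D` joining `x` and `y`, and a component of the rest attached to `x`
  let P : Set V → Prop := fun K => ∃ D ⊆ S, (ConnSet G D ∧ Touch G {x} D ∧ Touch G {y} D) ∧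
    K ⊆ S \ D ∧ ConnSet G K ∧ Touch G {x} K
  obtain ⟨K, hK, hKmax⟩ : ∃ K, P K ∧ ∀ K', P K' → K'.ncard ≤ K.ncard := by
    obtain ⟨E, hE, hEc⟩ := h a
    have hP : P {a} := ⟨E, hE.trans Set.sdiff_subset, hEc,
      by simpa using ⟨ha, fun h => (hE h).2 rfl⟩, connSet_singleton a,
      touch_singleton_singleton.2 hxa⟩
    obtain ⟨K, hK, hmax⟩ := (Set.toFinite {K | P K}).exists_maximalFor Set.ncard _ ⟨_, hP⟩
    exact ⟨K, hK, fun K' hK' => by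
      by_contra hcon
      exact hcon (hmax hK' (by omega))⟩
  obtain ⟨D, hDS, hD, hKS, hKc, hxK⟩ := hK
  have hKD : Disjoint D K := Set.disjoint_left.2 fun v hv hv' => (hKS hv').2 hv
  by_cases hyK : Touch G {y} K
  · exact ⟨D, hDS, K, hKS.trans Set.sdiff_subset, hKD, hD, hKc, hxK, hyK⟩
  exfalso
  -- By maximality `K` can be left inside `S` only into the connection `D`.
  have hcl : ∀ v ∈ K, ∀ w ∈ S, G.Adj v w → w ∈ K ∨ w ∈ D := by
    intro v hv w hw hvw
    by_contra! hcon
    have := hKmax (insert w K) ⟨D, hDS, hD, Set.insert_subset ⟨hw, hcon.2⟩ hKS,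
      hKc.insert ⟨v, hv, hvw.symm⟩, hxK.mono subset_rfl (Set.subset_insert _ _)⟩
    rw [Set.ncard_insert_of_notMem hcon.1] at this
    omega
  set W := S \ K with hW
  have hDW : D ⊆ W := fun v hv => ⟨hDS hv, fun h => Set.disjoint_left.1 hKD hv h⟩
  -- A connection outside `K` avoiding `p` could replace `D`, and `K` could then grow by `p`. So
  -- every vertex of `D` next to `K` separates `x` from `y` outside `K`.
  have hsep : ∀ p ∈ D, Touch G {p} K → ∀ E ⊆ W \ {p}, ConnSet G E → Touch G {x} E →
      ¬ Touch G {y} E := by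
    intro p hp hpK E hE hEc hxE hyE
    have := hKmax (insert p K) ⟨E, hE.trans (Set.sdiff_subset.trans Set.sdiff_subset),
      ⟨hEc, hxE, hyE⟩, Set.insert_subset ⟨hDS hp, fun h => (hE h).2 rfl⟩
        fun v hv => ⟨(hKS hv).1, fun h => (hE h).1.2 hv⟩,
      hKc.insert (touch_singleton_left.1 hpK), hxK.mono subset_rfl (Set.subset_insert _ _)⟩
    rw [Set.ncard_insert_of_notMem fun h => Set.disjoint_left.1 hKD hp h] at this
    omega
  -- `Y p` is the part of `W` beyond the separator `p`, on the side of `y`. The separator leaving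
  -- the smallest such part is chosen.
  let Y : V → Set V := fun p => {w ∈ W \ {p} | Touch G {y} (compIn G (W \ {p}) w)}
  obtain ⟨p, ⟨hp, hpK⟩, hpmin⟩ : ∃ p, (p ∈ D ∧ Touch G {p} K) ∧
      ∀ p', (p' ∈ D ∧ Touch G {p'} K) → (Y p).ncard ≤ (Y p').ncard := by
    obtain ⟨p, hp⟩ : ∃ p, p ∈ D ∧ Touch G {p} K := by
      obtain ⟨v, hv, w, hw, hvw⟩ := hS.touch_diff (hKS.trans Set.sdiff_subset) hKc.1
        ⟨hD.1.1.some, hDW hD.1.1.some_mem⟩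
      exact ⟨w, (hcl v hv w hw.1 hvw).resolve_left hw.2, ⟨w, rfl, v, hv, hvw.symm⟩⟩
    obtain ⟨p, hp, hmin⟩ := (Set.toFinite {p | p ∈ D ∧ Touch G {p} K}).exists_minimalFor
      (fun p => (Y p).ncard) _ ⟨p, hp⟩
    exact ⟨p, hp, fun p' hp' => by
      by_contra hcon
      exact hcon (hmin hp' (by dsimp only; omega))⟩
  obtain ⟨E, hE, hEc, hxE, hyE⟩ := h p
  have hEY : (E ∩ Y p).Nonempty := by
    obtain ⟨e, he, hye⟩ := touch_singleton_left.1 hyE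
    have heW : e ∈ W \ {p} := ⟨⟨(hE he).1, fun h => hyK ⟨y, rfl, e, h, hye⟩⟩, (hE he).2⟩
    exact ⟨e, he, heW, ⟨y, rfl, e, mem_compIn_self heW, hye⟩⟩
  have hEK : (E \ (E ∩ Y p)).Nonempty := by
    by_contra hcon
    rw [Set.not_nonempty_iff_eq_empty, Set.sdiff_eq_empty] at hcon
    exact hsep p hp hpK E (fun e he => (hcon he).2.1) hEc hxE hyE
  -- A connection avoiding `p` reaches `Y p` from outside. Since `Y p` is a union of components of
  -- `W \ {p}`, it does so from `K`, and the vertex `p'` of entry is a separator in `D` beyond `p`.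
  -- The part beyond `p'` is smaller, a contradiction.
  obtain ⟨p', ⟨hp'E, hp'Y⟩, w, ⟨hwE, hwY⟩, hpw⟩ := hEc.touch_diff Set.inter_subset_left hEY hEK
  have hp'W := hp'Y.1
  have hwK : w ∈ K := by
    by_contra hwK
    have hwW : w ∈ W \ {p} := ⟨⟨(hE hwE).1, hwK⟩, (hE hwE).2⟩
    refine hwY ⟨hwE, hwW, hp'Y.2.mono subset_rfl ?_⟩
    have h1 := compIn_closed (mem_compIn_self hp'W) hwW hpw
    exact subset_compIn (connSet_compIn hp'W) (compIn_subset _) h1 (mem_compIn_self hwW)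
  have hp'D : p' ∈ D := (hcl w hwK p' hp'W.1.1 hpw.symm).resolve_left hp'W.1.2
  have hp'K : Touch G {p'} K := ⟨p', rfl, w, hwK, hpw⟩
  have hpY : p ∉ Y p' := by
    intro hpY
    -- one of `p`, `p'` can be reached from `x` inside `D` without meeting the other
    have key : ∀ q q' : V, q ∈ Y q' → q' ∈ D → Touch G {q'} K → ∀ C ⊆ D \ {q'}, ConnSet G C →
        Touch G {x} C → q ∈ C → False := by
      intro q q' hq hq' hq'K C hC hCc hxC hqC
      refine hsep q' hq' hq'K (C ∪ compIn G (W \ {q'}) q)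
        (Set.union_subset (fun c hc => ⟨hDW (hC hc).1, (hC hc).2⟩) (compIn_subset _))
        (hCc.union_of_inter (connSet_compIn hq.1) ⟨q, hqC, mem_compIn_self hq.1⟩)
        (hxC.mono subset_rfl Set.subset_union_left) (hq.2.mono subset_rfl Set.subset_union_right)
    have hne : p' ≠ p := hp'W.2
    obtain ⟨b, hb, hxb⟩ := touch_singleton_left.1 hD.2.1
    have hxb' : ∀ {C : Set V}, b ∈ C → Touch G {x} C := fun h => ⟨x, rfl, b, h, hxb⟩
    by_cases hbp : b = p
    · subst hbp
      exact key b p' hpY hp'D hp'K {b} (by simpa using ⟨hb, hne.symm⟩) (connSet_singleton b)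
        (hxb' rfl) rfl
    by_cases hbp' : b = p'
    · subst hbp'
      exact key b p hp'Y hp hpK {b} (by simpa using ⟨hb, hne⟩) (connSet_singleton b)
        (hxb' rfl) rfl
    have hbT : b ∈ D \ {p, p'} := ⟨hb, by simp [hbp, hbp']⟩
    set C := compIn G (D \ {p, p'}) b with hC
    have hCD : C ⊆ D \ {p, p'} := compIn_subset b
    have hCc : ConnSet G C := connSet_compIn hbT
    obtain ⟨c, hc, d, hd, hcd⟩ := hD.1.touch_diff (hCD.trans Set.sdiff_subset) hCc.1
      ⟨p, hp, fun h => (hCD h).2 (by simp)⟩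
    have hd' : d ∈ ({p, p'} : Set V) := by
      by_contra hcon
      exact hd.2 (compIn_closed hc ⟨hd.1, hcon⟩ hcd)
    have hsub : ∀ q q' : V, q ∈ D → q ≠ q' → ({q', q} : Set V) = {p, p'} →
        insert q C ⊆ D \ {q'} := by
      intro q q' hq hqq heq
      refine Set.insert_subset ⟨hq, hqq⟩ fun v hv => ⟨(hCD hv).1, ?_⟩
      rintro rfl
      exact (hCD hv).2 (by rw [← heq]; simp)
    rcases hd' with rfl | rfl
    · exact key d p' hpY hp'D hp'K (insert d C) (hsub d p' hp hne.symm (Set.pair_comm _ _))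
        (hCc.insert ⟨c, hc, hcd.symm⟩) (hxb' (Or.inr (mem_compIn_self hbT))) (Or.inl rfl)
    · exact key d p hp'Y hp hpK (insert d C) (hsub d p hp'D hne rfl)
        (hCc.insert ⟨c, hc, hcd.symm⟩) (hxb' (Or.inr (mem_compIn_self hbT))) (Or.inl rfl)
  have hsub : Y p' ⊆ Y p \ {p'} := by
    rintro v ⟨hv, hyv⟩
    have hsub : compIn G (W \ {p'}) v ⊆ W \ {p} := by
      intro w hw
      refine ⟨(compIn_subset _ hw).1, ?_⟩
      rintro rfl
      refine hpY ⟨compIn_subset _ hw, hyv.mono subset_rfl ?_⟩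
      exact subset_compIn (connSet_compIn hv) (compIn_subset _) hw
        (mem_compIn_self (compIn_subset _ hw))
    have hvp : v ∈ W \ {p} := hsub (mem_compIn_self hv)
    exact ⟨⟨hvp, hyv.mono subset_rfl (subset_compIn (connSet_compIn hv) hsub (mem_compIn_self hv)
      (mem_compIn_self hvp))⟩, hv.2⟩
  have h1 := hpmin p' ⟨hp'D, hp'K⟩
  have h2 := Set.ncard_le_ncard hsub (Set.toFinite _)
  have h3 := Set.ncard_sdiff_singleton_lt_of_mem hp'Y (Set.toFinite _)
  omega

end Menger

/-! ### Deleting both ends of an edge -/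

section Separation

variable {V : Type*} {G : SimpleGraph V} [Finite V]

theorem exists_adj_of_three_le_deg {x : V} (h : 3 ≤ deg G x) (S : Finset V) (hS : S.card ≤ 2) :
    ∃ a, G.Adj x a ∧ a ∉ S := by
  by_contra! hcon
  have h1 : G.neighborSet x ⊆ (S : Set V) := fun a ha => hcon a ha
  have h2 := Set.ncard_le_ncard h1 (Set.toFinite _)
  rw [Set.ncard_coe_finset] at h2
  unfold deg at h
  omega

theorem exists_adj_of_three_le_deg₁ {x : V} (h : 3 ≤ deg G x) (b c : V) :
    ∃ a, G.Adj x a ∧ a ≠ b ∧ a ≠ c := by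
  classical
  obtain ⟨a, ha, hS⟩ := exists_adj_of_three_le_deg h {b, c} Finset.card_le_two
  exact ⟨a, ha, by simpa using hS⟩

/-- The complement of an edge with both ends of degree at least three is connected. -/
theorem Rigid.connSet_compl_pair (hG : Rigid G) {x y : V} (hxy : G.Adj x y) (hx : 3 ≤ deg G x) :
    ConnSet G ({x, y}ᶜ : Set V) := by
  obtain ⟨a, hxa, hax, hay⟩ := exists_adj_of_three_le_deg₁ hx x y
  have haS : a ∈ ({x, y}ᶜ : Set V) := by simp [hax, hay]
  -- A component not attached to one end of the edge would be separated from that end by the other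
  -- one, which would be a cutvertex. So two components would form a theta with the edge.
  have htouch : ∀ C ⊆ ({x, y}ᶜ : Set V), C.Nonempty →
      (∀ v ∈ C, ∀ w ∈ ({x, y}ᶜ : Set V), G.Adj v w → w ∈ C) → Touch G {x} C ∧ Touch G {y} C := by
    have key : ∀ x y, ∀ C ⊆ ({x, y}ᶜ : Set V), C.Nonempty → x ≠ y →
      (∀ v ∈ C, ∀ w ∈ ({x, y}ᶜ : Set V), G.Adj v w → w ∈ C) → Touch G {x} C := by
      intro x y C hC hne hxy hcl
      by_contra hcon
      have := (hG.cut₁ y).2 C (fun v hv h => hC hv (Or.inr h)) hne fun v hv w hw hvw => by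
        refine hcl v hv w ?_ hvw
        rintro (rfl | rfl)
        · exact hcon ⟨w, rfl, v, hv, hvw.symm⟩
        · exact hw rfl
      exact hC (this (a := x) (by simpa using hxy)) (Or.inl rfl)
    intro C hC hne hcl
    refine ⟨key x y C hC hne hxy.ne hcl, key y x C (by rwa [Set.pair_comm]) hne hxy.ne.symm ?_⟩
    rwa [Set.pair_comm]
  set C := compIn G ({x, y}ᶜ : Set V) a with hC
  have hCc := connSet_compIn (G := G) haS
  by_cases hall : ({x, y}ᶜ : Set V) ⊆ C
  · rwa [Set.Subset.antisymm hall (compIn_subset a)]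
  exfalso
  obtain ⟨b, hb, hbC⟩ := Set.not_subset.1 hall
  set C' := compIn G ({x, y}ᶜ : Set V) b with hC'
  have hcl : ∀ b, ∀ v ∈ compIn G ({x, y}ᶜ : Set V) b, ∀ w ∈ ({x, y}ᶜ : Set V), G.Adj v w →
    w ∈ compIn G ({x, y}ᶜ : Set V) b := fun b v hv w hw hvw => compIn_closed hv hw hvw
  have hdisj : Disjoint C C' := by
    rw [Set.disjoint_left]
    intro v hv hv'
    exact hbC (subset_compIn (connSet_compIn hb) (compIn_subset _) hv' hv (mem_compIn_self hb))
  obtain ⟨t1, t2⟩ := htouch C (compIn_subset a) ⟨a, mem_compIn_self haS⟩ (hcl a)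
  obtain ⟨t3, t4⟩ := htouch C' (compIn_subset b) ⟨b, mem_compIn_self hb⟩ (hcl b)
  refine hG.noTheta x y C C' ⟨hxy, hCc, connSet_compIn hb, hdisj, ?_, ?_, ?_, ?_, ?_, t1, t3, t2, t4⟩
  · rintro ⟨v, hv, w, hw, hvw⟩
    exact Set.disjoint_left.1 hdisj (hcl a v hv w (compIn_subset _ hw) hvw) hw
  · exact fun h => compIn_subset _ h (Or.inl rfl)
  · exact fun h => compIn_subset _ h (Or.inl rfl)
  · exact fun h => compIn_subset _ h (Or.inr rfl)
  · exact fun h => compIn_subset _ h (Or.inr rfl)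

end Separation

/-! ### Connecting the ends of an edge while avoiding a vertex -/

section Separation

variable {V : Type*} {G : SimpleGraph V} [Finite V]

/-- The ends of an edge can not be separated by a vertex in the graph without that edge. -/
theorem Rigid.exists_connSet_avoiding (hG : Rigid G) {x y : V} (hxy : G.Adj x y)
    (hx : 3 ≤ deg G x) (hy : 3 ≤ deg G y) (z : V) :
    ∃ E ⊆ ({x, y}ᶜ : Set V) \ {z}, ConnSet G E ∧ Touch G {x} E ∧ Touch G {y} E := by
  classical
  set S : Set V := {x, y}ᶜ with hS
  have hSc : ConnSet G S := hG.connSet_compl_pair hxy hx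
  have hmemS : ∀ {v}, v ≠ x → v ≠ y → v ∈ S := fun h1 h2 => by simp [hS, h1, h2]
  have hxS : x ∉ S := by simp [hS]
  have hyS : y ∉ S := by simp [hS]
  by_contra hcon
  let Bad : V → Prop := fun z => z ∈ S ∧ ∀ E ⊆ S \ {z}, ConnSet G E → Touch G {x} E →
    ¬ Touch G {y} E
  have hbad : Bad z := by
    refine ⟨?_, fun E h1 h2 h3 h4 => hcon ⟨E, h1, h2, h3, h4⟩⟩
    by_contra hz
    obtain ⟨a, ha, hax, hay⟩ := exists_adj_of_three_le_deg₁ hx x y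
    obtain ⟨b, hb, hbx, hby⟩ := exists_adj_of_three_le_deg₁ hy x y
    exact hcon ⟨S, fun v hv => ⟨hv, fun h => hz (h ▸ hv)⟩, hSc, ⟨x, rfl, a, hmemS hax hay, ha⟩,
      ⟨y, rfl, b, hmemS hbx hby, hb⟩⟩
  -- `L z` is the part of `S \ {z}` on the side of `x`. Among the separating vertices, one with the
  -- smallest such part is taken.
  let L : V → Set V := fun z => {w ∈ S \ {z} | Touch G {x} (compIn G (S \ {z}) w)}
  clear hcon
  obtain ⟨z, ⟨hzS, hz⟩, hmin⟩ : ∃ z, Bad z ∧ ∀ z', Bad z' → (L z).ncard ≤ (L z').ncard := by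
    obtain ⟨z, hz, hmin⟩ := (Set.toFinite {z | Bad z}).exists_minimalFor
      (fun z => (L z).ncard) _ ⟨z, hbad⟩
    exact ⟨z, hz, fun z' hz' => by
      by_contra hcon
      exact hcon (hmin hz' (by dsimp only; omega))⟩
  have hzx : z ≠ x := fun h => hxS (h ▸ hzS)
  have hzy : z ≠ y := fun h => hyS (h ▸ hzS)
  have hcompeq : ∀ {w w'}, w ∈ S \ {z} → w' ∈ S \ {z} → G.Adj w w' →
      compIn G (S \ {z}) w ⊆ compIn G (S \ {z}) w' := fun hw hw' hadj =>
    subset_compIn (connSet_compIn hw) (compIn_subset _)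
      (compIn_closed (mem_compIn_self hw) hw' hadj) (mem_compIn_self hw')
  have f1 : ∀ w ∈ L z, ∀ w' ∈ S \ {z}, G.Adj w w' → w' ∈ L z := fun w hw w' hw' hadj =>
    ⟨hw', hw.2.mono subset_rfl (hcompeq hw.1 hw' hadj)⟩
  have f2 : ∀ w ∈ L z, ¬ G.Adj y w := fun w hw hyw =>
    hz _ (compIn_subset _) (connSet_compIn hw.1) hw.2 ⟨y, rfl, w, mem_compIn_self hw.1, hyw⟩
  have f4 : ∀ {a}, G.Adj x a → a ≠ y → a ≠ z → a ∈ L z := by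
    intro a ha hay haz
    have : a ∈ S \ {z} := ⟨hmemS ha.ne' hay, haz⟩
    exact ⟨this, ⟨x, rfl, a, mem_compIn_self this, ha⟩⟩
  set R := (S \ {z}) \ L z with hR
  have f4' : ∀ {a}, G.Adj y a → a ≠ x → a ≠ z → a ∈ R := fun ha hax haz =>
    ⟨⟨hmemS hax ha.ne', haz⟩, fun h => f2 _ h ha⟩
  have f1' : ∀ w ∈ R, ∀ w' ∈ S \ {z}, G.Adj w w' → w' ∈ R := fun w hw w' hw' hadj =>
    ⟨hw', fun h => hw.2 (f1 w' h w hw.1 hadj.symm)⟩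
  have hLne : (L z).Nonempty := by
    obtain ⟨a, ha, h1, h2⟩ := exists_adj_of_three_le_deg₁ hx y z
    exact ⟨a, f4 ha h1 h2⟩
  have hRne : R.Nonempty := by
    obtain ⟨a, ha, h1, h2⟩ := exists_adj_of_three_le_deg₁ hy x z
    exact ⟨a, f4' ha h1 h2⟩
  have f5 : ∀ T ⊆ S \ {z}, T.Nonempty → (∀ w ∈ T, ∀ w' ∈ S \ {z}, G.Adj w w' → w' ∈ T) →
      ∃ l ∈ T, G.Adj z l := by
    intro T hT hne hcl
    obtain ⟨l, hl, w, hw, hlw⟩ := hSc.touch_diff (hT.trans Set.sdiff_subset) hne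
      ⟨z, hzS, fun h => (hT h).2 rfl⟩
    have : w = z := by
      by_contra hwz
      exact hw.2 (hcl l hl w ⟨hw.1, hwz⟩ hlw)
    exact ⟨l, hl, this ▸ hlw.symm⟩
  obtain ⟨l, hl, hzl⟩ := f5 (L z) (fun w hw => hw.1) hLne f1
  obtain ⟨r, hr, hzr⟩ := f5 R Set.sdiff_subset hRne f1'
  have hlr : l ≠ r := by rintro rfl; exact hr.2 hl
  have hLS : ∀ {w}, w ∈ L z → w ≠ x ∧ w ≠ y ∧ w ≠ z := fun hw =>
    ⟨fun h => hxS (h ▸ hw.1.1), fun h => hyS (h ▸ hw.1.1), hw.1.2⟩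
  have hRS : ∀ {w}, w ∈ R → w ≠ x ∧ w ≠ y ∧ w ≠ z := fun hw =>
    ⟨fun h => hxS (h ▸ hw.1.1), fun h => hyS (h ▸ hw.1.1), hw.1.2⟩
  -- If `z` has degree at least three, one of the pairs `{y, z}` and `{x, z}` is a proper 2-cutset:
  -- the first when `x` is adjacent to `z`, since `y` is then not, by absence of triangles, and the
  -- second otherwise.
  by_cases hdeg : 3 ≤ deg G z
  · by_cases hxz : G.Adj x z
    · have hyz : ¬ G.Adj y z := fun h => hG.tri x z y hxz h.symm hxy.symm
      refine hG.cut₂ y z R (insert x (L z)) hzy.symm hyz hy hdeg ?_ ?_ ?_ ?_ ?_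
      · ext w
        by_cases hwx : w = x
        · subst hwx; simp [hxy.ne, hzx.symm]
        · simp only [hR, Set.mem_union, Set.mem_sdiff, Set.mem_insert_iff, hwx, false_or,
            Set.mem_compl_iff, Set.mem_singleton_iff, hS]
          have : w ∈ L z → w ≠ y ∧ w ≠ z := fun h => (hLS h).2
          tauto
      · rw [Set.disjoint_insert_right]
        exact ⟨fun h => (hRS h).1 rfl, Set.disjoint_sdiff_left⟩
      · obtain ⟨a, ha, h1, h2⟩ := exists_adj_of_three_le_deg₁ hy x z
        obtain ⟨b, hb, h3, h4⟩ := exists_adj_of_three_le_deg₁ hy x a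
        exact ⟨a, f4' ha h1 h2, b, f4' hb h3 (fun h => hyz (h ▸ hb)), h4.symm⟩
      · exact ⟨x, Or.inl rfl, l, Or.inr hl, (hLS hl).1.symm⟩
      · rintro ⟨w, hw, w', rfl | hw', hadj⟩
        · exact hw.2 (f4 hadj.symm (hRS hw).2.1 (hRS hw).2.2)
        · exact hw.2 (f1 w' hw' w hw.1 hadj.symm)
    · refine hG.cut₂ x z (L z) (insert y R) hzx.symm hxz hx hdeg ?_ ?_ ?_ ?_ ?_
      · ext w
        by_cases hwy : w = y
        · subst hwy; simp [hxy.ne', hzy.symm]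
        · simp only [hR, Set.mem_union, Set.mem_sdiff, Set.mem_insert_iff, hwy, false_or,
            Set.mem_compl_iff, Set.mem_singleton_iff, hS]
          have : w ∈ L z → w ≠ x ∧ w ≠ z := fun h => ⟨(hLS h).1, (hLS h).2.2⟩
          tauto
      · rw [Set.disjoint_insert_right]
        exact ⟨fun h => (hLS h).2.1 rfl, Set.disjoint_sdiff_right⟩
      · obtain ⟨a, ha, h1, h2⟩ := exists_adj_of_three_le_deg₁ hx y z
        obtain ⟨b, hb, h3, h4⟩ := exists_adj_of_three_le_deg₁ hx y a
        exact ⟨a, f4 ha h1 h2, b, f4 hb h3 (fun h => hxz (h ▸ hb)), h4.symm⟩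
      · exact ⟨y, Or.inl rfl, r, Or.inr hr, (hRS hr).2.1.symm⟩
      · rintro ⟨w, hw, w', rfl | hw', hadj⟩
        · exact f2 w hw hadj.symm
        · exact hw'.2 (f1 w hw w' hw'.1 hadj)
  -- Here `z` has only the neighbours `l` and `r`, one on each side. Then `l` separates as well and
  -- has a smaller part on the side of `x`.
  · have hN : ∀ {w}, G.Adj z w → w = l ∨ w = r := by
      intro w hw
      by_contra! h
      exact hdeg (three_le_deg hzl hzr hw hlr h.1.symm h.2.symm)
    have hxz : ¬ G.Adj z x := fun h => by
      rcases hN h with h | h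
      · exact (hLS hl).1 h.symm
      · exact (hRS hr).1 h.symm
    -- a connected set in `S` that meets `L z` and avoids `l` stays in `L z`
    have hstay : ∀ E ⊆ S \ {l}, ConnSet G E → Touch G {x} E → E ⊆ L z := by
      intro E hE hEc hxE
      obtain ⟨e, he, hxe⟩ := touch_singleton_left.1 hxE
      have heL : e ∈ L z := f4 hxe (fun h => hyS (h ▸ (hE he).1)) (fun h => hxz (h ▸ hxe.symm))
      refine fun v hv => (hEc.2 (E ∩ L z) Set.inter_subset_left ⟨e, he, heL⟩ ?_ hv).2
      rintro v ⟨hvE, hvL⟩ w hw hvw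
      refine ⟨hw, f1 v hvL w ⟨(hE hw).1, ?_⟩ hvw⟩
      rintro rfl
      rcases hN hvw.symm with rfl | rfl
      · exact (hE hvE).2 rfl
      · exact hr.2 hvL
    have hbl : Bad l := by
      refine ⟨hl.1.1, fun E hE hEc hxE hyE => ?_⟩
      obtain ⟨e, he, hye⟩ := touch_singleton_left.1 hyE
      exact f2 e (hstay E hE hEc hxE he) hye
    have hsub : L l ⊆ L z \ {l} := by
      rintro w ⟨hw, ht⟩
      exact ⟨hstay _ (compIn_subset _) (connSet_compIn hw) ht (mem_compIn_self hw), hw.2⟩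
    have h1 := hmin l hbl
    have h2 := Set.ncard_le_ncard hsub (Set.toFinite _)
    have h3 := Set.ncard_sdiff_singleton_lt_of_mem hl (Set.toFinite _)
    omega

end Separation

/-! ### Two induced paths of minimal total length -/

section Tracks

variable {V : Type*} {G : SimpleGraph V}

/-- An induced path from `x` to `y` in `n + 2` steps, apart from the edge `x y`. -/
structure IndTrack (G : SimpleGraph V) (x y : V) (n : ℕ) (f : ℕ → V) : Prop where
  zero : f 0 = x
  last : f (n + 2) = y
  inj : ∀ i j, i ≤ n + 2 → j ≤ n + 2 → f i = f j → i = j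
  adj_iff : ∀ i j, i < j → j ≤ n + 2 → (G.Adj (f i) (f j) ↔ j = i + 1 ∨ (i = 0 ∧ j = n + 2))

theorem IndTrack.reverse {x y : V} {n : ℕ} {f : ℕ → V} (h : IndTrack G x y n f) :
    IndTrack G y x n (fun i => f (n + 2 - i)) := by
  refine ⟨by simpa using h.last, by simpa using h.zero, fun i j hi hj hij => ?_,
    fun i j hij hj => ?_⟩
  · have := h.inj _ _ (by omega) (by omega) hij
    omega
  · rw [G.adj_comm, h.adj_iff _ _ (by omega) (by omega)]
    omega

theorem IndTrack.connSet {x y : V} {n : ℕ} {f : ℕ → V} (h : IndTrack G x y n f) {a b : ℕ}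
    (hab : a ≤ b) (hb : b ≤ n + 2) : ConnSet G (f '' Set.Icc a b) :=
  connSet_interval f hab fun i _ h2 => (h.adj_iff i (i + 1) (by omega) (by omega)).2 (Or.inl rfl)

theorem IndTrack.disjoint {x y : V} {n : ℕ} {f : ℕ → V} (h : IndTrack G x y n f) {a b c d : ℕ}
    (hbc : b < c) (hd : d ≤ n + 2) : Disjoint (f '' Set.Icc a b) (f '' Set.Icc c d) := by
  rw [Set.disjoint_left]
  rintro _ ⟨i, ⟨_, hi⟩, rfl⟩ ⟨j, ⟨hj, hj'⟩, hij⟩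
  have := h.inj j i (by omega) (by omega) hij
  omega

theorem IndTrack.touch_iff {x y : V} {n : ℕ} {f : ℕ → V} (h : IndTrack G x y n f) {a b c d : ℕ}
    (hab : a ≤ b) (hbc : b < c) (hcd : c ≤ d) (hd : d ≤ n + 2) :
    Touch G (f '' Set.Icc a b) (f '' Set.Icc c d) ↔ c = b + 1 ∨ (a = 0 ∧ d = n + 2) := by
  constructor
  · rintro ⟨_, ⟨i, ⟨hi, hi'⟩, rfl⟩, _, ⟨j, ⟨hj, hj'⟩, rfl⟩, hij⟩
    have := (h.adj_iff i j (by omega) (by omega)).1 hij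
    omega
  · rintro (rfl | ⟨rfl, rfl⟩)
    · exact ⟨_, ⟨b, ⟨hab, le_rfl⟩, rfl⟩, _, ⟨b + 1, ⟨le_rfl, hcd⟩, rfl⟩,
        (h.adj_iff _ _ (by omega) (by omega)).2 (Or.inl rfl)⟩
    · exact ⟨_, ⟨0, ⟨le_rfl, hab⟩, rfl⟩, _, ⟨n + 2, ⟨hcd, le_rfl⟩, rfl⟩,
        (h.adj_iff _ _ (by omega) (by omega)).2 (Or.inr ⟨rfl, rfl⟩)⟩

/-- Two disjoint induced paths between the ends of an edge, of minimal total length. -/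
theorem exists_indTracks [Finite V] {x y : V} (hxy : G.Adj x y) {S : Set V} (hx : x ∉ S)
    (hy : y ∉ S) (h : ∃ D₁ ⊆ S, ∃ D₂ ⊆ S, Disjoint D₁ D₂ ∧
      (ConnSet G D₁ ∧ Touch G {x} D₁ ∧ Touch G {y} D₁) ∧
        ConnSet G D₂ ∧ Touch G {x} D₂ ∧ Touch G {y} D₂) :
    ∃ n f m g, IndTrack G x y n f ∧ IndTrack G x y m g ∧
      (∀ i j, 1 ≤ i → i ≤ n + 1 → j ≤ m + 2 → f i ≠ g j) ∧
      ∀ i i' j j', 1 ≤ i → i < i' → i' ≤ n + 1 → 1 ≤ j' → j' < j → j ≤ m + 1 →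
        G.Adj (f i) (g j) → G.Adj (f i') (g j') → i' = i + 1 ∧ j = j' + 1 := by
  classical
  let P : Set V × Set V → Prop := fun D => D.1 ⊆ S ∧ D.2 ⊆ S ∧ Disjoint D.1 D.2 ∧
    (ConnSet G D.1 ∧ Touch G {x} D.1 ∧ Touch G {y} D.1) ∧
      ConnSet G D.2 ∧ Touch G {x} D.2 ∧ Touch G {y} D.2
  obtain ⟨⟨D₁, D₂⟩, hP, hmin⟩ : ∃ D, P D ∧
      ∀ D', P D' → D.1.ncard + D.2.ncard ≤ D'.1.ncard + D'.2.ncard := by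
    obtain ⟨D₁, h1, D₂, h2, h3, h4⟩ := h
    have hex : ∃ k D, P D ∧ D.1.ncard + D.2.ncard = k := ⟨_, (D₁, D₂), ⟨h1, h2, h3, h4⟩, rfl⟩
    obtain ⟨D, hD, hk⟩ := Nat.find_spec hex
    exact ⟨D, hD, fun D' hD' => hk ▸ Nat.find_min' hex ⟨D', hD', rfl⟩⟩
  obtain ⟨hS₁, hS₂, hd, ⟨hc₁, tx₁, ty₁⟩, hc₂, tx₂, ty₂⟩ := hP
  dsimp only at hS₁ hS₂ hd hc₁ tx₁ ty₁ hc₂ tx₂ ty₂ hmin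
  have key : ∀ D ⊆ S, ConnSet G D → Touch G {x} D → Touch G {y} D →
      ∃ n f, IndTrack G x y n f ∧ f '' Set.Icc 1 (n + 1) ⊆ D := by
    intro D hDS hD hxD hyD
    obtain ⟨n, f, ⟨h0, h1, h2, h3⟩, hinj, hind⟩ := exists_induced_track hD hxD hyD
      (fun h => hx (hDS h)) (fun h => hy (hDS h)) hxy.ne
    refine ⟨n, f, ⟨h0, h1, hinj, fun i j hij hj => ⟨hind i j hij hj, ?_⟩⟩, ?_⟩
    · rintro (rfl | ⟨rfl, rfl⟩)
      · exact h3 i (by omega)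
      · rwa [h0, h1]
    · rintro _ ⟨i, ⟨hi, hi'⟩, rfl⟩
      exact h2 i hi hi'
  have hcard : ∀ {n f} (a b : ℕ), IndTrack G x y n f → b ≤ n + 2 →
      (f '' Set.Icc a b).ncard = b + 1 - a := by
    intro n f a b hf hb
    rw [Set.InjOn.ncard_image fun i hi j hj hij => hf.inj i j (hi.2.trans hb) (hj.2.trans hb) hij,
      ← Finset.coe_Icc, Set.ncard_coe_finset, Nat.card_Icc]
  have ht : ∀ {n f}, IndTrack G x y n f → ∀ D : Set V, f 1 ∈ D → Touch G {x} D := fun hf D h =>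
    ⟨x, rfl, _, h, by
      have := (hf.adj_iff 0 1 (by omega) (by omega)).2 (Or.inl rfl)
      rwa [hf.zero] at this⟩
  have ht' : ∀ {n f}, IndTrack G x y n f → ∀ D : Set V, f (n + 1) ∈ D → Touch G {y} D :=
    fun {n} {f} hf D h => ⟨y, rfl, _, h, by
      have := (hf.adj_iff (n + 1) (n + 2) (by omega) (by omega)).2 (Or.inl rfl)
      rw [hf.last] at this
      exact this.symm⟩
  obtain ⟨n, f, hf, hfD⟩ := key D₁ hS₁ hc₁ tx₁ ty₁
  obtain ⟨m, g, hg, hgD⟩ := key D₂ hS₂ hc₂ tx₂ ty₂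
  have hfg : ∀ i j, 1 ≤ i → i ≤ n + 1 → j ≤ m + 2 → f i ≠ g j := by
    intro i j hi hi' hj heq
    have h1 := hfD ⟨i, ⟨hi, hi'⟩, rfl⟩
    rcases Nat.eq_zero_or_pos j with rfl | hj1
    · rw [heq, hg.zero] at h1; exact hx (hS₁ h1)
    by_cases hj2 : j = m + 2
    · rw [heq, hj2, hg.last] at h1; exact hy (hS₁ h1)
    · exact Set.disjoint_left.1 hd h1 (heq ▸ hgD ⟨j, ⟨hj1, by omega⟩, rfl⟩)
  have hle : n + 1 + (m + 1) ≤ D₁.ncard + D₂.ncard := by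
    have h1 := Set.ncard_le_ncard hfD (Set.toFinite _)
    have h2 := Set.ncard_le_ncard hgD (Set.toFinite _)
    rw [hcard _ _ hf (by omega)] at h1
    rw [hcard _ _ hg (by omega)] at h2
    omega
  refine ⟨n, f, m, g, hf, hg, hfg, fun i i' j j' hi hii hi' hj' hjj hj e1 e2 => ?_⟩
  have hdfg : ∀ a b c d, 1 ≤ a → b ≤ n + 1 → d ≤ m + 2 →
      Disjoint (f '' Set.Icc a b) (g '' Set.Icc c d) := by
    intro a b c d ha hb hd
    rw [Set.disjoint_left]
    rintro _ ⟨s, ⟨hs, hs'⟩, rfl⟩ ⟨t, ⟨_, ht⟩, hst⟩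
    exact hfg s t (by omega) (by omega) (by omega) hst.symm
  have hfS : ∀ a b, 1 ≤ a → b ≤ n + 1 → f '' Set.Icc a b ⊆ S := fun a b ha hb =>
    (Set.image_mono (Set.Icc_subset_Icc ha hb)).trans (hfD.trans hS₁)
  have hgS : ∀ a b, 1 ≤ a → b ≤ m + 1 → g '' Set.Icc a b ⊆ S := fun a b ha hb =>
    (Set.image_mono (Set.Icc_subset_Icc ha hb)).trans (hgD.trans hS₂)
  -- Two crossing edges allow the paths to exchange their tails. The vertices strictly between the
  -- ends of the crossing edges are lost, so by minimality there are none.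
  have := hmin (f '' Set.Icc 1 i ∪ g '' Set.Icc j (m + 1), g '' Set.Icc 1 j' ∪ f '' Set.Icc i' (n + 1))
    ⟨Set.union_subset (hfS _ _ le_rfl (by omega)) (hgS _ _ (by omega) le_rfl),
      Set.union_subset (hgS _ _ le_rfl (by omega)) (hfS _ _ (by omega) le_rfl), ?_,
      ⟨(hf.connSet hi (by omega)).union (hg.connSet hj (by omega))
        ⟨_, ⟨i, ⟨hi, le_rfl⟩, rfl⟩, _, ⟨j, ⟨le_rfl, hj⟩, rfl⟩, e1⟩,
        ht hf _ (Or.inl ⟨1, ⟨le_rfl, hi⟩, rfl⟩), ht' hg _ (Or.inr ⟨m + 1, ⟨hj, le_rfl⟩, rfl⟩)⟩,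
      (hg.connSet hj' (by omega)).union (hf.connSet hi' (by omega))
        ⟨_, ⟨j', ⟨hj', le_rfl⟩, rfl⟩, _, ⟨i', ⟨le_rfl, hi'⟩, rfl⟩, e2.symm⟩,
      ht hg _ (Or.inl ⟨1, ⟨le_rfl, hj'⟩, rfl⟩), ht' hf _ (Or.inr ⟨n + 1, ⟨hi', le_rfl⟩, rfl⟩)⟩
  · dsimp only at this
    have h1 := Set.ncard_union_le (f '' Set.Icc 1 i) (g '' Set.Icc j (m + 1))
    have h2 := Set.ncard_union_le (g '' Set.Icc 1 j') (f '' Set.Icc i' (n + 1))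
    rw [hcard _ _ hf (by omega), hcard _ _ hg (by omega)] at h1 h2
    have h0 := hmin (f '' Set.Icc 1 (n + 1), g '' Set.Icc 1 (m + 1))
      ⟨hfS _ _ le_rfl le_rfl, hgS _ _ le_rfl le_rfl, hdfg _ _ _ _ le_rfl le_rfl (by omega),
        ⟨hf.connSet (by omega) (by omega), ht hf _ ⟨1, ⟨le_rfl, by omega⟩, rfl⟩,
          ht' hf _ ⟨n + 1, ⟨by omega, le_rfl⟩, rfl⟩⟩,
        hg.connSet (by omega) (by omega), ht hg _ ⟨1, ⟨le_rfl, by omega⟩, rfl⟩,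
          ht' hg _ ⟨m + 1, ⟨by omega, le_rfl⟩, rfl⟩⟩
    omega
  · dsimp only
    rw [Set.disjoint_union_left, Set.disjoint_union_right, Set.disjoint_union_right]
    exact ⟨⟨hdfg _ _ _ _ le_rfl (by omega) (by omega), hf.disjoint hii (by omega)⟩,
      (hg.disjoint hjj (by omega)).symm, (hdfg _ _ _ _ (by omega) le_rfl (by omega)).symm⟩

end Tracks

/-! ### The first pattern from an edge between vertices of large degree -/

section Ladder

variable {V : Type*} {G : SimpleGraph V}

/-- Two disjoint induced paths between the ends of an edge, with exactly one edge between them. -/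
structure Ladder (G : SimpleGraph V) (x y : V) (n : ℕ) (f : ℕ → V) (m : ℕ) (g : ℕ → V)
    (i j : ℕ) : Prop where
  left : IndTrack G x y n f
  right : IndTrack G x y m g
  ne : ∀ s t, 1 ≤ s → s ≤ n + 1 → t ≤ m + 2 → f s ≠ g t
  ne' : ∀ s t, s ≤ n + 2 → 1 ≤ t → t ≤ m + 1 → f s ≠ g t
  one_le_i : 1 ≤ i
  i_le : i ≤ n + 1
  one_le_j : 1 ≤ j
  j_le : j ≤ m + 1
  adj_iff : ∀ s t, 1 ≤ s → s ≤ n + 1 → 1 ≤ t → t ≤ m + 1 → (G.Adj (f s) (g t) ↔ s = i ∧ t = j)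

variable {x y : V} {n m i j : ℕ} {f g : ℕ → V}

theorem Ladder.swap (h : Ladder G x y n f m g i j) : Ladder G x y m g n f j i :=
  ⟨h.right, h.left, fun s t h1 h2 h3 => (h.ne' t s h3 h1 h2).symm,
    fun s t h1 h2 h3 => (h.ne t s h2 h3 h1).symm, h.one_le_j, h.j_le, h.one_le_i, h.i_le,
    fun s t h1 h2 h3 h4 => by rw [G.adj_comm, h.adj_iff t s h3 h4 h1 h2, and_comm]⟩

theorem Ladder.reverse (h : Ladder G x y n f m g i j) :
    Ladder G y x n (fun s => f (n + 2 - s)) m (fun s => g (m + 2 - s)) (n + 2 - i) (m + 2 - j) := by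
  have h1 := h.one_le_i
  have h2 := h.i_le
  have h3 := h.one_le_j
  have h4 := h.j_le
  refine ⟨h.left.reverse, h.right.reverse, fun s t h1 h2 h3 => h.ne _ _ (by omega) (by omega)
    (by omega), fun s t h1 h2 h3 => h.ne' _ _ (by omega) (by omega) (by omega), by omega, by omega,
    by omega, by omega, fun s t h5 h6 h7 h8 => ?_⟩
  rw [h.adj_iff _ _ (by omega) (by omega) (by omega) (by omega)]
  omega

theorem Ladder.disjoint (h : Ladder G x y n f m g i j) {a b c d : ℕ} (ha : 1 ≤ a) (hb : b ≤ n + 1)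
    (hd : d ≤ m + 2) : Disjoint (f '' Set.Icc a b) (g '' Set.Icc c d) := by
  rw [Set.disjoint_left]
  rintro _ ⟨s, ⟨hs, hs'⟩, rfl⟩ ⟨t, ⟨_, ht⟩, hst⟩
  exact h.ne s t (by omega) (by omega) (by omega) hst.symm

theorem Ladder.touch_iff (h : Ladder G x y n f m g i j) {a b c d : ℕ} (ha : 1 ≤ a) (hb : b ≤ n + 1)
    (hc : 1 ≤ c) (hd : d ≤ m + 1) : Touch G (f '' Set.Icc a b) (g '' Set.Icc c d) ↔
      (a ≤ i ∧ i ≤ b) ∧ c ≤ j ∧ j ≤ d := by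
  constructor
  · rintro ⟨_, ⟨s, ⟨hs, hs'⟩, rfl⟩, _, ⟨t, ⟨ht, ht'⟩, rfl⟩, hst⟩
    rw [h.adj_iff s t (by omega) (by omega) (by omega) (by omega)] at hst
    omega
  · rintro ⟨⟨h1, h2⟩, h3, h4⟩
    exact ⟨_, ⟨i, ⟨h1, h2⟩, rfl⟩, _, ⟨j, ⟨h3, h4⟩, rfl⟩,
      (h.adj_iff i j (by omega) (by omega) (by omega) (by omega)).2 ⟨rfl, rfl⟩⟩

/-- If the rung started at the neighbour `f 1` of `x`, it would close a square when its other end is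
next to `y`. Otherwise `x` and `f 1` are the ends of the chord of a theta: one side runs along `g`
up to the rung, the other along `f` to `y`. -/
theorem Ladder.two_le (h : Ladder G x y n f m g i j) (hG : Rigid G) : 2 ≤ i := by
  by_contra hcon
  have h1 : i = 1 := by have := h.one_le_i; omega
  subst h1
  have h3 := h.one_le_j
  have h4 := h.j_le
  have e1 : G.Adj x (f 1) := by
    rw [← h.left.zero]; exact (h.left.adj_iff 0 1 (by omega) (by omega)).2 (Or.inl rfl)
  have hxy : G.Adj x y := by
    rw [← h.left.zero, ← h.left.last]
    exact (h.left.adj_iff 0 (n + 2) (by omega) (by omega)).2 (Or.inr ⟨rfl, rfl⟩)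
  have e2 := (h.adj_iff 1 j (by omega) (by omega) h3 h4).2 ⟨rfl, rfl⟩
  by_cases hj : j = m + 1
  · subst hj
    refine hG.sq x (f 1) (g (m + 1)) y ?_ ?_ e1 e2 ?_ hxy.symm
    · intro hx
      rw [← h.right.zero] at hx
      have := h.right.inj 0 (m + 1) (by omega) (by omega) hx
      omega
    · intro hy
      rw [← h.right.last] at hy
      exact h.ne 1 (m + 2) (by omega) (by omega) (by omega) hy
    · rw [← h.right.last]
      exact (h.right.adj_iff _ _ (by omega) (by omega)).2 (Or.inl rfl)
  · have hx0 : ({x} : Set V) = g '' Set.Icc 0 0 := by simp [h.right.zero]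
    have hx0' : ({x} : Set V) = f '' Set.Icc 0 0 := by simp [h.left.zero]
    have hsplit : f '' Set.Icc 2 (n + 2) = f '' Set.Icc 2 (n + 1) ∪ g '' Set.Icc (m + 2) (m + 2) := by
      rw [show g '' Set.Icc (m + 2) (m + 2) = f '' {n + 2} by simp [h.left.last, h.right.last],
        ← Set.image_union]
      congr 1
      ext k
      simp only [Set.mem_Icc, Set.mem_union, Set.mem_singleton_iff]
      omega
    refine hG.noTheta x (f 1) (g '' Set.Icc 1 j) (f '' Set.Icc 2 (n + 2)) ⟨e1,
      h.right.connSet h3 (by omega), h.left.connSet (by omega) le_rfl, ?_, ?_, ?_, ?_, ?_, ?_, ?_, ?_,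
      ?_, ?_⟩
    · rw [hsplit, Set.disjoint_union_right]
      exact ⟨(h.disjoint (by omega) le_rfl (by omega)).symm, h.right.disjoint (by omega) le_rfl⟩
    · rw [hsplit, touch_union_right, touch_comm, h.touch_iff (by omega) le_rfl le_rfl h4,
        h.right.touch_iff h3 (by omega) le_rfl le_rfl]
      omega
    · rw [← Set.disjoint_singleton_left, hx0]
      exact h.right.disjoint (by omega) (by omega)
    · rw [← Set.disjoint_singleton_left, hx0']
      exact h.left.disjoint (by omega) (by omega)
    · rintro ⟨t, ⟨h5, h6⟩, h7⟩
      exact h.ne 1 t (by omega) (by omega) (by omega) h7.symm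
    · rintro ⟨t, ⟨h5, h6⟩, h7⟩
      have := h.left.inj t 1 (by omega) (by omega) h7
      omega
    · rw [hx0, h.right.touch_iff le_rfl (by omega) (by omega) (by omega)]
      omega
    · rw [hx0', h.left.touch_iff le_rfl (by omega) (by omega) (by omega)]
      omega
    · exact ⟨_, rfl, _, ⟨j, ⟨h3, le_rfl⟩, rfl⟩, e2⟩
    · refine ⟨_, rfl, _, ⟨2, ⟨le_rfl, by omega⟩, rfl⟩,
        (h.left.adj_iff 1 2 (by omega) (by omega)).2 (Or.inl rfl)⟩

/-- Swapping the paths and reversing them turns `Ladder.two_le` into the statement that `x`, `y` and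
the ends of the rung cut the paths into four nonempty pieces. These are the four fat bags. -/
theorem Ladder.exists_pModel (h : Ladder G x y n f m g i j) (hG : Rigid G) :
    ∃ B, PModel G pattern8 15 B := by
  have h1 := h.two_le hG
  have h2 := h.swap.two_le hG
  have h3 := h.reverse.two_le hG
  have h4 := h.reverse.swap.two_le hG
  have hwf : WF pattern8 := (patternShape_of_shapeCheck shapeCheck_pattern8).wf
  let B : ℕ → Set V := fun
    | 0 => f '' Set.Icc 0 0
    | 1 => f '' Set.Icc i i
    | 2 => f '' Set.Icc (n + 2) (n + 2)
    | 3 => g '' Set.Icc j j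
    | 4 => f '' Set.Icc 1 (i - 1)
    | 5 => f '' Set.Icc (i + 1) (n + 1)
    | 6 => g '' Set.Icc (j + 1) (m + 1)
    | 7 => g '' Set.Icc 1 (j - 1)
    | _ => ∅
  have hx : f '' Set.Icc 0 0 = g '' Set.Icc 0 0 := by simp [h.left.zero, h.right.zero]
  have hy : f '' Set.Icc (n + 2) (n + 2) = g '' Set.Icc (m + 2) (m + 2) := by
    simp [h.left.last, h.right.last]
  have hlt : ∀ s t, t < s → s < 8 →
      Disjoint (B s) (B t) ∧ (Touch G (B s) (B t) ↔ bit pattern8 s t = true) := by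
    intro s t hts hs
    rw [touch_comm, disjoint_comm]
    have ff : ∀ {a b c d : ℕ} {p : Bool}, a ≤ b → b < c → c ≤ d → d ≤ n + 2 →
        (c = b + 1 ∨ (a = 0 ∧ d = n + 2) ↔ p = true) →
        Disjoint (f '' Set.Icc a b) (f '' Set.Icc c d) ∧
          (Touch G (f '' Set.Icc a b) (f '' Set.Icc c d) ↔ p = true) := fun h5 h6 h7 h8 h9 =>
      ⟨h.left.disjoint h6 h8, (h.left.touch_iff h5 h6 h7 h8).trans h9⟩
    have ff' : ∀ {a b c d : ℕ} {p : Bool}, a ≤ b → b < c → c ≤ d → d ≤ n + 2 →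
        (c = b + 1 ∨ (a = 0 ∧ d = n + 2) ↔ p = true) →
        Disjoint (f '' Set.Icc c d) (f '' Set.Icc a b) ∧
          (Touch G (f '' Set.Icc c d) (f '' Set.Icc a b) ↔ p = true) := fun h5 h6 h7 h8 h9 =>
      ⟨(h.left.disjoint h6 h8).symm, touch_comm.trans ((h.left.touch_iff h5 h6 h7 h8).trans h9)⟩
    have gg : ∀ {a b c d : ℕ} {p : Bool}, a ≤ b → b < c → c ≤ d → d ≤ m + 2 →
        (c = b + 1 ∨ (a = 0 ∧ d = m + 2) ↔ p = true) →
        Disjoint (g '' Set.Icc a b) (g '' Set.Icc c d) ∧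
          (Touch G (g '' Set.Icc a b) (g '' Set.Icc c d) ↔ p = true) := fun h5 h6 h7 h8 h9 =>
      ⟨h.right.disjoint h6 h8, (h.right.touch_iff h5 h6 h7 h8).trans h9⟩
    have gg' : ∀ {a b c d : ℕ} {p : Bool}, a ≤ b → b < c → c ≤ d → d ≤ m + 2 →
        (c = b + 1 ∨ (a = 0 ∧ d = m + 2) ↔ p = true) →
        Disjoint (g '' Set.Icc c d) (g '' Set.Icc a b) ∧
          (Touch G (g '' Set.Icc c d) (g '' Set.Icc a b) ↔ p = true) := fun h5 h6 h7 h8 h9 =>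
      ⟨(h.right.disjoint h6 h8).symm, touch_comm.trans ((h.right.touch_iff h5 h6 h7 h8).trans h9)⟩
    have fg : ∀ {a b c d : ℕ} {p : Bool}, 1 ≤ a → b ≤ n + 1 → 1 ≤ c → d ≤ m + 1 →
        ((a ≤ i ∧ i ≤ b) ∧ c ≤ j ∧ j ≤ d ↔ p = true) →
        Disjoint (f '' Set.Icc a b) (g '' Set.Icc c d) ∧
          (Touch G (f '' Set.Icc a b) (g '' Set.Icc c d) ↔ p = true) := fun h5 h6 h7 h8 h9 =>
      ⟨h.disjoint h5 h6 (by omega), (h.touch_iff h5 h6 h7 h8).trans h9⟩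
    have fg' : ∀ {a b c d : ℕ} {p : Bool}, 1 ≤ a → b ≤ n + 1 → 1 ≤ c → d ≤ m + 1 →
        ((a ≤ i ∧ i ≤ b) ∧ c ≤ j ∧ j ≤ d ↔ p = true) →
        Disjoint (g '' Set.Icc c d) (f '' Set.Icc a b) ∧
          (Touch G (g '' Set.Icc c d) (f '' Set.Icc a b) ↔ p = true) := fun h5 h6 h7 h8 h9 =>
      ⟨(h.disjoint h5 h6 (by omega)).symm, touch_comm.trans ((h.touch_iff h5 h6 h7 h8).trans h9)⟩
    have ht : ∀ {P : Prop} {p : Bool}, p = true → P → (P ↔ p = true) := fun h5 h6 =>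
      iff_of_true h6 h5
    have hf : ∀ {P : Prop} {p : Bool}, p = false → ¬ P → (P ↔ p = true) := fun h5 h6 =>
      iff_of_false h6 (by simp [h5])
    have hi := h.i_le
    have hj := h.j_le
    interval_cases s <;> interval_cases t <;> dsimp only [B]
    all_goals first
      | exact ff (by omega) (by omega) (by omega) (by omega)
          (by first | exact ht rfl (by omega) | exact hf rfl (by omega))
      | exact ff' (by omega) (by omega) (by omega) (by omega)
          (by first | exact ht rfl (by omega) | exact hf rfl (by omega))
      | exact fg (by omega) (by omega) (by omega) (by omega)
          (by first | exact ht rfl (by omega) | exact hf rfl (by omega))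
      | exact fg' (by omega) (by omega) (by omega) (by omega)
          (by first | exact ht rfl (by omega) | exact hf rfl (by omega))
      | (try rw [hx]
         try rw [hy]
         exact gg (by omega) (by omega) (by omega) (by omega)
          (by first | exact ht rfl (by omega) | exact hf rfl (by omega)))
      | (try rw [hy]
         exact gg' (by omega) (by omega) (by omega) (by omega)
          (by first | exact ht rfl (by omega) | exact hf rfl (by omega)))
  have hout : ∀ s, 8 ≤ s → B s = ∅ := by
    intro s hs
    obtain ⟨k, rfl⟩ := Nat.exists_eq_add_of_le hs
    rw [add_comm]
    rfl
  have hall : ∀ s t, t < s →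
      Disjoint (B s) (B t) ∧ (Touch G (B s) (B t) ↔ bit pattern8 s t = true) := by
    intro s t hts
    by_cases hs : s < 8
    · exact hlt s t hts hs
    · rw [hout s (by omega)]
      refine ⟨Set.empty_disjoint _, iff_of_false not_touch_empty_left fun hb => ?_⟩
      have : s < 8 := bit_lt_left hb
      omega
  have hi := h.i_le
  have hj := h.j_le
  refine ⟨B, fun s hs => ?_, fun s t hst => ?_, fun s t hst => ?_, fun s hs => ?_, hout⟩
  · have hs : s < 8 := hs
    interval_cases s
    · exact h.left.connSet le_rfl (by omega)
    · exact h.left.connSet le_rfl (by omega)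
    · exact h.left.connSet le_rfl (by omega)
    · exact h.right.connSet le_rfl (by omega)
    · exact h.left.connSet (by omega) (by omega)
    · exact h.left.connSet (by omega) (by omega)
    · exact h.right.connSet (by omega) (by omega)
    · exact h.right.connSet (by omega) (by omega)
  · rcases lt_or_gt_of_ne hst with h' | h'
    · exact (hall t s h').1.symm
    · exact (hall s t h').1
  · rw [hwf.adj_iff]
    rcases lt_or_gt_of_ne hst with h' | h'
    · rw [touch_comm, hwf.bit_comm]; exact (hall t s h').2
    · exact (hall s t h').2
  · have hs4 : s < 4 := lt_of_testBit_of_lt (n := 4) (by norm_num) hs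
    interval_cases s
    · exact ⟨f 0, by simp [B]⟩
    · exact ⟨f i, by simp [B]⟩
    · exact ⟨f (n + 2), by simp [B]⟩
    · exact ⟨g j, by simp [B]⟩

/-- An edge with both ends of degree at least three leads to the pattern with eight positions. -/
theorem Rigid.exists_pModel [Finite V] (hG : Rigid G) (hxy : G.Adj x y) (hx : 3 ≤ deg G x)
    (hy : 3 ≤ deg G y) : ∃ B, PModel G pattern8 15 B := by
  have hSc := hG.connSet_compl_pair hxy hx
  have htx : Touch G {x} ({x, y}ᶜ : Set V) := by
    obtain ⟨a, ha, hax, hay⟩ := exists_adj_of_three_le_deg₁ hx x y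
    exact ⟨x, rfl, a, by simp [hax, hay], ha⟩
  obtain ⟨n, f, m, g, hf, hg, hne, hcross⟩ := exists_indTracks hxy (S := {x, y}ᶜ) (by simp)
    (by simp) (exists_disjoint_connSet hSc htx (hG.exists_connSet_avoiding hxy hx hy))
  have hne' : ∀ s t, s ≤ n + 2 → 1 ≤ t → t ≤ m + 1 → f s ≠ g t := by
    intro s t hs ht ht' heq
    rcases Nat.eq_zero_or_pos s with rfl | hs0
    · rw [hf.zero, ← hg.zero] at heq
      have := hg.inj 0 t (by omega) (by omega) heq
      omega
    · by_cases hsn : s = n + 2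
      · rw [hsn, hf.last, ← hg.last] at heq
        have := hg.inj (m + 2) t (by omega) (by omega) heq
        omega
      · exact hne s t hs0 (by omega) (by omega) heq
  -- there are no crossing edges
  have hcr : ∀ s s' t t', 1 ≤ s → s < s' → s' ≤ n + 1 → 1 ≤ t' → t' < t → t ≤ m + 1 →
      G.Adj (f s) (g t) → ¬ G.Adj (f s') (g t') := by
    intro s s' t t' h1 h2 h3 h4 h5 h6 e1 e2
    obtain ⟨rfl, rfl⟩ := hcross s s' t t' h1 h2 h3 h4 h5 h6 e1 e2
    refine hG.sq (f s) (f (s + 1)) (g t') (g (t' + 1)) (hne _ _ h1 (by omega) (by omega))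
      (hne _ _ (by omega) h3 (by omega)) ((hf.adj_iff _ _ (by omega) (by omega)).2 (Or.inl rfl)) e2
      ((hg.adj_iff _ _ (by omega) (by omega)).2 (Or.inl rfl)) e1.symm
  -- there are no two parallel edges
  have hpar : ∀ s s' t t', 1 ≤ s → s ≤ s' → s' ≤ n + 1 → 1 ≤ t → t ≤ t' → t' ≤ m + 1 →
      G.Adj (f s) (g t) → G.Adj (f s') (g t') → s = s' ∧ t = t' := by
    intro s s' t t' h1 h2 h3 h4 h5 h6 e1 e2
    by_contra hcon
    have hs' : s < s' ∨ t < t' := by omega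
    have hff : ∀ p p', p < p' → p' ≤ n + 1 → G.Adj (f p) (f p') → p' = p + 1 := by
      intro p p' hp hp' e
      have := (hf.adj_iff p p' hp (by omega)).1 e
      omega
    have hgg : ∀ p p', p < p' → p' ≤ m + 1 → G.Adj (g p) (g p') → p' = p + 1 := by
      intro p p' hp hp' e
      have := (hg.adj_iff p p' hp (by omega)).1 e
      omega
    have h0 : f 0 = g 0 := hf.zero.trans hg.zero.symm
    -- One side goes back along both paths and meets at `x`; the other goes forward to the second
    -- edge, where one of its two pieces may be empty. An edge between the sides would cross the
    -- edge from `f s` to `g t`.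
    refine hG.noTheta (f s) (g t) (f '' Set.Icc 0 (s - 1) ∪ g '' Set.Icc 0 (t - 1))
      (f '' Set.Icc (s + 1) s' ∪ g '' Set.Icc (t + 1) t') ⟨e1, ?_, ?_, ?_, ?_, ?_, ?_, ?_, ?_, ?_, ?_,
      ?_, ?_⟩
    · exact (hf.connSet (by omega) (by omega)).union_of_inter (hg.connSet (by omega) (by omega))
        ⟨f 0, ⟨0, ⟨le_rfl, by omega⟩, rfl⟩, ⟨0, ⟨le_rfl, by omega⟩, h0.symm⟩⟩
    · by_cases hs : s < s'
      · by_cases ht : t < t'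
        · exact (hf.connSet hs (by omega)).union (hg.connSet ht (by omega))
            ⟨f s', ⟨s', ⟨hs, le_rfl⟩, rfl⟩, g t', ⟨t', ⟨ht, le_rfl⟩, rfl⟩, e2⟩
        · rw [Set.Icc_eq_empty (a := t + 1) (by omega), Set.image_empty, Set.union_empty]
          exact hf.connSet hs (by omega)
      · rw [Set.Icc_eq_empty (a := s + 1) (by omega), Set.image_empty, Set.empty_union]
        exact hg.connSet (by omega) (by omega)
    · rw [Set.disjoint_left]
      rintro _ (⟨p, ⟨hp, hp'⟩, rfl⟩ | ⟨p, ⟨hp, hp'⟩, rfl⟩) (⟨q, ⟨hq, hq'⟩, hpq⟩ | ⟨q, ⟨hq, hq'⟩, hpq⟩)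
      · have := hf.inj q p (by omega) (by omega) hpq
        omega
      · exact hne' p q (by omega) (by omega) (by omega) hpq.symm
      · exact hne q p (by omega) (by omega) (by omega) hpq
      · have := hg.inj q p (by omega) (by omega) hpq
        omega
    · rintro ⟨_, (⟨p, ⟨hp, hp'⟩, rfl⟩ | ⟨p, ⟨hp, hp'⟩, rfl⟩), _, (⟨q, ⟨hq, hq'⟩, rfl⟩ | ⟨q, ⟨hq, hq'⟩, rfl⟩),
        e⟩
      · have := hff p q (by omega) (by omega) e
        omega
      · rcases Nat.eq_zero_or_pos p with rfl | hp0
        · rw [h0] at e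
          have := hgg 0 q (by omega) (by omega) e
          omega
        · exact hcr p s q t hp0 (by omega) (by omega) h4 (by omega) (by omega) e e1
      · rcases Nat.eq_zero_or_pos p with rfl | hp0
        · rw [← h0] at e
          have := hff 0 q (by omega) (by omega) e
          omega
        · exact hcr s q t p h1 (by omega) (by omega) hp0 (by omega) (by omega) e1 e.symm
      · have := hgg p q (by omega) (by omega) e
        omega
    · rintro (⟨p, ⟨hp, hp'⟩, hpq⟩ | ⟨p, ⟨hp, hp'⟩, hpq⟩)
      · have := hf.inj p s (by omega) (by omega) hpq
        omega
      · exact hne s p h1 (by omega) (by omega) hpq.symm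
    · rintro (⟨p, ⟨hp, hp'⟩, hpq⟩ | ⟨p, ⟨hp, hp'⟩, hpq⟩)
      · have := hf.inj p s (by omega) (by omega) hpq
        omega
      · exact hne s p h1 (by omega) (by omega) hpq.symm
    · rintro (⟨p, ⟨hp, hp'⟩, hpq⟩ | ⟨p, ⟨hp, hp'⟩, hpq⟩)
      · exact hne' p t (by omega) (by omega) (by omega) hpq
      · have := hg.inj p t (by omega) (by omega) hpq
        omega
    · rintro (⟨p, ⟨hp, hp'⟩, hpq⟩ | ⟨p, ⟨hp, hp'⟩, hpq⟩)
      · exact hne' p t (by omega) (by omega) (by omega) hpq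
      · have := hg.inj p t (by omega) (by omega) hpq
        omega
    · exact ⟨_, rfl, f (s - 1), Or.inl ⟨s - 1, ⟨by omega, le_rfl⟩, rfl⟩,
        ((hf.adj_iff (s - 1) s (by omega) (by omega)).2 (Or.inl (by omega))).symm⟩
    · by_cases hs : s < s'
      · exact ⟨_, rfl, f (s + 1), Or.inl ⟨s + 1, ⟨le_rfl, hs⟩, rfl⟩,
          (hf.adj_iff s (s + 1) (by omega) (by omega)).2 (Or.inl rfl)⟩
      · have : s = s' := by omega
        subst this
        exact ⟨_, rfl, g t', Or.inr ⟨t', ⟨by omega, le_rfl⟩, rfl⟩, e2⟩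
    · exact ⟨_, rfl, g (t - 1), Or.inr ⟨t - 1, ⟨by omega, le_rfl⟩, rfl⟩,
        ((hg.adj_iff (t - 1) t (by omega) (by omega)).2 (Or.inl (by omega))).symm⟩
    · by_cases ht : t < t'
      · exact ⟨_, rfl, g (t + 1), Or.inr ⟨t + 1, ⟨le_rfl, ht⟩, rfl⟩,
          (hg.adj_iff t (t + 1) (by omega) (by omega)).2 (Or.inl rfl)⟩
      · have : t = t' := by omega
        subst this
        exact ⟨_, rfl, f s', Or.inl ⟨s', ⟨by omega, le_rfl⟩, rfl⟩, e2.symm⟩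
  obtain ⟨i, j, hi, hi', hj, hj', hij⟩ : ∃ i j, 1 ≤ i ∧ i ≤ n + 1 ∧ 1 ≤ j ∧ j ≤ m + 1 ∧
      G.Adj (f i) (g j) := by
    -- Without any edge between them, the two paths would form a theta with chord `x y`.
    by_contra! hcon
    have tx : ∀ {k h}, IndTrack G x y k h → Touch G {x} (h '' Set.Icc 1 (k + 1)) := fun hh =>
      ⟨x, rfl, _, ⟨1, ⟨le_rfl, by omega⟩, rfl⟩, by
        rw [← hh.zero]
        exact (hh.adj_iff 0 1 (by omega) (by omega)).2 (Or.inl rfl)⟩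
    have ty : ∀ {k h}, IndTrack G x y k h → Touch G {y} (h '' Set.Icc 1 (k + 1)) := fun {k} _ hh =>
      ⟨y, rfl, _, ⟨k + 1, ⟨by omega, le_rfl⟩, rfl⟩, by
        rw [← hh.last]
        exact ((hh.adj_iff (k + 1) (k + 2) (by omega) (by omega)).2 (Or.inl rfl)).symm⟩
    have nx : ∀ {k h}, IndTrack G x y k h → x ∉ h '' Set.Icc 1 (k + 1) := by
      rintro k h hh ⟨p, ⟨hp, hp'⟩, hpx⟩
      have := hh.inj p 0 (by omega) (by omega) (hpx.trans hh.zero.symm)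
      omega
    have ny : ∀ {k h}, IndTrack G x y k h → y ∉ h '' Set.Icc 1 (k + 1) := by
      rintro k h hh ⟨p, ⟨hp, hp'⟩, hpx⟩
      have := hh.inj p (k + 2) (by omega) (by omega) (hpx.trans hh.last.symm)
      omega
    refine hG.noTheta x y (f '' Set.Icc 1 (n + 1)) (g '' Set.Icc 1 (m + 1)) ⟨hxy,
      hf.connSet (by omega) (by omega), hg.connSet (by omega) (by omega), ?_, ?_, nx hf, nx hg,
      ny hf, ny hg, tx hf, tx hg, ty hf, ty hg⟩
    · rw [Set.disjoint_left]
      rintro _ ⟨p, ⟨hp, hp'⟩, rfl⟩ ⟨q, ⟨hq, hq'⟩, hpq⟩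
      exact hne p q hp hp' (by omega) hpq.symm
    · rintro ⟨_, ⟨p, ⟨hp, hp'⟩, rfl⟩, _, ⟨q, ⟨hq, hq'⟩, rfl⟩, e⟩
      exact hcon p q hp hp' hq hq' e
  have huniq : ∀ s t, 1 ≤ s → s ≤ n + 1 → 1 ≤ t → t ≤ m + 1 →
      (G.Adj (f s) (g t) ↔ s = i ∧ t = j) := by
    intro s t hs hs' ht ht'
    constructor
    · intro e
      rcases le_total s i with h1 | h1 <;> rcases le_total t j with h2 | h2
      · exact hpar s i t j hs h1 hi' ht h2 hj' e hij
      · by_cases h : s < i ∧ j < t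
        · exact (hcr s i t j hs h.1 hi' hj h.2 ht' e hij).elim
        · rcases eq_or_lt_of_le h1 with rfl | h1
          · have := hpar s s j t hs le_rfl hs' hj h2 ht' hij e
            omega
          · have : t = j := by omega
            subst this
            exact hpar s i t t hs h1.le hi' ht le_rfl ht' e hij
      · by_cases h : i < s ∧ t < j
        · exact (hcr i s j t hi h.1 hs' ht h.2 hj' hij e).elim
        · rcases eq_or_lt_of_le h1 with rfl | h1
          · exact hpar i i t j hs le_rfl hs' ht h2 hj' e hij
          · have : t = j := by omega
            subst this
            have := hpar i s t t hi h1.le hs' ht le_rfl ht' hij e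
            omega
      · have := hpar i s j t hi h1 hs' hj h2 ht' hij e
        omega
    · rintro ⟨rfl, rfl⟩
      exact hij
  exact Ladder.exists_pModel ⟨hf, hg, hne, hne', hi, hi', hj, hj', huniq⟩ hG

end Ladder

/-! ### Vertices of degree two -/

section Degrees

variable {V : Type*} {G : SimpleGraph V}

theorem exists_neighborSet_eq_of_deg_eq_two {u v : V} (h : deg G u = 2) (huv : G.Adj u v) :
    ∃ w, w ≠ v ∧ G.neighborSet u = {v, w} := by
  obtain ⟨a, b, hab, hs⟩ := Set.ncard_eq_two.1 h
  have : v ∈ ({a, b} : Set V) := hs ▸ huv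
  rcases this with rfl | hv
  · exact ⟨b, hab.symm, hs⟩
  · rw [Set.mem_singleton_iff] at hv
    subst hv
    exact ⟨a, hab, by rw [hs, Set.pair_comm]⟩

theorem Rigid.exists_adj_ne (hG : Rigid G) {v a b : V} (hva : v ≠ a) (hbv : b ≠ v) (hba : b ≠ a) :
    ∃ c, G.Adj v c ∧ c ≠ a := by
  by_contra! hcon
  have h : b ∈ ({a}ᶜ : Set V) := by simpa using hba
  refine hbv ((hG.cut₁ a).2 {v} (by simpa using hva.symm) ⟨v, rfl⟩ ?_ h)
  rintro x rfl y hy hxy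
  exact absurd (hcon y hxy) (by simpa using hy)

variable [Finite V]

/-- A vertex without a neighbour other than `c` would be separated from the remaining vertices by
`c`. -/
theorem Rigid.two_le_deg (hG : Rigid G) (h3 : 3 ≤ Nat.card V) (v : V) : 2 ≤ deg G v := by
  classical
  have key : ∀ a, ∃ b, b ≠ v ∧ b ≠ a := by
    intro a
    by_contra! hcon
    have : (Set.univ : Set V) ⊆ {v, a} := fun b _ => by
      by_cases hb : b = v
      · exact Or.inl hb
      · exact Or.inr (hcon b hb)
    have := (Set.ncard_le_ncard this (Set.toFinite _)).trans (Set.ncard_insert_le v {a})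
    rw [Set.ncard_univ, Set.ncard_singleton] at this
    omega
  obtain ⟨a, hav, -⟩ := key v
  obtain ⟨b, hbv, hba⟩ := key a
  obtain ⟨c, hc, -⟩ := hG.exists_adj_ne hav.symm hbv hba
  obtain ⟨b, hbv, hbc⟩ := key c
  obtain ⟨d, hd, hdc⟩ := hG.exists_adj_ne hc.ne hbv hbc
  have h : ({c, d} : Set V) ⊆ G.neighborSet v := by
    rintro z (rfl | rfl) <;> assumption
  have := Set.ncard_le_ncard h (Set.toFinite _)
  rwa [Set.ncard_pair hdc.symm] at this

/-- The edges leaving `T`, directed outwards. -/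
def outEdges (G : SimpleGraph V) (T : Set V) : Set (V × V) := {p | p.1 ∈ T ∧ p.2 ∉ T ∧ G.Adj p.1 p.2}

/-- In a sparse rigid graph that is not a cycle, vertices of degree two are pairwise nonadjacent. -/
theorem Rigid.not_adj_of_deg_eq_two (hG : Rigid G) (hc : G.Connected)
    (hsp : ∀ x y, G.Adj x y → 3 ≤ deg G x → ¬ 3 ≤ deg G y) (hd : ∀ v, 2 ≤ deg G v) {c : V}
    (hc3 : 3 ≤ deg G c) {u v : V} (hu : deg G u = 2) (hv : deg G v = 2) : ¬ G.Adj u v := by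
  classical
  intro huv
  -- A set of vertices of degree two grown from `u` and `v`. Adding an outside neighbour of degree
  -- two replaces a leaving edge by at most one other, so never more than two edges leave; a maximal
  -- set has all its outside neighbours of degree at least three.
  let P : Set V → Prop := fun T => u ∈ T ∧ v ∈ T ∧ (∀ t ∈ T, deg G t = 2) ∧
    (outEdges G T).ncard ≤ 2
  have hbase : P {u, v} := by
    obtain ⟨u', -, hu'⟩ := exists_neighborSet_eq_of_deg_eq_two hu huv
    obtain ⟨v', -, hv'⟩ := exists_neighborSet_eq_of_deg_eq_two hv huv.symm
    refine ⟨by simp, by simp, by rintro t (rfl | rfl) <;> assumption, ?_⟩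
    have hsub : outEdges G {u, v} ⊆ {(u, u'), (v, v')} := by
      rintro ⟨a, b⟩ ⟨ha, hb, hab⟩
      dsimp only at ha hb hab
      simp only [Set.mem_insert_iff, Set.mem_singleton_iff, not_or] at ha hb
      rcases ha with rfl | rfl
      · have : b ∈ ({v, u'} : Set V) := hu' ▸ hab
        rcases this with rfl | rfl
        · exact absurd rfl hb.2
        · exact Or.inl rfl
      · have : b ∈ ({u, v'} : Set V) := hv' ▸ hab
        rcases this with rfl | rfl
        · exact absurd rfl hb.1
        · exact Or.inr rfl
    refine (Set.ncard_le_ncard hsub (Set.toFinite _)).trans ((Set.ncard_insert_le _ _).trans ?_)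
    rw [Set.ncard_singleton]
  obtain ⟨T, ⟨huT, hvT, hT2, hTE⟩, hmax⟩ :=
    (Set.toFinite {T | P T}).exists_maximalFor Set.ncard _ ⟨_, hbase⟩
  have hbd : ∀ t ∈ T, ∀ w, w ∉ T → G.Adj t w → 3 ≤ deg G w := by
    intro t ht w hw htw
    by_contra hcon
    have hw2 : deg G w = 2 := by have := hd w; omega
    obtain ⟨w', -, hw'⟩ := exists_neighborSet_eq_of_deg_eq_two hw2 htw.symm
    have hsub : outEdges G (insert w T) ⊆ insert (w, w') (outEdges G T \ {(t, w)}) := by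
      rintro ⟨a, b⟩ ⟨ha, hb, hab⟩
      dsimp only at ha hb hab
      rw [Set.mem_insert_iff, not_or] at hb
      rcases ha with rfl | ha
      · left
        have : b ∈ ({t, w'} : Set V) := hw' ▸ hab
        rcases this with rfl | rfl
        · exact absurd ht hb.2
        · rfl
      · exact Or.inr ⟨⟨ha, hb.2, hab⟩, fun h => hb.1 (congrArg Prod.snd h)⟩
    have h1 := Set.ncard_le_ncard hsub (Set.toFinite _)
    have h2 := Set.ncard_insert_le (w, w') (outEdges G T \ {(t, w)})
    have h3 := Set.ncard_sdiff_singleton_lt_of_mem (s := outEdges G T) (a := (t, w)) ⟨ht, hw, htw⟩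
      (Set.toFinite _)
    have hP : P (insert w T) := ⟨Or.inr huT, Or.inr hvT, by
      rintro s (rfl | hs)
      · exact hw2
      · exact hT2 s hs, by omega⟩
    have h4 := Set.ncard_insert_of_notMem hw (Set.toFinite T)
    have := hmax hP (by omega)
    omega
  have hcT : c ∉ T := fun h => by have := hT2 c h; omega
  obtain ⟨s, hs, a, ⟨-, ha⟩, hsa⟩ := (connSet_univ_iff.2 hc).touch_diff (T := T) (Set.subset_univ _)
    ⟨u, huT⟩ ⟨c, trivial, hcT⟩
  have ha3 := hbd s hs a ha hsa
  -- three edges leaving `T` are too many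
  have hthree : ∀ p q r, p ∈ outEdges G T → q ∈ outEdges G T → r ∈ outEdges G T → p ≠ q → p ≠ r →
      q ≠ r → False := by
    intro p q r hp hq hr hpq hpr hqr
    have h : ({p, q, r} : Set (V × V)) ⊆ outEdges G T := by
      rintro z (rfl | rfl | rfl) <;> assumption
    have := Set.ncard_le_ncard h (Set.toFinite _)
    rw [Set.ncard_eq_three.2 ⟨p, q, r, hpq, hpr, hqr, rfl⟩] at this
    omega
  -- With two outside neighbours, these two form a proper 2-cutset separating `T`. With `a` alone,
  -- `T` is everything but `a`, and the degree of `a` would give three edges leaving `T`.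
  by_cases hb : ∃ b ∉ T, b ≠ a ∧ ∃ t ∈ T, G.Adj t b
  · obtain ⟨b, hbT, hba, t, ht, htb⟩ := hb
    have hb3 := hbd t ht b hbT htb
    have hone : ∀ r ∈ T, G.Adj a r → r = s := by
      intro r hr har
      by_contra hrs
      refine hthree (s, a) (r, a) (t, b) ⟨hs, ha, hsa⟩ ⟨hr, ha, har.symm⟩ ⟨ht, hbT, htb⟩ ?_ ?_ ?_
      · exact fun h => hrs (congrArg Prod.fst h).symm
      · exact fun h => hba (congrArg Prod.snd h).symm
      · exact fun h => hba (congrArg Prod.snd h).symm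
    have hnab : ¬ G.Adj a b := fun h => hsp a b h ha3 hb3
    obtain ⟨p, hap, hps, -⟩ := exists_adj_of_three_le_deg₁ ha3 s s
    obtain ⟨q, haq, hqs, hqp⟩ := exists_adj_of_three_le_deg₁ ha3 s p
    have hY : ∀ {p}, G.Adj a p → p ≠ s → p ∈ (T ∪ {a, b})ᶜ := by
      rintro p hap hps (h | rfl | h)
      · exact hps (hone p h hap)
      · exact hap.ne rfl
      · exact hnab (h ▸ hap)
    refine hG.cut₂ a b T (T ∪ {a, b})ᶜ hba.symm hnab ha3 hb3 ?_ ?_ ⟨u, huT, v, hvT, huv.ne⟩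
      ⟨p, hY hap hps, q, hY haq hqs, hqp.symm⟩ ?_
    · ext w
      simp only [Set.mem_union, Set.mem_compl_iff, Set.mem_insert_iff, Set.mem_singleton_iff]
      by_cases hw : w ∈ T
      · simp only [hw, true_or, true_iff]
        rintro (rfl | rfl)
        · exact ha hw
        · exact hbT hw
      · simp [hw]
    · rw [Set.disjoint_left]
      exact fun w hw hw' => hw' (Or.inl hw)
    · rintro ⟨r, hr, w, hw, hrw⟩
      have hw' : w ∉ T ∧ w ≠ a ∧ w ≠ b :=
        ⟨fun h => hw (Or.inl h), fun h => hw (Or.inr (Or.inl h)), fun h => hw (Or.inr (Or.inr h))⟩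
      refine hthree (s, a) (t, b) (r, w) ⟨hs, ha, hsa⟩ ⟨ht, hbT, htb⟩ ⟨hr, hw'.1, hrw⟩ ?_ ?_ ?_
      · exact fun h => hba (congrArg Prod.snd h).symm
      · exact fun h => hw'.2.1 (congrArg Prod.snd h).symm
      · exact fun h => hw'.2.2 (congrArg Prod.snd h).symm
  · push Not at hb
    have hTa : ({a} : Set V)ᶜ ⊆ T := by
      refine (hG.cut₁ a).2 T (fun t ht => ?_) ⟨u, huT⟩ fun x hx y hy hxy => ?_
      · rintro rfl; exact ha ht
      · by_contra hyT
        exact hb y hyT (by simpa using hy) x hx hxy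
    obtain ⟨p, hap, hps, -⟩ := exists_adj_of_three_le_deg₁ ha3 s s
    obtain ⟨q, haq, hqs, hqp⟩ := exists_adj_of_three_le_deg₁ ha3 s p
    refine hthree (s, a) (p, a) (q, a) ⟨hs, ha, hsa⟩ ⟨hTa hap.ne', ha, hap.symm⟩
      ⟨hTa haq.ne', ha, haq.symm⟩ ?_ ?_ ?_
    · exact fun h => hps (congrArg Prod.fst h).symm
    · exact fun h => hqs (congrArg Prod.fst h).symm
    · exact fun h => hqp (congrArg Prod.fst h).symm

end Degrees

/-! ### Rigid graphs are basic -/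

section Cycles

variable {V : Type*} {G : SimpleGraph V}

/-- A rigid graph with all degrees two is a cycle. -/
theorem Rigid.exists_iso_cycleGraph [Finite V] (hG : Rigid G) (hc : G.Connected) (hd : ∀ v, deg G v = 2) :
    ∃ n, Nonempty (G ≃g SimpleGraph.cycleGraph (n + 3)) := by
  obtain ⟨x⟩ := hc.nonempty
  obtain ⟨y, a, hya, hN⟩ := Set.ncard_eq_two.1 (hd x)
  have hxy : G.Adj x y := by rw [← SimpleGraph.mem_neighborSet, hN]; simp
  have hxa : G.Adj x a := by rw [← SimpleGraph.mem_neighborSet, hN]; simp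
  have haS : a ∈ ({x, y}ᶜ : Set V) := by simp [hxa.ne', hya.symm]
  have hsub := compIn_subset (G := G) (S := ({x, y}ᶜ : Set V)) a
  have hyD : Touch G {y} (compIn G ({x, y}ᶜ : Set V) a) := by
    by_contra hcon
    have hyx : y ∈ ({x}ᶜ : Set V) := by simpa using hxy.ne'
    have := (hG.cut₁ x).2 (compIn G ({x, y}ᶜ : Set V) a) (fun v hv h => hsub hv (Or.inl h))
      ⟨a, mem_compIn_self haS⟩ (fun v hv w hw hvw => by
        refine compIn_closed hv ?_ hvw
        rintro (rfl | rfl)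
        · exact hw rfl
        · exact hcon ⟨w, rfl, v, hv, hvw.symm⟩) hyx
    exact hsub this (Or.inr rfl)
  obtain ⟨n, f, ⟨h0, h1, h2, h3⟩, hinj, hind⟩ := exists_induced_track (connSet_compIn haS)
    ⟨x, rfl, a, mem_compIn_self haS, hxa⟩ hyD (fun h => hsub h (Or.inl rfl))
    (fun h => hsub h (Or.inr rfl)) hxy.ne
  have hlast : G.Adj (f (n + 2)) (f 0) := by rw [h0, h1]; exact hxy.symm
  have hadj : ∀ i j, i < j → j ≤ n + 2 → (G.Adj (f i) (f j) ↔ j = i + 1 ∨ i = 0 ∧ j = n + 2) := by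
    refine fun i j hij hj => ⟨hind i j hij hj, ?_⟩
    rintro (rfl | ⟨rfl, rfl⟩)
    · exact h3 i (by omega)
    · exact hlast.symm
  have hN2 : ∀ i b c, f b ≠ f c → G.Adj (f i) (f b) → G.Adj (f i) (f c) → ∀ w, G.Adj (f i) w →
      w = f b ∨ w = f c := by
    intro i b c hbc hb hc w hw
    by_contra! hcon
    have := three_le_deg hb hc hw hbc hcon.1.symm hcon.2.symm
    have := hd (f i)
    omega
  have hne : ∀ b c, b ≤ n + 2 → c ≤ n + 2 → b ≠ c → f b ≠ f c := fun b c hb hc h h' =>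
    h (hinj b c hb hc h')
  -- The track with its closing edge already uses both edges at each of its vertices, so it cannot
  -- be left and is the whole graph.
  have hall : ∀ v, ∃ i ≤ n + 2, f i = v := by
    intro v
    have := (connSet_univ_iff.2 hc).2 (f '' Set.Icc 0 (n + 2)) (Set.subset_univ _)
      ⟨f 0, 0, ⟨le_rfl, by omega⟩, rfl⟩ ?_ (Set.mem_univ v)
    · obtain ⟨i, hi, h⟩ := this
      exact ⟨i, hi.2, h⟩
    rintro _ ⟨i, ⟨-, hi⟩, rfl⟩ w - hw
    obtain ⟨b, c, hb, hc, hbc⟩ : ∃ b c, b ≤ n + 2 ∧ c ≤ n + 2 ∧ (w = f b ∨ w = f c) := by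
      by_cases hi0 : i = 0
      · subst hi0
        exact ⟨1, n + 2, by omega, by omega, hN2 0 1 (n + 2) (hne _ _ (by omega) le_rfl (by omega))
          (h3 0 (by omega)) hlast.symm w hw⟩
      by_cases hin : i = n + 2
      · subst hin
        exact ⟨n + 1, 0, by omega, by omega, hN2 (n + 2) (n + 1) 0
          (hne _ _ (by omega) (by omega) (by omega)) (h3 (n + 1) (by omega)).symm hlast w hw⟩
      · refine ⟨i + 1, i - 1, by omega, by omega, hN2 i (i + 1) (i - 1)
          (hne _ _ (by omega) (by omega) (by omega)) (h3 i (by omega)) ?_ w hw⟩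
        exact ((hadj (i - 1) i (by omega) hi).2 (Or.inl (by omega))).symm
    rcases hbc with rfl | rfl
    · exact ⟨b, ⟨by omega, hb⟩, rfl⟩
    · exact ⟨c, ⟨by omega, hc⟩, rfl⟩
  refine ⟨n, ⟨SimpleGraph.Iso.symm ⟨Equiv.ofBijective (fun i : Fin (n + 3) => f i) ⟨?_, ?_⟩, ?_⟩⟩⟩
  · intro i j hij
    exact Fin.ext (hinj i j (by omega) (by omega) hij)
  · intro v
    obtain ⟨i, hi, h⟩ := hall v
    exact ⟨⟨i, by omega⟩, h⟩
  · have key : ∀ i j : Fin (n + 3), i < j →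
        (G.Adj (f i) (f j) ↔ (SimpleGraph.cycleGraph (n + 3)).Adj i j) := by
      intro i j hij
      have hi := i.isLt
      have hj := j.isLt
      have hij' : (i : ℕ) < j := hij
      rw [hadj i j hij (by omega), SimpleGraph.cycleGraph_adj', Fin.sub_val_of_le hij.le,
        Fin.coe_sub_iff_lt.2 hij]
      omega
    intro i j
    change G.Adj (f i) (f j) ↔ _
    rcases lt_trichotomy i j with h | rfl | h
    · exact key i j h
    · simp
    · rw [G.adj_comm, key j i h, SimpleGraph.adj_comm]

theorem Rigid.not_cycleGraph_four (hG : Rigid G) : ¬ SimpleGraph.cycleGraph 4 ⊴ G := by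
  rintro ⟨f⟩
  have h : ∀ i j : Fin 4, (SimpleGraph.cycleGraph 4).Adj i j → G.Adj (f i) (f j) := fun i j =>
    f.map_adj_iff.2
  exact hG.sq (f 0) (f 1) (f 2) (f 3) (fun h => by simpa using f.injective h)
    (fun h => by simpa using f.injective h) (h _ _ (by decide)) (h _ _ (by decide))
    (h _ _ (by decide)) (h _ _ (by decide))

theorem cycleGraph_five_isIndContained_petersen : SimpleGraph.cycleGraph 5 ⊴ petersen :=
  ⟨⟨⟨Sum.inl, Sum.inl_injective⟩, by decide⟩⟩

theorem cycleGraph_six_isIndContained_petersen : SimpleGraph.cycleGraph 6 ⊴ petersen :=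
  ⟨⟨⟨![.inl 2, .inl 3, .inr 4, .inr 3, .inr 2, .inr 1], by decide⟩, by decide⟩⟩

/-- The position of the vertices of degree at least three decides. Two adjacent ones lead to the
Petersen or Heawood graph. If there are some but no two adjacent, the absence of adjacent vertices
of degree two makes the graph strongly 2-bipartite. If there are none, the graph is a cycle. -/
theorem Rigid.isBasic {V : Type u} [Finite V] {G : SimpleGraph V} (hG : Rigid G) (hc : G.Connected)
    (htop : G ≠ ⊤) : IsBasic G := by
  refine ⟨hc, Or.inr ?_⟩
  have h3 : 3 ≤ Nat.card V := by
    obtain ⟨a, b, hab, hn⟩ : ∃ a b, a ≠ b ∧ ¬ G.Adj a b := by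
      by_contra! hcon
      exact htop (eq_top_iff.2 fun a b hab => hcon a b hab)
    by_contra hcon
    have hu : ∀ c, c = a ∨ c = b := by
      intro c
      by_contra! h
      have := Set.ncard_le_ncard (Set.subset_univ ({a, b, c} : Set V)) (Set.toFinite _)
      rw [Set.ncard_eq_three.2 ⟨a, b, c, hab, h.1.symm, h.2.symm, rfl⟩, Set.ncard_univ] at this
      omega
    have := (connSet_univ_iff.2 hc).2 {a} (Set.subset_univ _) ⟨a, rfl⟩ ?_ (Set.mem_univ b)
    · exact hab this.symm
    · rintro x rfl y - hxy
      rcases hu y with h | rfl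
      · exact h
      · exact absurd hxy hn
  have hd := hG.two_le_deg h3
  by_cases hedge : ∃ x y, G.Adj x y ∧ 3 ≤ deg G x ∧ 3 ≤ deg G y
  · obtain ⟨x, y, hxy, hx, hy⟩ := hedge
    obtain ⟨B, hB⟩ := hG.exists_pModel hxy hx hy
    exact Or.inr (Or.inr (isIndContained_of_pattern8 hG hB))
  by_cases hbig : ∃ c, 3 ≤ deg G c
  · obtain ⟨c, hc3⟩ := hbig
    refine Or.inr (Or.inl ⟨hG.not_cycleGraph_four, ⟨?_, fun x y hxy => ?_⟩, ?_⟩)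
    · rw [Set.disjoint_left]
      intro v (hv : deg G v = 2) (hv' : 3 ≤ deg G v)
      omega
    · have h1 := hd x
      have h2 := hd y
      have h4 : ¬ (3 ≤ deg G x ∧ 3 ≤ deg G y) := fun h => hedge ⟨x, y, hxy, h⟩
      have h5 : ¬ (deg G x = 2 ∧ deg G y = 2) := fun h => hG.not_adj_of_deg_eq_two hc
        (fun a b hab ha hb => hedge ⟨a, b, hab, ha, hb⟩) hd hc3 h.1 h.2 hxy
      simp only [Set.mem_ofPred_eq]
      omega
    · ext v
      have := hd v
      simp only [Set.mem_union, Set.mem_ofPred_eq, Set.mem_univ, iff_true]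
      omega
  · push Not at hbig
    obtain ⟨n, ⟨e⟩⟩ := hG.exists_iso_cycleGraph hc fun v => by
      have := hd v; have := hbig v; omega
    have hadj : ∀ i j, (SimpleGraph.cycleGraph (n + 3)).Adj i j → G.Adj (e.symm i) (e.symm j) :=
      fun i j => e.symm.map_adj_iff.2
    -- The cycle has `n + 3` vertices. Lengths three and four are excluded by rigidity, and five and
    -- six occur inside the Petersen graph.
    rcases Nat.lt_or_ge n 4 with h4 | h4
    · interval_cases n
      · exact (hG.tri _ _ _ (hadj 0 1 (by decide)) (hadj 1 2 (by decide))
          (hadj 2 0 (by decide))).elim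
      · exact (hG.not_cycleGraph_four ⟨e.symm.toEmbedding⟩).elim
      · exact Or.inr (Or.inr (Or.inl (SimpleGraph.IsIndContained.trans ⟨e.toEmbedding⟩
          cycleGraph_five_isIndContained_petersen)))
      · exact Or.inr (Or.inr (Or.inl (SimpleGraph.IsIndContained.trans ⟨e.toEmbedding⟩
          cycleGraph_six_isIndContained_petersen)))
    · exact Or.inl ⟨n + 3, by omega, ⟨e⟩⟩

end Cycles

/-! ### Triangles and squares -/

section Reductions

variable {V : Type*} {G : SimpleGraph V} [Finite V]

/-- A connected graph without unique chords that has a triangle is complete or has a cutvertex. -/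
theorem NoTheta.eq_top_of_triangle (hG : NoTheta G) (hc : G.Connected)
    (hcut : ∀ v, ConnSet G {v}ᶜ) {x y z : V} (hxy : G.Adj x y) (hyz : G.Adj y z) (hzx : G.Adj z x) :
    G = ⊤ := by
  obtain ⟨K, ⟨hxK, hyK, hzK, hK⟩, hmax⟩ :=
    (Set.toFinite {K : Set V | x ∈ K ∧ y ∈ K ∧ z ∈ K ∧ G.IsClique K}).exists_maximalFor Set.ncard _
      ⟨{x, y, z}, by simp, by simp, by simp, by
        simp [SimpleGraph.isClique_iff, Set.Pairwise, hxy, hyz, hzx, hxy.symm, hyz.symm, hzx.symm]⟩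
  by_cases hKu : K = Set.univ
  · refine eq_top_iff.2 fun a b hab => hK (hKu ▸ Set.mem_univ a) (hKu ▸ Set.mem_univ b) hab
  exfalso
  obtain ⟨w, hw⟩ := (Set.ne_univ_iff_exists_notMem K).1 hKu
  have hwK : w ∈ Kᶜ := hw
  let P : Set V → Prop := fun Q => Q ⊆ Kᶜ ∧ ConnSet G Q ∧
    ∃ a ∈ K, ∃ b ∈ K, a ≠ b ∧ Touch G {a} Q ∧ Touch G {b} Q
  -- A component outside a maximal clique containing the triangle is attached to two of its
  -- vertices, since one alone would be a cutvertex.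
  have hP : P (compIn G Kᶜ w) := by
    have hclosed : ∀ c ∈ compIn G Kᶜ w, ∀ d, G.Adj c d → d ∉ K → d ∈ compIn G Kᶜ w :=
      fun c hc d hcd hd => compIn_closed hc hd hcd
    obtain ⟨c, hcC, k, hk, hck⟩ := (connSet_univ_iff.2 hc).touch_diff
      (Set.subset_univ (compIn G Kᶜ w)) ⟨w, mem_compIn_self hwK⟩
      ⟨x, trivial, fun h => compIn_subset _ h hxK⟩
    have hkK : k ∈ K := by
      by_contra hkK
      exact hk.2 (hclosed c hcC k hck hkK)
    refine ⟨compIn_subset w, connSet_compIn hwK, k, hkK, ?_⟩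
    by_contra! hcon
    have hsub := (hcut k).2 (compIn G Kᶜ w) (fun c hc => by
      rintro rfl
      exact compIn_subset _ hc hkK) ⟨w, mem_compIn_self hwK⟩ fun c hc d hd hcd => by
        refine hclosed c hc d hcd fun hdK => ?_
        exact hcon d hdK (Ne.symm hd) ⟨k, rfl, _, hcC, hck.symm⟩ ⟨d, rfl, c, hc, hcd.symm⟩
    have hmem : ∀ v ∈ K, v = k := by
      intro v hv
      by_contra hvk
      exact compIn_subset _ (hsub hvk) hv
    exact hxy.ne ((hmem x hxK).trans (hmem y hyK).symm)
  obtain ⟨Q, ⟨hQK, hQ, a, ha, b, hb, hab, haQ, hbQ⟩, hmin⟩ :=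
    (Set.toFinite {Q | P Q}).exists_minimalFor Set.ncard _ ⟨_, hP⟩
  have hsmall : ∀ R ⊆ Q, R ≠ Q → ConnSet G R → ∀ a ∈ K, ∀ b ∈ K, Touch G {a} R → Touch G {b} R →
      a = b := by
    intro R hRQ hne hR a ha b hb h1 h2
    by_contra hab
    have h3 := Set.ncard_lt_ncard (hRQ.ssubset_of_ne hne) (Set.toFinite _)
    have h4 := hmin (j := R) ⟨hRQ.trans hQK, hR, a, ha, b, hb, hab, h1, h2⟩ h3.le
    omega
  -- If a smallest such set `Q` saw all of `K`, there would be two cases. A single vertex would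
  -- enlarge the clique. A larger `Q` splits into a vertex and a connected rest, and two of the
  -- three vertices `x`, `y`, `z` are attached to the same part, against minimality.
  obtain ⟨c, hc, hcQ⟩ : ∃ c ∈ K, ¬ Touch G {c} Q := by
    by_contra! hall
    rcases Q.subsingleton_or_nontrivial with hs | hnt
    · obtain ⟨q, rfl⟩ := hs.eq_empty_or_singleton.resolve_left hQ.1.ne_empty
      have hqK : q ∉ K := hQK rfl
      have h1 := Set.ncard_lt_ncard (Set.ssubset_insert hqK) (Set.toFinite _)
      have h2 := hmax (j := insert q K) ⟨Or.inr hxK, Or.inr hyK, Or.inr hzK, by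
        rw [SimpleGraph.isClique_insert]
        exact ⟨hK, fun v hv _ => (touch_singleton_singleton.1 (hall v hv)).symm⟩⟩ h1.le
      omega
    · obtain ⟨u, hu, hQu⟩ := hQ.exists_diff_singleton (Set.toFinite _) hnt
      have h1 : ∀ v ∈ K, Touch G {v} {u} ∨ Touch G {v} (Q \ {u}) := by
        intro v hv
        rw [← touch_union_right, Set.union_sdiff_cancel (by simpa using hu)]
        exact hall v hv
      have h2 := hsmall {u} (by simpa using hu) (fun h => by
        rw [← h] at hnt; exact Set.not_nontrivial_singleton hnt) (connSet_singleton u)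
      have h3 := hsmall (Q \ {u}) Set.sdiff_subset (fun h => by
        rw [← h] at hu; exact hu.2 rfl) hQu
      rcases h1 x hxK with hx | hx <;> rcases h1 y hyK with hy | hy <;>
        rcases h1 z hzK with hz | hz
      all_goals first
        | exact hxy.ne (h2 x hxK y hyK hx hy)
        | exact hxy.ne (h3 x hxK y hyK hx hy)
        | exact hyz.ne (h2 y hyK z hzK hy hz)
        | exact hyz.ne (h3 y hyK z hzK hy hz)
        | exact hzx.ne (h2 z hzK x hxK hz hx)
        | exact hzx.ne (h3 z hzK x hxK hz hx)
  have hca : c ≠ a := by rintro rfl; exact hcQ haQ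
  have hcb : c ≠ b := by rintro rfl; exact hcQ hbQ
  -- The chord joins two vertices of the clique attached to `Q`; the vertex `c`, not attached to
  -- `Q`, is the other side.
  refine hG a b Q {c} ⟨hK ha hb hab, hQ, connSet_singleton c, ?_, fun h => hcQ h.symm,
    fun h => hQK h ha, hca.symm, fun h => hQK h hb, hcb.symm, haQ,
    touch_singleton_singleton.2 (hK ha hc hca.symm), hbQ,
    touch_singleton_singleton.2 (hK hb hc hcb.symm)⟩
  rw [Set.disjoint_singleton_right]
  exact fun h => hQK h hc

/-- A triangle-free graph without unique chords that has a square has a proper 1-join. -/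
theorem NoTheta.exists_join (hG : NoTheta G)
    (htri : ∀ x y z, G.Adj x y → G.Adj y z → G.Adj z x → False) {x y z w : V} (hxz : x ≠ z)
    (hyw : y ≠ w) (hxy : G.Adj x y) (hyz : G.Adj y z) (hzw : G.Adj z w) (hwx : G.Adj w x) :
    ∃ X A B : Set V, A.Nontrivial ∧ B.Nontrivial ∧ A ⊆ X ∧ B ⊆ Xᶜ ∧
      ∀ a ∈ X, ∀ b ∈ Xᶜ, G.Adj a b ↔ a ∈ A ∧ b ∈ B := by
  let P : Set V × Set V → Prop := fun D => D.1.Nontrivial ∧ D.2.Nontrivial ∧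
    ∀ a ∈ D.1, ∀ b ∈ D.2, G.Adj a b
  have hbase : P ({x, z}, {y, w}) := by
    refine ⟨Set.nontrivial_pair hxz, Set.nontrivial_pair hyw, ?_⟩
    rintro a (rfl | rfl) b (rfl | rfl)
    exacts [hxy, hwx.symm, hyz.symm, hzw]
  -- The square is extended to a largest complete bipartite pair, so that every other vertex misses
  -- some vertex of `A` and some vertex of `B`.
  obtain ⟨⟨A, B⟩, ⟨hA, hB, hAB⟩, hmax⟩ := (Set.toFinite {D | P D}).exists_maximalFor
    (fun D => D.1.ncard + D.2.ncard) _ ⟨_, hbase⟩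
  dsimp only at hA hB hAB hmax
  have hdAB : ∀ v, v ∈ A → v ∉ B := fun v hv hv' => G.irrefl (hAB v hv v hv')
  have hfullA : ∀ v, v ∉ A ∪ B → ∃ a ∈ A, ¬ G.Adj v a := by
    intro v hv
    by_contra! hcon
    have h2 := Set.ncard_insert_of_notMem (fun h => hv (Or.inr h)) (Set.toFinite B)
    have h3 := hmax (j := (A, insert v B)) ⟨hA, hB.mono (Set.subset_insert _ _), by
      rintro a ha b (rfl | hb)
      · exact (hcon a ha).symm
      · exact hAB a ha b hb⟩ (by dsimp only; omega)
    dsimp only at h3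
    omega
  have hfullB : ∀ v, v ∉ A ∪ B → ∃ b ∈ B, ¬ G.Adj v b := by
    intro v hv
    by_contra! hcon
    have h2 := Set.ncard_insert_of_notMem (fun h => hv (Or.inl h)) (Set.toFinite A)
    have h3 := hmax (j := (insert v A, B)) ⟨hA.mono (Set.subset_insert _ _), hB, by
      rintro a (rfl | ha) b hb
      · exact hcon b hb
      · exact hAB a ha b hb⟩ (by dsimp only; omega)
    dsimp only at h3
    omega
  -- No connected set outside `A` and `B` is attached to both. A smallest one has a single vertex
  -- `u` attached to `A` and a single vertex `v` attached to `B`; a vertex `a'` missed by `u` and a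
  -- vertex `b'` missed by `v` are then not attached to it at all.
  have hsep : ∀ Q ⊆ (A ∪ B)ᶜ, ConnSet G Q → Touch G Q A → ¬ Touch G Q B := by
    intro Q₀ hQ₀ hQ₀c h1 h2
    obtain ⟨Q, ⟨hQ, hQc, hQA, hQB⟩, hmin⟩ :=
      (Set.toFinite {Q | Q ⊆ (A ∪ B)ᶜ ∧ ConnSet G Q ∧ Touch G Q A ∧ Touch G Q B}).exists_minimalFor
        Set.ncard _ ⟨Q₀, hQ₀, hQ₀c, h1, h2⟩
    have hmin' : ∀ R ⊆ Q, ConnSet G R → Touch G R A → Touch G R B → R = Q := by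
      intro R hR hRc hRA hRB
      by_contra hne
      have h3 := Set.ncard_lt_ncard (hR.ssubset_of_ne hne) (Set.toFinite _)
      have h4 := hmin (j := R) ⟨hR.trans hQ, hRc, hRA, hRB⟩ h3.le
      omega
    -- only one vertex of `Q` is attached to each side
    have key : ∀ C D : Set V, (∀ R ⊆ Q, ConnSet G R → Touch G R C → Touch G R D → R = Q) →
        (∀ u, Touch G {u} C → Touch G {u} D → False) → ∀ u ∈ Q, Touch G {u} C →
          ∀ v ∈ Q, Touch G {v} D → ¬ Touch G (Q \ {v}) D := by
      intro C D hm hne u hu huC v hv hvD hcon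
      have huv : u ∈ Q \ {v} := ⟨hu, by rintro rfl; exact hne u huC hvD⟩
      have hsub := compIn_subset (G := G) (S := Q \ {v}) u
      obtain ⟨r, hr, s, hs, hrs⟩ := hQc.touch_diff (hsub.trans Set.sdiff_subset)
        ⟨u, mem_compIn_self huv⟩ ⟨v, hv, fun h => (hsub h).2 rfl⟩
      have hsv : s = v := by
        by_contra hsv
        exact hs.2 (compIn_closed hr ⟨hs.1, hsv⟩ hrs)
      subst hsv
      have h1 := hm (insert s (compIn G (Q \ {s}) u))
        (Set.insert_subset hv (hsub.trans Set.sdiff_subset))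
        ((connSet_compIn huv).insert ⟨r, hr, hrs.symm⟩)
        (huC.mono (by simpa using Or.inr (mem_compIn_self huv)) subset_rfl)
        (hvD.mono (by simp) subset_rfl)
      have h2 : Q \ {s} = compIn G (Q \ {s}) u := by
        refine Set.Subset.antisymm (fun q hq => ?_) hsub
        rw [← h1] at hq
        exact hq.1.resolve_left hq.2
      have h3 := hm (Q \ {s}) Set.sdiff_subset (h2 ▸ connSet_compIn huv)
        (huC.mono (by simpa using huv) subset_rfl) hcon
      rw [← h3] at hv
      exact hv.2 rfl
    have hno : ∀ u, Touch G {u} A → Touch G {u} B → False := by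
      intro u h1 h2
      obtain ⟨a, ha, hua⟩ := touch_singleton_left.1 h1
      obtain ⟨b, hb, hub⟩ := touch_singleton_left.1 h2
      exact htri u a b hua (hAB a ha b hb) hub.symm
    obtain ⟨u, hu, a, ha, hua⟩ := hQA
    obtain ⟨v, hv, b, hb, hvb⟩ := hQB
    have huA : Touch G {u} A := ⟨u, rfl, a, ha, hua⟩
    have hvB : Touch G {v} B := ⟨v, rfl, b, hb, hvb⟩
    have k1 := key A B hmin' hno u hu huA v hv hvB
    have k2 := key B A (fun R h1 h2 h3 h4 => hmin' R h1 h2 h4 h3) (fun u h1 h2 => hno u h2 h1)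
      v hv hvB u hu huA
    obtain ⟨a', ha', hua'⟩ := hfullA u (hQ hu)
    obtain ⟨b', hb', hvb'⟩ := hfullB v (hQ hv)
    have haQ : ∀ q ∈ Q, ¬ G.Adj q a' := by
      intro q hq hqa
      by_cases hqu : q = u
      · exact hua' (hqu ▸ hqa)
      · exact k2 ⟨q, ⟨hq, hqu⟩, a', ha', hqa⟩
    have hbQ : ∀ q ∈ Q, ¬ G.Adj q b' := by
      intro q hq hqb
      by_cases hqv : q = v
      · exact hvb' (hqv ▸ hqb)
      · exact k1 ⟨q, ⟨hq, hqv⟩, b', hb', hqb⟩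
    have haa : a ≠ a' := by rintro rfl; exact hua' hua
    have hbb : b ≠ b' := by rintro rfl; exact hvb' hvb
    -- The chord `a b` lies in the complete bipartite pair; its sides are `Q` and the edge `a' b'`.
    refine hG a b Q {a', b'} ⟨hAB a ha b hb, hQc, connSet_pair (hAB a' ha' b' hb'), ?_, ?_,
      fun h => hQ h (Or.inl ha), ?_, fun h => hQ h (Or.inr hb), ?_, ⟨a, rfl, u, hu, hua.symm⟩,
      ⟨a, rfl, b', by simp, hAB a ha b' hb'⟩, ⟨b, rfl, v, hv, hvb.symm⟩,
      ⟨b, rfl, a', by simp, (hAB a' ha' b hb).symm⟩⟩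
    · rw [Set.disjoint_right]
      rintro q (rfl | rfl) hq
      · exact hQ hq (Or.inl ha')
      · exact hQ hq (Or.inr hb')
    · rintro ⟨q, hq, r, rfl | rfl, hqr⟩
      · exact haQ q hq hqr
      · exact hbQ q hq hqr
    · rintro (h | rfl)
      · exact haa h
      · exact hdAB _ ha hb'
    · rintro (rfl | h)
      · exact hdAB _ ha' hb
      · exact hbb h
  -- One side of the 1-join is `A` with all components of the rest attached to `A`.
  refine ⟨{v | v ∈ A ∨ v ∈ (A ∪ B)ᶜ ∧ Touch G (compIn G (A ∪ B)ᶜ v) A}, A, B, hA, hB,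
    fun a ha => Or.inl ha, fun b hb h => ?_, fun a ha b hb => ⟨fun hab => ?_, fun h =>
      hAB a h.1 b h.2⟩⟩
  · rcases h with h | h
    · exact hdAB b h hb
    · exact h.1 (Or.inr hb)
  · have hb' : b ∉ A ∧ (b ∈ (A ∪ B)ᶜ → ¬ Touch G (compIn G (A ∪ B)ᶜ b) A) :=
      ⟨fun h => hb (Or.inl h), fun h h' => hb (Or.inr ⟨h, h'⟩)⟩
    rcases ha with ha | ⟨ha, hat⟩
    · refine ⟨ha, ?_⟩
      by_contra hbB
      have hbc : b ∈ (A ∪ B)ᶜ := fun h => h.elim hb'.1 hbB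
      exact hb'.2 hbc ⟨b, mem_compIn_self hbc, a, ha, hab.symm⟩
    · exfalso
      by_cases hbB : b ∈ B
      · exact hsep _ (compIn_subset a) (connSet_compIn ha) hat ⟨a, mem_compIn_self ha, b, hbB, hab⟩
      · have hbc : b ∈ (A ∪ B)ᶜ := fun h => h.elim hb'.1 hbB
        refine hb'.2 hbc (hat.mono ?_ subset_rfl)
        exact subset_compIn (connSet_compIn ha) (compIn_subset a) (mem_compIn_self ha)
          (compIn_closed (mem_compIn_self hbc) ha hab.symm)

end Reductions

/-! ### Reversing disjoint union, cutvertex and 1-join -/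

section Decompositions

variable {V : Type u} {G : SimpleGraph V}

/-- Disconnected graphs are disjoint unions. -/
theorem Constructible.of_separation (X : Set V) (hX : ¬ Touch G X Xᶜ)
    (h₁ : Constructible (G.induce X)) (h₂ : Constructible (G.induce Xᶜ)) : Constructible G := by
  classical
  refine (h₁.op0 h₂).iso ⟨Equiv.Set.sumCompl X, ?_⟩
  rintro (x | x) (y | y)
  · simp
  · simpa using fun h => hX ⟨x, x.2, y, y.2, h⟩
  · simpa using fun h => hX ⟨y, y.2, x, x.2, h.symm⟩
  · simp

/-- Decomposition along a cutvertex. -/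
theorem Constructible.of_cutvertex {v : V} (X : Set V) (hv : v ∉ X)
    (hX : ∀ x ∈ X, ∀ y ∈ Xᶜ, G.Adj x y → y = v) (h₁ : Constructible (G.induce (insert v X)))
    (h₂ : Constructible (G.induce Xᶜ)) : Constructible G := by
  have h1 : ∀ x : {x : ↥(insert v X) // x ≠ ⟨v, Or.inl rfl⟩}, x.1.1 ∈ X := fun x =>
    x.1.2.resolve_left fun h => x.2 (Subtype.ext h)
  have h2 : ∀ y : {y : ↥Xᶜ // y ≠ ⟨v, hv⟩}, y.1.1 ≠ v := fun y h => y.2 (Subtype.ext h)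
  refine (h₁.op1 h₂ ⟨v, Or.inl rfl⟩ ⟨v, hv⟩).iso ⟨Equiv.ofBijective
    (Sum.elim (Sum.elim (fun x => x.1.1) fun y => y.1.1) fun _ => v) ⟨?_, ?_⟩, ?_⟩
  · rintro ((x | x) | _) ((y | y) | _) h
    · exact congrArg (Sum.inl ∘ Sum.inl) (Subtype.ext (Subtype.ext h))
    · exact absurd (Set.mem_of_eq_of_mem h.symm (h1 x) : y.1.1 ∈ X) y.1.2
    · exact absurd (Set.mem_of_eq_of_mem h.symm (h1 x) : v ∈ X) hv
    · exact absurd (Set.mem_of_eq_of_mem h (h1 y) : x.1.1 ∈ X) x.1.2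
    · exact congrArg (Sum.inl ∘ Sum.inr) (Subtype.ext (Subtype.ext h))
    · exact absurd h (h2 x)
    · exact absurd (Set.mem_of_eq_of_mem h (h1 y) : v ∈ X) hv
    · exact absurd h.symm (h2 y)
    · rfl
  · intro w
    by_cases hwv : w = v
    · exact ⟨.inr (), hwv.symm⟩
    by_cases hwX : w ∈ X
    · exact ⟨.inl (.inl ⟨⟨w, Or.inr hwX⟩, fun h => hwv (congrArg Subtype.val h)⟩), rfl⟩
    · exact ⟨.inl (.inr ⟨⟨w, hwX⟩, fun h => hwv (congrArg Subtype.val h)⟩), rfl⟩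
  · rintro ((x | x) | _) ((y | y) | _)
    · exact Iff.rfl
    · exact iff_of_false (fun h => h2 y (hX _ (h1 x) _ y.1.2 h)) id
    · exact G.adj_comm _ _
    · exact iff_of_false (fun h => h2 x (hX _ (h1 y) _ x.1.2 h.symm)) id
    · exact Iff.rfl
    · exact G.adj_comm _ _
    · exact Iff.rfl
    · exact Iff.rfl
    · exact iff_of_false G.irrefl id

theorem two_le_deg_of_adj [Finite V] {x a b : V} (hab : a ≠ b) (ha : G.Adj x a) (hb : G.Adj x b) :
    2 ≤ deg G x := by
  have h : ({a, b} : Set V) ⊆ G.neighborSet x := by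
    rintro z (rfl | rfl) <;> assumption
  have := Set.ncard_le_ncard h (Set.toFinite _)
  rwa [Set.ncard_pair hab] at this

/-- Decomposition along a 1-join. -/
theorem Constructible.of_join [Finite V]
    (htri : ∀ x y z, G.Adj x y → G.Adj y z → G.Adj z x → False) {X A B : Set V}
    (hA : A.Nontrivial) (hB : B.Nontrivial) (hAX : A ⊆ X) (hBX : B ⊆ Xᶜ)
    (hAB : ∀ a ∈ X, ∀ b ∈ Xᶜ, G.Adj a b ↔ a ∈ A ∧ b ∈ B) {a b : V} (ha : a ∈ A) (hb : b ∈ B)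
    (h₁ : Constructible (G.induce (insert b X)))
    (h₂ : Constructible (G.induce (insert a Xᶜ))) : Constructible G := by
  have hadj : ∀ a ∈ A, ∀ b ∈ B, G.Adj a b := fun a ha b hb =>
    (hAB a (hAX ha) b (hBX hb)).2 ⟨ha, hb⟩
  have hstab : ∀ (S : Set V) (p : S), (G.induce S).IsIndepSet ((G.induce S).neighborSet p) :=
    fun S p x hx y hy _ hxy => htri p x y hx hxy hy.symm
  obtain ⟨a₁, ha₁, a₂, ha₂, ha₁₂⟩ := hA
  obtain ⟨b₁, hb₁, b₂, hb₂, hb₁₂⟩ := hB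
  have hd₁ : 2 ≤ deg (G.induce (insert b X)) ⟨b, Or.inl rfl⟩ :=
    two_le_deg_of_adj (a := ⟨a₁, Or.inr (hAX ha₁)⟩) (b := ⟨a₂, Or.inr (hAX ha₂)⟩)
      (fun h => ha₁₂ (congrArg Subtype.val h)) (hadj a₁ ha₁ b hb).symm (hadj a₂ ha₂ b hb).symm
  have hd₂ : 2 ≤ deg (G.induce (insert a Xᶜ)) ⟨a, Or.inl rfl⟩ :=
    two_le_deg_of_adj (a := ⟨b₁, Or.inr (hBX hb₁)⟩) (b := ⟨b₂, Or.inr (hBX hb₂)⟩)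
      (fun h => hb₁₂ (congrArg Subtype.val h)) (hadj a ha b₁ hb₁) (hadj a ha b₂ hb₂)
  have h1 : ∀ x : {x : ↥(insert b X) // x ≠ ⟨b, Or.inl rfl⟩}, x.1.1 ∈ X := fun x =>
    x.1.2.resolve_left fun h => x.2 (Subtype.ext h)
  have h2 : ∀ y : {y : ↥(insert a Xᶜ) // y ≠ ⟨a, Or.inl rfl⟩}, y.1.1 ∈ Xᶜ := fun y =>
    y.1.2.resolve_left fun h => y.2 (Subtype.ext h)
  -- The representative `b` sees exactly the vertices of `A` in `X`, and `a` sees exactly those of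
  -- `B` in the complement. So the edges restored by the gluing are the pairs in `A` and `B`.
  have key : ∀ x ∈ X, ∀ y ∈ Xᶜ, G.Adj x y ↔ G.Adj b x ∧ G.Adj a y := by
    intro x hx y hy
    rw [hAB x hx y hy, G.adj_comm b x, hAB x hx b (hBX hb), hAB a (hAX ha) y hy]
    tauto
  refine (h₁.op2 h₂ ⟨b, Or.inl rfl⟩ ⟨a, Or.inl rfl⟩ (hstab _ _) hd₁ (hstab _ _) hd₂).iso
    ⟨Equiv.ofBijective (Sum.elim (fun x => x.1.1) fun y => y.1.1) ⟨?_, ?_⟩, ?_⟩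
  · rintro (x | x) (y | y) h
    · exact congrArg Sum.inl (Subtype.ext (Subtype.ext h))
    · exact absurd (Set.mem_of_eq_of_mem h.symm (h1 x) : y.1.1 ∈ X) (h2 y)
    · exact absurd (Set.mem_of_eq_of_mem h (h1 y) : x.1.1 ∈ X) (h2 x)
    · exact congrArg Sum.inr (Subtype.ext (Subtype.ext h))
  · intro w
    by_cases hwX : w ∈ X
    · exact ⟨.inl ⟨⟨w, Or.inr hwX⟩, fun h => hBX hb (Set.mem_of_eq_of_mem (congrArg Subtype.val h).symm hwX)⟩, rfl⟩
    · exact ⟨.inr ⟨⟨w, Or.inr hwX⟩, fun h => hwX (Set.mem_of_eq_of_mem (congrArg Subtype.val h) (hAX ha))⟩, rfl⟩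
  · rintro (x | x) (y | y)
    · exact Iff.rfl
    · exact key _ (h1 x) _ (h2 y)
    · exact (G.adj_comm _ _).trans (key _ (h1 y) _ (h2 x))
    · exact Iff.rfl

end Decompositions

/-! ### Capping the sides of a 2-cutset -/

section Cap

variable {V : Type u} {G : SimpleGraph V} {S : Set V} {a b : V}

/-- The graph induced on `S` with a new vertex adjacent to `a` and `b`. -/
def addCap (G : SimpleGraph V) (S : Set V) (a b : V) : SimpleGraph (Option S) where
  Adj
    | some x, some y => G.Adj x y
    | none, some x => x = a ∨ x = b
    | some x, none => x = a ∨ x = b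
    | none, none => False
  symm := ⟨by
    rintro (_ | x) (_ | y) h
    all_goals first | exact h | exact h.symm⟩
  loopless := ⟨by
    rintro (_ | x) h
    · exact h
    · exact G.irrefl h⟩

theorem addCap_adj_some_some {x y : S} : (addCap G S a b).Adj (some x) (some y) ↔ G.Adj x y :=
  Iff.rfl

theorem addCap_adj_none_some {x : S} : (addCap G S a b).Adj none (some x) ↔ (x : V) = a ∨ (x : V) = b :=
  Iff.rfl

theorem neighborSet_addCap_none (ha : a ∈ S) (hb : b ∈ S) :
    (addCap G S a b).neighborSet none = {some ⟨a, ha⟩, some ⟨b, hb⟩} := by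
  ext (_ | x)
  · simp
  · rw [SimpleGraph.mem_neighborSet, addCap_adj_none_some]
    simp [Subtype.ext_iff]

theorem deg_addCap [Finite V] {x : S} (hx : (x : V) = a ∨ (x : V) = b) :
    deg (addCap G S a b) (some x) = (S ∩ G.neighborSet x).ncard + 1 := by
  have h : (addCap G S a b).neighborSet (some x) =
      insert none (some '' (Subtype.val ⁻¹' G.neighborSet (x : V))) := by
    ext (_ | y)
    · simp only [SimpleGraph.mem_neighborSet, Set.mem_insert_iff, true_or, iff_true]
      exact hx
    · simp [addCap_adj_some_some]
  rw [deg, h, Set.ncard_insert_of_notMem (by simp), Set.ncard_image_of_injective _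
    (Option.some_injective _), ← Set.ncard_image_of_injective _ Subtype.val_injective,
    Subtype.image_preimage_coe]

/-- Capping preserves the absence of unique chords if the cap can be routed outside. -/
theorem NoTheta.addCap (hG : NoTheta G) {C : Set V} (hC : ConnSet G C) (hCS : Disjoint S C)
    (htouch : ∀ s ∈ S, Touch G {s} C ↔ s = a ∨ s = b) : NoTheta (addCap G S a b) := by
  let B : Option S → Set V := fun o => o.elim C fun s => {s.1}
  have hB : Model G (UniqueChord.addCap G S a b) B := by
    refine ⟨?_, ?_, ?_⟩
    · rintro (_ | x) - -
      · exact hC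
      · exact connSet_singleton _
    · rintro (_ | x) (_ | y) h
      · exact absurd rfl h
      · exact Set.disjoint_singleton_right.2 (Set.disjoint_left.1 hCS y.2)
      · exact Set.disjoint_singleton_left.2 (Set.disjoint_left.1 hCS x.2)
      · refine Set.disjoint_singleton.2 fun h' => h ?_
        rw [Subtype.ext h']
    · rintro (_ | x) (_ | y) h
      · exact absurd rfl h
      · exact touch_comm.trans (htouch y y.2)
      · exact htouch x x.2
      · exact touch_singleton_singleton
  -- The cap has only two neighbours. If it were an end of the chord, one of them would be the other
  -- end, and both sides would have to share the remaining one.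
  have hnone : ∀ {y D₁ D₂}, ¬ Theta (UniqueChord.addCap G S a b) none y D₁ D₂ := by
    intro y D₁ D₂ ht
    rcases y with _ | y
    · exact ht.adj.ne rfl
    obtain ⟨c, hc, hc'⟩ := touch_singleton_left.1 ht.tx₁
    obtain ⟨d, hd, hd'⟩ := touch_singleton_left.1 ht.tx₂
    have hcd : c = d := by
      rcases c with _ | c
      · exact absurd rfl hc'.ne
      rcases d with _ | d
      · exact absurd rfl hd'.ne
      have hy : (y : V) = a ∨ (y : V) = b := ht.adj
      have hc'' : (c : V) = a ∨ (c : V) = b := hc'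
      have hd'' : (d : V) = a ∨ (d : V) = b := hd'
      have h1 : (c : V) ≠ y := fun h => ht.y₁ (Subtype.ext h ▸ hc)
      have h2 : (d : V) ≠ y := fun h => ht.y₂ (Subtype.ext h ▸ hd)
      congr 1
      apply Subtype.ext
      rcases hy with h | h <;> rcases hc'' with h' | h' <;> rcases hd'' with h'' | h'' <;>
        first | exact h'.trans h''.symm | exact absurd (h'.trans h.symm) h1 |
          exact absurd (h''.trans h.symm) h2
    exact Set.disjoint_left.1 ht.disj hc (hcd ▸ hd)
  rintro (_ | x) y D₁ D₂ ht
  · exact hnone ht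
  rcases y with _ | y
  · exact hnone ht.symm
  · exact hG _ _ _ _ (hB.theta ht (a := x) (b := y) rfl rfl)

theorem ConnSet.not_isOneCutset {v : V} (h : ConnSet G {v}ᶜ) : ¬ IsOneCutset G v := by
  rintro ⟨-, X, Y, hX, ⟨y, hy⟩, hd, hvX, hvY, hu, hn⟩
  have h1 := h.2 X (fun x hx => by rintro rfl; exact hvX hx) hX fun x hx z hz hxz => by
    have : z ∈ X ∪ Y ∪ {v} := hu ▸ Set.mem_univ z
    rcases this with (h | h) | h
    · exact h
    · exact absurd hxz (hn x hx z h)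
    · exact absurd h hz
  have hyv : y ∈ ({v}ᶜ : Set V) := by rintro rfl; exact hvY hy
  exact Set.disjoint_left.1 hd (h1 hyv) hy

theorem ConnSet.addCap (h : ConnSet G S) : ConnSet (addCap G S a b) {none}ᶜ := by
  classical
  have := h.image (H := UniqueChord.addCap G S a b)
    (fun v => if hv : v ∈ S then some ⟨v, hv⟩ else none) fun u hu v hv huv => by
      simp only [hu, hv, dif_pos]
      exact Or.inr huv
  convert this using 1
  ext (_ | x)
  · simp only [Set.mem_compl_iff, Set.mem_singleton_iff, not_true_eq_false, Set.mem_image,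
      false_iff, not_exists, not_and]
    intro v hv
    simp [hv]
  · simp only [Set.mem_compl_iff, Set.mem_singleton_iff, reduceCtorEq, not_false_eq_true, true_iff]
    exact ⟨x, x.2, by simp⟩

/-- In a graph without cutvertices, the sides of a separation by a pair are attached to both
vertices of the pair. -/
theorem touch_compIn_of_cut (hcut : ∀ v, ConnSet G {v}ᶜ) {X Y : Set V} (hab : a ≠ b)
    (hXY : X ∪ Y = {a, b}ᶜ) (hn : ¬ Touch G X Y) {x : V} (hx : x ∈ X) :
    Touch G {a} (compIn G X x) := by
  have hX : ∀ v ∈ X, v ≠ a ∧ v ≠ b := by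
    intro v hv
    have : v ∈ ({a, b}ᶜ : Set V) := hXY ▸ Or.inl hv
    simpa using this
  by_contra hcon
  have hab' : a ∈ ({b}ᶜ : Set V) := hab
  refine (hX a (compIn_subset x ((hcut b).2 (compIn G X x) (fun v hv => (hX v (compIn_subset x hv)).2)
    ⟨x, mem_compIn_self hx⟩ (fun v hv w hw hvw => ?_) hab'))).1 rfl
  by_cases hwa : w = a
  · exact absurd ⟨a, rfl, v, hv, hwa ▸ hvw.symm⟩ hcon
  have : w ∈ X ∪ Y := by
    rw [hXY]
    rintro (h | h)
    · exact hwa h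
    · exact hw h
  refine compIn_closed hv (this.resolve_right fun hwY => ?_) hvw
  exact hn ⟨v, compIn_subset x hv, w, hwY, hvw⟩

/-- Every component of a side is attached to both cutset vertices, so the side with these two
vertices is connected. This shows that the cap is not a 1-cutset of the capped graph. -/
theorem connSet_of_cut (hcut : ∀ v, ConnSet G {v}ᶜ) {X Y : Set V} (hab : a ≠ b)
    (hXY : X ∪ Y = {a, b}ᶜ) (hd : Disjoint X Y) (hn : ¬ Touch G X Y) (hX : X.Nonempty) :
    ConnSet G Yᶜ := by
  have ha : ∀ {x}, x ∈ X → Touch G {a} (compIn G X x) := fun hx =>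
    touch_compIn_of_cut hcut hab hXY hn hx
  have hb : ∀ {x}, x ∈ X → Touch G {b} (compIn G X x) := fun hx =>
    touch_compIn_of_cut hcut hab.symm (by rwa [Set.pair_comm]) hn hx
  have hmem : ∀ v, v ∉ Y → v ∈ X ∨ v = a ∨ v = b := by
    intro v hv
    by_contra! h
    have : v ∈ X ∪ Y := by rw [hXY]; simp [h.2]
    exact this.elim h.1 hv
  have hXs : X ⊆ Yᶜ := fun v hv => Set.disjoint_left.1 hd hv
  have haY : a ∉ Y := fun h => by
    have : a ∈ ({a, b}ᶜ : Set V) := hXY ▸ Or.inr h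
    simp at this
  have hbY : b ∉ Y := fun h => by
    have : b ∈ ({a, b}ᶜ : Set V) := hXY ▸ Or.inr h
    simp at this
  refine connSet_of_forall (x := a) haY fun y hy => ?_
  have hins : ∀ {x}, x ∈ X → ConnSet G (insert a (compIn G X x)) := fun hx =>
    (connSet_compIn hx).insert (touch_singleton_left.1 (ha hx))
  have hsub : ∀ {x}, insert a (compIn G X x) ⊆ Yᶜ := fun {x} =>
    Set.insert_subset haY ((compIn_subset x).trans hXs)
  rcases hmem y hy with hyX | rfl | rfl
  · exact ⟨_, hsub, hins hyX, Or.inl rfl, Or.inr (mem_compIn_self hyX)⟩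
  · exact ⟨{y}, by simpa using haY, connSet_singleton y, rfl, rfl⟩
  · obtain ⟨x, hx⟩ := hX
    obtain ⟨c, hc, hyc⟩ := touch_singleton_left.1 (hb hx)
    exact ⟨insert y (insert a (compIn G X x)), Set.insert_subset hy hsub,
      (hins hx).insert ⟨c, Or.inr hc, hyc⟩, Or.inr (Or.inl rfl), Or.inl rfl⟩

/-- Decomposition along a pair of nonadjacent vertices. -/
theorem Constructible.of_pair [Finite V] (hcut : ∀ v, ConnSet G {v}ᶜ) {X Y : Set V} (hab : a ≠ b)
    (hnab : ¬ G.Adj a b) (ha3 : 3 ≤ deg G a) (hb3 : 3 ≤ deg G b) (hXY : X ∪ Y = {a, b}ᶜ)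
    (hd : Disjoint X Y) (hX : X.Nonempty) (hY : Y.Nonempty) (hn : ¬ Touch G X Y)
    (h₁ : Constructible (addCap G Yᶜ a b)) (h₂ : Constructible (addCap G Xᶜ a b)) :
    Constructible G := by
  have hXm : ∀ v ∈ X, v ≠ a ∧ v ≠ b := by
    intro v hv
    have : v ∈ ({a, b}ᶜ : Set V) := hXY ▸ Or.inl hv
    simpa using this
  have hYm : ∀ v ∈ Y, v ≠ a ∧ v ≠ b := by
    intro v hv
    have : v ∈ ({a, b}ᶜ : Set V) := hXY ▸ Or.inr hv
    simpa using this
  have hmem : ∀ v, v ≠ a → v ≠ b → v ∈ X ∨ v ∈ Y := by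
    intro v ha hb
    have : v ∈ X ∪ Y := by rw [hXY]; simp [ha, hb]
    exact this
  have haX : a ∈ Xᶜ := fun h => (hXm a h).1 rfl
  have hbX : b ∈ Xᶜ := fun h => (hXm b h).2 rfl
  have haY : a ∈ Yᶜ := fun h => (hYm a h).1 rfl
  have hbY : b ∈ Yᶜ := fun h => (hYm b h).2 rfl
  -- The cap adds one to each degree and the subtraction in the condition takes it away. Every
  -- neighbour of `v` is counted in at least one of the two capped graphs.
  have hdeg : ∀ v (hvX : v ∈ Xᶜ) (hvY : v ∈ Yᶜ), v = a ∨ v = b → 3 ≤ deg G v →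
      3 ≤ (deg (addCap G Yᶜ a b) (some ⟨v, hvY⟩) - 1) + (deg (addCap G Xᶜ a b) (some ⟨v, hvX⟩) - 1) := by
    intro v hvX hvY hv h3
    rw [deg_addCap hv, deg_addCap hv]
    have hsub : G.neighborSet v ⊆ (Yᶜ ∩ G.neighborSet v) ∪ (Xᶜ ∩ G.neighborSet v) := by
      intro w hw
      by_cases hwY : w ∈ Y
      · exact Or.inr ⟨fun h => Set.disjoint_left.1 hd h hwY, hw⟩
      · exact Or.inl ⟨hwY, hw⟩
    have h4 := Set.ncard_le_ncard hsub (Set.toFinite _)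
    have h5 := Set.ncard_union_le (Yᶜ ∩ G.neighborSet v) (Xᶜ ∩ G.neighborSet v)
    unfold deg at h3
    dsimp only
    omega
  have hc₁ := (connSet_of_cut hcut hab hXY hd hn hX).addCap (a := a) (b := b)
  have hc₂ := (connSet_of_cut hcut hab (by rwa [Set.union_comm]) hd.symm
    (fun h => hn h.symm) hY).addCap (a := a) (b := b)
  have hv : ∀ {S : Set V} {x : S} {ha : a ∈ S} {hb : b ∈ S},
      (some x ≠ none ∧ some x ≠ some ⟨a, ha⟩ ∧ some x ≠ some ⟨b, hb⟩) → x.1 ≠ a ∧ x.1 ≠ b :=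
    fun h => ⟨fun h' => h.2.1 (congrArg some (Subtype.ext h')),
      fun h' => h.2.2 (congrArg some (Subtype.ext h'))⟩
  have hv' : ∀ {S : Set V} {x : S} {ha : a ∈ S} {hb : b ∈ S}, x.1 ≠ a → x.1 ≠ b →
      (some x ≠ none ∧ some x ≠ some ⟨a, ha⟩ ∧ some x ≠ some ⟨b, hb⟩) :=
    fun h1 h2 => ⟨Option.some_ne_none _, fun h => h1 (congrArg Subtype.val (Option.some.inj h)),
      fun h => h2 (congrArg Subtype.val (Option.some.inj h))⟩
  have hne : ∀ {S : Set V} {ha : a ∈ S} {hb : b ∈ S},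
      (some ⟨a, ha⟩ : Option S) ≠ some ⟨b, hb⟩ :=
    fun h => hab (congrArg Subtype.val (Option.some.inj h))
  refine (h₁.op3 h₂ none (some ⟨a, haY⟩) (some ⟨b, hbY⟩) none (some ⟨a, haX⟩) (some ⟨b, hbX⟩)
    (neighborSet_addCap_none haY hbY) hne hnab hc₁.not_isOneCutset
    (neighborSet_addCap_none haX hbX) hne hnab hc₂.not_isOneCutset
    (hdeg a haX haY (Or.inl rfl) ha3) (hdeg b hbX hbY (Or.inr rfl) hb3)).iso
    ⟨Equiv.ofBijective (Sum.elim (Sum.elim (fun x => x.1.elim a Subtype.val)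
      fun y => y.1.elim a Subtype.val) fun i => bif i then b else a) ⟨?_, ?_⟩, ?_⟩
  · rintro ((⟨_ | x, hx⟩ | ⟨_ | x, hx⟩) | (_ | _)) ((⟨_ | y, hy⟩ | ⟨_ | y, hy⟩) | (_ | _)) h
    all_goals first
      | exact absurd rfl hx.1
      | exact absurd rfl hy.1
      | skip
    · obtain rfl : x = y := Subtype.ext h
      rfl
    · exact ((hmem x (hv hx).1 (hv hx).2).elim (fun h' => y.2 (Set.mem_of_eq_of_mem h.symm h')) x.2).elim
    · exact absurd h (hv hx).1
    · exact absurd h (hv hx).2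
    · exact ((hmem x (hv hx).1 (hv hx).2).elim x.2 (fun h' => y.2 (Set.mem_of_eq_of_mem h.symm h'))).elim
    · obtain rfl : x = y := Subtype.ext h
      rfl
    · exact absurd h (hv hx).1
    · exact absurd h (hv hx).2
    · exact absurd h.symm (hv hy).1
    · exact absurd h.symm (hv hy).1
    · rfl
    · exact absurd h hab
    · exact absurd h.symm (hv hy).2
    · exact absurd h.symm (hv hy).2
    · exact absurd h.symm hab
    · rfl
  · intro w
    by_cases hwa : w = a
    · exact ⟨.inr false, hwa.symm⟩
    by_cases hwb : w = b
    · exact ⟨.inr true, hwb.symm⟩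
    rcases hmem w hwa hwb with hwX | hwY
    · exact ⟨.inl (.inl ⟨some ⟨w, fun h => Set.disjoint_left.1 hd hwX h⟩, hv' hwa hwb⟩), rfl⟩
    · exact ⟨.inl (.inr ⟨some ⟨w, fun h => Set.disjoint_left.1 hd h hwY⟩, hv' hwa hwb⟩), rfl⟩
  · have hno : ∀ x y, x ∉ Y → y ∉ X → (x ≠ a ∧ x ≠ b) → (y ≠ a ∧ y ≠ b) → ¬ G.Adj x y :=
      fun x y hx hy hx' hy' h => hn ⟨x, (hmem x hx'.1 hx'.2).resolve_right hx, y,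
        (hmem y hy'.1 hy'.2).resolve_left hy, h⟩
    rintro ((⟨_ | x, hx⟩ | ⟨_ | x, hx⟩) | (_ | _)) ((⟨_ | y, hy⟩ | ⟨_ | y, hy⟩) | (_ | _))
    all_goals first
      | exact absurd rfl hx.1
      | exact absurd rfl hy.1
      | skip
    · exact Iff.rfl
    · exact iff_of_false (hno x y x.2 y.2 (hv hx) (hv hy)) id
    · exact G.adj_comm _ _
    · exact G.adj_comm _ _
    · exact iff_of_false (fun h => hno y x y.2 x.2 (hv hy) (hv hx) h.symm) id
    · exact Iff.rfl
    · exact G.adj_comm _ _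
    · exact G.adj_comm _ _
    · exact Iff.rfl
    · exact Iff.rfl
    · exact iff_of_false G.irrefl id
    · exact iff_of_false hnab id
    · exact Iff.rfl
    · exact Iff.rfl
    · exact iff_of_false (fun h => hnab h.symm) id
    · exact iff_of_false G.irrefl id

end Cap

/-! ### The decomposition, by induction on the number of vertices -/

/-- Every graph without unique chords can be built from basic graphs. -/
theorem constructible_of_noTheta (n : ℕ) : ∀ {V : Type u} [Finite V] [Nonempty V]
    (G : SimpleGraph V), Nat.card V = n → NoTheta G → Constructible G := by
  classical
  induction n using Nat.strong_induction_on with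
  | _ n ih =>
  intro V _ _ G hn hG
  subst hn
  have hind : ∀ S : Set V, S.Nonempty → S ≠ Set.univ → Constructible (G.induce S) := by
    intro S hS hSu
    have := hS.to_subtype
    refine ih (Nat.card S) ?_ _ rfl (hG.of_embedding (SimpleGraph.Embedding.induce S))
    rw [Nat.card_coe_set_eq, ← Set.ncard_univ]
    exact Set.ncard_lt_ncard (Set.ssubset_univ_iff.2 hSu) (Set.toFinite _)
  have hne : ∀ {S : Set V} {v}, v ∉ S → S ≠ Set.univ := fun h h' => h (h' ▸ Set.mem_univ _)
  -- separations
  have hsep : ∀ S : Set V, S.Nonempty → ¬ ConnSet G S → ∃ T ⊆ S, T.Nonempty ∧ (S \ T).Nonempty ∧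
      ∀ x ∈ T, ∀ y ∈ S, G.Adj x y → y ∈ T := by
    intro S hS hcon
    by_contra! h
    exact hcon ⟨hS, fun T hT hTne hcl => by
      by_contra hST
      obtain ⟨x, hx, y, hy, hxy, hyT⟩ := h T hT hTne (Set.sdiff_nonempty.2 hST)
      exact hyT (hcl x hx y hy hxy)⟩
  by_cases hc : G.Connected
  swap
  · obtain ⟨T, -, ⟨t, ht⟩, ⟨s, -, hs⟩, hcl⟩ := hsep Set.univ Set.univ_nonempty
      (fun h => hc (connSet_univ_iff.1 h))
    refine Constructible.of_separation T ?_ (hind T ⟨t, ht⟩ (hne hs))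
      (hind Tᶜ ⟨s, hs⟩ (hne (not_not.2 ht)))
    rintro ⟨x, hx, y, hy, hxy⟩
    exact hy (hcl x hx y trivial hxy)
  by_cases htop : G = ⊤
  · exact .basic G ⟨hc, Or.inl htop⟩
  have hcard : ∀ v : V, ({v}ᶜ : Set V).Nonempty := by
    intro v
    by_contra hcon
    rw [Set.not_nonempty_iff_eq_empty, Set.compl_empty_iff] at hcon
    have h : ∀ w, w = v := fun w => by
      have : w ∈ ({v} : Set V) := hcon ▸ Set.mem_univ w
      exact this
    exact htop (eq_top_iff.2 fun a b hab => (hab ((h a).trans (h b).symm)).elim)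
  by_cases hcut : ∀ v, ConnSet G {v}ᶜ
  swap
  · push Not at hcut
    obtain ⟨v, hv⟩ := hcut
    obtain ⟨T, hT, ⟨t, ht⟩, ⟨s, hsv, hs⟩, hcl⟩ := hsep _ (hcard v) hv
    have hvT : v ∉ T := fun h => hT h rfl
    refine Constructible.of_cutvertex T hvT (fun x hx y hy hxy => ?_)
      (hind _ ⟨v, Or.inl rfl⟩ (hne (v := s) ?_)) (hind Tᶜ ⟨v, hvT⟩ (hne (not_not.2 ht)))
    · by_contra hyv
      exact hy (hcl x hx y hyv hxy)
    · rintro (h | h)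
      · exact hsv h
      · exact hs h
  by_cases htri : ∀ x y z, G.Adj x y → G.Adj y z → G.Adj z x → False
  swap
  · push Not at htri
    obtain ⟨x, y, z, hxy, hyz, hzx, -⟩ := htri
    exact (htop (hG.eq_top_of_triangle hc hcut hxy hyz hzx)).elim
  by_cases hsq : ∀ x y z w, x ≠ z → y ≠ w → G.Adj x y → G.Adj y z → G.Adj z w → G.Adj w x → False
  swap
  · push Not at hsq
    obtain ⟨x, y, z, w, hxz, hyw, hxy, hyz, hzw, hwx, -⟩ := hsq
    obtain ⟨X, A, B, hA, hB, hAX, hBX, hAB⟩ := hG.exists_join htri hxz hyw hxy hyz hzw hwx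
    obtain ⟨a, ha, a', ha', haa⟩ := id hA
    obtain ⟨b, hb, b', hb', hbb⟩ := id hB
    refine Constructible.of_join htri hA hB hAX hBX hAB ha hb
      (hind _ ⟨b, Or.inl rfl⟩ (hne (v := b') ?_)) (hind _ ⟨a, Or.inl rfl⟩ (hne (v := a') ?_))
    · rintro (h | h)
      · exact hbb h.symm
      · exact hBX hb' h
    · rintro (h | h)
      · exact haa h.symm
      · exact h (hAX ha')
  by_cases hpair : ∀ a b X Y, a ≠ b → ¬ G.Adj a b → 3 ≤ deg G a → 3 ≤ deg G b → X ∪ Y = {a, b}ᶜ →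
    Disjoint X Y → X.Nontrivial → Y.Nontrivial → ¬ Touch G X Y → False
  · exact .basic G (Rigid.isBasic ⟨hG, htri, hsq, hcut, hpair⟩ hc htop)
  push Not at hpair
  obtain ⟨a, b, X, Y, hab, hnab, ha3, hb3, hXY, hd, hX, hY, hnt, -⟩ := hpair
  -- The cap is the contraction of a component of `Y`, attached to both `a` and `b` because there is
  -- no cutvertex. As `Y` has at least two vertices, replacing it by one cap decreases the number of
  -- vertices.
  have hcap : ∀ X Y : Set V, X ∪ Y = {a, b}ᶜ → Disjoint X Y → X.Nontrivial → Y.Nontrivial →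
      ¬ Touch G X Y → Constructible (addCap G Yᶜ a b) := by
    intro X Y hXY hd hX hY hnt
    obtain ⟨y, hy⟩ := hY.nonempty
    have hsub := compIn_subset (G := G) (S := Y) y
    have hta : Touch G {a} (compIn G Y y) := touch_compIn_of_cut hcut hab
      (by rwa [Set.union_comm]) (fun h => hnt h.symm) hy
    have htb : Touch G {b} (compIn G Y y) := touch_compIn_of_cut hcut hab.symm
      (by rwa [Set.union_comm, Set.pair_comm]) (fun h => hnt h.symm) hy
    refine ih _ ?_ _ rfl (hG.addCap (connSet_compIn hy) ?_ fun s hs => ⟨fun h => ?_, ?_⟩)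
    · have h1 := Set.ncard_add_ncard_compl Y
      have h2 := (Set.one_lt_ncard (Set.toFinite Y)).2 hY
      rw [Finite.card_option, Nat.card_coe_set_eq]
      omega
    · rw [Set.disjoint_left]
      exact fun v hv hv' => hv (hsub hv')
    · by_contra! hcon
      have : s ∈ X ∪ Y := by rw [hXY]; simp [hcon]
      exact hnt ((h.mono (by simpa using this.resolve_right hs) hsub))
    · rintro (rfl | rfl)
      exacts [hta, htb]
  exact Constructible.of_pair hcut hab hnab ha3 hb3 hXY hd hX.nonempty hY.nonempty hnt
    (hcap X Y hXY hd hX hY hnt)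
    (hcap Y X (by rwa [Set.union_comm]) hd.symm hY hX fun h => hnt h.symm)

/-! ### Exhaustive verification that a small graph has no theta -/

section FiniteCheck

/-- The positions below `n` outside `M`. -/
def compMask (n M : ℕ) : ℕ := force M fun M => ((2 ^ n - 1) ||| M) ^^^ M

theorem testBit_compMask {n M i : ℕ} :
    (compMask n M).testBit i = true ↔ i < n ∧ M.testBit i = false := by
  rw [compMask, force_eq, Nat.testBit_xor, Nat.testBit_or, Nat.testBit_two_pow_sub_one]
  cases M.testBit i <;> simp

/-- There is no way from `a` to `b` inside `W`. -/
def escapeCheck (L : List ℕ) (W a b : ℕ) : Bool :=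
  force (growMask L W L.length (2 ^ a)) fun C =>
    C.testBit a && !C.testBit b && (C ||| (nbrMask L C &&& W)) == C

/-- The computed set contains `a`, misses `b`, and is verified to be closed under adjacency inside
`W`, so no connected subset of `W` joins `a` to `b`. -/
theorem not_connSet_of_escapeCheck {L : List ℕ} (hL : WF L) {W a b : ℕ}
    (h : escapeCheck L W a b = true) {D : Set ℕ} (hD : ConnSet (maskGraph L) D)
    (hDW : D ⊆ maskSet W) (ha : a ∈ D) : b ∉ D := by
  simp only [escapeCheck, force_eq, Bool.and_eq_true, Bool.not_eq_true', beq_iff_eq] at h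
  obtain ⟨⟨h1, h2⟩, h3⟩ := h
  set C := growMask L W L.length (2 ^ a)
  intro hb
  have := hD.2 (D ∩ maskSet C) Set.inter_subset_left ⟨a, ha, h1⟩ ?_ hb
  · rw [Set.mem_inter_iff, maskSet, Set.mem_ofPred_eq, h2] at this
    exact Bool.noConfusion this.2
  · rintro i ⟨hi, hiC⟩ j hj hij
    refine ⟨hj, ?_⟩
    have hjW : W.testBit j = true := hDW hj
    have hjn : (nbrMask L C).testBit j = true := testBit_nbrMask.2 ⟨i, hiC, hL.adj_iff.1 hij⟩
    show C.testBit j = true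
    rw [← h3, Nat.testBit_or, Nat.testBit_and, hjW, hjn]
    simp

/-- Test all masks between `A` and the union of `A` with the positions in a list. -/
def allBetween (p : ℕ → Bool) : List ℕ → ℕ → Bool
  | [], A => p A
  | i :: l, A => allBetween p l A && force (A ||| 2 ^ i) fun A' => allBetween p l A'

theorem of_allBetween {p : ℕ → Bool} {l : List ℕ} {A : ℕ} (h : allBetween p l A = true) {D : ℕ}
    (h₁ : ∀ i, A.testBit i = true → D.testBit i = true)
    (h₂ : ∀ i, D.testBit i = true → A.testBit i = true ∨ i ∈ l) : p D = true := by
  induction l generalizing A with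
  | nil =>
    rw [eq_of_testBit_iff (a := D) (b := A) fun i => ⟨fun hi => by simpa using h₂ i hi, h₁ i⟩]
    exact h
  | cons a l ih =>
    rw [allBetween, force_eq, Bool.and_eq_true] at h
    cases ha : D.testBit a
    · refine ih h.1 h₁ fun i hi => ?_
      rcases h₂ i hi with h | h
      · exact Or.inl h
      · rcases List.mem_cons.1 h with rfl | h
        · rw [ha] at hi
          exact Bool.noConfusion hi
        · exact Or.inr h
    · refine ih h.2 (fun i hi => ?_) fun i hi => ?_
      · rw [Nat.testBit_or, Bool.or_eq_true, Nat.testBit_two_pow, decide_eq_true_eq] at hi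
        rcases hi with hi | rfl
        · exact h₁ i hi
        · exact ha
      · rw [Nat.testBit_or, Bool.or_eq_true, Nat.testBit_two_pow, decide_eq_true_eq]
        rcases h₂ i hi with h | h
        · exact Or.inl (Or.inl h)
        · rcases List.mem_cons.1 h with rfl | h
          · exact Or.inl (Or.inr rfl)
          · exact Or.inr h

/-- No theta with chord `x y` uses the neighbours `x₁`, `x₂` of `x` and `y₁`, `y₂` of `y`. -/
def chordCheck (L : List ℕ) (x y x₁ y₁ x₂ y₂ : ℕ) : Bool :=
  force (2 ^ x ||| 2 ^ y) fun P =>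
  force (compMask L.length (P ||| (2 ^ x₂ ||| 2 ^ y₂) ||| nbrMask L (2 ^ x₂ ||| 2 ^ y₂))) fun U =>
  !U.testBit x₁ || !U.testBit y₁ ||
  forceList ((List.range L.length).filter fun i => U.testBit i && i != x₁ && i != y₁) fun l =>
  allBetween (fun D =>
    force (compMask L.length (P ||| D ||| nbrMask L D)) (fun W => escapeCheck L W x₂ y₂) ||
      escapeCheck L D x₁ y₁) l (2 ^ x₁ ||| 2 ^ y₁)

/-- A test for graphs without unique chords. -/
def noThetaCheck (L : List ℕ) : Bool :=
  (List.range L.length).all fun x => (List.range x).all fun y => !bit L x y ||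
    (List.range L.length).all fun x₁ => !bit L x x₁ || (List.range L.length).all fun x₂ =>
      !bit L x x₂ || (List.range L.length).all fun y₁ => !bit L y y₁ ||
        (List.range L.length).all fun y₂ => !bit L y y₂ || chordCheck L x y x₁ y₁ x₂ y₂

/-- With neighbours of both chord ends fixed in each side, the first side lies between `{x₁, y₁}`
and the positions far from `x₂` and `y₂`. For every candidate in that range, either it does not join
`x₁` to `y₁`, or the positions left over for the second side do not join `x₂` to `y₂`. -/
theorem not_theta_of_chordCheck {L : List ℕ} (hL : WF L) {x y x₁ y₁ x₂ y₂ : ℕ}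
    (h : chordCheck L x y x₁ y₁ x₂ y₂ = true) {D₁ D₂ : Set ℕ}
    (hD₁ : ∀ i ∈ D₁, i < L.length) (hD₂ : ∀ i ∈ D₂, i < L.length) (hx₁ : x₁ ∈ D₁) (hy₁ : y₁ ∈ D₁)
    (hx₂ : x₂ ∈ D₂) (hy₂ : y₂ ∈ D₂) : ¬ Theta (maskGraph L) x y D₁ D₂ := by
  classical
  intro ht
  have hanti : ∀ i ∈ D₁, ∀ j ∈ D₂, bit L i j = false := fun i hi j hj => by
    rw [Bool.eq_false_iff]
    exact fun hb => ht.anti ⟨i, hi, j, hj, hL.adj_iff.2 hb⟩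
  have hne : ∀ i ∈ D₁, ∀ j ∈ D₂, i ≠ j := fun i hi j hj hij =>
    Set.disjoint_left.1 ht.disj hi (hij ▸ hj)
  have hxy₁ : ∀ i ∈ D₁, i ≠ x ∧ i ≠ y := fun i hi =>
    ⟨fun h => ht.x₁ (h ▸ hi), fun h => ht.y₁ (h ▸ hi)⟩
  have hxy₂ : ∀ i ∈ D₂, i ≠ x ∧ i ≠ y := fun i hi =>
    ⟨fun h => ht.x₂ (h ▸ hi), fun h => ht.y₂ (h ▸ hi)⟩
  simp only [chordCheck, force_eq, forceList_eq] at h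
  set U := compMask L.length (2 ^ x ||| 2 ^ y ||| (2 ^ x₂ ||| 2 ^ y₂) |||
    nbrMask L (2 ^ x₂ ||| 2 ^ y₂)) with hU
  have hDU : ∀ i ∈ D₁, U.testBit i = true := by
    intro i hi
    rw [hU, testBit_compMask]
    refine ⟨hD₁ i hi, ?_⟩
    rw [Bool.eq_false_iff]
    simp only [ne_eq, Nat.testBit_or, Nat.testBit_two_pow, Bool.or_eq_true, decide_eq_true_eq,
      testBit_nbrMask]
    rintro (((h | h) | (h | h)) | ⟨j, (h | h), hb⟩)
    · exact (hxy₁ i hi).1 h.symm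
    · exact (hxy₁ i hi).2 h.symm
    · exact hne i hi _ hx₂ h.symm
    · exact hne i hi _ hy₂ h.symm
    · subst h
      rw [hL.bit_comm, hanti i hi _ hx₂] at hb
      exact Bool.noConfusion hb
    · subst h
      rw [hL.bit_comm, hanti i hi _ hy₂] at hb
      exact Bool.noConfusion hb
  rw [hDU _ hx₁, hDU _ hy₁, Bool.not_true, Bool.false_or, Bool.false_or] at h
  -- The first side itself, encoded as a mask, is one of the candidates that were enumerated.
  set M := ofBits (fun i => decide (i ∈ D₁)) L.length with hM
  have hMi : ∀ i, M.testBit i = true ↔ i ∈ D₁ := fun i => by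
    rw [hM, testBit_ofBits, Bool.and_eq_true, decide_eq_true_eq, decide_eq_true_eq]
    exact ⟨fun h => h.2, fun h => ⟨hD₁ i h, h⟩⟩
  have h3 := of_allBetween h (D := M) (fun i hi => ?_) fun i hi => ?_
  · rw [Bool.or_eq_true] at h3
    rcases h3 with h3 | h3
    · refine not_connSet_of_escapeCheck hL h3 ht.conn₂ (fun i hi => ?_) hx₂ hy₂
      refine testBit_compMask.2 ⟨hD₂ i hi, ?_⟩
      rw [Bool.eq_false_iff]
      simp only [ne_eq, Nat.testBit_or, Nat.testBit_two_pow, Bool.or_eq_true, decide_eq_true_eq,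
        testBit_nbrMask]
      rintro (((h | h) | h) | ⟨j, h, hb⟩)
      · exact (hxy₂ i hi).1 h.symm
      · exact (hxy₂ i hi).2 h.symm
      · exact hne i ((hMi i).1 h) i hi rfl
      · rw [hanti j ((hMi j).1 h) i hi] at hb
        exact Bool.noConfusion hb
    · exact not_connSet_of_escapeCheck hL h3 ht.conn₁ (fun i hi => (hMi i).2 hi) hx₁ hy₁
  · rw [Nat.testBit_or, Bool.or_eq_true, Nat.testBit_two_pow, Nat.testBit_two_pow,
      decide_eq_true_eq, decide_eq_true_eq] at hi
    rw [hMi]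
    rcases hi with rfl | rfl <;> assumption
  · rw [hMi] at hi
    rw [Nat.testBit_or, Bool.or_eq_true, Nat.testBit_two_pow, Nat.testBit_two_pow,
      decide_eq_true_eq, decide_eq_true_eq, List.mem_filter, List.mem_range, hDU i hi]
    by_cases h4 : i = x₁
    · exact Or.inl (Or.inl h4.symm)
    by_cases h5 : i = y₁
    · exact Or.inl (Or.inr h5.symm)
    · exact Or.inr ⟨hD₁ i hi, by simp [h4, h5]⟩

/-- A theta can be read from either end of its chord, so it is enough to test chords whose first end
has the larger number. -/
theorem noTheta_of_noThetaCheck {W : Type*} {H : SimpleGraph W} {L : List ℕ} (hL : WF L)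
    (h : noThetaCheck L = true) (f : W → ℕ) (hf : Function.Injective f)
    (hlt : ∀ w, f w < L.length) (hadj : ∀ v w, bit L (f v) (f w) = true ↔ H.Adj v w) :
    NoTheta H := by
  simp only [noThetaCheck, List.all_eq_true, List.mem_range, Bool.or_eq_true, Bool.not_eq_true']
    at h
  have hadj' : ∀ v w, (maskGraph L).Adj (f v) (f w) ↔ H.Adj v w := fun v w =>
    hL.adj_iff.trans (hadj v w)
  have key : ∀ v w D₁ D₂, f w < f v → ¬ Theta H v w D₁ D₂ := by
    intro v w D₁ D₂ hwv ht
    have hB : Model (maskGraph L) H (fun i => {f i}) := by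
      refine ⟨fun i _ _ => connSet_singleton _, fun i j hij => ?_, fun i j _ => ?_⟩
      · simpa using fun h => hij (hf h)
      · rw [touch_singleton_singleton, hadj']
    have hmem : ∀ {D : Set W} {i}, i ∈ D → f i ∈ ⋃ i ∈ D, ({f i} : Set ℕ) := fun h =>
      Set.mem_biUnion h rfl
    have hlt' : ∀ D : Set W, ∀ i ∈ ⋃ i ∈ D, ({f i} : Set ℕ), i < L.length := by
      intro D i hi
      obtain ⟨j, -, rfl⟩ := Set.mem_iUnion₂.1 hi
      exact hlt j
    obtain ⟨v₁, hv₁, hvv₁⟩ := touch_singleton_left.1 ht.tx₁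
    obtain ⟨v₂, hv₂, hvv₂⟩ := touch_singleton_left.1 ht.tx₂
    obtain ⟨w₁, hw₁, hww₁⟩ := touch_singleton_left.1 ht.ty₁
    obtain ⟨w₂, hw₂, hww₂⟩ := touch_singleton_left.1 ht.ty₂
    have hb : ∀ {v w}, H.Adj v w → ¬ bit L (f v) (f w) = false := fun h => by
      rw [(hadj _ _).2 h]
      exact Bool.noConfusion
    have := (((((h (f v) (hlt v) (f w) hwv).resolve_left (hb ht.adj)) (f v₁) (hlt _)).resolve_left
      (hb hvv₁) (f v₂) (hlt _)).resolve_left (hb hvv₂) (f w₁) (hlt _)).resolve_left (hb hww₁)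
      (f w₂) (hlt _) |>.resolve_left (hb hww₂)
    exact not_theta_of_chordCheck hL this (hlt' _) (hlt' _) (hmem hv₁) (hmem hw₁) (hmem hv₂)
      (hmem hw₂) (hB.theta ht rfl rfl)
  intro v w D₁ D₂ ht
  rcases lt_trichotomy (f v) (f w) with h1 | h1 | h1
  · exact key w v D₁ D₂ h1 ht.symm
  · exact ht.adj.ne (hf h1)
  · exact key v w D₁ D₂ h1 ht

end FiniteCheck

/-! ### The Petersen and Heawood graphs -/

section Targets

/-- The positions 0–4 are the vertices of the first 5-cycle and 5–9 those of the second, in order.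
-/
theorem noTheta_petersen : NoTheta petersen :=
  noTheta_of_noThetaCheck (L := [50, 261, 74, 532, 137, 577, 164, 336, 642, 296])
    (wf_of_wfCheck (by decide +kernel)) (by decide +kernel)
    (Sum.elim (fun i => i) fun i => i + 5) (by decide) (by decide) (by decide)

theorem noTheta_heawood : NoTheta heawood :=
  noTheta_of_noThetaCheck
    (L := [8706, 69, 2058, 276, 8232, 1104, 162, 4416, 648, 1281, 2592, 5124, 10368, 4113])
    (wf_of_wfCheck (by decide +kernel)) (by decide +kernel) (fun i => i) (by decide) (by decide)
    (by decide)

end Targets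

/-! ### Basic graphs have no theta -/

section Basics

variable {V : Type*} {G : SimpleGraph V} {x y : V} {D₁ D₂ : Set V}

/-- Each end of the chord has, besides the other end, a neighbour in each side. This settles cycles,
and strongly 2-bipartite graphs, where every edge has an end of degree two. -/
theorem Theta.three_le_deg [Finite V] (h : Theta G x y D₁ D₂) : 3 ≤ deg G x := by
  obtain ⟨a, ha, hxa⟩ := touch_singleton_left.1 h.tx₁
  obtain ⟨b, hb, hxb⟩ := touch_singleton_left.1 h.tx₂
  refine UniqueChord.three_le_deg h.adj hxa hxb ?_ ?_ ?_
  · rintro rfl; exact h.y₁ ha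
  · rintro rfl; exact h.y₂ hb
  · rintro rfl; exact Set.disjoint_left.1 h.disj ha hb

theorem noTheta_top : NoTheta (⊤ : SimpleGraph V) := by
  intro x y D₁ D₂ h
  obtain ⟨a, ha⟩ := h.conn₁.1
  obtain ⟨b, hb⟩ := h.conn₂.1
  exact h.anti ⟨a, ha, b, hb, fun hab => Set.disjoint_left.1 h.disj ha (hab ▸ hb)⟩

theorem noTheta_cycleGraph (n : ℕ) : NoTheta (SimpleGraph.cycleGraph (n + 3)) := by
  classical
  intro x y D₁ D₂ h
  have h3 := h.three_le_deg
  have := SimpleGraph.cycleGraph_degree_three_le (n := n) (v := x)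
  rw [deg, ← SimpleGraph.coe_neighborFinset, Set.ncard_coe_finset,
    SimpleGraph.card_neighborFinset_eq_degree, this] at h3
  omega

theorem StronglyTwoBipartite.noTheta {V : Type u} [Finite V] {G : SimpleGraph V}
    (hG : StronglyTwoBipartite G) : NoTheta G := by
  intro x y D₁ D₂ h
  have hx := h.three_le_deg
  have hy := h.symm.three_le_deg
  rcases hG.2.1.mem_of_adj h.adj with ⟨h1, h2⟩ | ⟨h1, h2⟩ <;> simp only [Set.mem_ofPred_eq] at h1 h2 <;>
    omega

theorem IsBasic.noTheta {V : Type u} [Finite V] {G : SimpleGraph V} (hG : IsBasic G) :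
    NoTheta G := by
  rcases hG.2 with rfl | ⟨n, hn, ⟨e⟩⟩ | h | h | h
  · exact noTheta_top
  · obtain ⟨k, rfl⟩ : ∃ k, n = k + 3 := ⟨n - 3, by omega⟩
    exact (noTheta_cycleGraph k).of_embedding e.toEmbedding
  · exact h.noTheta
  · exact noTheta_petersen.of_isIndContained h
  · exact noTheta_heawood.of_isIndContained h

end Basics

/-! ### Restricting thetas to a part; disjoint unions and cutvertices -/

section Composition

variable {V W : Type*} {G : SimpleGraph V} {H : SimpleGraph W} {S : Set V}

/-- No theta of `G` lies in `S`. -/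
def NoThetaOn (G : SimpleGraph V) (S : Set V) : Prop :=
  ∀ x ∈ S, ∀ y ∈ S, ∀ D₁ ⊆ S, ∀ D₂ ⊆ S, ¬ Theta G x y D₁ D₂

/-- A part of a composed graph need only be identified with an induced subgraph of one of the given
graphs by a map injective on that part; its values elsewhere do not matter. -/
theorem NoTheta.noThetaOn (hH : NoTheta H) (f : V → W) (hinj : Set.InjOn f S)
    (hadj : ∀ u ∈ S, ∀ v ∈ S, G.Adj u v ↔ H.Adj (f u) (f v)) : NoThetaOn G S := by
  intro x hx y hy D₁ h₁ D₂ h₂ ht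
  have hmem : ∀ {v} {D : Set V}, v ∈ S → D ⊆ S → f v ∈ f '' D → v ∈ D := by
    rintro v D hv hD ⟨u, hu, huv⟩
    rwa [← hinj (hD hu) hv huv]
  have htouch : ∀ {v} {D : Set V}, v ∈ S → D ⊆ S → Touch G {v} D → Touch H {f v} (f '' D) := by
    rintro v D hv hD ⟨_, rfl, d, hd, h⟩
    exact ⟨f _, rfl, f d, ⟨d, hd, rfl⟩, (hadj _ hv _ (hD hd)).1 h⟩
  have hconn : ∀ {D : Set V}, D ⊆ S → ConnSet G D → ConnSet H (f '' D) := fun hD h =>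
    h.image f fun u hu v hv huv => Or.inr ((hadj u (hD hu) v (hD hv)).1 huv)
  refine hH (f x) (f y) (f '' D₁) (f '' D₂) ⟨(hadj x hx y hy).1 ht.adj, hconn h₁ ht.conn₁,
    hconn h₂ ht.conn₂, ?_, ?_, fun h => ht.x₁ (hmem hx h₁ h), fun h => ht.x₂ (hmem hx h₂ h),
    fun h => ht.y₁ (hmem hy h₁ h), fun h => ht.y₂ (hmem hy h₂ h), htouch hx h₁ ht.tx₁,
    htouch hx h₂ ht.tx₂, htouch hy h₁ ht.ty₁, htouch hy h₂ ht.ty₂⟩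
  · rw [Set.disjoint_left]
    rintro _ ⟨u, hu, rfl⟩ hu'
    exact Set.disjoint_left.1 ht.disj hu (hmem (h₁ hu) h₂ hu')
  · rintro ⟨_, ⟨u, hu, rfl⟩, _, ⟨v, hv, rfl⟩, h⟩
    exact ht.anti ⟨u, hu, v, hv, (hadj u (h₁ hu) v (h₂ hv)).2 h⟩

/-- The part of `D` in `S` can play the role of `D` in a theta with chord `x y`. -/
def Restricts (G : SimpleGraph V) (S : Set V) (x y : V) (D : Set V) : Prop :=
  ConnSet G (D ∩ S) ∧ Touch G {x} (D ∩ S) ∧ Touch G {y} (D ∩ S)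

theorem NoThetaOn.not_theta (hS : NoThetaOn G S) {x y : V} {D₁ D₂ : Set V} (hx : x ∈ S)
    (hy : y ∈ S) (h₁ : Restricts G S x y D₁) (h₂ : Restricts G S x y D₂) : ¬ Theta G x y D₁ D₂ :=
  fun ht => hS x hx y hy _ Set.inter_subset_right _ Set.inter_subset_right ⟨ht.adj, h₁.1, h₂.1,
    ht.disj.mono Set.inter_subset_left Set.inter_subset_left,
    fun h => ht.anti (h.mono Set.inter_subset_left Set.inter_subset_left), fun h => ht.x₁ h.1,
    fun h => ht.x₂ h.1, fun h => ht.y₁ h.1, fun h => ht.y₂ h.1, h₁.2.1, h₂.2.1, h₁.2.2, h₂.2.2⟩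

theorem ConnSet.subset_of_closed {D : Set V} (hD : ConnSet G D) (hne : (D ∩ S).Nonempty)
    (hcl : ∀ u ∈ S, ∀ v ∈ D, G.Adj u v → v ∈ S) : D ⊆ S := by
  have := hD.2 (D ∩ S) Set.inter_subset_left hne fun u hu v hv huv => ⟨hv, hcl u hu.2 v hv huv⟩
  exact this.trans Set.inter_subset_right

theorem noTheta_of_separation {X : Set V} (hX : ¬ Touch G X Xᶜ) (h₁ : NoThetaOn G X)
    (h₂ : NoThetaOn G Xᶜ) : NoTheta G := by
  have key : ∀ X : Set V, ¬ Touch G X Xᶜ → NoThetaOn G X → ∀ x ∈ X, ∀ y D₁ D₂,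
      ¬ Theta G x y D₁ D₂ := by
    intro X hX h x hx y D₁ D₂ ht
    have hcl : ∀ u ∈ X, ∀ v, G.Adj u v → v ∈ X := fun u hu v huv => by
      by_contra hv
      exact hX ⟨u, hu, v, hv, huv⟩
    have hsub : ∀ {D}, ConnSet G D → Touch G {x} D → D ⊆ X := fun {D} hD hxD => by
      obtain ⟨d, hd, hxd⟩ := touch_singleton_left.1 hxD
      exact hD.subset_of_closed ⟨d, hd, hcl x hx d hxd⟩ fun u hu v _ huv => hcl u hu v huv
    exact h x hx y (hcl x hx y ht.adj) D₁ (hsub ht.conn₁ ht.tx₁) D₂ (hsub ht.conn₂ ht.tx₂) ht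
  intro x y D₁ D₂ ht
  by_cases hx : x ∈ X
  · exact key X hX h₁ x hx y D₁ D₂ ht
  · refine key Xᶜ (fun h => hX ?_) h₂ x hx y D₁ D₂ ht
    rw [compl_compl] at h
    exact h.symm

/-- The part contains both ends of the chord and is attached to the outside only at `c`. A side
leaving it must contain `c`, and sending everything outside to `c` retracts that side to a connected
set with the same attachments. -/
theorem not_theta_of_cutvertex {X : Set V} {c : V} (hX : ∀ u ∈ X, ∀ v ∈ Xᶜ, G.Adj u v → v = c)
    (h : NoThetaOn G (insert c X)) {x y : V} (hx : x ∈ insert c X) (hy : y ∈ insert c X)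
    {D₁ D₂ : Set V} : ¬ Theta G x y D₁ D₂ := by
  classical
  have hS : ∀ u ∈ insert c X, ∀ v ∉ insert c X, G.Adj u v → u = c := by
    rintro u (hu | hu) v hv huv
    · exact hu
    · exact absurd (Or.inl (hX u hu v (fun h => hv (Or.inr h)) huv)) hv
  have key : ∀ D E, Theta G x y D E → Restricts G (insert c X) x y D := by
    intro D E ht
    -- Without `c`, a side with an outside point would be wholly outside, and both ends of the chord
    -- would have to be `c`.
    have hc : ∀ d ∈ D, d ∉ insert c X → c ∈ D := by
      intro d hd hdS
      by_contra hcD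
      have hsub := ht.conn₁.subset_of_closed (S := (insert c X)ᶜ) ⟨d, hd, hdS⟩
        fun u hu v hv huv hvS => hcD (hS v hvS u hu huv.symm ▸ hv)
      obtain ⟨d, hd, hxd⟩ := touch_singleton_left.1 ht.tx₁
      obtain ⟨e, he, hye⟩ := touch_singleton_left.1 ht.ty₁
      exact ht.adj.ne ((hS x hx d (hsub hd) hxd).trans (hS y hy e (hsub he) hye).symm)
    have htouch : ∀ z ∈ insert c X, z ∉ D → Touch G {z} D → Touch G {z} (D ∩ insert c X) := by
      intro z hz hzD hzt
      obtain ⟨d, hd, hzd⟩ := touch_singleton_left.1 hzt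
      by_cases hdS : d ∈ insert c X
      · exact ⟨z, rfl, d, ⟨hd, hdS⟩, hzd⟩
      · exact absurd (hS z hz d hdS hzd ▸ hc d hd hdS) hzD
    refine ⟨?_, htouch x hx ht.x₁ ht.tx₁, htouch y hy ht.y₁ ht.ty₁⟩
    have := ht.conn₁.image (H := G) (fun u => if u ∈ insert c X then u else c) ?_
    · convert this using 1
      ext v
      constructor
      · rintro ⟨hv, hvS⟩
        exact ⟨v, hv, if_pos hvS⟩
      · rintro ⟨u, hu, rfl⟩
        by_cases huS : u ∈ insert c X
        · simpa only [if_pos huS] using ⟨hu, huS⟩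
        · simpa only [if_neg huS] using ⟨hc u hu huS, Or.inl rfl⟩
    · intro u hu v hv huv
      by_cases huS : u ∈ insert c X <;> by_cases hvS : v ∈ insert c X <;>
        simp only [if_pos, if_neg, huS, hvS, not_false_eq_true]
      · exact Or.inr huv
      · exact Or.inl (hS u huS v hvS huv)
      · exact Or.inl (hS v hvS u huS huv.symm).symm
      · exact Or.inl trivial
  exact fun ht => h.not_theta hx hy (key _ _ ht) (key _ _ ht.swap) ht

/-- No edge joins the two sides of `c` except at `c`, so the chord lies in one of the two parts. -/
theorem noTheta_of_cutvertex {X : Set V} {c : V} (hc : c ∉ X)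
    (hX : ∀ u ∈ X, ∀ v ∈ Xᶜ, G.Adj u v → v = c) (h₁ : NoThetaOn G (insert c X))
    (h₂ : NoThetaOn G Xᶜ) : NoTheta G := by
  intro x y D₁ D₂ ht
  have he : insert c (insert c X)ᶜ = Xᶜ := by
    ext v
    by_cases hv : v = c
    · simp [hv, hc]
    · simp [hv]
  by_cases hx : x ∈ insert c X
  · by_cases hy : y ∈ insert c X
    · exact not_theta_of_cutvertex hX h₁ hx hy ht
    · have hx' : x ∈ Xᶜ := fun h => hy (Or.inl (hX x h y (fun h => hy (Or.inr h)) ht.adj))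
      refine not_theta_of_cutvertex (X := (insert c X)ᶜ) (c := c) ?_ (by rwa [he]) (by rwa [he])
        (Or.inr hy) ht
      intro u hu v hv huv
      rw [compl_compl] at hv
      exact hv.resolve_right fun h => hu (Or.inl (hX v h u (fun h => hu (Or.inr h)) huv.symm))
  · have hy' : y ∈ Xᶜ := fun h => hx (Or.inl (hX y h x (fun h => hx (Or.inr h)) ht.adj.symm))
    refine not_theta_of_cutvertex (X := (insert c X)ᶜ) (c := c) ?_ (by rwa [he])
      (Or.inr hx) (by rwa [he]) ht
    intro u hu v hv huv
    rw [compl_compl] at hv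
    exact hv.resolve_right fun h => hu (Or.inl (hX v h u (fun h => hu (Or.inr h)) huv.symm))

end Composition

/-! ### Thetas and 1-joins: chords on one side -/

section Join

variable {V : Type*} {G : SimpleGraph V} {X A B : Set V}

/-- The edges between `X` and its complement are the pairs in `A × B`. -/
structure IsJoin (G : SimpleGraph V) (X A B : Set V) : Prop where
  left : A ⊆ X
  right : B ⊆ Xᶜ
  adj_iff : ∀ a ∈ X, ∀ b ∈ Xᶜ, (G.Adj a b ↔ a ∈ A ∧ b ∈ B)

theorem IsJoin.symm (h : IsJoin G X A B) : IsJoin G Xᶜ B A :=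
  ⟨h.right, by rw [compl_compl]; exact h.left, fun a ha b hb => by
    rw [compl_compl] at hb
    rw [G.adj_comm, h.adj_iff b hb a ha, and_comm]⟩

theorem IsJoin.adj (h : IsJoin G X A B) {a b : V} (ha : a ∈ A) (hb : b ∈ B) : G.Adj a b :=
  (h.adj_iff a (h.left ha) b (h.right hb)).2 ⟨ha, hb⟩

/-- A connected set that meets both sides meets the border. -/
theorem IsJoin.inter_nonempty' (h : IsJoin G X A B) {D : Set V} (hD : ConnSet G D)
    (hne : (D ∩ X).Nonempty) (hD' : ¬ D ⊆ X) : (D ∩ A).Nonempty := by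
  obtain ⟨u, hu, v, hv, huv⟩ := hD.touch_diff Set.inter_subset_left hne
    (Set.sdiff_nonempty.2 fun hsub => hD' (hsub.trans Set.inter_subset_right))
  exact ⟨u, hu.1, ((h.adj_iff u hu.2 v fun hvX => hv.2 ⟨hv.1, hvX⟩).1 huv).1⟩

/-- A connected set attached to the outside that meets the inside does so at the border. -/
theorem IsJoin.inter_nonempty (h : IsJoin G X A B) {z : V} {D : Set V} (hz : z ∉ X)
    (hzD : Touch G {z} D) (hD : ConnSet G D) (hne : (D ∩ X).Nonempty) : (D ∩ A).Nonempty := by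
  by_cases hsub : D ⊆ X
  · obtain ⟨d, hd, hzd⟩ := touch_singleton_left.1 hzD
    exact ⟨d, hd, ((h.adj_iff d (hsub hd) z hz).1 hzd.symm).1⟩
  · exact h.inter_nonempty' hD hne hsub

/-- Every vertex outside `X` with a neighbour in `X` has the same neighbours there as `b`. Sending
all outside vertices to `b` therefore keeps a side connected and attached, provided `b` belongs to
the side whenever the side leaves `X`. -/
theorem IsJoin.restricts (h : IsJoin G X A B) {b x y : V} (hb : b ∈ B) {D E : Set V}
    (hD : ∀ d ∈ D, d ∉ X → b ∈ D) (hx : x ∈ insert b X) (hy : y ∈ insert b X)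
    (ht : Theta G x y D E) : Restricts G (insert b X) x y D := by
  classical
  have htouch : ∀ z ∈ insert b X, z ∉ D → Touch G {z} D → Touch G {z} (D ∩ insert b X) := by
    intro z hz hzD hzt
    obtain ⟨d, hd, hzd⟩ := touch_singleton_left.1 hzt
    by_cases hdX : d ∈ X
    · exact ⟨z, rfl, d, ⟨hd, Or.inr hdX⟩, hzd⟩
    · have hbD := hD d hd hdX
      have hzX : z ∈ X := hz.resolve_left fun h => hzD (h ▸ hbD)
      exact ⟨z, rfl, b, ⟨hbD, Or.inl rfl⟩, h.adj ((h.adj_iff z hzX d hdX).1 hzd).1 hb⟩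
  refine ⟨?_, htouch x hx ht.x₁ ht.tx₁, htouch y hy ht.y₁ ht.ty₁⟩
  have := ht.conn₁.image (H := G) (fun u => if u ∈ X then u else b) ?_
  · convert this using 1
    ext v
    constructor
    · rintro ⟨hv, rfl | hvX⟩
      · exact ⟨v, hv, if_neg (h.right hb)⟩
      · exact ⟨v, hv, if_pos hvX⟩
    · rintro ⟨u, hu, rfl⟩
      by_cases huX : u ∈ X
      · simpa only [if_pos huX] using ⟨hu, Or.inr huX⟩
      · simpa only [if_neg huX] using ⟨hD u hu huX, Or.inl rfl⟩
  · intro u hu v hv huv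
    by_cases huX : u ∈ X <;> by_cases hvX : v ∈ X <;>
      simp only [if_pos, if_neg, huX, hvX, not_false_eq_true]
    · exact Or.inr huv
    · exact Or.inr (h.adj ((h.adj_iff u huX v hvX).1 huv).1 hb)
    · exact Or.inr (h.adj ((h.adj_iff v hvX u huX).1 huv.symm).1 hb).symm
    · exact Or.inl trivial

/-- If one side stays in `X`, both restrict to `X` with a suitable `b`. Otherwise both leave `X`, so
the second contains a vertex of `B`. The first then avoids `A` and lies entirely outside `X`, so
both ends of the chord are in the stable set `A`. -/
theorem IsJoin.not_theta (h : IsJoin G X A B) (hA : G.IsIndepSet A) (hB : B.Nonempty)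
    (hS : ∀ b ∈ B, NoThetaOn G (insert b X)) {x y : V} (hx : x ∈ X) (hy : y ∈ X) {D₁ D₂ : Set V} :
    ¬ Theta G x y D₁ D₂ := by
  have hBn : ∀ {D E}, Theta G x y D E → ¬ D ⊆ X → (D ∩ B).Nonempty := by
    intro D E ht hD
    obtain ⟨d, hd, hdX⟩ := Set.not_subset.1 hD
    exact h.symm.inter_nonempty (not_not.2 hx) ht.tx₁ ht.conn₁ ⟨d, hd, hdX⟩
  have key : ∀ D E, Theta G x y D E → ¬ E ⊆ X := by
    intro D E ht hE
    obtain ⟨b, hb, hbD⟩ : ∃ b ∈ B, ∀ d ∈ D, d ∉ X → b ∈ D := by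
      by_cases hD : D ⊆ X
      · obtain ⟨b, hb⟩ := hB
        exact ⟨b, hb, fun d hd hdX => absurd (hD hd) hdX⟩
      · obtain ⟨b, hbD, hb⟩ := hBn ht hD
        exact ⟨b, hb, fun _ _ _ => hbD⟩
    exact (hS b hb).not_theta (Or.inr hx) (Or.inr hy)
      (h.restricts hb hbD (Or.inr hx) (Or.inr hy) ht)
      (h.restricts hb (fun d hd hdX => absurd (hE hd) hdX) (Or.inr hx) (Or.inr hy) ht.swap) ht
  intro ht
  obtain ⟨b, hbD, hb⟩ := hBn ht.swap (key _ _ ht)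
  have hD : ∀ d ∈ D₁, d ∉ X := fun d hd hdX => by
    obtain ⟨a, ha, haA⟩ := h.inter_nonempty' ht.conn₁ ⟨d, hd, hdX⟩ (key _ _ ht.swap)
    exact ht.anti ⟨a, ha, b, hbD, h.adj haA hb⟩
  obtain ⟨d, hd, hxd⟩ := touch_singleton_left.1 ht.tx₁
  obtain ⟨e, he, hye⟩ := touch_singleton_left.1 ht.ty₁
  exact hA ((h.adj_iff x hx d (hD d hd)).1 hxd).1 ((h.adj_iff y hy e (hD e he)).1 hye).1 ht.adj.ne
    ht.adj

end Join

/-! ### Thetas and 1-joins: chords across the join -/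

section Join

variable {V : Type*} {G : SimpleGraph V} {X A B : Set V}

/-- For a chord across the join, one side meeting `A` and the other meeting `B` would be adjacent.
This forces both sides of the theta into `X` or both into its complement, and the chord end on the
other side serves as the representative. -/
theorem IsJoin.noTheta (h : IsJoin G X A B) (hA : G.IsIndepSet A) (hB : G.IsIndepSet B)
    (hA' : A.Nonempty) (hB' : B.Nonempty) (h₁ : ∀ b ∈ B, NoThetaOn G (insert b X))
    (h₂ : ∀ a ∈ A, NoThetaOn G (insert a Xᶜ)) : NoTheta G := by
  have key : ∀ {x y D₁ D₂}, x ∈ X → y ∉ X → ¬ Theta G x y D₁ D₂ := by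
    intro x y D₁ D₂ hx hy ht
    obtain ⟨hxA, hyB⟩ := (h.adj_iff x hx y hy).1 ht.adj
    have hxX : x ∉ Xᶜ := not_not.2 hx
    have mA : ∀ {D}, ConnSet G D → Touch G {y} D → ¬ D ⊆ Xᶜ → (D ∩ A).Nonempty := by
      intro D hD hyD hne
      obtain ⟨d, hd, hdX⟩ := Set.not_subset.1 hne
      exact h.inter_nonempty hy hyD hD ⟨d, hd, not_not.1 hdX⟩
    have mB : ∀ {D}, ConnSet G D → Touch G {x} D → ¬ D ⊆ X → (D ∩ B).Nonempty := by
      intro D hD hxD hne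
      obtain ⟨d, hd, hdX⟩ := Set.not_subset.1 hne
      exact h.symm.inter_nonempty hxX hxD hD ⟨d, hd, hdX⟩
    have hno : ∀ {D E}, Theta G x y D E → (D ∩ A).Nonempty → (E ∩ B).Nonempty → False := by
      rintro D E ht ⟨a, haD, ha⟩ ⟨b, hbE, hb⟩
      exact ht.anti ⟨a, haD, b, hbE, h.adj ha hb⟩
    have hout : ∀ {D}, D.Nonempty → D ⊆ X → ¬ D ⊆ Xᶜ := by
      rintro D ⟨d, hd⟩ h1 h2
      exact h2 hd (h1 hd)
    by_cases h1 : D₁ ⊆ X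
    · have h2 : D₂ ⊆ X := by
        by_contra h2
        exact hno ht (mA ht.conn₁ ht.ty₁ (hout ht.conn₁.1 h1)) (mB ht.conn₂ ht.tx₂ h2)
      exact h₁ y hyB x (Or.inr hx) y (Or.inl rfl) D₁ (h1.trans (Set.subset_insert _ _)) D₂
        (h2.trans (Set.subset_insert _ _)) ht
    · have hb := mB ht.conn₁ ht.tx₁ h1
      have h2 : D₂ ⊆ Xᶜ := by
        by_contra h2
        exact hno ht.swap (mA ht.conn₂ ht.ty₂ h2) hb
      have h3 : D₁ ⊆ Xᶜ := by
        by_contra h3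
        refine hno ht (mA ht.conn₁ ht.ty₁ h3) (mB ht.conn₂ ht.tx₂ fun h4 => hout ht.conn₂.1 h4 h2)
      exact h₂ x hxA x (Or.inl rfl) y (Or.inr hy) D₁ (h3.trans (Set.subset_insert _ _)) D₂
        (h2.trans (Set.subset_insert _ _)) ht
  intro x y D₁ D₂ ht
  by_cases hx : x ∈ X <;> by_cases hy : y ∈ X
  · exact h.not_theta hA hB' h₁ hx hy ht
  · exact key hx hy ht
  · exact key hy hx ht.symm
  · exact h.symm.not_theta hB hA' h₂ hx hy ht

end Join

/-! ### Thetas and 2-cutsets -/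

section Pair

variable {V : Type u} {G : SimpleGraph V} {S : Set V} {a b : V}

/-- A side leaving `S` is carried into the capped graph in one of two ways. If `a` and `b` both
belong to it or to the chord, its outside part is contracted to the cap. If one of them is missing,
the side leaves `S` through the other one only and is retracted to it. -/
theorem not_theta_of_noTheta_addCap (ha : a ∈ S) (hb : b ∈ S) (hab : a ≠ b) (hnab : ¬ G.Adj a b)
    (hS : ∀ u ∈ S, ∀ v ∉ S, G.Adj u v → u = a ∨ u = b) (h : NoTheta (addCap G S a b)) {x y : V}
    (hx : x ∈ S) (hy : y ∈ S) {D₁ D₂ : Set V} : ¬ Theta G x y D₁ D₂ := by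
  classical
  intro ht
  have key : ∀ D E, Theta G x y D E → ∃ F : Set (Option S), ConnSet (addCap G S a b) F ∧
      (∀ s : S, some s ∈ F ↔ (s : V) ∈ D) ∧
      (none ∈ F → (a ∈ D ∨ a = x ∨ a = y) ∧ (b ∈ D ∨ b = x ∨ b = y)) ∧
      Touch (addCap G S a b) {some ⟨x, hx⟩} F ∧ Touch (addCap G S a b) {some ⟨y, hy⟩} F := by
    intro D E ht
    by_cases hD : D ⊆ S ∨ (a ∈ D ∨ a = x ∨ a = y) ∧ (b ∈ D ∨ b = x ∨ b = y)
    · let f : V → Option S := fun v => if hv : v ∈ S then some ⟨v, hv⟩ else none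
      have hf : ∀ u v, G.Adj u v → f u = f v ∨ (addCap G S a b).Adj (f u) (f v) := by
        intro u v huv
        by_cases huS : u ∈ S <;> by_cases hvS : v ∈ S <;> simp only [f, huS, hvS, dif_pos, dif_neg,
          not_false_eq_true]
        · exact Or.inr huv
        · exact Or.inr (hS u huS v hvS huv)
        · exact Or.inr (hS v hvS u huS huv.symm)
        · exact Or.inl trivial
      have htouch : ∀ z (hz : z ∈ S), Touch G {z} D →
          Touch (addCap G S a b) {some ⟨z, hz⟩} (f '' D) := by
        rintro z hz ⟨_, rfl, d, hd, hzd⟩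
        refine ⟨_, rfl, f d, ⟨d, hd, rfl⟩, ?_⟩
        by_cases hdS : d ∈ S <;> simp only [f, hdS, dif_pos, dif_neg, not_false_eq_true]
        · exact hzd
        · exact hS _ hz d hdS hzd
      refine ⟨f '' D, ht.conn₁.image f fun u _ v _ huv => hf u v huv, fun s => ⟨?_, fun hs => ?_⟩,
        ?_, htouch x hx ht.tx₁, htouch y hy ht.ty₁⟩
      · rintro ⟨u, hu, hus⟩
        by_cases huS : u ∈ S <;> simp only [f, huS, dif_pos, dif_neg, not_false_eq_true] at hus
        · rwa [← Option.some.inj hus]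
        · exact absurd hus.symm (Option.some_ne_none _)
      · exact ⟨s, hs, dif_pos s.2⟩
      · rintro ⟨u, hu, hun⟩
        refine hD.resolve_left fun hDS => ?_
        simp only [f, hDS hu, dif_pos] at hun
        exact Option.some_ne_none _ hun
    · push Not at hD
      obtain ⟨hDS, hD⟩ := hD
      -- `c` is missing, so that `D` leaves `S` through `c'` only
      have aux : ∀ c c' : V, c' ∈ S → (∀ u ∈ S, ∀ v ∉ S, G.Adj u v → u = c ∨ u = c') → c ∉ D →
          c ≠ x → c ≠ y → ∃ F : Set (Option S), ConnSet (addCap G S a b) F ∧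
            (∀ s : S, some s ∈ F ↔ (s : V) ∈ D) ∧ none ∉ F ∧
            Touch (addCap G S a b) {some ⟨x, hx⟩} F ∧ Touch (addCap G S a b) {some ⟨y, hy⟩} F := by
        intro c c' hc' hcS hcD hcx hcy
        have hc'D : c' ∈ D := by
          by_contra hc'D
          obtain ⟨d, hd, hdS⟩ := Set.not_subset.1 hDS
          have hsub := ht.conn₁.subset_of_closed (S := Sᶜ) ⟨d, hd, hdS⟩ fun u hu v hv huv hvS => by
            rcases hcS v hvS u hu huv.symm with rfl | rfl
            · exact hcD hv
            · exact hc'D hv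
          obtain ⟨d, hd, hxd⟩ := touch_singleton_left.1 ht.tx₁
          obtain ⟨e, he, hye⟩ := touch_singleton_left.1 ht.ty₁
          have h1 := (hcS x hx d (hsub hd) hxd).resolve_left hcx.symm
          have h2 := (hcS y hy e (hsub he) hye).resolve_left hcy.symm
          exact ht.adj.ne (h1.trans h2.symm)
        let f : V → Option S := fun v => if hv : v ∈ S then some ⟨v, hv⟩ else some ⟨c', hc'⟩
        have htouch : ∀ z (hz : z ∈ S), z ≠ c → z ∉ D → Touch G {z} D →
            Touch (addCap G S a b) {some ⟨z, hz⟩} (f '' D) := by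
          rintro z hz hzc hzD ⟨_, rfl, d, hd, hzd⟩
          refine ⟨_, rfl, f d, ⟨d, hd, rfl⟩, ?_⟩
          by_cases hdS : d ∈ S
          · simp only [f, hdS, dif_pos]
            exact hzd
          · exact absurd ((hcS _ hz d hdS hzd).resolve_left hzc ▸ hc'D) hzD
        refine ⟨f '' D, ht.conn₁.image f fun u hu v hv huv => ?_, fun s => ⟨?_, fun hs =>
          ⟨s, hs, dif_pos s.2⟩⟩, ?_, htouch x hx hcx.symm ht.x₁ ht.tx₁,
          htouch y hy hcy.symm ht.y₁ ht.ty₁⟩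
        · by_cases huS : u ∈ S <;> by_cases hvS : v ∈ S <;> simp only [f, huS, hvS, dif_pos, dif_neg,
            not_false_eq_true]
          · exact Or.inr huv
          · left
            congr 2
            exact (hcS u huS v hvS huv).resolve_left fun h => hcD (h ▸ hu)
          · left
            congr 2
            exact ((hcS v hvS u huS huv.symm).resolve_left fun h => hcD (h ▸ hv)).symm
          · exact Or.inl trivial
        · rintro ⟨u, hu, hus⟩
          by_cases huS : u ∈ S <;> simp only [f, huS, dif_pos, dif_neg, not_false_eq_true] at hus
          · rwa [← Option.some.inj hus]
          · rwa [← Option.some.inj hus]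
        · rintro ⟨u, hu, hun⟩
          by_cases huS : u ∈ S <;> simp only [f, huS, dif_pos, dif_neg, not_false_eq_true] at hun <;>
            exact Option.some_ne_none _ hun
      have hF : ∃ F : Set (Option S), ConnSet (addCap G S a b) F ∧
          (∀ s : S, some s ∈ F ↔ (s : V) ∈ D) ∧ none ∉ F ∧
          Touch (addCap G S a b) {some ⟨x, hx⟩} F ∧ Touch (addCap G S a b) {some ⟨y, hy⟩} F := by
        by_cases haD : a ∈ D ∨ a = x ∨ a = y
        · obtain ⟨h1, h2, h3⟩ := hD haD
          exact aux b a ha (fun u hu v hv huv => (hS u hu v hv huv).symm) h1 h2 h3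
        · push Not at haD
          exact aux a b hb hS haD.1 haD.2.1 haD.2.2
      obtain ⟨F, h1, h2, h3, h4⟩ := hF
      exact ⟨F, h1, h2, fun h => absurd h h3, h4⟩
  obtain ⟨F₁, hF₁, hm₁, hn₁, tx₁, ty₁⟩ := key _ _ ht
  obtain ⟨F₂, hF₂, hm₂, hn₂, tx₂, ty₂⟩ := key _ _ ht.swap
  have hcap : ∀ {D E : Set V} {F : Set (Option S)}, Theta G x y D E →
      (none ∈ F → (a ∈ D ∨ a = x ∨ a = y) ∧ (b ∈ D ∨ b = x ∨ b = y)) → none ∈ F →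
        a ∉ E ∧ b ∉ E := by
    intro D E F ht hn hF
    have : ∀ c, c ∈ D ∨ c = x ∨ c = y → c ∉ E := by
      rintro c (hc | rfl | rfl)
      · exact fun h => Set.disjoint_left.1 ht.disj hc h
      · exact ht.x₂
      · exact ht.y₂
    exact ⟨this a (hn hF).1, this b (hn hF).2⟩
  refine h (some ⟨x, hx⟩) (some ⟨y, hy⟩) F₁ F₂ ⟨ht.adj, hF₁, hF₂, ?_, ?_, fun h => ht.x₁ ((hm₁ _).1 h),
    fun h => ht.x₂ ((hm₂ _).1 h), fun h => ht.y₁ ((hm₁ _).1 h), fun h => ht.y₂ ((hm₂ _).1 h), tx₁, tx₂,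
    ty₁, ty₂⟩
  · rw [Set.disjoint_left]
    rintro (_ | s) h1 h2
    -- If both sides used the cap, neither could contain `a` or `b`, so the chord would join `a` and
    -- `b`, which are not adjacent.
    · obtain ⟨h3, h4⟩ := hcap ht hn₁ h1
      obtain ⟨h5, h6⟩ := hn₂ h2
      have h5 := h5.resolve_left h3
      have h6 := h6.resolve_left h4
      rcases h5 with h5 | h5 <;> rcases h6 with h6 | h6
      · exact hab (h5.trans h6.symm)
      · exact hnab (h5 ▸ h6 ▸ ht.adj)
      · exact hnab (h5 ▸ h6 ▸ ht.adj.symm)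
      · exact hab (h5.trans h6.symm)
    · exact Set.disjoint_left.1 ht.disj ((hm₁ s).1 h1) ((hm₂ s).1 h2)
  · rintro ⟨_ | s, hs, _ | t, ht', hst⟩
    · exact hst
    · obtain ⟨h3, h4⟩ := hcap ht hn₁ hs
      have := (hm₂ t).1 ht'
      rcases hst with h | h
      · exact h3 (h ▸ this)
      · exact h4 (h ▸ this)
    · obtain ⟨h3, h4⟩ := hcap ht.swap hn₂ ht'
      have := (hm₁ s).1 hs
      rcases hst with h | h
      · exact h3 (h ▸ this)
      · exact h4 (h ▸ this)
    · exact ht.anti ⟨s, (hm₁ s).1 hs, t, (hm₂ t).1 ht', hst⟩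

/-- Gluing along a pair of nonadjacent vertices does not create unique chords. -/
theorem noTheta_of_pair {X Y : Set V} (hab : a ≠ b) (hnab : ¬ G.Adj a b) (hXY : X ∪ Y = {a, b}ᶜ)
    (hn : ¬ Touch G X Y) (h₁ : NoTheta (addCap G (X ∪ {a, b}) a b))
    (h₂ : NoTheta (addCap G (Y ∪ {a, b}) a b)) : NoTheta G := by
  have hmem : ∀ v, v ∈ X ∨ v ∈ Y ∨ v ∈ ({a, b} : Set V) := by
    intro v
    by_cases hv : v ∈ ({a, b} : Set V)
    · exact Or.inr (Or.inr hv)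
    · have : v ∈ X ∪ Y := hXY ▸ hv
      exact this.imp_right Or.inl
  have hS : ∀ X Y : Set V, (∀ v, v ∈ X ∨ v ∈ Y ∨ v ∈ ({a, b} : Set V)) → ¬ Touch G X Y →
      ∀ u ∈ X ∪ {a, b}, ∀ v ∉ X ∪ {a, b}, G.Adj u v → u = a ∨ u = b := by
    rintro X Y hm hn u (hu | hu) v hv huv
    · rcases hm v with h | h | h
      · exact absurd (Or.inl h) hv
      · exact absurd ⟨u, hu, v, h, huv⟩ hn
      · exact absurd (Or.inr h) hv
    · exact hu
  have hmem' : ∀ v, v ∈ Y ∨ v ∈ X ∨ v ∈ ({a, b} : Set V) := fun v => by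
    have := hmem v; tauto
  intro x y D₁ D₂ ht
  have key : (x ∈ X ∪ {a, b} ∧ y ∈ X ∪ {a, b}) ∨ (x ∈ Y ∪ {a, b} ∧ y ∈ Y ∪ {a, b}) := by
    rcases hmem x with hx | hx | hx <;> rcases hmem y with hy | hy | hy
    · exact Or.inl ⟨Or.inl hx, Or.inl hy⟩
    · exact absurd ⟨x, hx, y, hy, ht.adj⟩ hn
    · exact Or.inl ⟨Or.inl hx, Or.inr hy⟩
    · exact absurd ⟨y, hy, x, hx, ht.adj.symm⟩ hn
    · exact Or.inr ⟨Or.inl hx, Or.inl hy⟩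
    · exact Or.inr ⟨Or.inl hx, Or.inr hy⟩
    · exact Or.inl ⟨Or.inr hx, Or.inl hy⟩
    · exact Or.inr ⟨Or.inr hx, Or.inl hy⟩
    · exact Or.inl ⟨Or.inr hx, Or.inr hy⟩
  have haU : ∀ X : Set V, a ∈ X ∪ {a, b} := fun X => Or.inr (Or.inl rfl)
  have hbU : ∀ X : Set V, b ∈ X ∪ {a, b} := fun X => Or.inr (Or.inr rfl)
  rcases key with ⟨hx, hy⟩ | ⟨hx, hy⟩
  · exact not_theta_of_noTheta_addCap (haU X) (hbU X) hab hnab (hS X Y hmem hn) h₁ hx hy ht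
  · exact not_theta_of_noTheta_addCap (haU Y) (hbU Y) hab hnab
      (hS Y X hmem' fun h => hn h.symm) h₂ hx hy ht

end Pair

/-! ### The four operations preserve the absence of thetas -/

section Operations

variable {V₁ V₂ : Type u} {G₁ : SimpleGraph V₁} {G₂ : SimpleGraph V₂}

theorem NoTheta.noThetaOn_range {V W : Type*} {G : SimpleGraph V} {H : SimpleGraph W}
    (hH : NoTheta H) (e : H ↪g G) : NoThetaOn G (Set.range e) := by
  rintro x ⟨w, rfl⟩
  have : Nonempty W := ⟨w⟩
  have hl := Function.leftInverse_invFun e.injective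
  refine hH.noThetaOn (Function.invFun e) ?_ ?_ _ ⟨w, rfl⟩
  · rintro _ ⟨u, rfl⟩ _ ⟨v, rfl⟩ h
    rw [hl, hl] at h
    rw [h]
  · rintro _ ⟨u, rfl⟩ _ ⟨v, rfl⟩
    rw [hl, hl, e.map_adj_iff]

theorem NoTheta.sum (h₁ : NoTheta G₁) (h₂ : NoTheta G₂) : NoTheta (G₁ ⊕g G₂) := by
  refine noTheta_of_separation (X := Set.range Sum.inl) ?_
    (h₁.noThetaOn_range SimpleGraph.Embedding.sumInl) ?_
  · rintro ⟨_, ⟨x, rfl⟩, y | y, hy, h⟩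
    · exact hy ⟨y, rfl⟩
    · simp at h
  · rw [Set.compl_range_inl]
    exact h₂.noThetaOn_range SimpleGraph.Embedding.sumInr

theorem NoTheta.glueVertex (h₁ : NoTheta G₁) (h₂ : NoTheta G₂) (p : V₁) (q : V₂) :
    NoTheta (glueVertex G₁ G₂ p q) := by
  refine noTheta_of_cutvertex (X := Set.range (Sum.inl ∘ Sum.inl)) (c := .inr ()) ?_ ?_
    (h₁.noThetaOn (Sum.elim (Sum.elim Subtype.val fun _ => p) fun _ => p) ?_ ?_)
    (h₂.noThetaOn (Sum.elim (Sum.elim (fun _ => q) Subtype.val) fun _ => q) ?_ ?_)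
  · rintro ⟨x, h⟩
    exact Sum.inl_ne_inr h
  · rintro _ ⟨x, rfl⟩ ((y | y) | y) hy h
    · exact absurd ⟨y, rfl⟩ hy
    · exact h.elim
    · rfl
  · rintro _ (rfl | ⟨x, rfl⟩) _ (rfl | ⟨y, rfl⟩) h
    · rfl
    · exact absurd h.symm y.2
    · exact absurd h x.2
    · exact congrArg (Sum.inl ∘ Sum.inl) (Subtype.ext h)
  · rintro _ (rfl | ⟨x, rfl⟩) _ (rfl | ⟨y, rfl⟩)
    · exact iff_of_false id G₁.irrefl
    · exact Iff.rfl
    · exact G₁.adj_comm _ _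
    · exact Iff.rfl
  · rintro ((x | x) | x) hx ((y | y) | y) hy h
    · exact absurd ⟨x, rfl⟩ hx
    · exact absurd ⟨x, rfl⟩ hx
    · exact absurd ⟨x, rfl⟩ hx
    · exact absurd ⟨y, rfl⟩ hy
    · exact congrArg (Sum.inl ∘ Sum.inr) (Subtype.ext h)
    · exact absurd h x.2
    · exact absurd ⟨y, rfl⟩ hy
    · exact absurd h.symm y.2
    · rfl
  · rintro ((x | x) | x) hx ((y | y) | y) hy
    · exact absurd ⟨x, rfl⟩ hx
    · exact absurd ⟨x, rfl⟩ hx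
    · exact absurd ⟨x, rfl⟩ hx
    · exact absurd ⟨y, rfl⟩ hy
    · exact Iff.rfl
    · exact G₂.adj_comm _ _
    · exact absurd ⟨y, rfl⟩ hy
    · exact Iff.rfl
    · exact iff_of_false id G₂.irrefl

theorem NoTheta.glueJoin (h₁ : NoTheta G₁) (h₂ : NoTheta G₂) {p : V₁} {q : V₂}
    (hp : G₁.IsIndepSet (G₁.neighborSet p)) (hp' : (G₁.neighborSet p).Nonempty)
    (hq : G₂.IsIndepSet (G₂.neighborSet q)) (hq' : (G₂.neighborSet q).Nonempty) :
    NoTheta (glueJoin G₁ G₂ p q) := by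
  have hjoin : IsJoin (UniqueChord.glueJoin G₁ G₂ p q) (Set.range Sum.inl)
      (Sum.inl '' {x | G₁.Adj p x}) (Sum.inr '' {y | G₂.Adj q y}) := by
    refine ⟨Set.image_subset_range _ _, ?_, ?_⟩
    · rintro _ ⟨y, -, rfl⟩ ⟨x, h⟩
      exact Sum.inl_ne_inr h
    · rintro _ ⟨x, rfl⟩ (y | y) hy
      · exact absurd ⟨y, rfl⟩ hy
      · constructor
        · exact fun h => ⟨⟨x, h.1, rfl⟩, y, h.2, rfl⟩
        · rintro ⟨⟨x', hx, hx'⟩, y', hy, hy'⟩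
          cases Sum.inl_injective hx'
          cases Sum.inr_injective hy'
          exact ⟨hx, hy⟩
  refine hjoin.noTheta ?_ ?_ ?_ ?_ ?_ ?_
  · rintro _ ⟨x, hx, rfl⟩ _ ⟨y, hy, rfl⟩ - h
    exact hp hx hy (G₁.ne_of_adj h) h
  · rintro _ ⟨x, hx, rfl⟩ _ ⟨y, hy, rfl⟩ - h
    exact hq hx hy (G₂.ne_of_adj h) h
  · obtain ⟨x, hx⟩ := hp'
    exact ⟨_, ⟨x, (G₁.ne_of_adj hx).symm⟩, hx, rfl⟩
  · obtain ⟨x, hx⟩ := hq'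
    exact ⟨_, ⟨x, (G₂.ne_of_adj hx).symm⟩, hx, rfl⟩
  · rintro _ ⟨b, hb, rfl⟩
    refine h₁.noThetaOn (Sum.elim Subtype.val fun _ => p) ?_ ?_
    · rintro _ (rfl | ⟨x, rfl⟩) _ (rfl | ⟨y, rfl⟩) h
      · rfl
      · exact absurd h.symm y.2
      · exact absurd h x.2
      · exact congrArg Sum.inl (Subtype.ext h)
    · rintro _ (rfl | ⟨x, rfl⟩) _ (rfl | ⟨y, rfl⟩)
      · exact iff_of_false G₂.irrefl G₁.irrefl
      · exact and_iff_left hb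
      · exact (and_iff_left hb).trans (G₁.adj_comm _ _)
      · exact Iff.rfl
  · rintro _ ⟨a, ha, rfl⟩
    rw [Set.compl_range_inl]
    refine h₂.noThetaOn (Sum.elim (fun _ => q) Subtype.val) ?_ ?_
    · rintro _ (rfl | ⟨x, rfl⟩) _ (rfl | ⟨y, rfl⟩) h
      · rfl
      · exact absurd h.symm y.2
      · exact absurd h x.2
      · exact congrArg Sum.inr (Subtype.ext h)
    · rintro _ (rfl | ⟨x, rfl⟩) _ (rfl | ⟨y, rfl⟩)
      · exact iff_of_false G₁.irrefl G₂.irrefl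
      · exact and_iff_right ha
      · exact (and_iff_right ha).trans (G₂.adj_comm _ _)
      · exact Iff.rfl

/-- The cap is played by a vertex `p` that already exists in `H`, so the capped part is an induced
subgraph of `H`. -/
theorem NoTheta.addCap_of_map {V W : Type u} {G : SimpleGraph V} {H : SimpleGraph W} {S : Set V}
    {a b : V} (hH : NoTheta H) (f : V → W) (p : W) (hinj : Set.InjOn f S)
    (hadj : ∀ u ∈ S, ∀ v ∈ S, H.Adj (f u) (f v) ↔ G.Adj u v) (hp : ∀ s ∈ S, f s ≠ p)
    (hp' : ∀ s ∈ S, H.Adj p (f s) ↔ s = a ∨ s = b) : NoTheta (UniqueChord.addCap G S a b) := by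
  refine hH.of_embedding ⟨⟨fun o => o.elim p fun s => f s, ?_⟩, ?_⟩
  · rintro (_ | s) (_ | t) h
    · rfl
    · exact absurd h.symm (hp t t.2)
    · exact absurd h (hp s s.2)
    · exact congrArg some (Subtype.ext (hinj s.2 t.2 h))
  · rintro (_ | s) (_ | t)
    · exact iff_of_false H.irrefl id
    · exact hp' t t.2
    · exact (H.adj_comm _ _).trans (hp' s s.2)
    · exact hadj s s.2 t t.2

/-- The degree-two vertices `p` and `q` are caps already: each side of the glued graph, capped at
the two new vertices, embeds in the graph from which it came. -/
theorem NoTheta.gluePair (h₁ : NoTheta G₁) (h₂ : NoTheta G₂) {p p₁ p₂ : V₁} {q q₁ q₂ : V₂}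
    (hp : G₁.neighborSet p = {p₁, p₂}) (hp12 : p₁ ≠ p₂) (hpadj : ¬ G₁.Adj p₁ p₂)
    (hq : G₂.neighborSet q = {q₁, q₂}) (hq12 : q₁ ≠ q₂) (hqadj : ¬ G₂.Adj q₁ q₂) :
    NoTheta (gluePair G₁ G₂ p p₁ p₂ q q₁ q₂) := by
  have hp' : ∀ x, G₁.Adj p x ↔ x = p₁ ∨ x = p₂ := fun x => by
    rw [← SimpleGraph.mem_neighborSet, hp]; rfl
  have hq' : ∀ x, G₂.Adj q x ↔ x = q₁ ∨ x = q₂ := fun x => by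
    rw [← SimpleGraph.mem_neighborSet, hq]; rfl
  have hpp₁ := (hp' p₁).2 (Or.inl rfl)
  have hpp₂ := (hp' p₂).2 (Or.inr rfl)
  have hqq₁ := (hq' q₁).2 (Or.inl rfl)
  have hqq₂ := (hq' q₂).2 (Or.inr rfl)
  refine noTheta_of_pair (X := Set.range (Sum.inl ∘ Sum.inl)) (Y := Set.range (Sum.inl ∘ Sum.inr))
    (a := .inr false) (b := .inr true) (by simp) id ?_ ?_
    (h₁.addCap_of_map (Sum.elim (Sum.elim Subtype.val fun _ => p) fun i => bif i then p₂ else p₁) p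
      ?_ ?_ ?_ ?_)
    (h₂.addCap_of_map (Sum.elim (Sum.elim (fun _ => q) Subtype.val) fun i => bif i then q₂ else q₁) q
      ?_ ?_ ?_ ?_)
  · ext ((x | x) | (_ | _)) <;> simp
  · rintro ⟨_, ⟨x, rfl⟩, _, ⟨y, rfl⟩, h⟩
    exact h
  · rintro _ (⟨x, rfl⟩ | rfl | rfl) _ (⟨y, rfl⟩ | rfl | rfl) h
    · exact congrArg (Sum.inl ∘ Sum.inl) (Subtype.ext h)
    · exact absurd h x.2.2.1
    · exact absurd h x.2.2.2
    · exact absurd h.symm y.2.2.1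
    · rfl
    · exact absurd h hp12
    · exact absurd h.symm y.2.2.2
    · exact absurd h.symm hp12
    · rfl
  · rintro _ (⟨x, rfl⟩ | rfl | rfl) _ (⟨y, rfl⟩ | rfl | rfl)
    · exact Iff.rfl
    · exact G₁.adj_comm _ _
    · exact G₁.adj_comm _ _
    · exact Iff.rfl
    · exact iff_of_false G₁.irrefl id
    · exact iff_of_false hpadj id
    · exact Iff.rfl
    · exact iff_of_false (fun h => hpadj h.symm) id
    · exact iff_of_false G₁.irrefl id
  · rintro _ (⟨x, rfl⟩ | rfl | rfl)
    · exact x.2.1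
    · exact (G₁.ne_of_adj hpp₁).symm
    · exact (G₁.ne_of_adj hpp₂).symm
  · rintro _ (⟨x, rfl⟩ | rfl | rfl)
    · refine iff_of_false (fun h => ?_) (by simp)
      exact ((hp' x.1).1 h).elim x.2.2.1 x.2.2.2
    · exact iff_of_true hpp₁ (Or.inl rfl)
    · exact iff_of_true hpp₂ (Or.inr rfl)
  · rintro _ (⟨x, rfl⟩ | rfl | rfl) _ (⟨y, rfl⟩ | rfl | rfl) h
    · exact congrArg (Sum.inl ∘ Sum.inr) (Subtype.ext h)
    · exact absurd h x.2.2.1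
    · exact absurd h x.2.2.2
    · exact absurd h.symm y.2.2.1
    · rfl
    · exact absurd h hq12
    · exact absurd h.symm y.2.2.2
    · exact absurd h.symm hq12
    · rfl
  · rintro _ (⟨x, rfl⟩ | rfl | rfl) _ (⟨y, rfl⟩ | rfl | rfl)
    · exact Iff.rfl
    · exact G₂.adj_comm _ _
    · exact G₂.adj_comm _ _
    · exact Iff.rfl
    · exact iff_of_false G₂.irrefl id
    · exact iff_of_false hqadj id
    · exact Iff.rfl
    · exact iff_of_false (fun h => hqadj h.symm) id
    · exact iff_of_false G₂.irrefl id
  · rintro _ (⟨x, rfl⟩ | rfl | rfl)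
    · exact x.2.1
    · exact (G₂.ne_of_adj hqq₁).symm
    · exact (G₂.ne_of_adj hqq₂).symm
  · rintro _ (⟨x, rfl⟩ | rfl | rfl)
    · refine iff_of_false (fun h => ?_) (by simp)
      exact ((hq' x.1).1 h).elim x.2.2.1 x.2.2.2
    · exact iff_of_true hqq₁ (Or.inl rfl)
    · exact iff_of_true hqq₂ (Or.inr rfl)

theorem Constructible.noTheta {V : Type u} {G : SimpleGraph V} (h : Constructible G) :
    NoTheta G := by
  have hne : ∀ {V : Type u} {G : SimpleGraph V} {p : V}, 2 ≤ deg G p → (G.neighborSet p).Nonempty :=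
    fun h => Set.nonempty_of_ncard_ne_zero (by unfold deg at h; omega)
  induction h with
  | basic G hG => exact hG.noTheta
  | iso _ e ih => exact ih.of_embedding e.symm.toEmbedding
  | op0 _ _ h₁ h₂ => exact h₁.sum h₂
  | op1 _ _ p q h₁ h₂ => exact h₁.glueVertex h₂ p q
  | op2 _ _ p q hp hp2 hq hq2 h₁ h₂ => exact h₁.glueJoin h₂ hp (hne hp2) hq (hne hq2)
  | op3 _ _ p p₁ p₂ q q₁ q₂ hp hp12 hpadj _ hq hq12 hqadj _ _ _ h₁ h₂ =>
    exact h₁.gluePair h₂ hp hp12 hpadj hq hq12 hqadj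

end Operations

end UniqueChord

theorem mainTheorem2 {V : Type u} [Finite V] [Nonempty V] (G : SimpleGraph V) :
    (UniqueChord.InC G → UniqueChord.Constructible G) ∧
      (UniqueChord.Constructible G → UniqueChord.InC G) := by
  exact ⟨fun h => UniqueChord.constructible_of_noTheta _ G rfl (UniqueChord.noTheta_of_inC h),
    fun h => UniqueChord.inC_of_noTheta h.noTheta⟩
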